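/- **Setting.** Let $F_0$ be a complete discretely valued field with ring of integers $O_{F_0}$, perfect residue field $k$ of characteristic $\neq 2$ and uniformizer $\pi_0$. Let $F/F_0$ be a ramified quadratic extension with ring of integers $O_F$ and a uniformizer $\pi$ with $\pi^2=\pi_0$. Let $n=2m>3$, let $r+s=n$ with $0\le s\le r$, and let $V=F^n$ with standard basis $e_1,\dots,e_n$ and the split $F/F_0$-hermitian form $\phi$, $\phi(e_i,e_{n+1-j})=\delta_{ij}$; put $(x,y)=\tfrac12\mathrm{Tr}_{F/F_0}\phi(x,y)$. Let $\Lambda_m=\mathrm{span}_{O_F}\{\pi^{-1}e_1,\dots,\pi^{-1}e_m,e_{m+1},\dots,e_n\}$, on which $(\ ,\ )$ is a perfect $O_{F_0}$-valued symmetric form, and let $t$ denote multiplication by $\pi$ on $\Lambda_m$. **Spin condition.** Let $f_1,\dots,f_{2n}$ be the ordered basis of $V\otimes_{F_0}F$ consisting of the vectors $e_i\otimes 1-\pi e_i\otimes\pi^{-1}$ $(1\le i\le n)$ followed by $\tfrac12(e_i\otimes1+\pi e_i\otimes\pi^{-1})$ $(1\le i\le n)$, so that $(f_i,f_{2n+1-j})=\delta_{ij}$.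 For $S\subset\{1,\dots,2n\}$ with $n$ elements let $f_S$ be the wedge product of the $f_i$, $i\in S$, in increasing order, $S^\perp$ the complement of $\{2n+1-i : i\in S\}$, and $\sigma_S$ the permutation mapping $\{1,\dots,n\}$ to $S$ and $\{n+1,\dots,2n\}$ to the complement of $S$, increasingly on each. For $\epsilon=\pm1$ let $W_\epsilon\subset\bigwedge^n_F(V\otimes_{F_0}F)$ be the span of all $f_S+\epsilon\,\mathrm{sgn}(\sigma_S)f_{S^\perp}$, and for an $O_F$-algebra $R$ let $L_{m,\epsilon}(R)\subset\bigwedge^n_R(\Lambda_m\otimes_{O_{F_0}}R)$ be the image of $\bigl(W_\epsilon\cap\bigwedge^n_{O_F}(\Lambda_m\otimes_{O_{F_0}}O_F)\bigr)\otimes_{O_F}R$. **Splitting model.** $\mathrm{M}^{\mathrm{spl}}$ is the moduli functor over $O_F$ whose $R$-points are the pairs $(\mathcal F_m,\mathcal G_m)$ of Zariski-locally direct summands of $\Lambda_m\otimes_{O_{F_0}}R$ of ranks $n$ and $s$ such that $\mathcal G_m\subset\mathcal F_m$; $\mathcal F_m=\mathcal F_m^\perp$; $(t+\pi)\mathcal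 F_m\subset\mathcal G_m$ and $(t-\pi)\mathcal G_m=0$; and $\bigwedge^n\mathcal F_m\subset L_{m,(-1)^s}(R)$. **Strata.** For a point $x=(\mathcal F_m,\mathcal G_m)$ of the special fiber let $\mathcal G_m^{\perp'}=t\,(\mathcal G_m^{\perp})\subset t\Lambda_m$ be the dual of $\mathcal G_m$ under the modified pairing $\{tx,ty\}=(tx,y)$ on $t\Lambda_m$, and let $X_{h,l}$ be the set of points $x$ of $\mathrm{M}^{\mathrm{spl}}\otimes k$ with $\dim t\mathcal F_m=h$ and $\dim(\mathcal G_m\cap\mathcal G_m^{\perp'})=l$ (dimensions over the residue field of $x$). **Proposition.** The functor $\mathrm{M}^{\mathrm{spl}}$ is representable by an $O_F$-scheme, and: 1. The smooth locus of $\mathrm{M}^{\mathrm{spl}}\otimes k$ over $k$ is $\bigcup_{0\le h\le s,\ h\equiv s\ (2)}X_{h,h}$. 2. For all integers $0\le h<l\le s$ with $h\equiv l\equiv s \pmod 2$ there is a $k$-rational point $x_0$ of $\mathrm{M}^{\mathrm{spl}}\otimes k$ lying in $X_{h,l}$, and a lift $x_1\in(\mathrm{M}^{\mathrm{spl}}\otimes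 k)(k[\epsilon]/\epsilon^2)$ of $x_0$, which does not extend to a point in $(\mathrm{M}^{\mathrm{spl}}\otimes k)(k[\epsilon]/\epsilon^3)$; moreover $\mathrm{M}^{\mathrm{spl}}\otimes k$ is not smooth at $x_0$. -/

import Mathlib

open CategoryTheory AlgebraicGeometry TensorProduct Polynomial

universe u

noncomputable section

set_option linter.unusedSectionVars false

namespace SplittingModel

/-- A locally direct summand of constant rank `d`: over an affine base, a submodule is Zariski
locally a direct summand exactly when it has a complement. -/
def IsSummandOfRank {R M : Type u} [CommRing R] [AddCommGroup M] [Module R M]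
    (d : ℕ) (P : Submodule R M) : Prop :=
  (∃ Q : Submodule R M, IsCompl P Q) ∧ ∀ p : PrimeSpectrum R, Module.rankAtStalk P p = d

/-- The set of points at which a morphism is smooth, i.e. the points having an open neighbourhood
on which the morphism is smooth. -/
def smoothPoints {X Y : Scheme.{u}} (f : X ⟶ Y) : Set X :=
  {x | ∃ U : X.Opens, x ∈ U ∧ Smooth (U.ι ≫ f)}

/-- The ring `K[ε]/ε^j`. -/
abbrev TruncPoly (K : Type u) [Field K] (j : ℕ) : Type u :=
  K[X] ⧸ Ideal.span {(X : K[X]) ^ j}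

/-- The reduction `K[ε]/ε^i → K[ε]/ε^j` for `j ≤ i`. -/
def truncPolyReduce (K : Type u) [Field K] {i j : ℕ} (h : j ≤ i) :
    TruncPoly K i →+* TruncPoly K j :=
  Ideal.Quotient.factor
    (by
      rw [Ideal.span_singleton_le_span_singleton]
      exact pow_dvd_pow _ h)

/-- The reduction `K[ε]/ε^(j+1) → K`, `ε ↦ 0`. -/
def truncPolyEval (K : Type u) [Field K] (j : ℕ) : TruncPoly K (j + 1) →+* K :=
  Ideal.Quotient.lift _ (Polynomial.evalRingHom 0) (by
    intro a ha
    obtain ⟨b, rfl⟩ := Ideal.mem_span_singleton.1 ha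
    simp)

section Setup

variable (O₀ F₀ O F : Type u)
  [CommRing O₀] [IsDomain O₀] [IsDiscreteValuationRing O₀]
  [Field F₀] [Algebra O₀ F₀] [IsFractionRing O₀ F₀]
  [Field F] [Algebra F₀ F] [Algebra O₀ F] [IsScalarTower O₀ F₀ F]
  [CommRing O] [IsDomain O] [IsDiscreteValuationRing O]
  [Algebra O₀ O] [Algebra O F] [IsScalarTower O₀ O F] [IsIntegralClosure O O₀ F]

/-- The data of a ramified quadratic extension `F/F₀` with residue characteristic different from
`2`, with a uniformizer `π` of `F` whose square `π₀` is a uniformizer of `F₀`, and with its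
nontrivial automorphism. Here `O₀`, `O` are the rings of integers of `F₀`, `F`. -/
structure RamifiedQuadratic where
  /-- The uniformizer `π₀`. -/
  unif₀ : O₀
  /-- The uniformizer `π`. -/
  unif : O
  /-- The nontrivial automorphism of `F/F₀`. -/
  conj : F ≃ₐ[F₀] F
  irreducible_unif₀ : Irreducible unif₀
  unif_sq : unif ^ 2 = algebraMap O₀ O unif₀
  finrank_eq_two : Module.finrank F₀ F = 2
  conj_ne_one : conj ≠ 1
  residue_two_ne_zero : (2 : IsLocalRing.ResidueField O₀) ≠ 0

end Setup

section Lattice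

variable {O₀ F₀ O F : Type u}
  [CommRing O₀] [IsDomain O₀] [IsDiscreteValuationRing O₀]
  [Field F₀] [Algebra O₀ F₀] [IsFractionRing O₀ F₀]
  [Field F] [Algebra F₀ F] [Algebra O₀ F] [IsScalarTower O₀ F₀ F]
  [CommRing O] [IsDomain O] [IsDiscreteValuationRing O]
  [Algebra O₀ O] [Algebra O F] [IsScalarTower O₀ O F] [IsIntegralClosure O O₀ F]
  (D : RamifiedQuadratic O₀ F₀ O F) (m : ℕ)

/-- The split hermitian form on `V = F^(2m)`, conjugate-linear in the first variable:
`φ (e i) (e (rev j)) = δ i j` for the standard basis `e`. -/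
def hermForm (x y : Fin (2 * m) → F) : F := ∑ i, D.conj (x i) * y (Fin.rev i)

theorem hermForm_single (i j : Fin (2 * m)) :
    hermForm D m (Pi.single i 1) (Pi.single (Fin.rev j) 1) = if i = j then 1 else 0 := by
  classical
  simp only [hermForm, Pi.single_apply, Fin.rev_inj]
  rw [Finset.sum_eq_single i]
  · simp
  · intro b _ hb
    simp [hb]
  · simp

/-- The symmetric form `(x, y) = ½ Tr_{F/F₀} φ(x, y)` on `V`. -/
def symForm : LinearMap.BilinForm F₀ (Fin (2 * m) → F) :=
  LinearMap.mk₂ F₀ (fun x y => (2 : F₀)⁻¹ * Algebra.trace F₀ F (hermForm D m x y))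
    (by
      intro x x' y
      simp [hermForm, add_mul, Finset.sum_add_distrib, mul_add])
    (by
      intro c x y
      simp only [hermForm, Pi.smul_apply, map_smul, smul_mul_assoc, ← Finset.smul_sum,
        smul_eq_mul]
      ring)
    (by
      intro x y y'
      simp [hermForm, Finset.sum_add_distrib, mul_add])
    (by
      intro c x y
      simp only [hermForm, Pi.smul_apply, map_smul, mul_smul_comm, ← Finset.smul_sum,
        smul_eq_mul]
      ring)

/-- The standard lattice `Λ_m`, spanned over `O` by `π⁻¹ e_i` for the first `m` indices and by
`e_i` for the last `m`. -/
def Lam : Submodule O (Fin (2 * m) → F) :=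
  Submodule.span O (Set.range fun i : Fin (2 * m) =>
    if (i : ℕ) < m then (algebraMap O F D.unif)⁻¹ • (Pi.single i 1 : Fin (2 * m) → F)
    else Pi.single i 1)

theorem conj_unif (D : RamifiedQuadratic O₀ F₀ O F) :
    D.conj (algebraMap O F D.unif) = algebraMap O F D.unif ∨
      D.conj (algebraMap O F D.unif) = -algebraMap O F D.unif := by
  have h2 : (algebraMap O F D.unif) ^ 2 = algebraMap F₀ F (algebraMap O₀ F₀ D.unif₀) := by
    rw [← map_pow, D.unif_sq, ← IsScalarTower.algebraMap_apply, ← IsScalarTower.algebraMap_apply]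
  rw [← sq_eq_sq_iff_eq_or_eq_neg, ← map_pow, h2, AlgEquiv.commutes]

theorem unif_ne_zero (D : RamifiedQuadratic O₀ F₀ O F) : algebraMap O F D.unif ≠ 0 := by
  intro h
  have h2 : (algebraMap O F D.unif) ^ 2 = algebraMap F₀ F (algebraMap O₀ F₀ D.unif₀) := by
    rw [← map_pow, D.unif_sq, ← IsScalarTower.algebraMap_apply, ← IsScalarTower.algebraMap_apply]
  rw [h, zero_pow two_ne_zero, eq_comm, map_eq_zero_iff _ (algebraMap F₀ F).injective,
    map_eq_zero_iff _ (IsFractionRing.injective O₀ F₀)] at h2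
  exact D.irreducible_unif₀.ne_zero h2

theorem mem_range_of_isIntegral {x : F} (hx : IsIntegral O₀ x) :
    x ∈ (algebraMap O F).range :=
  (IsIntegralClosure.isIntegral_iff (A := O)).1 hx

theorem conj_mem_range (D : RamifiedQuadratic O₀ F₀ O F) {x : F}
    (hx : x ∈ (algebraMap O F).range) : D.conj x ∈ (algebraMap O F).range := by
  have h : IsIntegral O₀ x := (IsIntegralClosure.isIntegral_iff (A := O)).2 hx
  exact mem_range_of_isIntegral (h.map (D.conj.toAlgHom.restrictScalars O₀))

theorem trace_eq (D : RamifiedQuadratic O₀ F₀ O F) (x : F) :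
    algebraMap F₀ F (Algebra.trace F₀ F x) = x + D.conj x := by
  classical
  have : FiniteDimensional F₀ F :=
    Module.finite_of_finrank_pos (by rw [D.finrank_eq_two]; norm_num)
  have hcard : Nat.card (F ≃ₐ[F₀] F) = 2 := by
    refine le_antisymm ?_ ?_
    · rw [← D.finrank_eq_two, Nat.card_eq_fintype_card]
      exact AlgEquiv.card_le
    · have : Nontrivial (F ≃ₐ[F₀] F) := ⟨⟨_, _, D.conj_ne_one⟩⟩
      exact Finite.one_lt_card
  have : IsGalois F₀ F := IsGalois.of_card_aut_eq_finrank F₀ F (by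
    rw [hcard, D.finrank_eq_two])
  rw [trace_eq_sum_automorphisms]
  have huniv : (Finset.univ : Finset (F ≃ₐ[F₀] F)) = {1, D.conj} := by
    symm
    rw [← Finset.card_eq_iff_eq_univ, ← Nat.card_eq_fintype_card, hcard,
      Finset.card_pair D.conj_ne_one.symm]
  change ∑ σ ∈ (Finset.univ : Finset (F ≃ₐ[F₀] F)), σ x = _
  rw [huniv, Finset.sum_pair D.conj_ne_one.symm]
  rfl

theorem mem_range_of_unif_mul (D : RamifiedQuadratic O₀ F₀ O F) {w : F₀}
    (hw : algebraMap O F D.unif * algebraMap F₀ F w ∈ (algebraMap O F).range) :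
    w ∈ (algebraMap O₀ F₀).range := by
  have h2 : (algebraMap O F D.unif) ^ 2 = algebraMap F₀ F (algebraMap O₀ F₀ D.unif₀) := by
    rw [← map_pow, D.unif_sq, ← IsScalarTower.algebraMap_apply, ← IsScalarTower.algebraMap_apply]
  have hint : IsIntegral O₀ (algebraMap O F D.unif * algebraMap F₀ F w) :=
    (IsIntegralClosure.isIntegral_iff (A := O)).2 hw
  have h3 := hint.pow 2
  rw [mul_pow, h2, ← map_pow, ← map_mul, isIntegral_algebraMap_iff (algebraMap F₀ F).injective]
    at h3
  obtain ⟨c, hc⟩ := IsIntegrallyClosed.isIntegral_iff.1 h3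
  have h4 : (algebraMap O₀ F₀ D.unif₀ * w) ^ 2 = algebraMap O₀ F₀ (D.unif₀ * c) := by
    rw [map_mul, hc]; ring
  have h5 : IsIntegral O₀ (algebraMap O₀ F₀ D.unif₀ * w) := by
    refine IsIntegral.of_pow (n := 2) (by norm_num) ?_
    rw [h4]
    exact isIntegral_algebraMap
  obtain ⟨d, hd⟩ := IsIntegrallyClosed.isIntegral_iff.1 h5
  rw [← hd, ← map_pow] at h4
  have h6 := IsFractionRing.injective O₀ F₀ h4
  obtain ⟨e, he⟩ := D.irreducible_unif₀.prime.dvd_of_dvd_pow ⟨c, h6⟩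
  refine ⟨e, ?_⟩
  rw [he, map_mul] at hd
  refine mul_left_cancel₀ ?_ hd
  rw [Ne, map_eq_zero_iff _ (IsFractionRing.injective O₀ F₀)]
  exact D.irreducible_unif₀.ne_zero

theorem coord_of_mem_lam {x : Fin (2 * m) → F} (hx : x ∈ Lam D m) (i : Fin (2 * m)) :
    (if (i : ℕ) < m then algebraMap O F D.unif * x i else x i) ∈ (algebraMap O F).range := by
  have hπ := unif_ne_zero D
  induction hx using Submodule.span_induction with
  | mem x h =>
    obtain ⟨j, rfl⟩ := h
    by_cases hij : i = j
    · subst hij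
      by_cases hi : (i : ℕ) < m
      · simp only [hi, if_true, Pi.smul_apply, Pi.single_eq_same, smul_eq_mul, mul_one]
        rw [mul_inv_cancel₀ hπ]
        exact one_mem _
      · simp only [hi, if_false, Pi.single_eq_same]
        exact one_mem _
    · have h0 : (if (j : ℕ) < m then
          (algebraMap O F D.unif)⁻¹ • (Pi.single j 1 : Fin (2 * m) → F)
          else Pi.single j 1) i = 0 := by
        split_ifs <;> simp [hij]
      simp only [h0, mul_zero, ite_self]
      exact zero_mem _
  | zero =>
    simp only [Pi.zero_apply, mul_zero, ite_self]
    exact zero_mem _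
  | add x y _ _ h h' =>
    have := add_mem h h'
    split_ifs at this ⊢ <;> simpa [mul_add] using this
  | smul a x _ h =>
    have := mul_mem (RingHom.mem_range_self (algebraMap O F) a) h
    split_ifs at this ⊢ <;> simpa [Algebra.smul_def, mul_left_comm] using this

theorem unif_mul_hermForm {x y : Fin (2 * m) → F} (hx : x ∈ Lam D m) (hy : y ∈ Lam D m) :
    algebraMap O F D.unif * hermForm D m x y ∈ (algebraMap O F).range := by
  rw [hermForm, Finset.mul_sum]
  refine sum_mem fun i _ => ?_
  have h1 := coord_of_mem_lam D m hx i
  have h2 := coord_of_mem_lam D m hy (Fin.rev i)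
  have hπ : algebraMap O F D.unif ∈ (algebraMap O F).range := ⟨_, rfl⟩
  by_cases hi : (i : ℕ) < m
  · have hr : ¬ ((Fin.rev i : Fin (2 * m)) : ℕ) < m := by
      rw [Fin.val_rev]; omega
    simp only [hi, if_true] at h1
    simp only [hr, if_false] at h2
    have h3 := mul_mem (conj_mem_range D h1) h2
    rw [map_mul] at h3
    rcases conj_unif D with h | h <;> rw [h] at h3
    · simpa [mul_assoc] using h3
    · rw [← neg_mem_iff]
      simpa [mul_assoc] using h3
  · have hr : ((Fin.rev i : Fin (2 * m)) : ℕ) < m := by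
      rw [Fin.val_rev]; omega
    simp only [hi, if_false] at h1
    simp only [hr, if_true] at h2
    have h3 := mul_mem (conj_mem_range D h1) h2
    rwa [mul_left_comm] at h3

/-- The symmetric form takes values in `O₀` on `Λ_m`. -/
theorem symForm_mem_range (x y : Lam D m) :
    symForm D m x y ∈ LinearMap.range (Algebra.linearMap O₀ F₀) := by
  suffices h : Algebra.trace F₀ F (hermForm D m x y) ∈ (algebraMap O₀ F₀).range by
    obtain ⟨a, ha⟩ := h
    have h2 : IsUnit (2 : O₀) := by
      have := D.residue_two_ne_zero
      rw [← map_ofNat (IsLocalRing.residue O₀) 2, IsLocalRing.residue_ne_zero_iff_isUnit] at this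
      exact this
    obtain ⟨b, hb⟩ := h2.exists_right_inv
    refine ⟨b * a, ?_⟩
    have hb' : (2 : F₀) * algebraMap O₀ F₀ b = 1 := by
      rw [← map_ofNat (algebraMap O₀ F₀) 2, ← map_mul, hb, map_one]
    change algebraMap O₀ F₀ (b * a) = (2 : F₀)⁻¹ * _
    rw [map_mul, ha, eq_inv_of_mul_eq_one_right hb']
  apply mem_range_of_unif_mul D
  rw [trace_eq D, mul_add]
  have h := unif_mul_hermForm D m x.2 y.2
  refine add_mem h ?_
  have h' := conj_mem_range D h
  rw [map_mul] at h'
  rcases conj_unif D with e | e <;> rw [e] at h'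
  · exact h'
  · rwa [neg_mul, neg_mem_iff] at h'

/-- The induced `O₀`-bilinear form `Λ_m × Λ_m → O₀`. -/
def latticeForm : LinearMap.BilinForm O₀ (Lam D m) :=
  LinearMap.restrictScalarsRange₂ ((Lam D m).subtype.restrictScalars O₀)
    ((Lam D m).subtype.restrictScalars O₀) (Algebra.linearMap O₀ F₀)
    (IsFractionRing.injective O₀ F₀) (symForm D m) (symForm_mem_range D m)

/-- The endomorphism `t` of `Λ_m` induced by multiplication by `π`. -/
def latticeT : Lam D m →ₗ[O₀] Lam D m :=
  (LinearMap.lsmul O (Lam D m) D.unif).restrictScalars O₀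

/-- The standard basis vector `e i`, as an element of `Λ_m`. -/
def latticeE (i : Fin (2 * m)) : Lam D m :=
  ⟨Pi.single i 1, by
    have h := Submodule.subset_span (R := O) (Set.mem_range_self (f := fun i : Fin (2 * m) =>
      if (i : ℕ) < m then (algebraMap O F D.unif)⁻¹ • (Pi.single i 1 : Fin (2 * m) → F)
      else Pi.single i 1) i)
    by_cases hi : (i : ℕ) < m
    · have h' := Submodule.smul_mem _ D.unif h
      simp only [hi, if_true] at h'
      rw [← algebraMap_smul F D.unif, smul_smul, mul_inv_cancel₀ (unif_ne_zero D), one_smul] at h'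
      exact h'
    · simp only [hi, if_false] at h
      exact h⟩

end Lattice

section BaseChange

variable {O₀ F₀ O F : Type u}
  [CommRing O₀] [IsDomain O₀] [IsDiscreteValuationRing O₀]
  [Field F₀] [Algebra O₀ F₀] [IsFractionRing O₀ F₀]
  [Field F] [Algebra F₀ F] [Algebra O₀ F] [IsScalarTower O₀ F₀ F]
  [CommRing O] [IsDomain O] [IsDiscreteValuationRing O]
  [Algebra O₀ O] [Algebra O F] [IsScalarTower O₀ O F] [IsIntegralClosure O O₀ F]
  (D : RamifiedQuadratic O₀ F₀ O F) (m : ℕ)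

/-- `Λ_m ⊗_{O₀} O`. -/
abbrev LamO : Type u := O ⊗[O₀] Lam D m

variable (R : Type u) [CommRing R] [Algebra O R]

/-- `Λ_m ⊗_{O₀} R = (Λ_m ⊗_{O₀} O) ⊗_O R` for an `O`-algebra `R`. -/
abbrev LamR : Type u := R ⊗[O] LamO D m

/-- The endomorphism `t = π ⊗ 1` of `Λ_m ⊗ R`. -/
def tR : LamR D m R →ₗ[R] LamR D m R :=
  ((latticeT D m).baseChange O).baseChange R

/-- The symmetric form on `Λ_m ⊗ R`. -/
def formR : LinearMap.BilinForm R (LamR D m R) :=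
  LinearMap.BilinForm.baseChange R (LinearMap.BilinForm.baseChange O (latticeForm D m))

/-- The operator `t + π`. -/
def tPlus : LamR D m R →ₗ[R] LamR D m R := tR D m R + algebraMap O R D.unif • LinearMap.id

/-- The operator `t - π`. -/
def tMinus : LamR D m R →ₗ[R] LamR D m R := tR D m R - algebraMap O R D.unif • LinearMap.id

/-- The canonical map `⋀^n (Λ_m ⊗ O) → ⋀^n (Λ_m ⊗ R)`, where `n = 2m`. -/
def wedgeMap : ⋀[O]^(2 * m) (LamO D m) →ₗ[O] ⋀[R]^(2 * m) (LamR D m R) :=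
  exteriorPower.alternatingMapLinearEquiv
    (({ (exteriorPower.ιMulti R (2 * m) (M := LamR D m R)).toMultilinearMap.restrictScalars O with
        map_eq_zero_of_eq' := (exteriorPower.ιMulti R (2 * m)).map_eq_zero_of_eq' } :
      (LamR D m R) [⋀^Fin (2 * m)]→ₗ[O] ⋀[R]^(2 * m) (LamR D m R)).compLinearMap
      (TensorProduct.mk O R (LamO D m) 1))

theorem wedgeMap_ιMulti (v : Fin (2 * m) → LamO D m) :
    wedgeMap D m R (exteriorPower.ιMulti O (2 * m) v) =
      exteriorPower.ιMulti R (2 * m) (fun i => (1 : R) ⊗ₜ[O] v i) := by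
  simp only [wedgeMap, exteriorPower.alternatingMapLinearEquiv_apply_ιMulti]
  rfl

/-- The split ordered basis of `V ⊗_{F₀} F = Λ_m ⊗_{O₀} F` consisting of
`e i ⊗ 1 - π e i ⊗ π⁻¹` for `1 ≤ i ≤ n`, followed by `½ (e i ⊗ 1 + π e i ⊗ π⁻¹)` for
`1 ≤ i ≤ n`, where `n = 2m`. The `i`-th vector pairs to `1` with the `(2n + 1 - i)`-th one and
to `0` with all others. -/
def splitBasis : Fin (2 * m + 2 * m) → LamR D m F :=
  Fin.append
    (fun i => (1 : F) ⊗ₜ[O] ((1 : O) ⊗ₜ[O₀] latticeE D m i) -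
      (algebraMap O F D.unif)⁻¹ ⊗ₜ[O] ((1 : O) ⊗ₜ[O₀] latticeT D m (latticeE D m i)))
    (fun i => (2 : F)⁻¹ • ((1 : F) ⊗ₜ[O] ((1 : O) ⊗ₜ[O₀] latticeE D m i) +
      (algebraMap O F D.unif)⁻¹ ⊗ₜ[O] ((1 : O) ⊗ₜ[O₀] latticeT D m (latticeE D m i))))

/-- The summand `W_ε` (`ε = ±1`) of `W = ⋀^n (V ⊗_{F₀} F)`, `n = 2m`. In terms of the split
ordered basis `f`, it is spanned by the vectors `f_S + ε sgn(σ_S) f_{S^⊥}`, where `S` runs through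
the subsets of `{1, …, 2n}` with `n` elements, `σ_S` is a permutation sending `{1, …, n}` to `S`,
and `S^⊥` is the complement of `{2n + 1 - i | i ∈ S}`. Below, `σ = σ_S` is arbitrary and
`f_S = f_{σ 1} ∧ … ∧ f_{σ n}`, `f_{S^⊥} = f_{σ' 1} ∧ … ∧ f_{σ' n}` with
`σ' i = 2n + 1 - σ (2n + 1 - i)`; reordering `S` or its complement changes a generator only by
a sign. -/
def W (ε : ℤˣ) : Submodule F (⋀[F]^(2 * m) (LamR D m F)) :=
  Submodule.span F (Set.range fun σ : Equiv.Perm (Fin (2 * m + 2 * m)) =>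
    exteriorPower.ιMulti F (2 * m)
        (fun i : Fin (2 * m) => splitBasis D m (σ (Fin.castAdd (2 * m) i))) +
      (ε * Equiv.Perm.sign σ) • exteriorPower.ιMulti F (2 * m)
        (fun i : Fin (2 * m) =>
          splitBasis D m (Fin.rev (σ (Fin.rev (Fin.castAdd (2 * m) i))))))

/-- `W(Λ_m)_ε = W_ε ∩ W(Λ_m)`, where `W(Λ_m) = ⋀^n (Λ_m ⊗ O)`. -/
def WLam (ε : ℤˣ) : Submodule O (⋀[O]^(2 * m) (LamO D m)) :=
  ((W D m ε).restrictScalars O).comap (wedgeMap D m F)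

/-- `L_{m,ε}(R)`, the image of `W(Λ_m)_ε ⊗ R` in `W(Λ_m) ⊗ R = ⋀^n (Λ_m ⊗ R)`. -/
def L (ε : ℤˣ) : Submodule R (⋀[R]^(2 * m) (LamR D m R)) :=
  Submodule.span R (wedgeMap D m R '' WLam D m ε)

/-- The points of the splitting model `M^spl` with values in an `O`-algebra `R`: pairs
`G ⊆ F ⊆ Λ_m ⊗ R` of locally direct summands of rank `s` and `n = 2m`. -/
structure SplPoint (s : ℕ) where
  /-- The subspace `F_m`. -/
  Fil : Submodule R (LamR D m R)
  /-- The subspace `G_m`. -/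
  Gil : Submodule R (LamR D m R)
  fil_summand : IsSummandOfRank (2 * m) Fil
  gil_summand : IsSummandOfRank s Gil
  gil_le_fil : Gil ≤ Fil
  fil_eq_orthogonal : Fil = (formR D m R).orthogonal Fil
  map_tPlus_le : Fil.map (tPlus D m R) ≤ Gil
  map_tMinus_eq_bot : Gil.map (tMinus D m R) = ⊥
  /-- The spin condition `⋀^n F_m ⊆ L_{m,(-1)^s}(R)`. -/
  spin : ∀ v : Fin (2 * m) → LamR D m R, (∀ i, v i ∈ Fil) →
    exteriorPower.ιMulti R (2 * m) v ∈ L D m R ((-1) ^ s)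

variable {D m R}

/-- The dual `G^⊥'` of `G_m ⊆ (t + π)Λ_m` under the modified pairing
`{(t + π)x, (t - π)y} = ((t + π)x, y)` between `(t + π)Λ_m` and `(t - π)Λ_m`: the set of those
`w = (t - π)y` with `{g, w} = (g, y) = 0` for all `g` in `G_m`. -/
def SplPoint.gilDual {s : ℕ} (x : SplPoint D m R s) : Submodule R (LamR D m R) :=
  ((formR D m R).orthogonal x.Gil).map (tMinus D m R)

/-- The dimension of `t F_m`, for a point with values in a field. -/
def SplPoint.dimTFil {s : ℕ} (x : SplPoint D m R s) : ℕ :=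
  Module.finrank R (x.Fil.map (tR D m R))

/-- The dimension of `G_m ∩ G_m^⊥'`, for a point with values in a field. -/
def SplPoint.dimGilInf {s : ℕ} (x : SplPoint D m R s) : ℕ :=
  Module.finrank R (x.Gil ⊓ x.gilDual : Submodule R (LamR D m R))

/-- The base change of a submodule of `Λ_m ⊗ R` along `R → R'`: the submodule of `Λ_m ⊗ R'`
generated by its image. -/
def pushSubmodule {R' : Type u} [CommRing R'] [Algebra O R'] (g : R →ₐ[O] R')
    (P : Submodule R (LamR D m R)) : Submodule R' (LamR D m R') :=
  Submodule.span R' (LinearMap.rTensor (LamO D m) g.toLinearMap '' P)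

variable (D m)

/-- A scheme over `O` representing the moduli problem of the splitting model: its `R`-valued
points over `O`, for any `O`-algebra `R`, are the pairs `(F_m, G_m)` over `R`, compatibly with
base change. -/
structure SplModel (s : ℕ) where
  /-- The scheme. -/
  scheme : Scheme.{u}
  /-- The structure morphism. -/
  str : scheme ⟶ Spec (.of O)
  /-- The functor of points. -/
  point (R : Type u) [CommRing R] [Algebra O R] :
    {f : Spec (.of R) ⟶ scheme // f ≫ str = Spec.map (CommRingCat.ofHom (algebraMap O R))} ≃
      SplPoint D m R s
  point_natural (R R' : Type u) [CommRing R] [CommRing R'] [Algebra O R] [Algebra O R']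
    (g : R →ₐ[O] R')
    (f : {f : Spec (.of R) ⟶ scheme //
      f ≫ str = Spec.map (CommRingCat.ofHom (algebraMap O R))})
    (f' : {f : Spec (.of R') ⟶ scheme //
      f ≫ str = Spec.map (CommRingCat.ofHom (algebraMap O R'))})
    (h : f'.1 = Spec.map (CommRingCat.ofHom g.toRingHom) ≫ f.1) :
    (point R' f').Fil = pushSubmodule g (point R f).Fil ∧
      (point R' f').Gil = pushSubmodule g (point R f).Gil

variable {D m}

namespace SplModel

variable {s : ℕ} (M : SplModel D m s)

/-- The special fiber `M^spl ⊗ k`, where `k` is the residue field. -/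
def specialFiber : Scheme.{u} :=
  Limits.pullback M.str (Spec.map (CommRingCat.ofHom (IsLocalRing.residue O)))

/-- The projection `M^spl ⊗ k → M^spl`. -/
def specialFiberι : M.specialFiber ⟶ M.scheme := Limits.pullback.fst _ _

/-- The structure morphism `M^spl ⊗ k → Spec k`. -/
def specialFiberStr : M.specialFiber ⟶ Spec (.of (IsLocalRing.ResidueField O)) :=
  Limits.pullback.snd _ _

/-- The `O`-algebra structure on the residue field of a point of the special fiber. -/
abbrev residueAlgebra (x : M.specialFiber) : Algebra O (M.specialFiber.residueField x) :=
  (Spec.preimage (M.specialFiber.fromSpecResidueField x ≫ M.specialFiberι ≫ M.str)).hom.toAlgebra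

/-- The pair `(F_m, G_m)` over the residue field `κ(x)` of a point `x` of the special fiber. -/
def pointAt (x : M.specialFiber) :
    letI := M.residueAlgebra x
    SplPoint D m (M.specialFiber.residueField x) s :=
  letI := M.residueAlgebra x
  M.point (M.specialFiber.residueField x)
    ⟨M.specialFiber.fromSpecResidueField x ≫ M.specialFiberι, by
      rw [Category.assoc]
      exact (Spec.map_preimage _).symm⟩

/-- The stratum `X_{h,l}`: the points `x` of the special fiber with `dim t F_m = h` and
`dim (G_m ∩ G_m^⊥') = l`. -/
def stratum (h l : ℕ) : Set M.specialFiber :=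
  {x |
    letI := M.residueAlgebra x
    (M.pointAt x).dimTFil = h ∧ (M.pointAt x).dimGilInf = l}

end SplModel

end BaseChange

end SplittingModel

end

/-! Representability. In a suitable basis `Λ_m ⊗ R` is `R^(4m)` with the hyperbolic form and an
explicit operator `t`. Locally `F_m` and `G_m` have unique frames showing an identity matrix at
chosen positions, and in terms of such frames the moduli conditions are polynomial equations. Each
choice of positions gives an affine chart; the charts are glued along the loci where minors are
invertible. The spin condition is handled by two families of linear forms on the exterior power,
`gramDet` and `fullDet`: the module `L_{m,ε}` is the locus where they agree up to the sign `ε`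
(`mem_L_iff`), and on an isotropic frame with a dual frame this is one equation
(`IsDualFrame.spin_iff`).

Special fibre. When `π = 0`, a vector is a pair `(y, u)` of vectors of a symplectic space with form
`ω`, and `t (y, u) = (u, 0)`, `(v, v') = ω(y, u') + ω(y', u)`. A point is a Lagrangian `F` with `t F
⊆ G ⊆ F ∩ {u = 0}`. Isotropy of `F` puts `t F` inside the radical `G ∩ G^⊥'` of `ω` on `G`, so `h ≤
l`. Both dimensions have the parity of `s`: a Lagrangian frame adapted to `t` has sign `(-1)^h`,
which the spin condition fixes, and `ω` is nondegenerate alternating on `G` modulo its radical.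

Smoothness for `h = l` (`RedPoint.exists_lift`). Over a local ring `F` is spanned by vectors `V₁`,
whose images under `t` span `t F`, and by vectors with `u = 0`, while `G` is spanned by `t V₁` and
vectors with invertible Gram matrix. Along a square zero extension, `t V₁` is lifted so as to be
orthogonal to all of `G`, then the `y`-parts are corrected so that `F` is isotropic. Since 2 is
invertible, the spin sign cannot change. Infinitesimal lifting for local rings, together with finite
presentation, gives smoothness.

Obstruction for `h < l` (`RedPoint.exists_obstructed`). By parity `l - h ≥ 2`, so there are `p₀, p₁`
in the radical independent modulo `t F`, and `y₀, y₁` orthogonal to `t F` with `ω(y_i, p_j) = δ_ij`.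
To first order, `F` is moved by `v ↦ (0, ω(y_v, p₁) p₀ - ω(y_v, p₀) p₁)` and `G` by `g ↦ (ω(y₀, y_g)
y₁, 0)`. In an extension modulo `ε³`, a lift `g` of `p₀ + ε y₁` in `G` and a lift `v` of `(y₀, -ε
p₁)` in `F` must be orthogonal; but `t v = ε z` with `z` in `G` reducing to `-p₁`, and `ω(g, z)` is
`-ε` modulo `ε²`.

Points with prescribed invariants are spanned by coordinate vectors
(`RedPoint.exists_of_invariants`). Everything is proved for an arbitrary representing scheme, which
is isomorphic to the glued one by Yoneda on affine schemes. -/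

noncomputable section

set_option linter.unusedSectionVars false

namespace SplittingModel

/-! ### Representing a functor by gluing affine charts. -/

/-- A set-valued functor on the category of `O`-algebras. -/
structure PointFunctor (O : Type u) [CommRing O] where
  /-- The points with values in `R`. -/
  obj (R : Type u) [CommRing R] [Algebra O R] : Type u
  /-- Base change. -/
  map {R R' : Type u} [CommRing R] [Algebra O R] [CommRing R'] [Algebra O R'] (g : R →ₐ[O] R') :
    obj R → obj R'
  map_id (R : Type u) [CommRing R] [Algebra O R] (x : obj R) : map (AlgHom.id O R) x = x
  map_comp {R R' R'' : Type u} [CommRing R] [Algebra O R] [CommRing R'] [Algebra O R']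
    [CommRing R''] [Algebra O R''] (g : R →ₐ[O] R') (h : R' →ₐ[O] R'') (x : obj R) :
    map (h.comp g) x = map h (map g x)

/-- The morphism of spectra induced by a map of algebras. -/
abbrev specMap {O A R : Type u} [CommRing O] [CommRing A] [Algebra O A] [CommRing R] [Algebra O R]
    (φ : A →ₐ[O] R) : Spec (.of R) ⟶ Spec (.of A) := Spec.map (CommRingCat.ofHom φ.toRingHom)

theorem specMap_comp {O A R R' : Type u} [CommRing O] [CommRing A] [Algebra O A] [CommRing R]
    [Algebra O R] [CommRing R'] [Algebra O R'] (φ : A →ₐ[O] R) (ψ : R →ₐ[O] R') :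
    specMap (ψ.comp φ) = specMap ψ ≫ specMap φ := by
  rw [← Spec.map_comp]; rfl

theorem specMap_id {O A : Type u} [CommRing O] [CommRing A] [Algebra O A] :
    specMap (AlgHom.id O A) = 𝟙 _ := Spec.map_id _

theorem specMap_injective {O A R : Type u} [CommRing O] [CommRing A] [Algebra O A] [CommRing R]
    [Algebra O R] {φ ψ : A →ₐ[O] R} (h : specMap φ = specMap ψ) : φ = ψ := by
  have := Spec.map_injective h
  ext a
  exact congr($(this).hom a)

/-- A cover of a functor by open affine subfunctors, closed under finite intersections. -/
structure DirectedAtlas {O : Type u} [CommRing O] (P : PointFunctor O) where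
  /-- The index set. -/
  J : Type u
  [inst : SemilatticeSup J]
  /-- The coordinate rings. -/
  A : J → Type u
  [ring (j : J) : CommRing (A j)]
  [alg (j : J) : Algebra O (A j)]
  /-- The universal points. -/
  univ (j : J) : P.obj (A j)
  inj (j : J) {R : Type u} [CommRing R] [Algebra O R] {φ ψ : A j →ₐ[O] R}
    (h : P.map φ (univ j) = P.map ψ (univ j)) : φ = ψ
  /-- The equation of the complement of the `j`-th subfunctor in the `i`-th one. -/
  δ (i j : J) : A i
  isUnit_iff (i j : J) {R : Type u} [CommRing R] [Algebra O R] (φ : A i →ₐ[O] R) :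
    IsUnit (φ (δ i j)) ↔ ∃ ψ : A j →ₐ[O] R, P.map ψ (univ j) = P.map φ (univ i)
  exists_of_le {i j : J} (h : i ≤ j) : ∃ φ : A i →ₐ[O] A j, P.map φ (univ i) = univ j
  exists_sup {i j : J} {R : Type u} [CommRing R] [Algebra O R] (φ : A i →ₐ[O] R)
    (ψ : A j →ₐ[O] R) (h : P.map φ (univ i) = P.map ψ (univ j)) :
    ∃ θ : A (i ⊔ j) →ₐ[O] R, P.map θ (univ (i ⊔ j)) = P.map φ (univ i)

attribute [instance] DirectedAtlas.inst DirectedAtlas.ring DirectedAtlas.alg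

namespace DirectedAtlas

variable {O : Type u} [CommRing O] {P : PointFunctor O} (T : DirectedAtlas P)

/-- The transition map. -/
def tr {i j : T.J} (h : i ≤ j) : T.A i →ₐ[O] T.A j := (T.exists_of_le h).choose

theorem map_tr {i j : T.J} (h : i ≤ j) : P.map (T.tr h) (T.univ i) = T.univ j :=
  (T.exists_of_le h).choose_spec

/-- By `inj` a map out of a chart ring is determined by the point it induces, so functoriality of
the transition maps is read off from universal points. -/
theorem tr_refl (i : T.J) : T.tr (le_refl i) = AlgHom.id O _ :=
  T.inj i (by rw [map_tr, P.map_id])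

theorem tr_comp {i j k : T.J} (h : i ≤ j) (h' : j ≤ k) :
    (T.tr h').comp (T.tr h) = T.tr (h.trans h') :=
  T.inj i (by rw [P.map_comp, map_tr, map_tr, map_tr])

theorem comp_tr_eq {i j : T.J} (h : i ≤ j) {R : Type u} [CommRing R] [Algebra O R]
    {φ : T.A i →ₐ[O] R} {θ : T.A j →ₐ[O] R} (e : P.map θ (T.univ j) = P.map φ (T.univ i)) :
    θ.comp (T.tr h) = φ :=
  T.inj i (by rw [P.map_comp, map_tr, e])

theorem isUnit_tr_δ {i j : T.J} (h : i ≤ j) : IsUnit (T.tr h (T.δ i j)) :=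
  (T.isUnit_iff i j _).2 ⟨AlgHom.id O _, by rw [map_tr, P.map_id]⟩

/-- By `isUnit_iff`, inverting `δ i j` amounts to requiring the `i`-th universal point to lie in the
`j`-th chart. Thus `L` and `T.A j` have the same universal property, and `inj` shows that the
comparison maps are inverse to each other. -/
theorem isLocalization_tr {i j : T.J} (h : i ≤ j) :
    letI := (T.tr h).toRingHom.toAlgebra
    IsLocalization.Away (T.δ i j) (T.A j) := by
  let _ := (T.tr h).toRingHom.toAlgebra
  let L := Localization.Away (T.δ i j)
  let a : T.A i →ₐ[O] L := IsScalarTower.toAlgHom O _ _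
  obtain ⟨ψ, hψ⟩ := (T.isUnit_iff i j a).1 (IsLocalization.Away.algebraMap_isUnit _)
  have hψa : ψ.comp (T.tr h) = a := T.comp_tr_eq h hψ
  let b : L →ₐ[O] T.A j := IsLocalization.liftAlgHom (M := Submonoid.powers (T.δ i j))
    (f := T.tr h) (by
      rintro ⟨_, n, rfl⟩
      simpa using (T.isUnit_tr_δ h).pow n)
  have hb : b.comp a = T.tr h := by
    ext x
    simp [a, b]
  have h1 : b.comp ψ = AlgHom.id O _ := T.inj j (by
    rw [P.map_comp, hψ, ← P.map_comp, hb, map_tr, P.map_id])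
  have h2 : ψ.comp b = AlgHom.id O _ := by
    apply IsLocalization.algHom_ext (Submonoid.powers (T.δ i j))
    change (ψ.comp b).comp a = (AlgHom.id O L).comp a
    rw [AlgHom.comp_assoc, hb, hψa, AlgHom.id_comp]
  let e : L ≃ₐ[T.A i] T.A j := AlgEquiv.ofRingEquiv (f := (AlgEquiv.ofAlgHom b ψ h1 h2).toRingEquiv)
    (fun x => congr($hb x))
  exact IsLocalization.isLocalization_of_algEquiv _ e

instance isOpenImmersion_tr {i j : T.J} (h : i ≤ j) : IsOpenImmersion (specMap (T.tr h)) := by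
  let _ := (T.tr h).toRingHom.toAlgebra
  have := T.isLocalization_tr h
  exact IsOpenImmersion.of_isLocalization (T.δ i j)

/-- The diagram of affine schemes. -/
def diagram : T.Jᵒᵖ ⥤ Scheme.{u} where
  obj j := Spec (.of (T.A j.unop))
  map f := specMap (T.tr (leOfHom f.unop))
  map_id j := by
    rw [← specMap_id (O := O)]; congr 1; exact T.tr_refl _
  map_comp f g := by
    rw [← specMap_comp]; congr 1; exact (T.tr_comp _ _).symm

instance {i j : T.Jᵒᵖ} (f : i ⟶ j) : IsOpenImmersion (T.diagram.map f) :=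
  T.isOpenImmersion_tr (leOfHom f.unop)

/-- The `k`-th universal point lies in both charts `i` and `j`, so the equation of the complement of
chart `j` becomes a unit on chart `k`. -/
theorem δ_notMem {i j k : T.J} (hi : i ≤ k) (hj : j ≤ k) (z : Spec (.of (T.A k))) :
    T.δ i j ∉ (specMap (T.tr hi) z).asIdeal := by
  have h : IsUnit (T.tr hi (T.δ i j)) :=
    (T.isUnit_iff i j (T.tr hi)).2 ⟨T.tr hj, by rw [map_tr, map_tr]⟩
  intro hmem
  exact z.2.ne_top (Ideal.eq_top_of_isUnit_mem _ hmem h)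

theorem exists_specMap_tr_eq {i j : T.J} (h : i ≤ j) (x : Spec (.of (T.A i)))
    (hx : T.δ i j ∉ x.asIdeal) : ∃ z, specMap (T.tr h) z = x := by
  let _ := (T.tr h).toRingHom.toAlgebra
  have := T.isLocalization_tr h
  have h' := PrimeSpectrum.localization_away_comap_range (T.A j) (T.δ i j)
  exact (eq_iff_iff.mp congr(x ∈ $h')).mpr hx

/-- The chart of `i ⊔ j` plays the role of the intersection. The point `xi` belongs to it as soon as
the associated point over its residue field lies in chart `j`, and this can be tested in the larger
chart `k`. -/
instance : (T.diagram ⋙ Scheme.forget).IsLocallyDirected where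
  cond := by
    intro i j k fi fj xi xj hij
    have hki := leOfHom fi.unop
    have hkj := leOfHom fj.unop
    change Spec (.of (T.A i.unop)) at xi
    change Spec (.of (T.A j.unop)) at xj
    replace hij : specMap (T.tr hki) xi = specMap (T.tr hkj) xj := hij
    have h1 : T.δ k.unop j.unop ∉ (specMap (T.tr hki) xi).asIdeal := by
      rw [hij]
      exact T.δ_notMem hkj le_rfl xj
    have h2 : T.δ i.unop (i.unop ⊔ j.unop) ∉ xi.asIdeal := by
      have := (show PrimeSpectrum (T.A i.unop) from xi).2
      -- Over the residue field, not lying in the prime becomes being invertible, which is what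
      -- `isUnit_iff` speaks about.
      let κ := xi.asIdeal.ResidueField
      let φ : T.A i.unop →ₐ[O] κ := IsScalarTower.toAlgHom O _ _
      have hφ (a) : IsUnit (φ a) ↔ a ∉ xi.asIdeal := by
        rw [isUnit_iff_ne_zero, Ne]
        exact not_congr (Ideal.algebraMap_residueField_eq_zero)
      obtain ⟨ψ, hψ⟩ := (T.isUnit_iff k.unop j.unop (φ.comp (T.tr hki))).1 ((hφ _).2 h1)
      rw [P.map_comp, map_tr] at hψ
      obtain ⟨θ, hθ⟩ := T.exists_sup φ ψ hψ.symm
      exact (hφ _).1 ((T.isUnit_iff _ _ φ).2 ⟨θ, hθ⟩)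
    obtain ⟨z, hz⟩ := T.exists_specMap_tr_eq (le_sup_left : i.unop ≤ i.unop ⊔ j.unop) xi h2
    refine ⟨.op (i.unop ⊔ j.unop), (homOfLE le_sup_left).op, (homOfLE le_sup_right).op, z, hz, ?_⟩
    apply (specMap (T.tr hkj)).isOpenEmbedding.injective
    change specMap (T.tr hkj) (specMap (T.tr le_sup_right) z) = specMap (T.tr hkj) xj
    rw [← hij, ← hz, ← Scheme.Hom.comp_apply, ← Scheme.Hom.comp_apply, ← specMap_comp,
      ← specMap_comp, tr_comp, tr_comp]

/-- The scheme glued from an atlas. -/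
def glued : Scheme.{u} := Limits.colimit T.diagram

/-- The inclusion of an affine chart. -/
def ι (i : T.J) : Spec (.of (T.A i)) ⟶ T.glued := Limits.colimit.ι T.diagram (.op i)

instance (i : T.J) : IsOpenImmersion (T.ι i) :=
  inferInstanceAs (IsOpenImmersion (Limits.colimit.ι T.diagram (.op i)))

theorem tr_ι {i j : T.J} (h : i ≤ j) : specMap (T.tr h) ≫ T.ι i = T.ι j :=
  Limits.colimit.w T.diagram (homOfLE h).op

theorem exists_ι_eq (x : T.glued) : ∃ i y, T.ι i y = x := by
  obtain ⟨i, y, h⟩ := Scheme.IsLocallyDirected.ι_jointly_surjective T.diagram x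
  exact ⟨i.unop, y, h⟩

/-- The structure morphism of the glued scheme. -/
def str : T.glued ⟶ Spec (.of O) :=
  Limits.colimit.desc T.diagram
    { pt := Spec (.of O)
      ι :=
        { app := fun j => Spec.map (CommRingCat.ofHom (algebraMap O (T.A j.unop)))
          naturality := by
            intro i j f
            dsimp [diagram]
            rw [← Spec.map_comp, Category.comp_id, ← CommRingCat.ofHom_comp]
            congr 2
            exact AlgHom.comp_algebraMap _ } }

theorem ι_str (i : T.J) :
    T.ι i ≫ T.str = Spec.map (CommRingCat.ofHom (algebraMap O (T.A i))) :=
  Limits.colimit.ι_desc _ _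

theorem specMap_ι_eq {i j : T.J} {R : Type u} [CommRing R] [Algebra O R] {φ : T.A i →ₐ[O] R}
    {ψ : T.A j →ₐ[O] R} (h : P.map φ (T.univ i) = P.map ψ (T.univ j)) :
    specMap φ ≫ T.ι i = specMap ψ ≫ T.ι j := by
  obtain ⟨θ, hθ⟩ := T.exists_sup φ ψ h
  rw [← T.comp_tr_eq le_sup_left hθ, ← T.comp_tr_eq le_sup_right (hθ.trans h), specMap_comp,
    specMap_comp, Category.assoc, Category.assoc, tr_ι, tr_ι]

theorem map_univ_eq {i j : T.J} {R : Type u} [CommRing R] [Algebra O R] {φ : T.A i →ₐ[O] R}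
    {ψ : T.A j →ₐ[O] R} (h : specMap φ ≫ T.ι i = specMap ψ ≫ T.ι j) :
    P.map φ (T.univ i) = P.map ψ (T.univ j) := by
  -- Invertibility is tested at maximal ideals. There the two image points coincide in the glued
  -- scheme, so both come from a common smaller chart, where `δ i j` does not vanish.
  have hu : IsUnit (φ (T.δ i j)) := by
    by_contra hu
    obtain ⟨I, hI, hmem⟩ := exists_max_ideal_of_mem_nonunits hu
    let p : Spec (.of R) := ⟨I, hI.isPrime⟩
    have hp : T.ι i (specMap φ p) = T.ι j (specMap ψ p) := by
      rw [← Scheme.Hom.comp_apply, h, Scheme.Hom.comp_apply]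
    obtain ⟨k, fi, fj, z, hzi, -⟩ := (Scheme.IsLocallyDirected.ι_eq_ι_iff T.diagram).1 hp
    have := T.δ_notMem (leOfHom fi.unop) (leOfHom fj.unop) z
    apply this
    have e : specMap (T.tr (leOfHom fi.unop)) z = specMap φ p := hzi
    rw [e]
    exact hmem
  obtain ⟨ψ', hψ'⟩ := (T.isUnit_iff i j φ).1 hu
  -- The factorization through chart `j` just obtained must be `ψ`, since `T.ι j` is a monomorphism.
  have h1 := T.specMap_ι_eq hψ'
  rw [h, cancel_mono] at h1
  rw [← hψ', specMap_injective h1]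

end DirectedAtlas

/-- The localization map as a map of `O`-algebras. -/
abbrev awayHom (O : Type u) [CommRing O] {R : Type u} [CommRing R] [Algebra O R] (r : R) :
    R →ₐ[O] Localization.Away r := IsScalarTower.toAlgHom O R _

/-- The map between localizations induced by a map of algebras. -/
def awayMap {O R R' : Type u} [CommRing O] [CommRing R] [Algebra O R] [CommRing R']
    [Algebra O R'] (g : R →ₐ[O] R') (r : R) : Localization.Away r →ₐ[O] Localization.Away (g r) :=
  IsLocalization.liftAlgHom (M := Submonoid.powers r) (f := (awayHom O (g r)).comp g) (by
    rintro ⟨_, n, rfl⟩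
    simpa using (IsLocalization.Away.algebraMap_isUnit (S := Localization.Away (g r)) (g r)).pow n)

theorem awayMap_comp {O R R' : Type u} [CommRing O] [CommRing R] [Algebra O R] [CommRing R']
    [Algebra O R'] (g : R →ₐ[O] R') (r : R) :
    (awayMap g r).comp (awayHom O r) = (awayHom O (g r)).comp g := by
  ext x
  simp [awayMap]

/-- The open cover by basic opens avoiding every prime. -/
def basicCover {R : Type u} [CommRing R] (r : PrimeSpectrum R → R) (hr : ∀ p, r p ∉ p.asIdeal) :
    (Spec (.of R)).OpenCover :=
  (Scheme.affineOpenCoverOfSpanRangeEqTop (R := .of R) r (by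
    by_contra h
    obtain ⟨M, hM, hle⟩ := Ideal.exists_le_maximal _ h
    exact hr ⟨M, hM.isPrime⟩ (hle (Ideal.subset_span ⟨_, rfl⟩)))).openCover

theorem basicCover_hom_ext {O R : Type u} [CommRing O] [CommRing R] [Algebra O R]
    (r : PrimeSpectrum R → R) (hr : ∀ p, r p ∉ p.asIdeal) {X : Scheme.{u}} {f g : Spec (.of R) ⟶ X}
    (h : ∀ p, specMap (awayHom O (r p)) ≫ f = specMap (awayHom O (r p)) ≫ g) : f = g :=
  (basicCover r hr).hom_ext _ _ h

namespace PointFunctor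

variable {O : Type u} [CommRing O] (P : PointFunctor O)

/-- The sheaf property for covers of affine schemes by basic opens. -/
structure IsZariskiSheaf : Prop where
  sep {R : Type u} [CommRing R] [Algebra O R] (r : PrimeSpectrum R → R)
    (hr : ∀ p, r p ∉ p.asIdeal) {x y : P.obj R}
    (h : ∀ p, P.map (awayHom O (r p)) x = P.map (awayHom O (r p)) y) : x = y
  glue {R : Type u} [CommRing R] [Algebra O R] (r : PrimeSpectrum R → R)
    (hr : ∀ p, r p ∉ p.asIdeal) (x : ∀ p, P.obj (Localization.Away (r p)))
    (h : ∀ (p q : PrimeSpectrum R) (R' : Type u) [CommRing R'] [Algebra O R']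
      (f : Localization.Away (r p) →ₐ[O] R') (g : Localization.Away (r q) →ₐ[O] R'),
      f.comp (awayHom O (r p)) = g.comp (awayHom O (r q)) → P.map f (x p) = P.map g (x q)) :
    ∃ y : P.obj R, ∀ p, P.map (awayHom O (r p)) y = x p

end PointFunctor

namespace DirectedAtlas

variable {O : Type u} [CommRing O] {P : PointFunctor O} (T : DirectedAtlas P)

/-- The charts cover the functor. -/
def IsCovering : Prop :=
  ∀ (R : Type u) [CommRing R] [Algebra O R] (x : P.obj R) (p : PrimeSpectrum R),
    ∃ r ∉ p.asIdeal, ∃ (j : T.J) (φ : T.A j →ₐ[O] Localization.Away r),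
      P.map φ (T.univ j) = P.map (awayHom O r) x

/-- The points of a scheme over `O` with values in `R`. -/
abbrev _root_.SplittingModel.SchemePoint {X : Scheme.{u}} (str : X ⟶ Spec (.of O)) (R : Type u)
    [CommRing R] [Algebra O R] : Type u :=
  {f : Spec (.of R) ⟶ X // f ≫ str = Spec.map (CommRingCat.ofHom (algebraMap O R))}

theorem _root_.SplittingModel.specMap_over {R R' : Type u} [CommRing R] [Algebra O R] [CommRing R']
    [Algebra O R'] (g : R →ₐ[O] R') :
    specMap g ≫ Spec.map (CommRingCat.ofHom (algebraMap O R)) =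
      Spec.map (CommRingCat.ofHom (algebraMap O R')) := by
  rw [← Spec.map_comp, ← CommRingCat.ofHom_comp]
  congr 2
  exact g.comp_algebraMap

/-- A morphism over `O` between spectra comes from a map of algebras. -/
theorem _root_.SplittingModel.exists_specMap_eq {A R : Type u} [CommRing A] [Algebra O A]
    [CommRing R] [Algebra O R] (f : Spec (.of R) ⟶ Spec (.of A))
    (hf : f ≫ Spec.map (CommRingCat.ofHom (algebraMap O A)) =
      Spec.map (CommRingCat.ofHom (algebraMap O R))) : ∃ φ : A →ₐ[O] R, specMap φ = f := by
  obtain ⟨φ, rfl⟩ := Spec.map_surjective f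
  refine ⟨⟨φ.hom, fun a => ?_⟩, rfl⟩
  rw [← Spec.map_comp] at hf
  exact congr($(Spec.map_injective hf).hom a)

/-- A morphism from an affine scheme locally factors through the charts. -/
theorem exists_local_chart {R : Type u} [CommRing R] [Algebra O R] (f : SchemePoint T.str R)
    (p : PrimeSpectrum R) : ∃ r ∉ p.asIdeal, ∃ (j : T.J) (φ : T.A j →ₐ[O] Localization.Away r),
      specMap (awayHom O r) ≫ f.1 = specMap φ ≫ T.ι j := by
  obtain ⟨j, y, hy⟩ := T.exists_ι_eq (f.1 p)
  let U : TopologicalSpace.Opens (PrimeSpectrum R) := f.1 ⁻¹ᵁ (T.ι j).opensRange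
  obtain ⟨_, ⟨r, rfl⟩, hpr, hle⟩ :=
    PrimeSpectrum.isTopologicalBasis_basic_opens.exists_subset_of_mem_open
      (show p ∈ (U : Set (PrimeSpectrum R)) from ⟨y, hy⟩) U.2
  refine ⟨r, hpr, j, ?_⟩
  have hrange : Set.range (specMap (awayHom O r) ≫ f.1) ⊆ Set.range (T.ι j) := by
    rintro _ ⟨z, rfl⟩
    have hz : specMap (awayHom O r) z ∈ (PrimeSpectrum.basicOpen r : Set (PrimeSpectrum R)) := by
      rw [← PrimeSpectrum.localization_away_comap_range (Localization.Away r) r]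
      exact ⟨z, rfl⟩
    rw [Scheme.Hom.comp_apply]
    exact hle hz
  obtain ⟨φ, hφ⟩ := exists_specMap_eq (O := O) (IsOpenImmersion.lift (T.ι j) _ hrange) (by
    rw [← T.ι_str, IsOpenImmersion.lift_fac_assoc, Category.assoc, f.2, specMap_over])
  exact ⟨φ, by rw [hφ, IsOpenImmersion.lift_fac]⟩

/-- The relation between morphisms to the glued scheme and elements of the functor. -/
def Classifies {R : Type u} [CommRing R] [Algebra O R] (f : Spec (.of R) ⟶ T.glued)
    (x : P.obj R) : Prop :=
  ∀ (R' : Type u) [CommRing R'] [Algebra O R'] (g : R →ₐ[O] R') (j : T.J) (φ : T.A j →ₐ[O] R'),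
    specMap g ≫ f = specMap φ ≫ T.ι j → P.map φ (T.univ j) = P.map g x

variable {T}

theorem Classifies.comp {R R' : Type u} [CommRing R] [Algebra O R] [CommRing R'] [Algebra O R']
    {f : Spec (.of R) ⟶ T.glued} {x : P.obj R} (h : T.Classifies f x) (g : R →ₐ[O] R') :
    T.Classifies (specMap g ≫ f) (P.map g x) := by
  intro R'' _ _ g' j φ e
  rw [← P.map_comp]
  exact h R'' _ j φ (by rw [specMap_comp, Category.assoc, e])

theorem Classifies.unique (hP : P.IsZariskiSheaf) {R : Type u} [CommRing R] [Algebra O R]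
    {f : SchemePoint T.str R} {x y : P.obj R} (h : T.Classifies f.1 x) (h' : T.Classifies f.1 y) :
    x = y := by
  choose r hr j φ hφ using fun p => T.exists_local_chart f p
  exact hP.sep r hr fun p => by rw [← h _ _ _ _ (hφ p), ← h' _ _ _ _ (hφ p)]

variable (T)

theorem exists_classifies (hP : P.IsZariskiSheaf) {R : Type u} [CommRing R] [Algebra O R]
    (f : SchemePoint T.str R) : ∃ x, T.Classifies f.1 x := by
  choose r hr j φ hφ using fun p => T.exists_local_chart f p
  obtain ⟨y, hy⟩ := hP.glue r hr (fun p => P.map (φ p) (T.univ (j p))) (by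
    intro p q R' _ _ g g' e
    rw [← P.map_comp, ← P.map_comp]
    apply T.map_univ_eq
    rw [specMap_comp, specMap_comp, Category.assoc, Category.assoc, ← hφ, ← hφ, ← Category.assoc,
      ← specMap_comp, e, specMap_comp, Category.assoc])
  refine ⟨y, fun R' _ _ g i ψ e => ?_⟩
  -- The cover of `Spec R'` is pulled back from that of `Spec R`: near `q` the function chosen at
  -- the contraction of `q` is used.
  refine hP.sep (fun q => g (r (q.comap g.toRingHom))) (fun q => hr (q.comap g.toRingHom)) ?_
  intro q
  let p := q.comap g.toRingHom
  change P.map (awayHom O (g (r p))) _ = P.map (awayHom O (g (r p))) _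
  rw [← P.map_comp, ← P.map_comp, ← awayMap_comp, P.map_comp _ _ y, hy, ← P.map_comp]
  apply T.map_univ_eq
  rw [specMap_comp, specMap_comp, Category.assoc, Category.assoc, ← e, ← hφ, ← Category.assoc,
    ← specMap_comp, ← Category.assoc, ← specMap_comp, awayMap_comp]

theorem classifies_injective {R : Type u} [CommRing R] [Algebra O R]
    {f f' : SchemePoint T.str R} {x : P.obj R} (h : T.Classifies f.1 x)
    (h' : T.Classifies f'.1 x) : f = f' := by
  apply Subtype.ext
  choose r hr j φ hφ using fun p => T.exists_local_chart f p
  refine basicCover_hom_ext (O := O) r hr fun p => ?_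
  have e := h _ _ _ _ (hφ p)
  let f₁ : SchemePoint T.str (Localization.Away (r p)) :=
    ⟨specMap (awayHom O (r p)) ≫ f'.1, by rw [Category.assoc, f'.2, specMap_over]⟩
  have h₁ : T.Classifies f₁.1 (P.map (awayHom O (r p)) x) := h'.comp _
  -- A second localization is needed, because a basic open on which `f` factors through a chart need
  -- not be small enough for `f'`.
  choose r' hr' j' φ' hφ' using fun q => T.exists_local_chart f₁ q
  refine basicCover_hom_ext (O := O) r' hr' fun q => ?_
  rw [hφ p]
  change _ = specMap (awayHom O (r' q)) ≫ f₁.1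
  rw [hφ' q, ← Category.assoc, ← specMap_comp]
  apply T.specMap_ι_eq
  rw [P.map_comp, e, h₁ _ _ _ _ (hφ' q)]

theorem pullback_compat {R R₁ R₂ : Type u} [CommRing R] [Algebra O R] [CommRing R₁] [Algebra O R₁]
    [CommRing R₂] [Algebra O R₂] (a₁ : R →ₐ[O] R₁) (a₂ : R →ₐ[O] R₂) {i j : T.J}
    (φ₁ : T.A i →ₐ[O] R₁) (φ₂ : T.A j →ₐ[O] R₂) (x : P.obj R)
    (h₁ : P.map φ₁ (T.univ i) = P.map a₁ x) (h₂ : P.map φ₂ (T.univ j) = P.map a₂ x) :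
    Limits.pullback.fst (specMap a₁) (specMap a₂) ≫ specMap φ₁ ≫ T.ι i =
      Limits.pullback.snd (specMap a₁) (specMap a₂) ≫ specMap φ₂ ≫ T.ι j := by
  -- The fibre product is affine. Replacing it by the spectrum of its global sections, with the
  -- `O`-structure inherited through `R`, turns the claim into an equality of points over a single
  -- ring.
  let Z := Limits.pullback (specMap a₁) (specMap a₂)
  have : IsAffine Z :=
    inferInstanceAs (IsAffine (Limits.pullback (specMap a₁) (specMap a₂)))
  let R' : Type u := Γ(Z, ⊤)
  let e : Spec (.of R') ⟶ Z := Z.isoSpec.inv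
  have : IsIso e := inferInstanceAs (IsIso Z.isoSpec.inv)
  let b₁ : Z ⟶ Spec (.of R₁) := Limits.pullback.fst (specMap a₁) (specMap a₂)
  let b₂ : Z ⟶ Spec (.of R₂) := Limits.pullback.snd (specMap a₁) (specMap a₂)
  have hcond : b₁ ≫ specMap a₁ = b₂ ≫ specMap a₂ := Limits.pullback.condition
  change b₁ ≫ specMap φ₁ ≫ T.ι i = b₂ ≫ specMap φ₂ ≫ T.ι j
  let a : Spec (.of R') ⟶ Spec (.of R) := e ≫ b₁ ≫ specMap a₁
  let _ : Algebra O R' := ((Spec.preimage a).hom.comp (algebraMap O R)).toAlgebra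
  have ha : a ≫ Spec.map (CommRingCat.ofHom (algebraMap O R)) =
      Spec.map (CommRingCat.ofHom (algebraMap O R')) := by
    conv_lhs => rw [← Spec.map_preimage a, ← Spec.map_comp]
    rfl
  obtain ⟨g₁, hg₁⟩ := exists_specMap_eq (O := O) (e ≫ b₁) (by
    rw [← specMap_over a₁, ← ha]
    simp only [a, Category.assoc])
  obtain ⟨g₂, hg₂⟩ := exists_specMap_eq (O := O) (e ≫ b₂) (by
    rw [← specMap_over a₂, ← ha]
    simp only [a, Category.assoc]
    rw [reassoc_of% hcond])
  have hg : g₁.comp a₁ = g₂.comp a₂ := by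
    apply specMap_injective
    rw [specMap_comp, specMap_comp, hg₁, hg₂, Category.assoc, Category.assoc, hcond]
  rw [← cancel_epi e]
  have key : specMap (g₁.comp φ₁) ≫ T.ι i = specMap (g₂.comp φ₂) ≫ T.ι j := by
    apply T.specMap_ι_eq
    rw [P.map_comp, P.map_comp, h₁, h₂, ← P.map_comp, ← P.map_comp, hg]
  rw [specMap_comp, specMap_comp, hg₁, hg₂] at key
  simpa only [Category.assoc] using key

theorem classifies_surjective (hP : P.IsZariskiSheaf) (hT : T.IsCovering) {R : Type u} [CommRing R]
    [Algebra O R] (x : P.obj R) : ∃ f : SchemePoint T.str R, T.Classifies f.1 x := by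
  choose r hr j φ hφ using fun p => hT R x p
  let 𝒰 := basicCover r hr
  have hcompat (p q : PrimeSpectrum R) :
      Limits.pullback.fst (𝒰.f p) (𝒰.f q) ≫ (specMap (φ p) ≫ T.ι (j p)) =
        Limits.pullback.snd (𝒰.f p) (𝒰.f q) ≫ (specMap (φ q) ≫ T.ι (j q)) :=
    T.pullback_compat (awayHom O (r p)) (awayHom O (r q)) (φ p) (φ q) x (hφ p) (hφ q)
  let f : Spec (.of R) ⟶ T.glued := 𝒰.glueMorphisms (fun p => specMap (φ p) ≫ T.ι (j p)) hcompat
  have hf (p : PrimeSpectrum R) : specMap (awayHom O (r p)) ≫ f = specMap (φ p) ≫ T.ι (j p) :=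
    𝒰.ι_glueMorphisms _ hcompat p
  refine ⟨⟨f, ?_⟩, ?_⟩
  · refine basicCover_hom_ext (O := O) r hr fun p => ?_
    rw [← Category.assoc, hf, Category.assoc, T.ι_str, specMap_over, specMap_over]
  · intro R' _ _ g i ψ e
    refine hP.sep (fun q => g (r (q.comap g.toRingHom))) (fun q => hr (q.comap g.toRingHom)) ?_
    intro q
    let p := q.comap g.toRingHom
    change P.map (awayHom O (g (r p))) _ = P.map (awayHom O (g (r p))) _
    rw [← P.map_comp, ← P.map_comp, ← awayMap_comp, P.map_comp _ _ x, ← hφ, ← P.map_comp]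
    apply T.map_univ_eq
    rw [specMap_comp, specMap_comp, Category.assoc, Category.assoc, ← e, ← hf, ← Category.assoc,
      ← specMap_comp, ← Category.assoc, ← specMap_comp, awayMap_comp]

/-- The glued scheme represents the functor. -/
def pointEquiv (hP : P.IsZariskiSheaf) (hT : T.IsCovering) (R : Type u) [CommRing R]
    [Algebra O R] : SchemePoint T.str R ≃ P.obj R :=
  Equiv.ofBijective (fun f => (T.exists_classifies hP f).choose) (by
    constructor
    · intro f f' h
      have h1 := (T.exists_classifies hP f).choose_spec
      have h2 := (T.exists_classifies hP f').choose_spec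
      dsimp only at h
      rw [← h] at h2
      exact T.classifies_injective h1 h2
    · intro x
      obtain ⟨f, hf⟩ := T.classifies_surjective hP hT x
      exact ⟨f, Classifies.unique hP (T.exists_classifies hP f).choose_spec hf⟩)

theorem pointEquiv_natural (hP : P.IsZariskiSheaf) (hT : T.IsCovering) {R R' : Type u} [CommRing R]
    [Algebra O R] [CommRing R'] [Algebra O R'] (g : R →ₐ[O] R') (f : SchemePoint T.str R)
    (f' : SchemePoint T.str R') (h : f'.1 = specMap g ≫ f.1) :
    T.pointEquiv hP hT R' f' = P.map g (T.pointEquiv hP hT R f) := by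
  have h1 : T.Classifies f.1 (T.pointEquiv hP hT R f) := (T.exists_classifies hP f).choose_spec
  have h2 : T.Classifies f'.1 (T.pointEquiv hP hT R' f') :=
    (T.exists_classifies hP f').choose_spec
  have h3 := h1.comp g
  rw [← h] at h3
  exact Classifies.unique hP h2 h3

/-- If the charts are of finite presentation, so is the glued scheme. -/
theorem locallyOfFinitePresentation_str
    (h : ∀ j, Algebra.FinitePresentation O (T.A j)) : LocallyOfFinitePresentation T.str := by
  let 𝒰 : T.glued.OpenCover := Scheme.IsLocallyDirected.openCover T.diagram
  have hloc : IsZariskiLocalAtSource @LocallyOfFinitePresentation.{u} :=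
    HasRingHomProperty.instIsZariskiLocalAtSource (Q := RingHom.FinitePresentation)
  refine (IsZariskiLocalAtSource.iff_of_openCover (P := @LocallyOfFinitePresentation) 𝒰).2 ?_
  intro j
  change LocallyOfFinitePresentation (T.ι j.unop ≫ T.str)
  rw [T.ι_str, LocallyOfFinitePresentation.SpecMap_iff]
  exact (RingHom.finitePresentation_algebraMap (A := O) (B := T.A j.unop)).2 (h j.unop)

end DirectedAtlas

/-! ### From charts to the directed system of their finite intersections. -/

/-- A cover of a functor by open affine subfunctors, each of which is the complement of the
vanishing locus of one function in each other one. -/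
structure Atlas {O : Type u} [CommRing O] (P : PointFunctor O) where
  /-- The index set. -/
  C : Type u
  /-- The coordinate rings. -/
  A : C → Type u
  [ring (c : C) : CommRing (A c)]
  [alg (c : C) : Algebra O (A c)]
  /-- The universal points. -/
  univ (c : C) : P.obj (A c)
  inj (c : C) {R : Type u} [CommRing R] [Algebra O R] {φ ψ : A c →ₐ[O] R}
    (h : P.map φ (univ c) = P.map ψ (univ c)) : φ = ψ
  /-- The equation of the complement of the `d`-th subfunctor in the `c`-th one. -/
  δ (c d : C) : A c
  isUnit_iff (c d : C) {R : Type u} [CommRing R] [Algebra O R] (φ : A c →ₐ[O] R) :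
    IsUnit (φ (δ c d)) ↔ ∃ ψ : A d →ₐ[O] R, P.map ψ (univ d) = P.map φ (univ c)

attribute [instance] Atlas.ring Atlas.alg

namespace Atlas

variable {O : Type u} [CommRing O] {P : PointFunctor O} (T : Atlas P)

/-- The equation of the complement of a finite intersection of charts. -/
def prodδ (c : T.C) (S : Finset T.C) : T.A c := ∏ d ∈ S, T.δ c d

theorem isUnit_prodδ_iff (c : T.C) (S : Finset T.C) {R : Type u} [CommRing R] [Algebra O R]
    (φ : T.A c →ₐ[O] R) : IsUnit (φ (T.prodδ c S)) ↔
      ∀ d ∈ S, ∃ ψ : T.A d →ₐ[O] R, P.map ψ (T.univ d) = P.map φ (T.univ c) := by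
  rw [prodδ, map_prod, IsUnit.prod_iff]
  exact forall₂_congr fun d _ => T.isUnit_iff c d φ

/-- An element of a nonempty set of charts. -/
def base (S : {S : Finset T.C // S.Nonempty}) : T.C := S.2.choose

/-- The coordinate ring of an intersection of charts. -/
abbrev interRing (S : {S : Finset T.C // S.Nonempty}) : Type u :=
  Localization.Away (T.prodδ (T.base S) S.1)

/-- The universal point of an intersection of charts. -/
def interUniv (S : {S : Finset T.C // S.Nonempty}) : P.obj (T.interRing S) :=
  P.map (awayHom O _) (T.univ (T.base S))

theorem map_interUniv (S : {S : Finset T.C // S.Nonempty}) {R : Type u} [CommRing R] [Algebra O R]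
    (φ : T.interRing S →ₐ[O] R) :
    P.map φ (T.interUniv S) = P.map (φ.comp (awayHom O _)) (T.univ (T.base S)) :=
  (P.map_comp _ _ _).symm

/-- The intersection is realized inside one arbitrarily chosen chart `T.base S`; this criterion is
symmetric in the charts of `S`, so the choice does not matter afterwards. -/
theorem exists_inter_iff (S : {S : Finset T.C // S.Nonempty}) {R : Type u} [CommRing R]
    [Algebra O R] (x : P.obj R) : (∃ φ : T.interRing S →ₐ[O] R, P.map φ (T.interUniv S) = x) ↔
      ∀ d ∈ S.1, ∃ ψ : T.A d →ₐ[O] R, P.map ψ (T.univ d) = x := by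
  constructor
  · rintro ⟨φ, rfl⟩
    rw [map_interUniv]
    rw [← T.isUnit_prodδ_iff]
    exact (IsLocalization.Away.algebraMap_isUnit (S := T.interRing S) _).map φ
  · intro h
    obtain ⟨φ, hφ⟩ := h (T.base S) S.2.choose_spec
    have hu : IsUnit (φ (T.prodδ (T.base S) S.1)) := by
      rw [T.isUnit_prodδ_iff, hφ]; exact h
    let ψ : T.interRing S →ₐ[O] R :=
      IsLocalization.liftAlgHom (M := Submonoid.powers (T.prodδ (T.base S) S.1)) (f := φ) (by
        rintro ⟨_, n, rfl⟩
        simpa using hu.pow n)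
    refine ⟨ψ, ?_⟩
    rw [map_interUniv, ← hφ]
    congr 1
    ext a
    simp [ψ]

open Classical in
/-- The cover by all finite intersections of charts. -/
def directed : DirectedAtlas P where
  J := {S : Finset T.C // S.Nonempty}
  inst := Subtype.semilatticeSup fun _ _ h _ => h.mono Finset.subset_union_left
  A := T.interRing
  univ := T.interUniv
  inj S R _ _ φ ψ h := by
    rw [map_interUniv, map_interUniv] at h
    exact IsLocalization.algHom_ext (Submonoid.powers (T.prodδ (T.base S) S.1)) (T.inj _ h)
  δ S S' := awayHom O _ (T.prodδ (T.base S) S'.1)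
  isUnit_iff S S' R _ _ φ := by
    rw [T.exists_inter_iff, map_interUniv, ← T.isUnit_prodδ_iff]
    rfl
  exists_of_le {S S'} h := by
    rw [T.exists_inter_iff]
    exact fun d hd => (T.exists_inter_iff S' _).1 ⟨AlgHom.id O _, P.map_id _ _⟩ d (h hd)
  exists_sup {S S'} R _ _ φ ψ h := by
    rw [T.exists_inter_iff]
    intro d hd
    rcases Finset.mem_union.1 hd with hd | hd
    · exact (T.exists_inter_iff S _).1 ⟨φ, rfl⟩ d hd
    · exact (T.exists_inter_iff S' _).1 ⟨ψ, h.symm⟩ d hd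

theorem isCovering_directed
    (h : ∀ (R : Type u) [CommRing R] [Algebra O R] (x : P.obj R) (p : PrimeSpectrum R),
      ∃ r ∉ p.asIdeal, ∃ (c : T.C) (φ : T.A c →ₐ[O] Localization.Away r),
        P.map φ (T.univ c) = P.map (awayHom O r) x) : T.directed.IsCovering := by
  intro R _ _ x p
  obtain ⟨r, hr, c, φ, hφ⟩ := h R x p
  refine ⟨r, hr, ⟨{c}, Finset.singleton_nonempty c⟩, (T.exists_inter_iff _ _).2 ?_⟩
  intro d hd
  obtain rfl := Finset.mem_singleton.1 hd
  exact ⟨φ, hφ⟩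

theorem finitePresentation_directed (h : ∀ c, Algebra.FinitePresentation O (T.A c))
    (S : T.directed.J) : Algebra.FinitePresentation O (T.directed.A S) := by
  have := h (T.base S)
  have : Algebra.FinitePresentation (T.A (T.base S)) (T.interRing S) :=
    IsLocalization.Away.finitePresentation (T.prodδ (T.base S) S.1)
  exact Algebra.FinitePresentation.trans O (T.A (T.base S)) (T.interRing S)

end Atlas

/-! ### Base change, localization and gluing of submodules of a free module. -/

section Push

variable {W : Type} {R R' R'' : Type u} [CommRing R] [CommRing R'] [CommRing R'']

/-- The base change of a submodule of `R^W` along `R → R'`: the span of its image. -/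
def push (f : R →+* R') (P : Submodule R (W → R)) : Submodule R' (W → R') :=
  Submodule.span R' ((fun v => f ∘ v) '' P)

theorem mem_push {f : R →+* R'} {P : Submodule R (W → R)} {v : W → R} (hv : v ∈ P) :
    f ∘ v ∈ push f P := Submodule.subset_span ⟨v, hv, rfl⟩

theorem push_le {f : R →+* R'} {P : Submodule R (W → R)} {Q : Submodule R' (W → R')} :
    push f P ≤ Q ↔ ∀ v ∈ P, f ∘ v ∈ Q := by
  rw [push, Submodule.span_le, Set.image_subset_iff]; rfl

theorem push_mono {f : R →+* R'} {P Q : Submodule R (W → R)} (h : P ≤ Q) : push f P ≤ push f Q :=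
  push_le.2 fun _ hv => mem_push (h hv)

theorem comp_add (f : R →+* R') (v w : W → R) : f ∘ (v + w) = f ∘ v + f ∘ w := by
  ext; simp

theorem comp_sub (f : R →+* R') (v w : W → R) : f ∘ (v - w) = f ∘ v - f ∘ w := by
  ext; simp

theorem comp_smul (f : R →+* R') (c : R) (v : W → R) : f ∘ (c • v) = f c • f ∘ v := by
  ext; simp

theorem comp_zero (f : R →+* R') : f ∘ (0 : W → R) = 0 := by
  ext; simp

theorem comp_sum (f : R →+* R') {ι : Type*} (S : Finset ι) (v : ι → W → R) :
    f ∘ (∑ i ∈ S, v i) = ∑ i ∈ S, f ∘ v i := by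
  ext; simp

theorem push_span (f : R →+* R') (S : Set (W → R)) :
    push f (Submodule.span R S) = Submodule.span R' ((fun v => f ∘ v) '' S) := by
  refine le_antisymm (push_le.2 fun v hv => ?_)
    (Submodule.span_mono (Set.image_mono Submodule.subset_span))
  induction hv using Submodule.span_induction with
  | mem x h => exact Submodule.subset_span ⟨x, h, rfl⟩
  | zero => rw [comp_zero]; exact zero_mem _
  | add x y _ _ h h' => rw [comp_add]; exact add_mem h h'
  | smul a x _ h => rw [comp_smul]; exact Submodule.smul_mem _ _ h

theorem push_span_range (f : R →+* R') {ι : Type*} (v : ι → W → R) :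
    push f (Submodule.span R (Set.range v)) =
      Submodule.span R' (Set.range fun i => f ∘ v i) := by
  rw [push_span, ← Set.range_comp]; rfl

theorem push_id (P : Submodule R (W → R)) : push (RingHom.id R) P = P := by
  have := push_span (RingHom.id R) (P : Set (W → R))
  rw [Submodule.span_eq] at this
  rw [this]
  simp

theorem push_comp (f : R →+* R') (g : R' →+* R'') (P : Submodule R (W → R)) :
    push (g.comp f) P = push g (push f P) := by
  rw [push.eq_1 f, push_span, push, Set.image_image]; rfl

theorem push_top [Fintype W] (f : R →+* R') : push f (⊤ : Submodule R (W → R)) = ⊤ := by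
  classical
  rw [eq_top_iff, ← (Pi.basisFun R' W).span_eq, Submodule.span_le]
  rintro _ ⟨i, rfl⟩
  have : (Pi.basisFun R' W i) = f ∘ (Pi.basisFun R W i) := by
    ext j; by_cases h : j = i
    · subst h; simp
    · simp [h]
  rw [this]
  exact mem_push trivial

theorem push_sup (f : R →+* R') (P Q : Submodule R (W → R)) :
    push f (P ⊔ Q) = push f P ⊔ push f Q := by
  refine le_antisymm (push_le.2 fun v hv => ?_)
    (sup_le (push_mono le_sup_left) (push_mono le_sup_right))
  obtain ⟨x, hx, y, hy, rfl⟩ := Submodule.mem_sup.1 hv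
  rw [comp_add]
  exact add_mem (Submodule.mem_sup_left (mem_push hx)) (Submodule.mem_sup_right (mem_push hy))

/-- The linear map over `R'` given by the image of the matrix of a linear map over `R`. -/
def pushLin [Fintype W] [DecidableEq W] {W' : Type} (f : R →+* R') (e : (W → R) →ₗ[R] (W' → R)) :
    (W → R') →ₗ[R'] (W' → R') :=
  Matrix.toLin' ((LinearMap.toMatrix' e).map f)

theorem pushLin_comp [Fintype W] [DecidableEq W] {W' : Type} (f : R →+* R')
    (e : (W → R) →ₗ[R] (W' → R)) (v : W → R) : pushLin f e (f ∘ v) = f ∘ e v := by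
  ext i
  rw [pushLin, Matrix.toLin'_apply, ← RingHom.map_mulVec, ← Matrix.toLin'_apply,
    Matrix.toLin'_toMatrix']
  rfl

/-- The matrix of the projection onto `P` along `Q` can be base changed; the result is the identity
on `push f P` and zero on `push f Q`, which forces them to be disjoint. No flatness of `f` is
involved. -/
theorem isCompl_push [Fintype W] (f : R →+* R') {P Q : Submodule R (W → R)} (h : IsCompl P Q) :
    IsCompl (push f P) (push f Q) := by
  classical
  have hsup : push f P ⊔ push f Q = ⊤ := by rw [← push_sup, h.sup_eq_top, push_top]
  refine ⟨?_, codisjoint_iff.2 hsup⟩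
  let e : (W → R) →ₗ[R] (W → R) := P.subtype ∘ₗ P.projectionOnto Q h
  have hP : ∀ x ∈ push f P, pushLin f e x = x := by
    intro x hx
    suffices push f P ≤ LinearMap.eqLocus (pushLin f e) LinearMap.id from this hx
    refine push_le.2 fun v hv => ?_
    change pushLin f e _ = f ∘ v
    rw [pushLin_comp]
    congr 1
    exact congr(($(Submodule.projectionOnto_apply_left h ⟨v, hv⟩) : W → R))
  have hQ : ∀ x ∈ push f Q, pushLin f e x = 0 := by
    intro x hx
    suffices push f Q ≤ LinearMap.ker (pushLin f e) from this hx
    refine push_le.2 fun v hv => ?_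
    rw [LinearMap.mem_ker, pushLin_comp]
    have : e v = 0 := congr(($(Submodule.projectionOnto_apply_right h ⟨v, hv⟩) : W → R))
    rw [this, comp_zero]
  rw [Submodule.disjoint_def]
  intro x hx hx'
  rw [← hP x hx, hQ x hx']

/-- The ideal of all `r` with `r • v ∈ Q` lies in no maximal ideal. -/
theorem mem_of_locally_mem {M : Type*} [AddCommGroup M] [Module R M] {Q : Submodule R M} {v : M}
    (h : ∀ p : PrimeSpectrum R, ∃ r ∉ p.asIdeal, r • v ∈ Q) : v ∈ Q := by
  let I : Ideal R := (Q.comap (LinearMap.toSpanSingleton R M v))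
  have hI : I = ⊤ := by
    by_contra hI
    obtain ⟨J, hJ, hle⟩ := Ideal.exists_le_maximal _ hI
    obtain ⟨r, hr, hrv⟩ := h ⟨J, hJ.isPrime⟩
    exact hr (hle (show r ∈ I from hrv))
  have : (1 : R) ∈ I := hI ▸ Submodule.mem_top
  simpa [I] using this

variable [Finite W]

theorem exists_comp_eq_smul (r : R) {S : Type*} [CommRing S] [Algebra R S]
    [IsLocalization.Away r S] (x : W → S) :
    ∃ (n : ℕ) (v : W → R), algebraMap R S ∘ v = algebraMap R S r ^ n • x := by
  obtain ⟨⟨_, n, rfl⟩, hb⟩ := IsLocalization.exist_integer_multiples_of_finite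
    (Submonoid.powers r) x
  choose v hv using hb
  refine ⟨n, v, ?_⟩
  ext w
  simpa [Algebra.smul_def] using hv w

theorem exists_smul_eq_of_comp_eq (r : R) {S : Type*} [CommRing S] [Algebra R S]
    [IsLocalization.Away r S] {v w : W → R} (h : algebraMap R S ∘ v = algebraMap R S ∘ w) :
    ∃ n : ℕ, r ^ n • v = r ^ n • w := by
  classical
  cases nonempty_fintype W
  have : ∀ i, ∃ n : ℕ, r ^ n * v i = r ^ n * w i := fun i => by
    obtain ⟨⟨_, n, rfl⟩, hb⟩ :=
      (IsLocalization.eq_iff_exists (Submonoid.powers r) S).1 (congrFun h i)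
    exact ⟨n, hb⟩
  choose n hn using this
  refine ⟨∑ i, n i, ?_⟩
  ext i
  have hi : ∑ i, n i = n i + ∑ j ∈ Finset.univ.erase i, n j :=
    (Finset.add_sum_erase _ _ (Finset.mem_univ i)).symm
  simp only [Pi.smul_apply, smul_eq_mul, hi, pow_add]
  linear_combination r ^ (∑ j ∈ Finset.univ.erase i, n j) * hn i

theorem exists_smul_eq_of_mem_push (r : R) {S : Type u} [CommRing S] [Algebra R S]
    [IsLocalization.Away r S] {P : Submodule R (W → R)} {x : W → S}
    (hx : x ∈ push (algebraMap R S) P) :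
    ∃ (n : ℕ) (v : W → R), v ∈ P ∧ algebraMap R S ∘ v = algebraMap R S r ^ n • x := by
  induction hx using Submodule.span_induction with
  | mem x h =>
    obtain ⟨v, hv, rfl⟩ := h
    exact ⟨0, v, hv, by simp⟩
  | zero => exact ⟨0, 0, zero_mem _, by simp⟩
  | add x y _ _ h h' =>
    obtain ⟨n, v, hv, e⟩ := h
    obtain ⟨k, w, hw, e'⟩ := h'
    refine ⟨n + k, r ^ k • v + r ^ n • w,
      add_mem (P.smul_mem _ hv) (P.smul_mem _ hw), ?_⟩
    rw [comp_add, comp_smul, comp_smul, e, e', smul_smul, smul_smul, map_pow, map_pow, ← pow_add,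
      ← pow_add, smul_add, add_comm k n]
  | smul a x _ h =>
    obtain ⟨n, v, hv, e⟩ := h
    obtain ⟨k, b, hb⟩ := exists_comp_eq_smul (W := Unit) r (S := S) (fun _ => a)
    refine ⟨k + n, b () • v, P.smul_mem _ hv, ?_⟩
    rw [comp_smul, e, show algebraMap R S (b ()) = _ from congrFun hb ()]
    simp only [Pi.smul_apply, smul_eq_mul, smul_smul, pow_add]
    congr 1
    ring

theorem comp_mem_push_iff (r : R) {S : Type u} [CommRing S] [Algebra R S]
    [IsLocalization.Away r S] {P : Submodule R (W → R)} {v : W → R} :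
    algebraMap R S ∘ v ∈ push (algebraMap R S) P ↔ ∃ n : ℕ, r ^ n • v ∈ P := by
  constructor
  · intro h
    obtain ⟨n, w, hw, e⟩ := exists_smul_eq_of_mem_push r h
    rw [← map_pow, ← comp_smul] at e
    obtain ⟨k, hk⟩ := exists_smul_eq_of_comp_eq r e
    exact ⟨k + n, by rw [pow_add, mul_smul, ← hk]; exact P.smul_mem _ hw⟩
  · rintro ⟨n, hn⟩
    have := mem_push (f := algebraMap R S) hn
    rw [comp_smul, map_pow] at this
    have hu := (IsLocalization.Away.algebraMap_isUnit (S := S) r).pow n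
    rwa [Submodule.smul_mem_iff_of_isUnit _ hu] at this

end Push

section Gluing

variable {O : Type u} [CommRing O] {W : Type} [Finite W] {R : Type u} [CommRing R] [Algebra O R]

theorem le_of_push_le (r : PrimeSpectrum R → R) (hr : ∀ p, r p ∉ p.asIdeal)
    {P Q : Submodule R (W → R)}
    (h : ∀ p, push (algebraMap R (Localization.Away (r p))) P ≤ push (algebraMap R _) Q) :
    P ≤ Q := fun v hv => mem_of_locally_mem fun p => by
  obtain ⟨n, hn⟩ := (comp_mem_push_iff (r p)).1 (h p (mem_push hv))
  exact ⟨r p ^ n, fun h => hr p (p.2.mem_of_pow_mem _ h), hn⟩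

theorem eq_of_push_eq (r : PrimeSpectrum R → R) (hr : ∀ p, r p ∉ p.asIdeal)
    {P Q : Submodule R (W → R)}
    (h : ∀ p, push (algebraMap R (Localization.Away (r p))) P = push (algebraMap R _) Q) :
    P = Q :=
  le_antisymm (le_of_push_le r hr fun p => (h p).le) (le_of_push_le r hr fun p => (h p).ge)

theorem exists_glue_submodule (r : PrimeSpectrum R → R) (hr : ∀ p, r p ∉ p.asIdeal)
    (S : ∀ p, Submodule (Localization.Away (r p)) (W → Localization.Away (r p)))
    (h : ∀ (p q : PrimeSpectrum R) (R' : Type u) [CommRing R'] [Algebra O R']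
      (f : Localization.Away (r p) →ₐ[O] R') (g : Localization.Away (r q) →ₐ[O] R'),
      f.comp (awayHom O (r p)) = g.comp (awayHom O (r q)) →
        push (f : _ →+* R') (S p) = push (g : _ →+* R') (S q)) :
    ∃ P : Submodule R (W → R), ∀ p, push (algebraMap R (Localization.Away (r p))) P = S p := by
  -- multiples of an element of one module lie in each other module
  have key : ∀ (p q : PrimeSpectrum R) (v : W → R),
      algebraMap R (Localization.Away (r p)) ∘ v ∈ S p →
        ∃ n : ℕ, algebraMap R (Localization.Away (r q)) ∘ (r p ^ n • v) ∈ S q := by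
    intro p q v hv
    let g := awayHom O (algebraMap R (Localization.Away (r q)) (r p))
    let f : Localization.Away (r p) →ₐ[O]
        Localization.Away (algebraMap R (Localization.Away (r q)) (r p)) :=
      IsLocalization.liftAlgHom (M := Submonoid.powers (r p))
        (f := g.comp (awayHom O (r q))) (by
          rintro ⟨_, n, rfl⟩
          simpa [g] using (IsLocalization.Away.algebraMap_isUnit
            (S := Localization.Away (algebraMap R (Localization.Away (r q)) (r p)))
            (algebraMap R (Localization.Away (r q)) (r p))).pow n)
    have hfg : f.comp (awayHom O (r p)) = g.comp (awayHom O (r q)) := by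
      ext x; simp [f]
    have h1 := mem_push (f := f.toRingHom) hv
    rw [show push f.toRingHom (S p) = push g.toRingHom (S q) from h p q _ f g hfg] at h1
    have h2 : f.toRingHom ∘ (algebraMap R (Localization.Away (r p)) ∘ v) =
        algebraMap _ (Localization.Away (algebraMap R (Localization.Away (r q)) (r p))) ∘
          (algebraMap R (Localization.Away (r q)) ∘ v) := by
      ext w
      exact congr($hfg (v w))
    rw [h2] at h1
    obtain ⟨n, hn⟩ := (comp_mem_push_iff
      (algebraMap R (Localization.Away (r q)) (r p))
      (S := Localization.Away (algebraMap R (Localization.Away (r q)) (r p)))).1 h1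
    exact ⟨n, by rwa [comp_smul, map_pow]⟩
  -- The glued submodule consists of the vectors whose image lies in every local piece. That it maps
  -- into `S p` is built in; the point is that it generates `S p`.
  let P : Submodule R (W → R) :=
    { carrier := {v | ∀ p, algebraMap R (Localization.Away (r p)) ∘ v ∈ S p}
      add_mem' := fun {v w} hv hw p => by rw [comp_add]; exact add_mem (hv p) (hw p)
      zero_mem' := fun p => by rw [comp_zero]; exact zero_mem _
      smul_mem' := fun c v hv p => by rw [comp_smul]; exact Submodule.smul_mem _ _ (hv p) }
  refine ⟨P, fun p => le_antisymm (push_le.2 fun v hv => hv p) fun x hx => ?_⟩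
  obtain ⟨n, v, hv⟩ := exists_comp_eq_smul (r p) (S := Localization.Away (r p)) x
  have hu := (IsLocalization.Away.algebraMap_isUnit (S := Localization.Away (r p)) (r p)).pow
  rw [← Submodule.smul_mem_iff_of_isUnit _ (hu n), ← hv]
  have hvS : algebraMap R (Localization.Away (r p)) ∘ v ∈ S p := by
    rw [hv]; exact Submodule.smul_mem _ _ hx
  -- finitely many of the basic opens cover
  have htop : Ideal.span (Set.range r) = ⊤ := by
    by_contra hI
    obtain ⟨J, hJ, hle⟩ := Ideal.exists_le_maximal _ hI
    exact hr ⟨J, hJ.isPrime⟩ (hle (Ideal.subset_span ⟨_, rfl⟩))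
  obtain ⟨T, hTr, hT⟩ := (Ideal.span_eq_top_iff_finite _).1 htop
  have hT' : ∀ t ∈ T, ∃ q, r q = t := fun t ht => hTr ht
  have : Nonempty (PrimeSpectrum R) := ⟨p⟩
  choose! q hq using hT'
  choose N hN using fun t => key p (q t) v hvS
  -- One power of `r p` works for the finitely many opens of a subcover. Membership in an arbitrary
  -- `S q'` then follows locally, from each member of the subcover by `key`.
  have hmem : r p ^ (∑ t ∈ T, N t) • v ∈ P := by
    intro q'
    have hcov : ∀ t ∈ T, ∃ k : ℕ, t ^ k • (algebraMap R (Localization.Away (r q')) ∘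
        (r p ^ (∑ t ∈ T, N t) • v)) ∈ S q' := by
      intro t ht
      have h1 : algebraMap R (Localization.Away (r (q t))) ∘ (r p ^ (∑ t ∈ T, N t) • v) ∈
          S (q t) := by
        classical
        rw [← Finset.add_sum_erase _ _ ht, add_comm, pow_add, mul_smul, comp_smul]
        exact Submodule.smul_mem _ _ (hN t)
      obtain ⟨k, hk⟩ := key (q t) q' _ h1
      refine ⟨k, ?_⟩
      rw [comp_smul, hq t ht, algebraMap_smul] at hk
      exact hk
    refine (mem_of_locally_mem (R := R) (Q := (S q').restrictScalars R) fun p' => ?_)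
    have : ∃ t ∈ T, t ∉ p'.asIdeal := by
      by_contra! hc
      exact p'.2.ne_top (top_le_iff.1 (hT ▸ Ideal.span_le.2 hc))
    obtain ⟨t, ht, htp⟩ := this
    obtain ⟨k, hk⟩ := hcov t ht
    exact ⟨t ^ k, fun h => htp (p'.2.mem_of_pow_mem _ h), hk⟩
  exact (comp_mem_push_iff (r p)).2 ⟨_, hmem⟩

end Gluing

/-! ### Normalized frames and direct summands. -/

section Frame

variable {W : Type} {R R' : Type u} [CommRing R] [CommRing R'] {d : ℕ}

/-- A family of vectors whose coordinates at the indices `a j` form the identity matrix. -/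
def Normalized (a : Fin d → W) (v : Fin d → W → R) : Prop :=
  ∀ i j, v i (a j) = if i = j then 1 else 0

namespace Normalized

variable {a : Fin d → W} {v : Fin d → W → R}

theorem map (h : Normalized a v) (f : R →+* R') : Normalized a fun i => f ∘ v i := fun i j => by
  simp only [Function.comp_apply, h i j]
  split_ifs <;> simp

theorem sum_apply (h : Normalized a v) (c : Fin d → R) (j : Fin d) :
    (∑ i, c i • v i) (a j) = c j := by
  simp [Finset.sum_apply, h _ j]

theorem eq_sum (h : Normalized a v) {x : W → R} (hx : x ∈ Submodule.span R (Set.range v)) :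
    x = ∑ i, x (a i) • v i := by
  obtain ⟨c, rfl⟩ := (Submodule.mem_span_range_iff_exists_fun R).1 hx
  simp only [h.sum_apply]

theorem linearIndependent (h : Normalized a v) : LinearIndependent R v := by
  rw [Fintype.linearIndependent_iff]
  intro c hc j
  rw [← h.sum_apply c j, hc, Pi.zero_apply]

theorem ext (h : Normalized a v) {w : Fin d → W → R} (hw : Normalized a w)
    (hvw : Submodule.span R (Set.range v) = Submodule.span R (Set.range w)) : v = w := by
  funext i
  have hm : v i ∈ Submodule.span R (Set.range w) := hvw ▸ Submodule.subset_span ⟨i, rfl⟩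
  rw [hw.eq_sum hm]
  simp [h i]

end Normalized

/-- Coordinate functions separate enough vectors of a subspace. -/
theorem exists_det_ne_zero {K : Type u} [Field K] [Finite W] {v : Fin d → W → K}
    (hv : LinearIndependent K v) :
    ∃ a : Fin d → W, (Matrix.of fun i j => v i (a j)).det ≠ 0 := by
  classical
  cases nonempty_fintype W
  let A : Matrix (Fin d) W K := Matrix.of v
  have hr : A.rank = d := by simpa using hv.rank_matrix (M := A)
  have hcol : Module.finrank K (Submodule.span K (Set.range A.transpose.row)) = d := by
    rw [← Matrix.rank_eq_finrank_span_row, Matrix.rank_transpose, hr]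
  obtain ⟨f, hf, -, hli⟩ := Submodule.exists_fun_fin_finrank_span_eq K (Set.range A.transpose.row)
  choose w hw using hf
  let a : Fin d → W := fun i => w (Fin.cast hcol.symm i)
  refine ⟨a, ?_⟩
  let B : Matrix (Fin d) (Fin d) K := Matrix.of fun i j => v i (a j)
  have hB : IsUnit B.transpose := by
    rw [← Matrix.linearIndependent_rows_iff_isUnit]
    have : B.transpose.row = f ∘ Fin.cast hcol.symm := by
      funext i
      exact hw _
    rw [this]
    exact hli.comp _ (Fin.cast_injective _)
  exact ((Matrix.isUnit_iff_isUnit_det _).1 ((Matrix.isUnit_transpose _).1 hB)).ne_zero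

/-- Multiplying a family by the inverse of a minor normalizes it. -/
theorem exists_normalized {a : Fin d → W} {w : Fin d → W → R}
    (h : IsUnit (Matrix.of fun i j => w i (a j)).det) :
    ∃ v : Fin d → W → R, Normalized a v ∧
      Submodule.span R (Set.range v) = Submodule.span R (Set.range w) := by
  let A : Matrix (Fin d) (Fin d) R := Matrix.of fun i j => w i (a j)
  refine ⟨fun i => ∑ k, A⁻¹ i k • w k, fun i j => ?_, le_antisymm ?_ ?_⟩
  · have := congrFun (congrFun (A.nonsing_inv_mul h) i) j
    rw [Matrix.one_apply] at this
    rw [← this, Matrix.mul_apply]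
    exact Finset.sum_apply _ _ _
  · rw [Submodule.span_le]
    rintro _ ⟨i, rfl⟩
    exact sum_mem fun k _ => Submodule.smul_mem _ _ (Submodule.subset_span ⟨k, rfl⟩)
  · rw [Submodule.span_le]
    rintro _ ⟨i, rfl⟩
    have : w i = ∑ j, A i j • ∑ k, A⁻¹ j k • w k := by
      simp_rw [Finset.smul_sum, smul_smul]
      rw [Finset.sum_comm]
      simp_rw [← Finset.sum_smul, ← Matrix.mul_apply, A.mul_nonsing_inv h, Matrix.one_apply]
      simp
    rw [this]
    exact sum_mem fun k _ => Submodule.smul_mem _ _ (Submodule.subset_span ⟨k, rfl⟩)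

end Frame

section Summand

variable {W : Type} [Fintype W] {R R' : Type u} [CommRing R] [CommRing R'] {d : ℕ}

/-- The base change of a direct summand is the abstract base change. -/
theorem finrank_push {S : Type u} [CommRing S] [Algebra R S] {P Q : Submodule R (W → R)}
    (h : IsCompl P Q) :
    Module.finrank S (push (algebraMap R S) P) = Module.finrank S (S ⊗[R] P) := by
  classical
  let e : S ⊗[R] (W → R) ≃ₗ[S] (W → S) := TensorProduct.piScalarRight R S S W
  let j : S ⊗[R] P →ₗ[S] (W → S) := e.toLinearMap ∘ₗ P.subtype.baseChange S
  have hj : Function.Injective j := by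
    refine e.injective.comp ?_
    have : (P.projectionOnto Q h).baseChange S ∘ₗ P.subtype.baseChange S = LinearMap.id := by
      rw [← LinearMap.baseChange_comp, show (P.projectionOnto Q h) ∘ₗ P.subtype = LinearMap.id from
        LinearMap.ext fun x => Submodule.projectionOnto_apply_left h x, LinearMap.baseChange_id]
    exact Function.LeftInverse.injective (g := (P.projectionOnto Q h).baseChange S)
      fun x => congr($this x)
  have hj' : ∀ (s : S) (x : P), j (s ⊗ₜ x) = s • (algebraMap R S ∘ (x : W → R)) := by
    intro s x
    ext w
    simp [j, e, Algebra.smul_def, mul_comm]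
  have hrange : LinearMap.range j = push (algebraMap R S) P := by
    refine le_antisymm ?_ (push_le.2 fun v hv => ⟨1 ⊗ₜ ⟨v, hv⟩, by rw [hj', one_smul]⟩)
    rintro _ ⟨x, rfl⟩
    induction x with
    | zero => rw [map_zero]; exact zero_mem _
    | add x y h h' => rw [map_add]; exact add_mem h h'
    | tmul s x => rw [hj']; exact Submodule.smul_mem _ _ (mem_push x.2)
  rw [← hrange]
  exact (LinearEquiv.ofInjective j hj).finrank_eq.symm

theorem rankAtStalk_eq_finrank_push {P Q : Submodule R (W → R)} (h : IsCompl P Q)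
    (p : PrimeSpectrum R) : Module.rankAtStalk P p =
      Module.finrank p.asIdeal.ResidueField
        (push (algebraMap R p.asIdeal.ResidueField) P) := by
  have : Module.Projective R P :=
    Module.Projective.of_split P.subtype (P.projectionOnto Q h)
      (LinearMap.ext fun x => Submodule.projectionOnto_apply_left h x)
  have : Module.Finite R P :=
    Module.Finite.of_surjective (P.projectionOnto Q h) (Submodule.projectionOnto_surjective h)
  rw [Module.rankAtStalk_eq, finrank_push h]

theorem exists_linearIndependent_of_push {K : Type u} [Field K] (f : R →+* K)
    (P : Submodule R (W → R)) {d : ℕ} (hd : Module.finrank K (push f P) = d) :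
    ∃ w : Fin d → W → R, (∀ i, w i ∈ P) ∧ LinearIndependent K fun i => f ∘ w i := by
  obtain ⟨g, hg, -, hli⟩ := Submodule.exists_fun_fin_finrank_span_eq K ((fun v => f ∘ v) '' (P : Set (W → R)))
  choose w hwP hw using hg
  refine ⟨fun i => w (Fin.cast hd.symm i), fun i => hwP _, ?_⟩
  have : (fun i => f ∘ w (Fin.cast hd.symm i)) = g ∘ Fin.cast hd.symm := by
    funext i; exact hw _
  rw [this]
  exact hli.comp _ (Fin.cast_injective _)

/-- Bases of `P` and of a complement `Q` over the residue field are lifted to `R`. Inverting the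
determinant `X.det` of all lifted vectors makes them a basis of the whole space, and the component
in `Q` of an element of `P` vanishes. Inverting in addition a minor `Y.det` of the vectors from `P`
allows their normalization. -/
theorem exists_local_frame {P : Submodule R (W → R)} (h : IsSummandOfRank d P)
    (p : PrimeSpectrum R) : ∃ r ∉ p.asIdeal, ∃ (a : Fin d → W) (v : Fin d → W →
      Localization.Away r), Normalized a v ∧
        push (algebraMap R (Localization.Away r)) P = Submodule.span _ (Set.range v) := by
  classical
  obtain ⟨⟨Q, hPQ⟩, hd⟩ := h
  let κ := p.asIdeal.ResidueField
  let f := algebraMap R κ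
  have hPQ' := isCompl_push f hPQ
  have hdP : Module.finrank κ (push f P) = d := by
    rw [← hd p, rankAtStalk_eq_finrank_push hPQ]
  obtain ⟨w, hwP, hwli⟩ := exists_linearIndependent_of_push f P hdP
  obtain ⟨e, he⟩ : ∃ e, Module.finrank κ (push f Q) = e := ⟨_, rfl⟩
  obtain ⟨u, huQ, huli⟩ := exists_linearIndependent_of_push f Q he
  obtain ⟨a, ha⟩ := exists_det_ne_zero hwli
  have hcard : Fintype.card (Fin d ⊕ Fin e) = Fintype.card W := by
    have := Submodule.finrank_add_eq_of_isCompl hPQ'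
    rw [hdP, he, Module.finrank_fintype_fun_eq_card] at this
    simpa using this
  let σ : W ≃ Fin d ⊕ Fin e := (Fintype.equivOfCardEq hcard).symm
  let x : Fin d ⊕ Fin e → W → R := Sum.elim w u
  have hli : LinearIndependent κ fun i => f ∘ x i := by
    rw [linearIndependent_sum]
    refine ⟨hwli, huli, hPQ'.disjoint.mono ?_ ?_⟩ <;> rw [Submodule.span_le] <;>
      rintro _ ⟨i, rfl⟩
    · exact mem_push (hwP i)
    · exact mem_push (huQ i)
  let X : Matrix W W R := Matrix.of fun i => x (σ i)
  have hX : f X.det ≠ 0 := by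
    rw [RingHom.map_det]
    refine ((Matrix.isUnit_iff_isUnit_det _).1 ?_).ne_zero
    rw [← Matrix.linearIndependent_rows_iff_isUnit]
    exact hli.comp _ σ.injective
  let Y : Matrix (Fin d) (Fin d) R := Matrix.of fun i j => w i (a j)
  have hY : f Y.det ≠ 0 := by
    rw [RingHom.map_det]; exact ha
  have hr : X.det * Y.det ∉ p.asIdeal := fun hm => by
    have := (Ideal.algebraMap_residueField_eq_zero (I := p.asIdeal)).2 hm
    rw [map_mul] at this
    exact mul_ne_zero hX hY this
  refine ⟨X.det * Y.det, hr, a, ?_⟩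
  let S := Localization.Away (X.det * Y.det)
  let g := algebraMap R S
  have hXu : IsUnit (g X.det) := isUnit_of_dvd_unit (map_dvd g (dvd_mul_right _ _))
    (IsLocalization.Away.algebraMap_isUnit (X.det * Y.det))
  have hYu : IsUnit (g Y.det) := isUnit_of_dvd_unit (map_dvd g (dvd_mul_left _ _))
    (IsLocalization.Away.algebraMap_isUnit (X.det * Y.det))
  rw [RingHom.map_det] at hXu hYu
  obtain ⟨v, hv, hvw⟩ := exists_normalized (a := a) (w := fun i => g ∘ w i) hYu
  refine ⟨v, hv, ?_⟩
  rw [hvw]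
  have hle : Submodule.span S (Set.range fun i => g ∘ w i) ≤ push g P := by
    rw [Submodule.span_le]
    rintro _ ⟨i, rfl⟩
    exact mem_push (hwP i)
  refine le_antisymm (fun y hy => ?_) hle
  have hg := isCompl_push g hPQ
  have hspan : y ∈ Submodule.span S (Set.range fun i => g ∘ x i) := by
    let Z : Matrix W W S := X.map g
    have : y = ∑ i, (Matrix.vecMul y Z⁻¹) i • (g ∘ x (σ i)) := by
      have h1 : Matrix.vecMul (Matrix.vecMul y Z⁻¹) Z = y := by
        rw [Matrix.vecMul_vecMul, Z.nonsing_inv_mul hXu, Matrix.vecMul_one]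
      conv_lhs => rw [← h1]
      ext j
      rw [Finset.sum_apply]
      rfl
    rw [this]
    exact sum_mem fun i _ => Submodule.smul_mem _ _ (Submodule.subset_span ⟨_, rfl⟩)
  obtain ⟨c, rfl⟩ := (Submodule.mem_span_range_iff_exists_fun S).1 hspan
  rw [Fintype.sum_sum_type] at hy ⊢
  have hw : ∑ i, c (Sum.inl i) • g ∘ x (Sum.inl i) ∈ push g P :=
    sum_mem fun i _ => Submodule.smul_mem _ _ (mem_push (hwP i))
  have hu : ∑ i, c (Sum.inr i) • g ∘ x (Sum.inr i) ∈ push g Q :=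
    sum_mem fun i _ => Submodule.smul_mem _ _ (mem_push (huQ i))
  have hu' := (Submodule.add_mem_iff_right _ hw).1 hy
  rw [(Submodule.disjoint_def.1 hg.disjoint) _ hu' hu, add_zero]
  exact sum_mem fun i _ => Submodule.smul_mem _ _ (Submodule.subset_span ⟨_, rfl⟩)

/-- A submodule which is locally spanned by a normalized frame is a direct summand. -/
theorem isSummandOfRank_of_frames {P : Submodule R (W → R)}
    (h : ∀ p : PrimeSpectrum R, ∃ r ∉ p.asIdeal, ∃ (a : Fin d → W) (v : Fin d → W →
      Localization.Away r), Normalized a v ∧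
        push (algebraMap R (Localization.Away r)) P = Submodule.span _ (Set.range v)) :
    IsSummandOfRank d P := by
  classical
  -- local data cleared of denominators
  have hloc : ∀ p : PrimeSpectrum R, ∃ r ∉ p.asIdeal, ∃ (n : ℕ) (a : Fin d → W)
      (u : Fin d → W → R), (∀ i, u i ∈ P) ∧
        ∀ x ∈ P, ∃ k : ℕ, r ^ k • (r ^ n • x - ∑ i, x (a i) • u i) = 0 := by
    intro p
    obtain ⟨r, hr, a, v, hv, hP⟩ := h p
    have hvP : ∀ i, ∃ (n : ℕ) (u : W → R), u ∈ P ∧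
        algebraMap R (Localization.Away r) ∘ u = algebraMap R _ r ^ n • v i := fun i =>
      exists_smul_eq_of_mem_push r (hP ▸ Submodule.subset_span ⟨i, rfl⟩)
    choose n u huP hu using hvP
    refine ⟨r, hr, ∑ i, n i, a, fun i => r ^ (∑ j ∈ Finset.univ.erase i, n j) • u i,
      fun i => P.smul_mem _ (huP i), fun x hx => ?_⟩
    have hN : ∀ i, (algebraMap R (Localization.Away r) : R → Localization.Away r) ∘
        (r ^ (∑ j ∈ Finset.univ.erase i, n j) • u i) =
        algebraMap R (Localization.Away r) r ^ (∑ i, n i) • v i := by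
      intro i
      rw [comp_smul, hu, smul_smul, map_pow, ← pow_add, add_comm _ (n i),
        Finset.add_sum_erase _ _ (Finset.mem_univ i)]
    have hx' := hv.eq_sum (hP ▸ mem_push (f := algebraMap R (Localization.Away r)) hx)
    have h0 : (algebraMap R (Localization.Away r) : R → Localization.Away r) ∘
        (∑ i, x (a i) • (r ^ (∑ j ∈ Finset.univ.erase i, n j) • u i)) =
        algebraMap R (Localization.Away r) ∘ (r ^ (∑ i, n i) • x) := by
      rw [comp_sum, comp_smul]
      conv_rhs => rw [hx', Finset.smul_sum]
      refine Finset.sum_congr rfl fun i _ => ?_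
      rw [comp_smul, hN i, smul_comm, map_pow]
      rfl
    obtain ⟨k, hk⟩ := exists_smul_eq_of_comp_eq (S := Localization.Away r) r h0
    exact ⟨k, by rw [smul_sub, hk, sub_self]⟩
  -- Finite generation is needed so that the torsion exponents in `hloc`, which depend on the
  -- vector, can be bounded for all of `P` at once.
  have hfg : P.FG := by
    choose r hr n a u huP hu using hloc
    have htop : Ideal.span (Set.range r) = ⊤ := by
      by_contra hI
      obtain ⟨J, hJ, hle⟩ := Ideal.exists_le_maximal _ hI
      exact hr ⟨J, hJ.isPrime⟩ (hle (Ideal.subset_span ⟨_, rfl⟩))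
    obtain ⟨T, hTr, hT⟩ := (Ideal.span_eq_top_iff_finite _).1 htop
    rw [← Set.image_univ, Finset.subset_set_image_iff] at hTr
    obtain ⟨T', -, rfl⟩ := hTr
    refine ⟨T'.biUnion fun p => Finset.univ.image (u p), le_antisymm ?_ ?_⟩
    · rw [Submodule.span_le]
      intro x hx
      obtain ⟨p, -, hx⟩ := Finset.mem_biUnion.1 hx
      obtain ⟨i, -, rfl⟩ := Finset.mem_image.1 hx
      exact huP p i
    · intro x hx
      refine mem_of_locally_mem fun p' => ?_
      have : ∃ q ∈ T', r q ∉ p'.asIdeal := by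
        by_contra! hc
        refine p'.2.ne_top (top_le_iff.1 (hT ▸ Ideal.span_le.2 ?_))
        intro t ht
        obtain ⟨q, hq, rfl⟩ := Finset.mem_image.1 ht
        exact hc q hq
      obtain ⟨q, hq, hqp⟩ := this
      obtain ⟨k, hk⟩ := hu q x hx
      refine ⟨r q ^ k * r q ^ n q, fun h => ?_, ?_⟩
      · rw [← pow_add] at h
        exact hqp (p'.2.mem_of_pow_mem _ h)
      · rw [smul_sub, sub_eq_zero] at hk
        rw [mul_smul, hk]
        refine Submodule.smul_mem _ _ (sum_mem fun i _ => Submodule.smul_mem _ _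
          (Submodule.subset_span ?_))
        exact Finset.mem_biUnion.2 ⟨q, hq, Finset.mem_image_of_mem _ (Finset.mem_univ _)⟩
  -- a retraction exists locally, hence globally
  let I : Ideal R :=
    { carrier := {c | ∃ ρ : (W → R) →ₗ[R] P, ∀ x : P, ρ x = c • x}
      add_mem' := by
        rintro c c' ⟨ρ, h⟩ ⟨ρ', h'⟩
        exact ⟨ρ + ρ', fun x => by simp [h, h', add_smul]⟩
      zero_mem' := ⟨0, fun x => by simp⟩
      smul_mem' := by
        rintro c c' ⟨ρ, h⟩
        exact ⟨c • ρ, fun x => by simp [h, mul_smul]⟩ }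
  have hI : I = ⊤ := by
    by_contra hI
    obtain ⟨J, hJ, hle⟩ := Ideal.exists_le_maximal _ hI
    obtain ⟨r, hr, n, a, u, huP, hu⟩ := hloc ⟨J, hJ.isPrime⟩
    obtain ⟨T, rfl⟩ := hfg
    have huT : ∀ x : T, ∃ k : ℕ, r ^ k • (r ^ n • (x : W → R) - ∑ i, (x : W → R) (a i) • u i) = 0 :=
      fun x => hu x (Submodule.subset_span x.2)
    choose k hk using huT
    let ρ₀ : (W → R) →ₗ[R] (W → R) :=
      ∑ i, (LinearMap.proj (a i)).smulRight (u i)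
    have hρ₀ : ∀ x, ρ₀ x = ∑ i, x (a i) • u i := fun x => by simp [ρ₀]
    -- The factor `r ^ ∑ k` kills the torsion error at every generator, so on `P` this map is
    -- multiplication by a power of `r`; hence that power belongs to `I`.
    let ρ : (W → R) →ₗ[R] Submodule.span R (T : Set (W → R)) :=
      r ^ (∑ x, k x) • ρ₀.codRestrict _ fun x => by
        rw [hρ₀]; exact sum_mem fun i _ => Submodule.smul_mem _ _ (huP i)
    refine hr (hJ.isPrime.mem_of_pow_mem (∑ x, k x + n) (hle ⟨ρ, ?_⟩))
    rintro ⟨x, hx⟩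
    ext1
    change r ^ (∑ x, k x) • ρ₀ x = r ^ (∑ x, k x + n) • x
    suffices Submodule.span R (T : Set (W → R)) ≤ LinearMap.eqLocus (r ^ (∑ x, k x) • ρ₀)
      (r ^ (∑ x, k x + n) • LinearMap.id) from this hx
    rw [Submodule.span_le]
    intro y hy
    change r ^ (∑ x, k x) • ρ₀ y = r ^ (∑ x, k x + n) • y
    have hky := hk ⟨y, hy⟩
    rw [smul_sub, sub_eq_zero] at hky
    rw [hρ₀, pow_add, mul_smul, ← Finset.add_sum_erase _ _ (Finset.mem_univ ⟨y, hy⟩), add_comm,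
      pow_add, mul_smul, mul_smul, hky]
  obtain ⟨ρ, hρ⟩ : (1 : R) ∈ I := hI ▸ Submodule.mem_top
  have hcompl : IsCompl P (LinearMap.ker ρ) :=
    LinearMap.isCompl_of_proj fun x => by rw [hρ, one_smul]
  refine ⟨⟨_, hcompl⟩, fun p => ?_⟩
  obtain ⟨r, hr, a, v, hv, hP⟩ := h p
  rw [rankAtStalk_eq_finrank_push hcompl]
  let κ := p.asIdeal.ResidueField
  have hu : IsUnit (algebraMap R κ r) := by
    rw [isUnit_iff_ne_zero]
    exact fun h0 => hr ((Ideal.algebraMap_residueField_eq_zero (I := p.asIdeal)).1 h0)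
  let g : Localization.Away r →+* κ := IsLocalization.Away.lift r hu
  have hg : g.comp (algebraMap R _) = algebraMap R κ := IsLocalization.Away.lift_comp r hu
  rw [← hg, push_comp, hP, push_span_range, finrank_span_eq_card (hv.map g).linearIndependent,
    Fintype.card_fin]

end Summand

/-! ### Integral bases, the form and the operator `t` in coordinates. -/

section UnifBasis

variable {O₀ F₀ O F : Type u}
  [CommRing O₀] [IsDomain O₀] [IsDiscreteValuationRing O₀]
  [Field F₀] [Algebra O₀ F₀] [IsFractionRing O₀ F₀]
  [Field F] [Algebra F₀ F] [Algebra O₀ F] [IsScalarTower O₀ F₀ F]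
  [CommRing O] [IsDomain O] [IsDiscreteValuationRing O]
  [Algebra O₀ O] [Algebra O F] [IsScalarTower O₀ O F] [IsIntegralClosure O O₀ F]
  (D : RamifiedQuadratic O₀ F₀ O F)

theorem isUnit_two₀ (D : RamifiedQuadratic O₀ F₀ O F) : IsUnit (2 : O₀) := by
  have := D.residue_two_ne_zero
  rwa [← map_ofNat (IsLocalRing.residue O₀) 2, IsLocalRing.residue_ne_zero_iff_isUnit] at this

theorem isUnit_two (D : RamifiedQuadratic O₀ F₀ O F) (R : Type u) [CommRing R] [Algebra O R] :
    IsUnit (2 : R) := by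
  have h := ((isUnit_two₀ D).map (algebraMap O₀ O)).map (algebraMap O R)
  rwa [map_ofNat, map_ofNat] at h

theorem algebraMap_injective_O (O₀ F₀ O F : Type u)
    [CommRing O₀] [IsDomain O₀] [IsDiscreteValuationRing O₀]
    [Field F₀] [Algebra O₀ F₀] [IsFractionRing O₀ F₀]
    [Field F] [Algebra F₀ F] [Algebra O₀ F] [IsScalarTower O₀ F₀ F]
    [CommRing O] [IsDomain O] [IsDiscreteValuationRing O]
    [Algebra O₀ O] [Algebra O F] [IsScalarTower O₀ O F] [IsIntegralClosure O O₀ F] :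
    Function.Injective (algebraMap O F) :=
  IsIntegralClosure.algebraMap_injective O O₀ F

theorem unif_sq_eq (D : RamifiedQuadratic O₀ F₀ O F) :
    (algebraMap O F D.unif) ^ 2 = algebraMap F₀ F (algebraMap O₀ F₀ D.unif₀) := by
  rw [← map_pow, D.unif_sq, ← IsScalarTower.algebraMap_apply, ← IsScalarTower.algebraMap_apply]

/-- Otherwise `π₀` would be the square of an element of `F₀`, which lies in `O₀` by integral
closedness; an irreducible element is not a square. -/
theorem unif_notMem (D : RamifiedQuadratic O₀ F₀ O F) (c : F₀) :
    algebraMap F₀ F c ≠ algebraMap O F D.unif := by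
  intro h
  have h2 := unif_sq_eq D
  rw [← h, ← map_pow] at h2
  have h3 := (algebraMap F₀ F).injective h2
  have hc : IsIntegral O₀ c :=
    IsIntegral.of_pow (n := 2) (by norm_num) (h3 ▸ isIntegral_algebraMap)
  obtain ⟨d, rfl⟩ := IsIntegrallyClosed.isIntegral_iff.1 hc
  rw [← map_pow] at h3
  have h4 := IsFractionRing.injective O₀ F₀ h3
  exact D.irreducible_unif₀.not_isSquare ⟨d, by rw [← h4, sq]⟩

theorem linearIndependent_unif (D : RamifiedQuadratic O₀ F₀ O F) :
    LinearIndependent F₀ ![(1 : F), algebraMap O F D.unif] := by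
  rw [LinearIndependent.pair_iff]
  intro s t h
  by_cases ht : t = 0
  · subst ht
    simpa using h
  · exfalso
    refine unif_notMem D (-(s / t)) ?_
    have ht' : algebraMap F₀ F t ≠ 0 := by simpa using ht
    rw [Algebra.smul_def, Algebra.smul_def, mul_one] at h
    rw [map_neg, map_div₀, neg_eq_iff_eq_neg, div_eq_iff ht']
    linear_combination h

theorem exists_eq_add (D : RamifiedQuadratic O₀ F₀ O F) (x : F) : ∃ a b : F₀,
    x = algebraMap F₀ F a + algebraMap F₀ F b * algebraMap O F D.unif := by
  have : FiniteDimensional F₀ F :=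
    Module.finite_of_finrank_pos (by rw [D.finrank_eq_two]; norm_num)
  have h := (linearIndependent_unif D).span_eq_top_of_card_eq_finrank (by simp [D.finrank_eq_two])
  have hx : x ∈ Submodule.span F₀ (Set.range ![(1 : F), algebraMap O F D.unif]) :=
    h ▸ Submodule.mem_top
  rw [Matrix.range_cons_cons_empty, Submodule.mem_span_pair] at hx
  obtain ⟨a, b, rfl⟩ := hx
  exact ⟨a, b, by rw [Algebra.smul_def, Algebra.smul_def, mul_one]⟩

/-- An automorphism fixing `π` would fix `F₀ + F₀ π = F`. -/
theorem conj_unif_eq (D : RamifiedQuadratic O₀ F₀ O F) :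
    D.conj (algebraMap O F D.unif) = -algebraMap O F D.unif := by
  refine (conj_unif D).resolve_left fun h => D.conj_ne_one ?_
  ext x
  obtain ⟨a, b, rfl⟩ := exists_eq_add D x
  simp [h]

/-- The basis `1, π` of `O` over `O₀`. -/
def unifBasis : Module.Basis (Fin 2) O₀ O :=
  Module.Basis.mk (v := ![1, D.unif])
    (by
      have h := (linearIndependent_unif D).restrict_scalars' O₀
      refine LinearIndependent.of_comp ((Algebra.linearMap O F).restrictScalars O₀) ?_
      convert h using 1
      ext i
      fin_cases i
      · simp
      · rfl)
    (by
      intro x _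
      obtain ⟨a, b, hx⟩ := exists_eq_add D (algebraMap O F x)
      -- For `x = a + b π`, the element `2 a` is the trace of `x`, hence integral, and 2 is a unit
      -- of `O₀`, so `a` is integral. Then `b π = x - a` lies in `O`, and `mem_range_of_unif_mul`
      -- gives the integrality of `b`.
      have hc : algebraMap F₀ F (2 * a) = algebraMap O F x + D.conj (algebraMap O F x) := by
        rw [hx, map_add, map_mul, map_mul D.conj, conj_unif_eq, AlgEquiv.commutes,
          AlgEquiv.commutes, map_ofNat]
        ring
      have hint : IsIntegral O₀ (2 * a) := by
        rw [← isIntegral_algebraMap_iff (algebraMap F₀ F).injective, hc]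
        have h : IsIntegral O₀ (algebraMap O F x) :=
          (IsIntegralClosure.isIntegral_iff (A := O)).2 ⟨x, rfl⟩
        exact h.add (h.map (D.conj.toAlgHom.restrictScalars O₀))
      obtain ⟨a₁, ha₁⟩ := IsIntegrallyClosed.isIntegral_iff.1 hint
      obtain ⟨e, he⟩ := (isUnit_two₀ D).exists_right_inv
      have ha : algebraMap O₀ F₀ (e * a₁) = a := by
        have he' : (2 : F₀) * algebraMap O₀ F₀ e = 1 := by
          rw [← map_ofNat (algebraMap O₀ F₀) 2, ← map_mul, he, map_one]
        rw [map_mul, ha₁]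
        linear_combination a * he'
      obtain ⟨b₁, hb⟩ := mem_range_of_unif_mul D (w := b) ⟨x - algebraMap O₀ O (e * a₁), by
        rw [map_sub, ← IsScalarTower.algebraMap_apply, IsScalarTower.algebraMap_apply O₀ F₀ F, ha,
          hx]
        ring⟩
      rw [Matrix.range_cons_cons_empty, Submodule.mem_span_pair]
      refine ⟨e * a₁, b₁, algebraMap_injective_O O₀ F₀ O F ?_⟩
      have e1 : ∀ z : O₀, algebraMap O F (algebraMap O₀ O z) =
          algebraMap F₀ F (algebraMap O₀ F₀ z) := fun z => by
        rw [← IsScalarTower.algebraMap_apply, ← IsScalarTower.algebraMap_apply]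
      rw [hx, ← ha, ← hb]
      simp only [map_add, Algebra.smul_def, map_mul, e1, mul_one])

theorem unifBasis_zero : unifBasis D 0 = 1 := by simp [unifBasis]

theorem unifBasis_one : unifBasis D 1 = D.unif := by simp [unifBasis]

variable (m : ℕ)

/-- The standard generators of `Λ_m`. -/
def lamGen (i : Fin (2 * m)) : Fin (2 * m) → F :=
  if (i : ℕ) < m then (algebraMap O F D.unif)⁻¹ • (Pi.single i 1 : Fin (2 * m) → F)
    else Pi.single i 1

/-- The standard basis of `Λ_m` over `O`. -/
def lamBasis : Module.Basis (Fin (2 * m)) O (Lam D m) :=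
  Module.Basis.span (v := lamGen D m) (by
    have hinj : Function.Injective (algebraMap O F) := algebraMap_injective_O O₀ F₀ O F
    have hz : ∀ a : O, algebraMap O F a = 0 ↔ a = 0 := fun a => map_eq_zero_iff _ hinj
    rw [Fintype.linearIndependent_iff]
    intro c hc i
    have hi := congrFun hc i
    rw [Finset.sum_apply, Finset.sum_eq_single i] at hi
    · by_cases h : (i : ℕ) < m
      · simpa [lamGen, h, Algebra.smul_def, unif_ne_zero D, hz] using hi
      · simpa [lamGen, h, Algebra.smul_def, hz] using hi
    · intro j _ hj
      have : lamGen D m j i = 0 := by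
        simp only [lamGen]
        split_ifs <;> simp [hj.symm]
      simp [this]
    · simp)

theorem lamBasis_apply (i : Fin (2 * m)) : (lamBasis D m i : Fin (2 * m) → F) = lamGen D m i :=
  Module.Basis.coe_span_apply (v := lamGen D m) _ i

/-- The basis of `Λ_m` over `O₀` consisting of the standard generators and their products with
`π`. -/
def lamBasis₀ : Module.Basis (Fin 2 × Fin (2 * m)) O₀ (Lam D m) :=
  (unifBasis D).smulTower (lamBasis D m)

theorem lamBasis₀_zero (i : Fin (2 * m)) : lamBasis₀ D m (0, i) = lamBasis D m i := by
  rw [lamBasis₀, Module.Basis.smulTower_apply, unifBasis_zero, one_smul]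

theorem lamBasis₀_one (i : Fin (2 * m)) :
    lamBasis₀ D m (1, i) = latticeT D m (lamBasis D m i) := by
  rw [lamBasis₀, Module.Basis.smulTower_apply, unifBasis_one]
  rfl

theorem latticeT_sq (x : Lam D m) : latticeT D m (latticeT D m x) = D.unif₀ • x := by
  change D.unif • D.unif • x = _
  rw [smul_smul, ← sq, D.unif_sq, algebraMap_smul]

/-- The sign `1` for the first half of the indices and `-1` for the second one. -/
def hsgn {m : ℕ} (i : Fin (2 * m)) : ℤ := if (i : ℕ) < m then 1 else -1

theorem hsgn_rev {m : ℕ} (i : Fin (2 * m)) : hsgn i.rev = -hsgn i := by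
  have := i.2
  simp only [hsgn, Fin.val_rev]
  split_ifs <;> omega

theorem hsgn_mul_self {m : ℕ} (i : Fin (2 * m)) : hsgn i * hsgn i = 1 := by
  simp only [hsgn]
  split_ifs <;> norm_num

theorem algebraMap_latticeForm (x y : Lam D m) :
    algebraMap O₀ F (latticeForm D m x y) =
      (2 : F)⁻¹ * (hermForm D m x y + D.conj (hermForm D m x y)) := by
  have h : algebraMap O₀ F₀ (latticeForm D m x y) = symForm D m x y :=
    LinearMap.restrictScalarsRange₂_apply ((Lam D m).subtype.restrictScalars O₀)
      ((Lam D m).subtype.restrictScalars O₀) (Algebra.linearMap O₀ F₀)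
      (IsFractionRing.injective O₀ F₀) (symForm D m) (symForm_mem_range (O₀ := O₀) (F₀ := F₀) D m) x y
  rw [IsScalarTower.algebraMap_apply O₀ F₀ F]
  erw [h]
  change algebraMap F₀ F ((2 : F₀)⁻¹ * Algebra.trace F₀ F (hermForm D m x y)) = _
  rw [map_mul, trace_eq D, map_inv₀, map_ofNat]

end UnifBasis

/-- The index set of the coordinates on `Λ_m ⊗ R`. -/
abbrev Idx (m : ℕ) : Type := Fin (2 * m) ⊕ Fin (2 * m)

section Model

variable (m : ℕ) (R : Type u) [CommRing R]

/-- The hyperbolic form. -/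
def hypForm : LinearMap.BilinForm R (Idx m → R) :=
  LinearMap.mk₂ R (fun v w => ∑ i, (v (.inl i) * w (.inr i) + v (.inr i) * w (.inl i)))
    (by intro v v' w; rw [← Finset.sum_add_distrib]; congr 1; ext i; simp; ring)
    (by intro c v w; rw [smul_eq_mul, Finset.mul_sum]; congr 1; ext i; simp; ring)
    (by intro v v' w; rw [← Finset.sum_add_distrib]; congr 1; ext i; simp; ring)
    (by intro c v w; rw [smul_eq_mul, Finset.mul_sum]; congr 1; ext i; simp; ring)

/-- The signed reversal of coordinates. -/
def srev : (Fin (2 * m) → R) →ₗ[R] (Fin (2 * m) → R) where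
  toFun w j := -(hsgn j : R) * w j.rev
  map_add' v w := by ext; simp; ring
  map_smul' c v := by ext; simp; ring

/-- The operator `t` in coordinates. -/
def coordT (c : R) : (Idx m → R) →ₗ[R] (Idx m → R) where
  toFun v := Sum.elim (srev m R (v ∘ .inr) - c • (v ∘ .inl)) (c • (v ∘ .inr))
  map_add' v w := by
    rw [show (v + w) ∘ Sum.inr = v ∘ Sum.inr + w ∘ Sum.inr from rfl,
      show (v + w) ∘ Sum.inl = v ∘ Sum.inl + w ∘ Sum.inl from rfl]
    ext (i | i)
    · simp; ring
    · simp
  map_smul' a v := by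
    rw [show (a • v) ∘ Sum.inr = a • (v ∘ Sum.inr) from rfl,
      show (a • v) ∘ Sum.inl = a • (v ∘ Sum.inl) from rfl]
    ext (i | i)
    · simp; ring
    · simp; ring

variable {m R}

theorem hypForm_apply (v w : Idx m → R) :
    hypForm m R v w = ∑ i, (v (.inl i) * w (.inr i) + v (.inr i) * w (.inl i)) := rfl

theorem hypForm_comm (v w : Idx m → R) : hypForm m R v w = hypForm m R w v := by
  simp only [hypForm_apply]
  congr 1; ext i; ring

theorem srev_apply (w : Fin (2 * m) → R) (j : Fin (2 * m)) :
    srev m R w j = -(hsgn j : R) * w j.rev := rfl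

theorem srev_srev (w : Fin (2 * m) → R) : srev m R (srev m R w) = -w := by
  ext j
  have h : (hsgn j : R) * hsgn j = 1 := by exact_mod_cast congrArg (Int.cast (R := R)) (hsgn_mul_self j)
  rw [srev_apply, srev_apply, hsgn_rev, Fin.rev_rev, Pi.neg_apply]
  push_cast
  linear_combination -w j * h

variable {R' : Type u} [CommRing R']

theorem map_hypForm (f : R →+* R') (v w : Idx m → R) :
    f (hypForm m R v w) = hypForm m R' (f ∘ v) (f ∘ w) := by
  simp [hypForm_apply]

theorem map_srev (f : R →+* R') (w : Fin (2 * m) → R) :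
    f ∘ srev m R w = srev m R' (f ∘ w) := by
  ext; simp [srev_apply]

theorem map_coordT (f : R →+* R') (c : R) (v : Idx m → R) :
    f ∘ coordT m R c v = coordT m R' (f c) (f ∘ v) := by
  ext (i | i) <;> simp [coordT, srev_apply]

end Model

section Coord

variable {O₀ F₀ O F : Type u}
  [CommRing O₀] [IsDomain O₀] [IsDiscreteValuationRing O₀]
  [Field F₀] [Algebra O₀ F₀] [IsFractionRing O₀ F₀]
  [Field F] [Algebra F₀ F] [Algebra O₀ F] [IsScalarTower O₀ F₀ F]
  [CommRing O] [IsDomain O] [IsDiscreteValuationRing O]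
  [Algebra O₀ O] [Algebra O F] [IsScalarTower O₀ O F] [IsIntegralClosure O O₀ F]
  (D : RamifiedQuadratic O₀ F₀ O F) (m : ℕ)

/-- Coordinates with respect to `(t - π) b_i` and `± b_{n+1-i}` in terms of coordinates with
respect to `b_i` and `t b_i`. -/
def shearEquiv {R : Type u} [CommRing R] (c : R) :
    (Fin 2 × Fin (2 * m) → R) ≃ₗ[R] (Idx m → R) where
  toFun x := Sum.elim (fun i => x (1, i))
    (fun j => (hsgn j : R) * (x (0, j.rev) + c * x (1, j.rev)))
  map_add' x y := by
    ext (i | i)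
    · simp
    · simp; ring
  map_smul' a x := by
    ext (i | i)
    · simp
    · simp; ring
  invFun v := fun p => if p.1 = 0 then (hsgn p.2.rev : R) * v (.inr p.2.rev) - c * v (.inl p.2)
    else v (.inl p.2)
  left_inv x := by
    ext ⟨a, i⟩
    have h : (hsgn i.rev : R) * hsgn i.rev = 1 := by
      exact_mod_cast congrArg (Int.cast (R := R)) (hsgn_mul_self i.rev)
    fin_cases a
    · simp only [Fin.zero_eta, if_true, Sum.elim_inr, Sum.elim_inl, Fin.rev_rev]
      linear_combination (x (0, i) + c * x (1, i)) * h
    · simp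
  right_inv v := by
    ext (i | i)
    · simp
    · have h : (hsgn i : R) * hsgn i = 1 := by
        exact_mod_cast congrArg (Int.cast (R := R)) (hsgn_mul_self i)
      simp only [Sum.elim_inr, if_true, Fin.rev_rev, one_ne_zero, if_false]
      linear_combination v (.inr i) * h

variable (R : Type u) [CommRing R] [Algebra O R]

/-- The basis of `Λ_m ⊗ R` induced by the basis of `Λ_m`. -/
def lamBasisR : Module.Basis (Fin 2 × Fin (2 * m)) R (LamR D m R) :=
  ((lamBasis₀ D m).baseChange O).baseChange R

theorem lamBasisR_apply (p : Fin 2 × Fin (2 * m)) :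
    lamBasisR D m R p = (1 : R) ⊗ₜ[O] ((1 : O) ⊗ₜ[O₀] lamBasis₀ D m p) := by
  simp [lamBasisR]

/-- The coordinates on `Λ_m ⊗ R`. -/
def coord : LamR D m R ≃ₗ[R] (Idx m → R) :=
  (lamBasisR D m R).equivFun ≪≫ₗ shearEquiv m (algebraMap O R D.unif)

theorem lamBasisR_repr_tmul (r : R) (o : O) (x : Lam D m) (p : Fin 2 × Fin (2 * m)) :
    (lamBasisR D m R).repr (r ⊗ₜ[O] (o ⊗ₜ[O₀] x)) p =
      r * algebraMap O R (o * algebraMap O₀ O ((lamBasis₀ D m).repr x p)) := by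
  simp [lamBasisR, Algebra.smul_def]
  ring

variable {R} in
theorem coord_rTensor {R' : Type u} [CommRing R'] [Algebra O R'] (g : R →ₐ[O] R')
    (v : LamR D m R) :
    coord D m R' (LinearMap.rTensor (LamO D m) g.toLinearMap v) = g ∘ coord D m R v := by
  have key : ∀ p, (lamBasisR D m R').repr (LinearMap.rTensor (LamO D m) g.toLinearMap v) p =
      g ((lamBasisR D m R).repr v p) := by
    intro p
    induction v using TensorProduct.induction_on with
    | zero => simp
    | add x y h h' => simp [h, h']
    | tmul r v =>
      induction v using TensorProduct.induction_on with
      | zero => simp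
      | add x y h h' => simp only [TensorProduct.tmul_add, map_add, Finsupp.add_apply, h, h']
      | tmul o x =>
        rw [LinearMap.rTensor_tmul, lamBasisR_repr_tmul, lamBasisR_repr_tmul]
        simp
  ext (i | i)
  · simp [coord, shearEquiv, key]
  · simp [coord, shearEquiv, key]

theorem coordT_shearEquiv {R : Type u} [CommRing R] (c : R) (x : Fin 2 × Fin (2 * m) → R) :
    coordT m R c (shearEquiv m c x) =
      shearEquiv m c (fun p => if p.1 = 0 then c ^ 2 * x (1, p.2) else x (0, p.2)) := by
  ext (i | i)
  · have h : (hsgn i : R) * hsgn i = 1 := by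
      exact_mod_cast congrArg (Int.cast (R := R)) (hsgn_mul_self i)
    simp [coordT, shearEquiv, srev_apply, hsgn_rev]
    linear_combination (x (0, i) + c * x (1, i)) * h
  · simp [coordT, shearEquiv]
    ring

theorem coord_lamBasisR (p : Fin 2 × Fin (2 * m)) : coord D m R (lamBasisR D m R p) =
    shearEquiv m (algebraMap O R D.unif) (Pi.single p 1) := by
  rw [coord, LinearEquiv.trans_apply]
  congr 1
  ext q
  rw [Module.Basis.equivFun_self, Pi.single_apply]
  simp only [eq_comm]

theorem tR_lamBasisR_zero (i : Fin (2 * m)) :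
    tR D m R (lamBasisR D m R (0, i)) = lamBasisR D m R (1, i) := by
  simp [lamBasisR_apply, tR, lamBasis₀_zero, lamBasis₀_one]

theorem tR_lamBasisR_one (i : Fin (2 * m)) :
    tR D m R (lamBasisR D m R (1, i)) =
      (algebraMap O R D.unif) ^ 2 • lamBasisR D m R (0, i) := by
  have : (algebraMap O R D.unif) ^ 2 = algebraMap O R (algebraMap O₀ O D.unif₀) := by
    rw [← map_pow, D.unif_sq]
  rw [this, algebraMap_smul, lamBasisR_apply, lamBasisR_apply, lamBasis₀_one, lamBasis₀_zero]
  simp only [tR, LinearMap.baseChange_tmul, latticeT_sq]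
  rw [TensorProduct.tmul_smul, ← algebraMap_smul O D.unif₀, TensorProduct.tmul_smul]

theorem coord_tR (v : LamR D m R) :
    coord D m R (tR D m R v) = coordT m R (algebraMap O R D.unif) (coord D m R v) := by
  suffices h : (coord D m R).toLinearMap ∘ₗ tR D m R =
      coordT m R (algebraMap O R D.unif) ∘ₗ (coord D m R).toLinearMap from congr($h v)
  refine (lamBasisR D m R).ext fun ⟨a, i⟩ => ?_
  simp only [LinearMap.comp_apply, LinearEquiv.coe_coe]
  rw [coord_lamBasisR, coordT_shearEquiv]
  fin_cases a
  · rw [Fin.zero_eta, tR_lamBasisR_zero, coord_lamBasisR]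
    congr 1
    ext ⟨b, j⟩
    fin_cases b <;> simp [Pi.single_apply]
  · rw [Fin.mk_one, tR_lamBasisR_one, map_smul, coord_lamBasisR, ← map_smul]
    congr 1
    ext ⟨b, j⟩
    fin_cases b <;> simp [Pi.single_apply]

/-- Reversal of the index changes the sign `hsgn`, so the two sums that contain `c` cancel: the
shear making `t - π` simple does not affect the form. -/
theorem hypForm_shearEquiv {R : Type u} [CommRing R] (c : R) (x y : Fin 2 × Fin (2 * m) → R) :
    hypForm m R (shearEquiv m c x) (shearEquiv m c y) =
      ∑ i, (hsgn i : R) * (x (1, i) * y (0, i.rev) - x (0, i) * y (1, i.rev)) := by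
  have h1 : ∑ i : Fin (2 * m), (hsgn i : R) * (x (0, i.rev) * y (1, i)) =
      ∑ i, -((hsgn i : R) * (x (0, i) * y (1, i.rev))) := by
    rw [← Equiv.sum_comp Fin.revPerm]
    refine Finset.sum_congr rfl fun i _ => ?_
    simp [hsgn_rev]
  have h2 : ∑ i : Fin (2 * m), (hsgn i : R) * (c * x (1, i.rev) * y (1, i)) =
      ∑ i, -((hsgn i : R) * (c * x (1, i) * y (1, i.rev))) := by
    rw [← Equiv.sum_comp Fin.revPerm]
    refine Finset.sum_congr rfl fun i _ => ?_
    simp [hsgn_rev]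
  have h3 : hypForm m R (shearEquiv m c x) (shearEquiv m c y) =
      ∑ i, ((hsgn i : R) * (x (1, i) * y (0, i.rev) + c * x (1, i) * y (1, i.rev))) +
        ∑ i : Fin (2 * m), (hsgn i : R) * (x (0, i.rev) * y (1, i)) +
        ∑ i : Fin (2 * m), (hsgn i : R) * (c * x (1, i.rev) * y (1, i)) := by
    rw [hypForm_apply, ← Finset.sum_add_distrib, ← Finset.sum_add_distrib]
    refine Finset.sum_congr rfl fun i _ => ?_
    simp [shearEquiv]
    ring
  rw [h3, h1, h2, ← Finset.sum_add_distrib, ← Finset.sum_add_distrib]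
  refine Finset.sum_congr rfl fun i _ => ?_
  ring

theorem hermForm_smul_left (c : F) (x y : Fin (2 * m) → F) :
    hermForm D m (c • x) y = D.conj c * hermForm D m x y := by
  simp [hermForm, Finset.mul_sum, mul_assoc]

theorem hermForm_smul_right (c : F) (x y : Fin (2 * m) → F) :
    hermForm D m x (c • y) = c * hermForm D m x y := by
  simp [hermForm, Finset.mul_sum, mul_left_comm]

theorem hermForm_single' (i j : Fin (2 * m)) :
    hermForm D m (Pi.single i 1) (Pi.single j 1) = if j = i.rev then 1 else 0 := by
  have := hermForm_single D m i j.rev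
  rw [Fin.rev_rev] at this
  rw [this]
  congr 1
  rw [eq_iff_iff]
  constructor
  · rintro rfl; rw [Fin.rev_rev]
  · rintro rfl; rw [Fin.rev_rev]

theorem hermForm_lamGen (i j : Fin (2 * m)) : hermForm D m (lamGen D m i) (lamGen D m j) =
    if j = i.rev then -(hsgn i : F) * (algebraMap O F D.unif)⁻¹ else 0 := by
  by_cases hij : j = i.rev
  · subst hij
    have := i.2
    by_cases hi : (i : ℕ) < m
    · have hr : ¬ ((i.rev : Fin (2 * m)) : ℕ) < m := by rw [Fin.val_rev]; omega
      simp only [lamGen, hi, hr, if_true, if_false, hermForm_smul_left, hermForm_single', hsgn,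
        map_inv₀, conj_unif_eq]
      simp
    · have hr : ((i.rev : Fin (2 * m)) : ℕ) < m := by rw [Fin.val_rev]; omega
      simp only [lamGen, hi, hr, if_true, if_false, hermForm_smul_right, hermForm_single', hsgn]
      simp
  · simp only [lamGen]
    split_ifs <;> simp [hermForm_smul_right, hermForm_smul_left, hermForm_single', hij]

theorem latticeT_coe (x : Lam D m) :
    (latticeT D m x : Fin (2 * m) → F) = algebraMap O F D.unif • (x : Fin (2 * m) → F) := by
  change D.unif • (x : Fin (2 * m) → F) = _
  rw [algebraMap_smul]

theorem latticeForm_lamBasis (i j : Fin (2 * m)) :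
    latticeForm D m (lamBasis D m i) (lamBasis D m j) = 0 ∧
    latticeForm D m (latticeT D m (lamBasis D m i)) (lamBasis D m j) =
      (if j = i.rev then (hsgn i : O₀) else 0) ∧
    latticeForm D m (lamBasis D m i) (latticeT D m (lamBasis D m j)) =
      (if j = i.rev then -(hsgn i : O₀) else 0) ∧
    latticeForm D m (latticeT D m (lamBasis D m i)) (latticeT D m (lamBasis D m j)) = 0 := by
  have hinj : Function.Injective (algebraMap O₀ F) := by
    rw [IsScalarTower.algebraMap_eq O₀ F₀ F]
    exact (algebraMap F₀ F).injective.comp (IsFractionRing.injective O₀ F₀)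
  have h2 : (2 : F) ≠ 0 := by
    have := (isUnit_two₀ D).map (algebraMap O₀ F)
    rw [map_ofNat] at this
    exact this.ne_zero
  have hπ := unif_ne_zero D
  refine ⟨hinj ?_, hinj ?_, hinj ?_, hinj ?_⟩ <;> rw [algebraMap_latticeForm] <;>
    simp only [latticeT_coe, lamBasis_apply, hermForm_smul_left, hermForm_smul_right,
      hermForm_lamGen, conj_unif_eq] <;> split_ifs with hij <;>
    simp [conj_unif_eq] <;> field_simp <;> ring

theorem formR_lamBasisR (p q : Fin 2 × Fin (2 * m)) :
    formR D m R (lamBasisR D m R p) (lamBasisR D m R q) =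
      algebraMap O R (algebraMap O₀ O (latticeForm D m (lamBasis₀ D m p) (lamBasis₀ D m q))) := by
  simp [lamBasisR_apply, formR, LinearMap.BilinForm.baseChange_tmul, Algebra.smul_def]

theorem formR_eq_hypForm (v w : LamR D m R) :
    formR D m R v w = hypForm m R (coord D m R v) (coord D m R w) := by
  suffices h : formR D m R = (hypForm m R).compl₁₂ (coord D m R).toLinearMap
      (coord D m R).toLinearMap from congr($h v w)
  refine (lamBasisR D m R).ext fun ⟨a, i⟩ => (lamBasisR D m R).ext fun ⟨b, j⟩ => ?_
  rw [formR_lamBasisR, LinearMap.compl₁₂_apply]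
  simp only [LinearEquiv.coe_coe]
  rw [coord_lamBasisR, coord_lamBasisR, hypForm_shearEquiv, Finset.sum_eq_single i]
  · obtain ⟨h1, h2, h3, h4⟩ := latticeForm_lamBasis D m i j
    fin_cases a <;> fin_cases b <;>
      simp only [Fin.zero_eta, Fin.mk_one, lamBasis₀_zero, lamBasis₀_one, h1, h2, h3, h4] <;>
      by_cases hij : j = i.rev <;> simp [hij, eq_comm]
  · intro k _ hk
    simp [Pi.single_apply, hk]
  · simp

end Coord

/-! ### The spin condition through pairings with decomposable vectors. -/

section SpinAlgebra

variable {m : ℕ} {R : Type u} [CommRing R]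

/-- The determinant of the matrix of pairings of two families of vectors. -/
def gramDet (x : Fin (2 * m) → Idx m → R) : (Idx m → R) [⋀^Fin (2 * m)]→ₗ[R] R :=
  Matrix.detRowAlternating.compLinearMap (LinearMap.pi fun j => (hypForm m R).flip (x j))

theorem gramDet_apply (x v : Fin (2 * m) → Idx m → R) :
    gramDet x v = (Matrix.of fun i j => hypForm m R (v i) (x j)).det := rfl

/-- The determinant of the concatenation of two families of vectors. -/
def fullDet (x : Fin (2 * m) → Idx m → R) : (Idx m → R) [⋀^Fin (2 * m)]→ₗ[R] R where
  toFun v := Matrix.detRowAlternating (Sum.elim v x)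
  map_update_add' {inst} v i a b := by
    obtain rfl : inst = instDecidableEqFin _ := Subsingleton.elim _ _
    simp only [← Sum.update_elim_inl]
    exact Matrix.detRowAlternating.map_update_add _ _ _ _
  map_update_smul' {inst} v i c a := by
    obtain rfl : inst = instDecidableEqFin _ := Subsingleton.elim _ _
    simp only [← Sum.update_elim_inl]
    exact Matrix.detRowAlternating.map_update_smul _ _ _ _
  map_eq_zero_of_eq' v i j h hij :=
    Matrix.detRowAlternating.map_eq_zero_of_eq _ (i := Sum.inl i) (j := Sum.inl j) h (by simpa)

theorem fullDet_apply (x v : Fin (2 * m) → Idx m → R) :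
    fullDet x v = (Matrix.of (Sum.elim v x)).det := rfl

theorem map_gramDet {R' : Type u} [CommRing R'] (f : R →+* R') (x v : Fin (2 * m) → Idx m → R) :
    f (gramDet x v) = gramDet (fun i => f ∘ x i) fun i => f ∘ v i := by
  rw [gramDet_apply, gramDet_apply, RingHom.map_det]
  congr 1
  ext i j
  exact map_hypForm f _ _

theorem map_fullDet {R' : Type u} [CommRing R'] (f : R →+* R') (x v : Fin (2 * m) → Idx m → R) :
    f (fullDet x v) = fullDet (fun i => f ∘ x i) fun i => f ∘ v i := by
  rw [fullDet_apply, fullDet_apply, RingHom.map_det]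
  congr 1
  ext (i | i) j <;> rfl

/-- A hyperbolic basis, with the orientation of the standard one. -/
structure IsHyperbolic (h : Fin (2 * m + 2 * m) → Idx m → R) : Prop where
  form_eq (i j) : hypForm m R (h i) (h j) = if j = i.rev then 1 else 0
  det_eq : (Matrix.of fun k => h (finSumFinEquiv k)).det =
    (Equiv.Perm.sign (Fin.revPerm : Equiv.Perm (Fin (2 * m))) : ℤ)

namespace IsHyperbolic

variable {h : Fin (2 * m + 2 * m) → Idx m → R} (hh : IsHyperbolic h)
include hh

theorem isUnit_det : IsUnit (Matrix.of fun k => h (finSumFinEquiv k)).det := by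
  rw [hh.det_eq]
  exact ((Units.isUnit _).map (Int.castRingHom R))

theorem eq_sum (x : Idx m → R) : x = ∑ k, hypForm m R x (h k.rev) • h k := by
  let H : Matrix (Idx m) (Idx m) R := Matrix.of fun k => h (finSumFinEquiv k)
  have h1 : Matrix.vecMul (Matrix.vecMul x H⁻¹) H = x := by
    rw [Matrix.vecMul_vecMul, H.nonsing_inv_mul hh.isUnit_det, Matrix.vecMul_one]
  obtain ⟨c, hc⟩ : ∃ c : Fin (2 * m + 2 * m) → R, x = ∑ k, c k • h k := by
    refine ⟨fun k => Matrix.vecMul x H⁻¹ (finSumFinEquiv.symm k), ?_⟩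
    rw [← Equiv.sum_comp finSumFinEquiv]
    simp only [Equiv.symm_apply_apply]
    conv_lhs => rw [← h1]
    ext j
    rw [Finset.sum_apply]
    rfl
  have hcl : ∀ l, hypForm m R x (h l.rev) = c l := by
    intro l
    rw [hc, map_sum, LinearMap.sum_apply, Finset.sum_eq_single l]
    · simp [hh.form_eq]
    · intro k _ hk
      simp [hh.form_eq, hk.symm]
    · simp
  simp only [hcl]
  exact hc

/-- This is the compatibility of the star operation `f_S ↦ sgn(σ_S) f_{S^⊥}` with the form. The sign
of `Fin.revPerm` demanded in `IsHyperbolic.det_eq` cancels the one produced by reversing the columns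
of `C`. -/
theorem gramDet_perm (σ : Equiv.Perm (Fin (2 * m + 2 * m))) (x : Fin (2 * m) → Idx m → R) :
    gramDet x (fun i => h (σ (Fin.castAdd _ i))) = (Equiv.Perm.sign σ : ℤ) *
      fullDet x fun i => h (Fin.rev (σ (Fin.rev (Fin.castAdd _ i)))) := by
  let ρ : Equiv.Perm (Fin (2 * m + 2 * m)) := Fin.revPerm
  let τ : Equiv.Perm (Fin (2 * m + 2 * m)) := (ρ.trans σ).trans ρ
  have hτ : ∀ k, τ k = (σ k.rev).rev := fun k => rfl
  let H₀ : Matrix (Idx m) (Idx m) R := Matrix.of fun k => h (finSumFinEquiv k)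
  let H : Matrix (Idx m) (Idx m) R := Matrix.of fun k => h (τ (finSumFinEquiv k))
  have hsq : ∀ z : ℤˣ, ((z : ℤ) : R) * ((z : ℤ) : R) = 1 := fun z => by
    rw [← Int.cast_mul, ← Units.val_mul, Int.units_mul_self]; simp
  have hH : H.det = (Equiv.Perm.sign σ : ℤ) *
      ((Equiv.Perm.sign (Fin.revPerm : Equiv.Perm (Fin (2 * m))) : ℤ) : R) := by
    have h1 : H = H₀.submatrix (finSumFinEquiv.symm.permCongr τ) id := by
      ext i j
      simp [H, H₀]
    rw [h1, Matrix.det_permute, hh.det_eq, Equiv.Perm.sign_permCongr]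
    congr 3
    simp only [τ, ← Equiv.Perm.mul_def, Equiv.Perm.sign_mul]
    rw [mul_comm (Equiv.Perm.sign σ), ← mul_assoc, Int.units_mul_self, one_mul]
  let C : Matrix (Fin (2 * m)) (Fin (2 * m)) R :=
    Matrix.of fun j i => hypForm m R (x j) (h (σ (Fin.castAdd _ i.rev)))
  have hC : C.det = (Equiv.Perm.sign (Fin.revPerm : Equiv.Perm (Fin (2 * m))) : ℤ) *
      gramDet x (fun i => h (σ (Fin.castAdd _ i))) := by
    have h1 : C = (((Matrix.of fun i j => hypForm m R (h (σ (Fin.castAdd _ i))) (x j)) :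
        Matrix (Fin (2 * m)) (Fin (2 * m)) R).submatrix Fin.revPerm id).transpose := by
      ext i j
      simp [C, hypForm_comm (x i)]
    rw [h1, Matrix.det_transpose, Matrix.det_permute, gramDet_apply]
  -- The vectors `x i` are expanded in the basis `h ∘ τ`. Since `(τ k).rev = σ k.rev`, the
  -- coefficients along its second half are pairings with the first half of `h ∘ σ`, so the matrix
  -- is block triangular relative to `H`, with diagonal blocks `1` and `C`.
  have hN : (Matrix.of (Sum.elim (fun i => h (Fin.rev (σ (Fin.rev (Fin.castAdd _ i))))) x) :
      Matrix (Idx m) (Idx m) R) = Matrix.fromBlocks 1 0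
        (Matrix.of fun j i => hypForm m R (x j) (h (τ (Fin.castAdd _ i)).rev)) C * H := by
    ext (i | i) j
    · simp only [Matrix.of_apply, Sum.elim_inl, Matrix.mul_apply, Fintype.sum_sum_type,
        Matrix.fromBlocks_apply₁₁, Matrix.fromBlocks_apply₁₂, Matrix.zero_apply, zero_mul,
        Finset.sum_const_zero, add_zero, Matrix.one_apply, ite_mul, one_mul, Finset.sum_ite_eq,
        Finset.mem_univ, if_true, H, finSumFinEquiv_apply_left, hτ]
    · simp only [Matrix.of_apply, Sum.elim_inr, Matrix.mul_apply, Fintype.sum_sum_type,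
        Matrix.fromBlocks_apply₂₁, Matrix.fromBlocks_apply₂₂, H, finSumFinEquiv_apply_left,
        finSumFinEquiv_apply_right, C]
      conv_lhs => rw [hh.eq_sum (x i), ← Equiv.sum_comp τ, ← Equiv.sum_comp finSumFinEquiv]
      simp only [Fintype.sum_sum_type, finSumFinEquiv_apply_left,
        finSumFinEquiv_apply_right, Finset.sum_apply, Pi.smul_apply, smul_eq_mul]
      congr 1
      refine Finset.sum_congr rfl fun k _ => ?_
      congr 3
      rw [hτ, Fin.rev_rev]
      congr 1
      ext
      simp [Fin.val_rev]
      omega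
  rw [fullDet_apply, hN, Matrix.det_mul, Matrix.det_fromBlocks_zero₁₂, Matrix.det_one, one_mul, hC,
    hH]
  linear_combination (-gramDet x (fun i => h (σ (Fin.castAdd _ i)))) * hsq (Equiv.Perm.sign σ) *
    (((Equiv.Perm.sign (Fin.revPerm : Equiv.Perm (Fin (2 * m))) : ℤ) : R)) ^ 2 -
    (gramDet x (fun i => h (σ (Fin.castAdd _ i)))) *
    hsq (Equiv.Perm.sign (Fin.revPerm : Equiv.Perm (Fin (2 * m))))

/-- Conjugation of `σ` by `rev` is an involution that preserves signs, so `gramDet_perm` can be read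
backwards. -/
theorem fullDet_perm (σ : Equiv.Perm (Fin (2 * m + 2 * m))) (x : Fin (2 * m) → Idx m → R) :
    fullDet x (fun i => h (σ (Fin.castAdd _ i))) = (Equiv.Perm.sign σ : ℤ) *
      gramDet x fun i => h (Fin.rev (σ (Fin.rev (Fin.castAdd _ i)))) := by
  have hsq : ∀ z : ℤˣ, ((z : ℤ) : R) * ((z : ℤ) : R) = 1 := fun z => by
    rw [← Int.cast_mul, ← Units.val_mul, Int.units_mul_self]; simp
  let ρ : Equiv.Perm (Fin (2 * m + 2 * m)) := Fin.revPerm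
  have h1 := hh.gramDet_perm ((ρ.trans σ).trans ρ) x
  have h2 : Equiv.Perm.sign ((ρ.trans σ).trans ρ) = Equiv.Perm.sign σ := by
    simp only [← Equiv.Perm.mul_def, Equiv.Perm.sign_mul]
    rw [mul_comm (Equiv.Perm.sign σ), ← mul_assoc, Int.units_mul_self, one_mul]
  rw [h2] at h1
  simp only [ρ, Equiv.trans_apply, Fin.revPerm_apply, Fin.rev_rev] at h1
  rw [h1, ← mul_assoc, hsq, one_mul]

end IsHyperbolic

variable {M : Type u} [AddCommGroup M] [Module R M] (e : M ≃ₗ[R] (Idx m → R))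

/-- `gramDet` as a linear form on the exterior power. -/
def wedgeGram (x : Fin (2 * m) → Idx m → R) : ⋀[R]^(2 * m) M →ₗ[R] R :=
  exteriorPower.alternatingMapLinearEquiv ((gramDet x).compLinearMap e.toLinearMap)

/-- `fullDet` as a linear form on the exterior power. -/
def wedgeFull (x : Fin (2 * m) → Idx m → R) : ⋀[R]^(2 * m) M →ₗ[R] R :=
  exteriorPower.alternatingMapLinearEquiv ((fullDet x).compLinearMap e.toLinearMap)

theorem wedgeGram_ιMulti (x : Fin (2 * m) → Idx m → R) (v : Fin (2 * m) → M) :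
    wedgeGram e x (exteriorPower.ιMulti R _ v) = gramDet x fun i => e (v i) :=
  exteriorPower.alternatingMapLinearEquiv_apply_ιMulti _ _

theorem wedgeFull_ιMulti (x : Fin (2 * m) → Idx m → R) (v : Fin (2 * m) → M) :
    wedgeFull e x (exteriorPower.ιMulti R _ v) = fullDet x fun i => e (v i) :=
  exteriorPower.alternatingMapLinearEquiv_apply_ιMulti _ _

/-- The sum of the wedge products attached to a permutation and to its dual. -/
def spinGen (ε : ℤˣ) (f : Fin (2 * m + 2 * m) → M) (σ : Equiv.Perm (Fin (2 * m + 2 * m))) :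
    ⋀[R]^(2 * m) M :=
  exteriorPower.ιMulti R (2 * m) (fun i : Fin (2 * m) => f (σ (Fin.castAdd (2 * m) i))) +
    (ε * Equiv.Perm.sign σ) • exteriorPower.ιMulti R (2 * m)
      (fun i : Fin (2 * m) => f (Fin.rev (σ (Fin.rev (Fin.castAdd (2 * m) i)))))

/-- The star operation exchanges the two kinds of linear forms by `gramDet_perm` and `fullDet_perm`.
A generator is a vector plus `ε` times its star, so the two forms agree on it up to `ε`. -/
theorem wedgeGram_spinGen (ε : ℤˣ) {f : Fin (2 * m + 2 * m) → M}
    (hf : IsHyperbolic fun i => e (f i)) (σ : Equiv.Perm (Fin (2 * m + 2 * m)))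
    (x : Fin (2 * m) → Idx m → R) :
    wedgeGram e x (spinGen ε f σ) = ((ε : ℤ) : R) * wedgeFull e x (spinGen ε f σ) := by
  have hsq : ∀ z : ℤˣ, ((z : ℤ) : R) * ((z : ℤ) : R) = 1 := fun z => by
    rw [← Int.cast_mul, ← Units.val_mul, Int.units_mul_self]; simp
  have h1 := hf.gramDet_perm σ x
  have h2 := hf.fullDet_perm σ x
  simp only [spinGen, map_add, Units.smul_def, map_zsmul, wedgeGram_ιMulti, wedgeFull_ιMulti,
    zsmul_eq_mul, h1, h2]
  push_cast
  linear_combination (-((Equiv.Perm.sign σ : ℤ) : R) * fullDet x fun i => e (f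
    (Fin.rev (σ (Fin.rev (Fin.castAdd _ i)))))) * hsq ε

/-- The basis attached to a hyperbolic family. -/
def hypBasis {h : Fin (2 * m + 2 * m) → M} (hh : IsHyperbolic fun i => e (h i)) :
    Module.Basis (Fin (2 * m + 2 * m)) R M :=
  Module.Basis.ofEquivFun
    { toFun := fun x k => hypForm m R (e x) (e (h k.rev))
      map_add' := fun x y => by ext; simp
      map_smul' := fun c x => by ext; simp
      invFun := fun c => ∑ k, c k • h k
      left_inv := fun x => e.injective (by
        rw [map_sum]
        simp only [map_smul]
        exact (hh.eq_sum _).symm)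
      right_inv := fun c => by
        ext l
        change hypForm m R (e (∑ k, c k • h k)) (e (h l.rev)) = c l
        rw [map_sum, map_sum, LinearMap.sum_apply, Finset.sum_eq_single l]
        · simp [hh.form_eq]
        · intro k _ hk
          simp [hh.form_eq, hk.symm]
        · simp }

theorem hypBasis_apply {h : Fin (2 * m + 2 * m) → M} (hh : IsHyperbolic fun i => e (h i))
    (k : Fin (2 * m + 2 * m)) : hypBasis e hh k = h k := by
  rw [hypBasis, Module.Basis.coe_ofEquivFun]
  change ∑ j, (Pi.single k 1 : _ → R) j • h j = h k
  simp [Pi.single_apply]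

theorem ιMultiDual_hypBasis {h : Fin (2 * m + 2 * m) → M} (hh : IsHyperbolic fun i => e (h i))
    (S : Set.powersetCard (Fin (2 * m + 2 * m)) (2 * m)) :
    exteriorPower.ιMultiDual R (2 * m) (hypBasis e hh) S =
      wedgeGram e fun j => e (h (Set.powersetCard.ofFinEmbEquiv.symm S j).rev) := by
  ext v
  simp only [LinearMap.compAlternatingMap_apply]
  rw [exteriorPower.ιMultiDual_apply_ιMulti, wedgeGram_ιMulti, gramDet_apply]
  rfl

/-- The forms `wedgeGram` separate elements of the exterior power. -/
theorem eq_zero_of_wedgeGram {h : Fin (2 * m + 2 * m) → M} (hh : IsHyperbolic fun i => e (h i))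
    {u : ⋀[R]^(2 * m) M} (hu : ∀ x, wedgeGram e x u = 0) : u = 0 := by
  refine ((hypBasis e hh).exteriorPower (2 * m)).ext_elem fun S => ?_
  rw [exteriorPower.basis_repr_apply, ιMultiDual_hypBasis, hu]
  simp

/-- A permutation sending an initial segment increasingly to a given set. -/
def permOfSet (S : Set.powersetCard (Fin (2 * m + 2 * m)) (2 * m)) :
    Equiv.Perm (Fin (2 * m + 2 * m)) :=
  finSumFinEquiv.symm.trans (finSumEquivOfFinset (s := S.1) S.2 (by
    rw [Finset.card_compl, Fintype.card_fin, show S.1.card = 2 * m from S.2]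
    omega))

theorem permOfSet_castAdd (S : Set.powersetCard (Fin (2 * m + 2 * m)) (2 * m)) (i : Fin (2 * m)) :
    permOfSet S (Fin.castAdd _ i) = Set.powersetCard.ofFinEmbEquiv.symm S i := by
  simp [permOfSet]
  rfl

/-- A solution of the equations satisfies `u = ε star u`, because the forms `wedgeGram` separate
vectors. Therefore `2 u = u + ε star u`, and the right-hand side is a combination of generators. -/
theorem two_smul_mem_span (ε : ℤˣ) {h : Fin (2 * m + 2 * m) → M}
    (hh : IsHyperbolic fun i => e (h i)) {u : ⋀[R]^(2 * m) M}
    (hu : ∀ x, wedgeGram e x u = ((ε : ℤ) : R) * wedgeFull e x u) :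
    (2 : R) • u ∈ Submodule.span R (Set.range (spinGen ε h)) := by
  have hsq : ∀ z : ℤˣ, ((z : ℤ) : R) * ((z : ℤ) : R) = 1 := fun z => by
    rw [← Int.cast_mul, ← Units.val_mul, Int.units_mul_self]; simp
  let b := (hypBasis e hh).exteriorPower (2 * m)
  have hb : ∀ S, b S = exteriorPower.ιMulti R (2 * m)
      fun i => h (permOfSet S (Fin.castAdd _ i)) := fun S => by
    rw [exteriorPower.basis_apply, exteriorPower.ιMulti_family]
    congr 1
    ext i
    rw [permOfSet_castAdd, ← hypBasis_apply e hh]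
    rfl
  -- The star operator, prescribed on basis vectors; composing `wedgeGram` with it gives
  -- `wedgeFull`.
  let star : ⋀[R]^(2 * m) M →ₗ[R] ⋀[R]^(2 * m) M := b.constr R fun S =>
    ((Equiv.Perm.sign (permOfSet S) : ℤ) : R) • exteriorPower.ιMulti R (2 * m)
      (fun i : Fin (2 * m) => h (Fin.rev (permOfSet S (Fin.rev (Fin.castAdd (2 * m) i)))))
  have hstar : ∀ S, star (b S) = ((Equiv.Perm.sign (permOfSet S) : ℤ) : R) •
      exteriorPower.ιMulti R (2 * m)
      (fun i : Fin (2 * m) => h (Fin.rev (permOfSet S (Fin.rev (Fin.castAdd (2 * m) i))))) :=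
    fun S => b.constr_basis R _ S
  have hgs : ∀ x u, wedgeGram e x (star u) = wedgeFull e x u := by
    intro x u
    suffices H : wedgeGram e x ∘ₗ star = wedgeFull e x from congr($H u)
    refine b.ext fun S => ?_
    rw [LinearMap.comp_apply, hstar, map_smul, hb, wedgeGram_ιMulti, wedgeFull_ιMulti,
      hh.fullDet_perm, smul_eq_mul]
  have hu' : u = ((ε : ℤ) : R) • star u := by
    rw [← sub_eq_zero]
    refine eq_zero_of_wedgeGram e hh fun x => ?_
    rw [map_sub, map_smul, hgs, hu, smul_eq_mul, sub_self]
  let Θ : ⋀[R]^(2 * m) M →ₗ[R] ⋀[R]^(2 * m) M := LinearMap.id + ((ε : ℤ) : R) • star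
  have h2 : (2 : R) • u = ∑ S, b.repr u S • spinGen ε h (permOfSet S) := by
    have h3 : ∀ S, spinGen ε h (permOfSet S) = Θ (b S) := by
      intro S
      dsimp only [Θ]
      rw [LinearMap.add_apply, LinearMap.smul_apply, hstar, LinearMap.id_apply, hb, spinGen,
        Units.smul_def, smul_smul, ← Int.cast_mul, Int.cast_smul_eq_zsmul, Units.val_mul]
    simp only [h3, ← map_smul, ← map_sum, b.sum_repr]
    dsimp only [Θ]
    rw [LinearMap.add_apply, LinearMap.smul_apply, LinearMap.id_apply, ← hu', two_smul]
  rw [h2]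
  exact sum_mem fun S _ => Submodule.smul_mem _ _ (Submodule.subset_span ⟨_, rfl⟩)

end SpinAlgebra

section Hyp

variable {m : ℕ} {R : Type u} [CommRing R]

/-- A triangular hyperbolic family. -/
def triFamily (c a d : Fin (2 * m) → R) : Fin (2 * m + 2 * m) → Idx m → R :=
  Fin.append (fun i => c i • Pi.single (.inl i) 1)
    (fun i => a i • Pi.single (.inl i) 1 + d i • Pi.single (.inr i.rev) 1)

theorem triFamily_castAdd (c a d : Fin (2 * m) → R) (i : Fin (2 * m)) :
    triFamily c a d (Fin.castAdd _ i) = c i • Pi.single (.inl i) 1 :=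
  Fin.append_left _ _ i

theorem triFamily_natAdd (c a d : Fin (2 * m) → R) (i : Fin (2 * m)) :
    triFamily c a d (Fin.natAdd _ i) =
      a i • Pi.single (.inl i) 1 + d i • Pi.single (.inr i.rev) 1 :=
  Fin.append_right _ _ i

theorem isHyperbolic_triFamily {c a d : Fin (2 * m) → R} (h1 : ∀ i, c i.rev * d i = 1)
    (h2 : ∀ i, a i * d i.rev + d i * a i.rev = 0) : IsHyperbolic (triFamily c a d) where
  form_eq i j := by
    have hrn : ∀ i : Fin (2 * m), (Fin.natAdd (2 * m) i).rev = Fin.castAdd (2 * m) i.rev := by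
      intro i; ext; simp [Fin.val_rev]; omega
    have hrc : ∀ i : Fin (2 * m), (Fin.castAdd (2 * m) i).rev = Fin.natAdd (2 * m) i.rev := by
      intro i; ext; simp [Fin.val_rev]; omega
    have hne : ∀ i j : Fin (2 * m), Fin.castAdd (2 * m) i ≠ Fin.natAdd (2 * m) j := by
      intro i j h
      have := congrArg Fin.val h
      simp at this
      omega
    have hrj : ∀ i j : Fin (2 * m), i.rev = j ↔ i = j.rev := fun i j =>
      ⟨fun h => by rw [← h, Fin.rev_rev], fun h => by rw [h, Fin.rev_rev]⟩
    induction i using Fin.addCases with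
    | left i =>
      induction j using Fin.addCases with
      | left j =>
        rw [hrc, if_neg (hne _ _), triFamily_castAdd, triFamily_castAdd]
        simp [hypForm_apply]
      | right j =>
        simp only [triFamily_castAdd, triFamily_natAdd, hypForm_apply, hrc]
        rw [Finset.sum_eq_single i]
        · by_cases hij : j = i.rev
          · subst hij
            have := h1 i.rev
            rw [Fin.rev_rev] at this
            simp [this]
          · have : i ≠ j.rev := fun h => hij (by rw [h, Fin.rev_rev])
            simp [hij, this]
        · intro k _ hk
          simp [hk]
        · simp
    | right i =>
      induction j using Fin.addCases with
      | left j =>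
        simp only [triFamily_castAdd, triFamily_natAdd, hypForm_apply, hrn]
        rw [Finset.sum_eq_single j]
        · by_cases hij : j = i.rev
          · subst hij
            simpa [mul_comm] using h1 i
          · simp [hij]
        · intro k _ hk
          simp [hk]
        · simp
      | right j =>
        simp only [triFamily_natAdd, hypForm_apply, hrn, (hne _ _).symm, if_false]
        rw [Finset.sum_add_distrib, Finset.sum_eq_single i, Finset.sum_eq_single j]
        · by_cases hij : j = i.rev
          · subst hij
            simpa using h2 i
          · have : i ≠ j.rev := fun h => hij (by rw [h, Fin.rev_rev])
            simp [hij, this]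
        · intro k _ hk
          simp [hk]
        · simp
        · intro k _ hk
          simp [hk]
        · simp
  det_eq := by
    let D' : Matrix (Fin (2 * m)) (Fin (2 * m)) R :=
      (Matrix.diagonal fun i => d i.rev).submatrix Fin.revPerm id
    have h : (Matrix.of fun k => triFamily c a d (finSumFinEquiv k)) =
        Matrix.fromBlocks (Matrix.diagonal c) 0 (Matrix.diagonal a) D' := by
      ext (i | i) (j | j)
      · rw [Matrix.of_apply, finSumFinEquiv_apply_left, triFamily_castAdd]
        simp [Matrix.diagonal_apply, Pi.single_apply, eq_comm]
      · rw [Matrix.of_apply, finSumFinEquiv_apply_left, triFamily_castAdd]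
        simp
      · rw [Matrix.of_apply, finSumFinEquiv_apply_right, triFamily_natAdd]
        simp [Matrix.diagonal_apply, Pi.single_apply, eq_comm]
      · simp only [triFamily_natAdd, D', Matrix.of_apply, finSumFinEquiv_apply_right,
          Matrix.fromBlocks_apply₂₂, Matrix.submatrix_apply, Matrix.diagonal_apply,
          Fin.revPerm_apply, id]
        by_cases hij : i.rev = j
        · subst hij; simp
        · have : j ≠ i.rev := fun h => hij h.symm
          simp [hij, this]
    rw [h, Matrix.det_fromBlocks_zero₁₂, Matrix.det_permute, Matrix.det_diagonal,
      Matrix.det_diagonal, mul_left_comm, ← Finset.prod_mul_distrib, Finset.prod_eq_one, mul_one]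
    intro i _
    have := h1 i.rev
    rwa [Fin.rev_rev] at this

variable (m R) in
/-- The standard hyperbolic family. -/
def stdHyp : Fin (2 * m + 2 * m) → Idx m → R := triFamily (fun _ => 1) (fun _ => 0) fun _ => 1

theorem isHyperbolic_stdHyp : IsHyperbolic (stdHyp m R) :=
  isHyperbolic_triFamily (by simp) (by simp)

theorem map_stdHyp {R' : Type u} [CommRing R'] (f : R →+* R') (i : Fin (2 * m + 2 * m)) :
    f ∘ stdHyp m R i = stdHyp m R' i := by
  ext w
  induction i using Fin.addCases with
  | left i =>
    simp only [stdHyp, triFamily_castAdd, Function.comp_apply]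
    simp [Pi.single_apply, apply_ite f]
  | right i =>
    simp only [stdHyp, triFamily_natAdd, Function.comp_apply]
    simp [Pi.single_apply, apply_ite f]

/-- The right-hand side does not mention `h`. When 2 is invertible, all hyperbolic bases with the
standard orientation therefore span the same submodule, which permits replacing the split basis over
`F` by a basis defined over `O`. -/
theorem mem_span_spinGen_iff (h2 : IsUnit (2 : R)) {M : Type u} [AddCommGroup M] [Module R M]
    (e : M ≃ₗ[R] (Idx m → R)) (ε : ℤˣ) {h : Fin (2 * m + 2 * m) → M}
    (hh : IsHyperbolic fun i => e (h i)) (u : ⋀[R]^(2 * m) M) :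
    u ∈ Submodule.span R (Set.range (spinGen ε h)) ↔
      ∀ x, wedgeGram e x u = ((ε : ℤ) : R) * wedgeFull e x u := by
  constructor
  · intro hu x
    induction hu using Submodule.span_induction with
    | mem z hz =>
      obtain ⟨σ, rfl⟩ := hz
      exact wedgeGram_spinGen e ε hh σ x
    | zero => simp
    | add y z _ _ hy hz => rw [map_add, map_add, hy, hz, mul_add]
    | smul c z _ hz => rw [map_smul, map_smul, hz, smul_eq_mul, smul_eq_mul, mul_left_comm]
  · intro hu
    exact (Submodule.smul_mem_iff_of_isUnit _ h2).1 (two_smul_mem_span e ε hh hu)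

end Hyp

section SpinL

variable {O₀ F₀ O F : Type u}
  [CommRing O₀] [IsDomain O₀] [IsDiscreteValuationRing O₀]
  [Field F₀] [Algebra O₀ F₀] [IsFractionRing O₀ F₀]
  [Field F] [Algebra F₀ F] [Algebra O₀ F] [IsScalarTower O₀ F₀ F]
  [CommRing O] [IsDomain O] [IsDiscreteValuationRing O]
  [Algebra O₀ O] [Algebra O F] [IsScalarTower O₀ O F] [IsIntegralClosure O O₀ F]
  (D : RamifiedQuadratic O₀ F₀ O F) (m : ℕ)

/-- The coordinates on `Λ_m ⊗ O`. -/
def coordO : LamO D m ≃ₗ[O] (Idx m → O) :=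
  (TensorProduct.lid O (LamO D m)).symm ≪≫ₗ coord D m O

theorem coord_one_tmul (R : Type u) [CommRing R] [Algebra O R] (v : LamO D m) :
    coord D m R ((1 : R) ⊗ₜ[O] v) = algebraMap O R ∘ coordO D m v := by
  have := coord_rTensor D m (Algebra.ofId O R) ((1 : O) ⊗ₜ[O] v)
  rw [LinearMap.rTensor_tmul] at this
  rw [show (Algebra.ofId O R).toLinearMap (1 : O) = 1 from map_one (algebraMap O R)] at this
  exact this

theorem wedgeGram_wedgeMap (R : Type u) [CommRing R] [Algebra O R]
    (x : Fin (2 * m) → Idx m → O) (u : ⋀[O]^(2 * m) (LamO D m)) :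
    wedgeGram (coord D m R) (fun i => algebraMap O R ∘ x i) (wedgeMap D m R u) =
      algebraMap O R (wedgeGram (coordO D m) x u) := by
  suffices h : (wedgeGram (coord D m R) (fun i => algebraMap O R ∘ x i)).restrictScalars O ∘ₗ
      wedgeMap D m R = Algebra.linearMap O R ∘ₗ wedgeGram (coordO D m) x from congr($h u)
  ext v
  simp only [LinearMap.compAlternatingMap_apply, LinearMap.comp_apply]
  rw [wedgeMap_ιMulti]
  change wedgeGram _ _ _ = algebraMap O R _
  rw [wedgeGram_ιMulti, wedgeGram_ιMulti, map_gramDet]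
  simp only [coord_one_tmul]

theorem wedgeFull_wedgeMap (R : Type u) [CommRing R] [Algebra O R]
    (x : Fin (2 * m) → Idx m → O) (u : ⋀[O]^(2 * m) (LamO D m)) :
    wedgeFull (coord D m R) (fun i => algebraMap O R ∘ x i) (wedgeMap D m R u) =
      algebraMap O R (wedgeFull (coordO D m) x u) := by
  suffices h : (wedgeFull (coord D m R) (fun i => algebraMap O R ∘ x i)).restrictScalars O ∘ₗ
      wedgeMap D m R = Algebra.linearMap O R ∘ₗ wedgeFull (coordO D m) x from congr($h u)
  ext v
  simp only [LinearMap.compAlternatingMap_apply, LinearMap.comp_apply]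
  rw [wedgeMap_ιMulti]
  change wedgeFull _ _ _ = algebraMap O R _
  rw [wedgeFull_ιMulti, wedgeFull_ιMulti, map_fullDet]
  simp only [coord_one_tmul]

theorem wedgeMap_spinGen (R : Type u) [CommRing R] [Algebra O R] (ε : ℤˣ)
    (f : Fin (2 * m + 2 * m) → LamO D m) (σ : Equiv.Perm (Fin (2 * m + 2 * m))) :
    wedgeMap D m R (spinGen ε f σ) = spinGen ε (fun i => (1 : R) ⊗ₜ[O] f i) σ := by
  simp only [spinGen, map_add, Units.smul_def, map_zsmul, wedgeMap_ιMulti]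

/-- The standard hyperbolic family of `Λ_m ⊗ O`. -/
def hypO (i : Fin (2 * m + 2 * m)) : LamO D m := (coordO D m).symm (stdHyp m O i)

theorem isHyperbolic_hypO (R : Type u) [CommRing R] [Algebra O R] :
    IsHyperbolic fun i => coord D m R ((1 : R) ⊗ₜ[O] hypO D m i) := by
  simp only [coord_one_tmul, hypO, LinearEquiv.apply_symm_apply, map_stdHyp]
  exact isHyperbolic_stdHyp

/-- The coordinates of the split basis. -/
theorem coord_splitBasis (i : Fin (2 * m + 2 * m)) : coord D m F (splitBasis D m i) =
    triFamily (fun i => if (i : ℕ) < m then 1 else -(algebraMap O F D.unif)⁻¹)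
      (fun i => if (i : ℕ) < m then 2⁻¹ else 2⁻¹ * (algebraMap O F D.unif)⁻¹)
      (fun i => if (i : ℕ) < m then -(algebraMap O F D.unif) else 1) i := by
  have hπ := unif_ne_zero D
  have h2 : (2 : F) ≠ 0 := (isUnit_two D F).ne_zero
  -- In the first half the generator of the lattice is `π⁻¹ e_i`, so `e_i` itself is `t` of that
  -- generator and corresponds to the index `(1, i)`.
  have hE : ∀ i, (1 : F) ⊗ₜ[O] ((1 : O) ⊗ₜ[O₀] latticeE D m i) =
      if (i : ℕ) < m then lamBasisR D m F (1, i) else lamBasisR D m F (0, i) := by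
    intro i
    have : latticeE D m i = if (i : ℕ) < m then lamBasis₀ D m (1, i) else lamBasis₀ D m (0, i) := by
      apply Subtype.ext
      split_ifs with h
      · rw [lamBasis₀_one, latticeT_coe, lamBasis_apply, lamGen, if_pos h, smul_smul,
          mul_inv_cancel₀ hπ, one_smul]
        rfl
      · rw [lamBasis₀_zero, lamBasis_apply, lamGen, if_neg h]
        rfl
    rw [this, lamBasisR_apply, lamBasisR_apply]
    split_ifs <;> rfl
  have hT : ∀ i, (algebraMap O F D.unif)⁻¹ ⊗ₜ[O] ((1 : O) ⊗ₜ[O₀] latticeT D m (latticeE D m i)) =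
      (algebraMap O F D.unif)⁻¹ • tR D m F ((1 : F) ⊗ₜ[O] ((1 : O) ⊗ₜ[O₀] latticeE D m i)) := by
    intro i
    simp [tR, TensorProduct.smul_tmul']
  have hrj : ∀ i j : Fin (2 * m), i.rev = j ↔ i = j.rev := fun i j =>
    ⟨fun h => by rw [← h, Fin.rev_rev], fun h => by rw [h, Fin.rev_rev]⟩
  have hrev : ∀ i : Fin (2 * m), ((i.rev : Fin (2 * m)) : ℕ) < m ↔ ¬ (i : ℕ) < m := fun i => by
    rw [Fin.val_rev]; omega
  induction i using Fin.addCases with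
  | left i =>
    simp only [splitBasis, triFamily_castAdd, Fin.append_left, hT, hE]
    by_cases hi : (i : ℕ) < m
    · simp only [hi, if_true, tR_lamBasisR_one, map_sub, map_smul, coord_lamBasisR]
      ext (j | j)
      · by_cases hj : j = i <;> simp [shearEquiv, Pi.single_apply, hj]
      · by_cases hj : j.rev = i
        · simp [shearEquiv, Pi.single_apply, hj]; field_simp; ring
        · simp [shearEquiv, Pi.single_apply, hj]
    · simp only [hi, if_false, tR_lamBasisR_zero, map_sub, map_smul, coord_lamBasisR]
      ext (j | j)
      · by_cases hj : j = i <;> simp [shearEquiv, Pi.single_apply, hj]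
      · by_cases hj : j.rev = i
        · simp [shearEquiv, Pi.single_apply, hj]; field_simp; ring
        · simp [shearEquiv, Pi.single_apply, hj]
  | right i =>
    simp only [splitBasis, triFamily_natAdd, Fin.append_right, hT, hE]
    by_cases hi : (i : ℕ) < m
    · simp only [hi, if_true, tR_lamBasisR_one, map_add, map_smul, coord_lamBasisR]
      ext (j | j)
      · simp [shearEquiv, Pi.single_apply]
      · by_cases hj : j.rev = i
        · have hj' := (hrj j i).1 hj
          subst hj'
          simp [shearEquiv, Pi.single_apply, hsgn, hrev, hi, -Fin.val_rev, -algebraMap_smul]; field_simp; ring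
        · have hj' : ¬ j = i.rev := fun h => hj ((hrj j i).2 h)
          simp [shearEquiv, Pi.single_apply, hj, hj', -algebraMap_smul]
    · simp only [hi, if_false, tR_lamBasisR_zero, map_add, map_smul, coord_lamBasisR]
      ext (j | j)
      · simp [shearEquiv, Pi.single_apply]
      · by_cases hj : j.rev = i
        · have hj' := (hrj j i).1 hj
          subst hj'
          simp [shearEquiv, Pi.single_apply, hsgn, hrev, hi, -Fin.val_rev, -algebraMap_smul]; field_simp; ring
        · have hj' : ¬ j = i.rev := fun h => hj ((hrj j i).2 h)
          simp [shearEquiv, Pi.single_apply, hj, hj', -algebraMap_smul]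

theorem isHyperbolic_splitBasis : IsHyperbolic fun i => coord D m F (splitBasis D m i) := by
  have hπ := unif_ne_zero D
  have h2 : (2 : F) ≠ 0 := (isUnit_two D F).ne_zero
  have hrev : ∀ i : Fin (2 * m), ((i.rev : Fin (2 * m)) : ℕ) < m ↔ ¬ (i : ℕ) < m := fun i => by
    rw [Fin.val_rev]; omega
  simp only [coord_splitBasis]
  refine isHyperbolic_triFamily (fun i => ?_) (fun i => ?_)
  · by_cases hi : (i : ℕ) < m <;> simp [hrev, hi, hπ, -Fin.val_rev]
  · by_cases hi : (i : ℕ) < m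
    · simp [hrev, hi, -Fin.val_rev]
      field_simp
      ring
    · simp [hrev, hi, hπ, -Fin.val_rev]

theorem mem_W_iff (ε : ℤˣ) (u : ⋀[F]^(2 * m) (LamR D m F)) : u ∈ W D m ε ↔
    ∀ x, wedgeGram (coord D m F) x u = ((ε : ℤ) : F) * wedgeFull (coord D m F) x u :=
  mem_span_spinGen_iff (isUnit_two D F) (coord D m F) ε (isHyperbolic_splitBasis D m) u

/-- Both `W_ε` over `F` and the span over `O` are cut out by the same linear equations, which have
coefficients in `O`. Since `O` injects into `F` and 2 is a unit of `O`, intersecting with the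
lattice yields the integral span. -/
theorem wlam_eq_span (ε : ℤˣ) :
    WLam D m ε = Submodule.span O (Set.range (spinGen ε (hypO D m))) := by
  have hinj := algebraMap_injective_O O₀ F₀ O F
  have hO : IsHyperbolic fun i => coordO D m (hypO D m i) := by
    simp only [hypO, LinearEquiv.apply_symm_apply]
    exact isHyperbolic_stdHyp
  refine le_antisymm (fun u hu => ?_) ?_
  · rw [mem_span_spinGen_iff (isUnit_two D O) (coordO D m) ε hO]
    intro x
    apply hinj
    have := (mem_W_iff D m ε _).1 hu fun i => algebraMap O F ∘ x i
    rw [wedgeGram_wedgeMap, wedgeFull_wedgeMap] at this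
    rw [this]
    simp
  · rw [Submodule.span_le]
    rintro _ ⟨σ, rfl⟩
    change wedgeMap D m F _ ∈ W D m ε
    rw [wedgeMap_spinGen, mem_W_iff]
    exact fun x => wedgeGram_spinGen _ ε (isHyperbolic_hypO D m F) σ x

/-- A consequence of `wlam_eq_span`: the generators of the integral module are explicit, so its
image over `R` is generated by the same expressions. -/
theorem L_eq_span (R : Type u) [CommRing R] [Algebra O R] (ε : ℤˣ) : L D m R ε =
    Submodule.span R (Set.range (spinGen ε fun i => (1 : R) ⊗ₜ[O] hypO D m i)) := by
  refine le_antisymm ?_ ?_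
  · rw [L, Submodule.span_le, wlam_eq_span]
    rintro _ ⟨u, hu, rfl⟩
    suffices Submodule.span O (Set.range (spinGen ε (hypO D m))) ≤
        ((Submodule.span R (Set.range (spinGen ε fun i => (1 : R) ⊗ₜ[O] hypO D m
          i))).restrictScalars O).comap (wedgeMap D m R) from this hu
    rw [Submodule.span_le]
    rintro _ ⟨σ, rfl⟩
    change wedgeMap D m R _ ∈ Submodule.span R _
    rw [wedgeMap_spinGen]
    exact Submodule.subset_span ⟨σ, rfl⟩
  · rw [Submodule.span_le]
    rintro _ ⟨σ, rfl⟩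
    rw [← wedgeMap_spinGen]
    refine Submodule.subset_span ⟨_, ?_, rfl⟩
    rw [SetLike.mem_coe, wlam_eq_span]
    exact Submodule.subset_span ⟨σ, rfl⟩

theorem mem_L_iff (R : Type u) [CommRing R] [Algebra O R] (ε : ℤˣ)
    (u : ⋀[R]^(2 * m) (LamR D m R)) : u ∈ L D m R ε ↔
      ∀ x, wedgeGram (coord D m R) x u = ((ε : ℤ) : R) * wedgeFull (coord D m R) x u := by
  rw [L_eq_span]
  exact mem_span_spinGen_iff (isUnit_two D R) (coord D m R) ε (isHyperbolic_hypO D m R) u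

theorem ιMulti_mem_L_iff (R : Type u) [CommRing R] [Algebra O R] (ε : ℤˣ)
    (v : Fin (2 * m) → LamR D m R) : exteriorPower.ιMulti R (2 * m) v ∈ L D m R ε ↔
      ∀ x, gramDet x (fun i => coord D m R (v i)) =
        ((ε : ℤ) : R) * fullDet x fun i => coord D m R (v i) := by
  rw [mem_L_iff]
  simp only [wedgeGram_ιMulti, wedgeFull_ιMulti]

end SpinL

/-! ### Isotropic frames with dual frames, and their sign. -/

section DualFrame

variable {m : ℕ} {R : Type u} [CommRing R]

/-- An isotropic family together with a dual family. -/
structure IsDualFrame (v x : Fin (2 * m) → Idx m → R) : Prop where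
  iso (i j) : hypForm m R (v i) (v j) = 0
  dual (i j) : hypForm m R (v i) (x j) = if i = j then 1 else 0

variable (m R) in
/-- The matrix of the hyperbolic form. -/
def hypMatrix : Matrix (Idx m) (Idx m) R := Matrix.fromBlocks 0 1 1 0

theorem hypMatrix_mul_self : hypMatrix m R * hypMatrix m R = 1 := by
  simp [hypMatrix, Matrix.fromBlocks_multiply]

theorem mul_hypMatrix_mul_transpose (N : Matrix (Idx m) (Idx m) R) (k l : Idx m) :
    (N * hypMatrix m R * N.transpose) k l = hypForm m R (N k) (N l) := by
  rw [Matrix.mul_apply, Fintype.sum_sum_type, hypForm_apply, ← Finset.sum_add_distrib,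
    ← Equiv.sum_comp (Equiv.refl _)]
  refine Finset.sum_congr rfl fun i _ => ?_
  simp [Matrix.mul_apply, hypMatrix, Matrix.one_apply]
  ring

namespace IsDualFrame

variable {v x : Fin (2 * m) → Idx m → R} (h : IsDualFrame v x)
include h

/-- With `J` the matrix of the form and `N` the matrix with rows `v`, `x`, duality says that `N J
Nᵀ` is `J` times a unipotent matrix; now compare determinants. -/
theorem fullDet_mul_self : fullDet x v * fullDet x v = 1 := by
  let N : Matrix (Idx m) (Idx m) R := Matrix.of (Sum.elim v x)
  let X : Matrix (Fin (2 * m)) (Fin (2 * m)) R := Matrix.of fun i j => hypForm m R (x i) (x j)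
  have h1 : N * hypMatrix m R * N.transpose = hypMatrix m R * Matrix.fromBlocks 1 X 0 1 := by
    ext k l
    rw [mul_hypMatrix_mul_transpose]
    rcases k with i | i <;> rcases l with j | j
    · change hypForm m R (v i) (v j) = _
      simpa [hypMatrix, Matrix.fromBlocks_multiply] using h.iso i j
    · change hypForm m R (v i) (x j) = _
      simpa [hypMatrix, Matrix.fromBlocks_multiply, Matrix.one_apply] using h.dual i j
    · change hypForm m R (x i) (v j) = _
      have := h.dual j i
      rw [hypForm_comm] at this
      simpa [hypMatrix, Matrix.fromBlocks_multiply, Matrix.one_apply, eq_comm] using this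
    · change hypForm m R (x i) (x j) = _
      simp [hypMatrix, Matrix.fromBlocks_multiply, X]
  have h2 := congrArg Matrix.det h1
  have h3 := congrArg Matrix.det (hypMatrix_mul_self (m := m) (R := R))
  rw [Matrix.det_mul, Matrix.det_one] at h3
  rw [Matrix.det_mul, Matrix.det_mul, Matrix.det_mul, Matrix.det_transpose,
    Matrix.det_fromBlocks_zero₂₁, Matrix.det_one] at h2
  rw [fullDet_apply]
  linear_combination (hypMatrix m R).det * h2 - (N.det * N.det - 1) * h3

/-- A vector is determined up to the span of the frame by its pairings with the frame. -/
theorem sub_mem_span (w : Idx m → R) :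
    w - ∑ i, hypForm m R (v i) w • x i ∈ Submodule.span R (Set.range v) := by
  let N : Matrix (Idx m) (Idx m) R := Matrix.of (Sum.elim v x)
  have hN : IsUnit N.det := IsUnit.of_mul_eq_one _ h.fullDet_mul_self
  have h1 : Matrix.vecMul (Matrix.vecMul w N⁻¹) N = w := by
    rw [Matrix.vecMul_vecMul, N.nonsing_inv_mul hN, Matrix.vecMul_one]
  have h2 : w = ∑ i, Matrix.vecMul w N⁻¹ (.inl i) • v i +
      ∑ i, Matrix.vecMul w N⁻¹ (.inr i) • x i := by
    conv_lhs => rw [← h1]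
    ext j
    rw [Pi.add_apply, Finset.sum_apply, Finset.sum_apply]
    exact Fintype.sum_sum_type (fun k => Matrix.vecMul w N⁻¹ k * N k j)
  have h3 : ∀ i, hypForm m R (v i) w = Matrix.vecMul w N⁻¹ (.inr i) := by
    intro i
    conv_lhs => rw [h2]
    simp [h.iso, h.dual]
  simp only [h3]
  rw [sub_eq_of_eq_add h2]
  exact sum_mem fun i _ => Submodule.smul_mem _ _ (Submodule.subset_span ⟨i, rfl⟩)

theorem mem_span_iff {w : Idx m → R} : w ∈ Submodule.span R (Set.range v) ↔
    ∀ i, hypForm m R (v i) w = 0 := by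
  constructor
  · intro hw i
    obtain ⟨c, rfl⟩ := (Submodule.mem_span_range_iff_exists_fun R).1 hw
    simp [h.iso]
  · intro hw
    simpa [hw] using h.sub_mem_span w

/-- Modulo the span of `v`, each `x' j` is the combination of the `x i` whose coefficients are its
pairings with the `v i`. The change of rows is block triangular with determinant `gramDet x' v`. -/
theorem fullDet_eq (x' : Fin (2 * m) → Idx m → R) :
    fullDet x' v = gramDet x' v * fullDet x v := by
  have h1 := fun j => (Submodule.mem_span_range_iff_exists_fun R).1 (h.sub_mem_span (x' j))
  choose c hc using h1
  have h2 : (Matrix.of (Sum.elim v x') : Matrix (Idx m) (Idx m) R) =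
      Matrix.fromBlocks 1 0 (Matrix.of c)
        (Matrix.of fun i j => hypForm m R (v i) (x' j)).transpose *
        Matrix.of (Sum.elim v x) := by
    ext (i | i) j
    · simp [Matrix.mul_apply, Matrix.one_apply]
    · have := congrFun (hc i) j
      simp only [Finset.sum_apply, Pi.smul_apply, smul_eq_mul, Pi.sub_apply] at this
      simp only [Matrix.of_apply, Sum.elim_inr, Matrix.mul_apply, Fintype.sum_sum_type,
        Matrix.fromBlocks_apply₂₁, Matrix.fromBlocks_apply₂₂, Sum.elim_inl,
        Matrix.transpose_apply]
      rw [this]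
      ring
  rw [fullDet_apply, h2, Matrix.det_mul, Matrix.det_fromBlocks_zero₁₂, Matrix.det_one, one_mul,
    Matrix.det_transpose]
  rfl

theorem gramDet_eq_one : gramDet x v = 1 := by
  rw [gramDet_apply]
  have : (Matrix.of fun i j => hypForm m R (v i) (x j)) = 1 := by
    ext i j
    simp [h.dual, Matrix.one_apply]
  rw [this, Matrix.det_one]

/-- The spin condition for the span of an isotropic frame amounts to one equation. -/
theorem spin_iff (ε : ℤˣ) : (∀ w : Fin (2 * m) → Idx m → R,
      (∀ i, w i ∈ Submodule.span R (Set.range v)) →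
        ∀ x', gramDet x' w = ((ε : ℤ) : R) * fullDet x' w) ↔
    fullDet x v = ((ε : ℤ) : R) := by
  have hsq : ((ε : ℤ) : R) * ((ε : ℤ) : R) = 1 := by
    rw [← Int.cast_mul, ← Units.val_mul, Int.units_mul_self]; simp
  constructor
  · intro H
    have := H v (fun i => Submodule.subset_span ⟨i, rfl⟩) x
    rw [h.gramDet_eq_one] at this
    linear_combination (-((ε : ℤ) : R)) * this - fullDet x v * hsq
  · intro H w hw x'
    have hA := fun i => (Submodule.mem_span_range_iff_exists_fun R).1 (hw i)
    choose A hA using hA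
    -- Every alternating form takes on a family of combinations of `v` the value `det A` times its
    -- value on `v`, so the case `w = v` decides.
    have h1 : ∀ f : (Idx m → R) [⋀^Fin (2 * m)]→ₗ[R] R, f w = (Matrix.of A).det * f v := by
      intro f
      have hf := AlternatingMap.congr_fun (AlternatingMap.eq_smul_basis_det
        (Pi.basisFun R (Fin (2 * m))) (f.compLinearMap (Fintype.linearCombination R v))) A
      rw [AlternatingMap.smul_apply, Pi.basisFun_det, AlternatingMap.compLinearMap_apply,
        AlternatingMap.compLinearMap_apply, smul_eq_mul] at hf
      rw [mul_comm (Matrix.of A).det]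
      convert hf using 2
      · exact funext fun i => (hA i).symm
      · congr 1
        funext i
        simp [Fintype.linearCombination_apply]
      · rfl
    rw [h1, h1, h.fullDet_eq, H]
    linear_combination (-(Matrix.of A).det * gramDet x' v) * hsq

end IsDualFrame

/-- The coordinate vectors dual to the coordinates in a family. -/
def dualCoord (a : Fin (2 * m) → Idx m) : Fin (2 * m) → Idx m → R :=
  fun j => Pi.single (a j).swap 1

theorem hypForm_single_swap (v : Idx m → R) (w : Idx m) :
    hypForm m R v (Pi.single w.swap 1) = v w := by
  rcases w with i | i
  · rw [hypForm_apply, Finset.sum_eq_single i]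
    · simp
    · intro j _ hj; simp [hj]
    · simp
  · rw [hypForm_apply, Finset.sum_eq_single i]
    · simp
    · intro j _ hj; simp [hj]
    · simp

theorem Normalized.isDualFrame {a : Fin (2 * m) → Idx m} {v : Fin (2 * m) → Idx m → R}
    (h : Normalized a v) (hv : ∀ i j, hypForm m R (v i) (v j) = 0) :
    IsDualFrame v (dualCoord a) where
  iso := hv
  dual i j := by rw [dualCoord, hypForm_single_swap, h]

theorem map_dualCoord {R' : Type u} [CommRing R'] (f : R →+* R') (a : Fin (2 * m) → Idx m)
    (j : Fin (2 * m)) : f ∘ dualCoord a j = dualCoord a j := by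
  ext w
  simp [dualCoord, Pi.single_apply, apply_ite f]

end DualFrame

/-! ### Equations of the splitting model in normalized frames, and its charts. -/

section Conds

variable {m s : ℕ} {R R' : Type u} [CommRing R] [CommRing R']

variable (m) in
/-- The operator `t + π` in coordinates. -/
def coordPlus (c : R) : (Idx m → R) →ₗ[R] (Idx m → R) := coordT m R c + c • LinearMap.id

variable (m) in
/-- The operator `t - π` in coordinates. -/
def coordMinus (c : R) : (Idx m → R) →ₗ[R] (Idx m → R) := coordT m R c - c • LinearMap.id

theorem map_coordPlus (f : R →+* R') (c : R) (v : Idx m → R) :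
    f ∘ coordPlus m c v = coordPlus m (f c) (f ∘ v) := by
  change f ∘ (coordT m R c v + c • v) = coordT m R' (f c) (f ∘ v) + f c • f ∘ v
  rw [comp_add, comp_smul, map_coordT]

theorem map_coordMinus (f : R →+* R') (c : R) (v : Idx m → R) :
    f ∘ coordMinus m c v = coordMinus m (f c) (f ∘ v) := by
  change f ∘ (coordT m R c v - c • v) = coordT m R' (f c) (f ∘ v) - f c • f ∘ v
  rw [comp_sub, comp_smul, map_coordT]

/-- The conditions on a pair of submodules defining the splitting model, apart from those on
their ranks. -/
structure Conds (s : ℕ) (c : R) (F G : Submodule R (Idx m → R)) : Prop where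
  le : G ≤ F
  iso : ∀ x ∈ F, ∀ y ∈ F, hypForm m R x y = 0
  plus : ∀ x ∈ F, coordPlus m c x ∈ G
  minus : ∀ x ∈ G, coordMinus m c x = 0
  spin : ∀ w : Fin (2 * m) → Idx m → R, (∀ i, w i ∈ F) →
    ∀ x, gramDet x w = (((-1) ^ s : ℤˣ) : ℤ) * fullDet x w

/-- The equations of the splitting model for a pair of normalized frames. -/
structure FrameEqs (s : ℕ) (c : R) (a : Fin (2 * m) → Idx m) (b : Fin s → Idx m)
    (v : Fin (2 * m) → Idx m → R) (g : Fin s → Idx m → R) : Prop where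
  norm_v (i j) : v i (a j) = if i = j then 1 else 0
  norm_g (i j) : g i (b j) = if i = j then 1 else 0
  mem (i k) : g i k = (∑ j, g i (a j) • v j) k
  iso (i j) : hypForm m R (v i) (v j) = 0
  plus (i k) : coordPlus m c (v i) k = (∑ j, coordPlus m c (v i) (b j) • g j) k
  minus (i k) : coordMinus m c (g i) k = 0
  spin : fullDet (dualCoord a) v = (((-1) ^ s : ℤˣ) : ℤ)

/-- The coefficients of a vector in a normalized frame are some of its coordinates
(`Normalized.eq_sum`). Membership in the spans thereby becomes polynomial, and the spin condition is
the single equation of `IsDualFrame.spin_iff`. -/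
theorem frameEqs_iff {c : R} {a : Fin (2 * m) → Idx m} {b : Fin s → Idx m}
    {v : Fin (2 * m) → Idx m → R} {g : Fin s → Idx m → R} : FrameEqs s c a b v g ↔
      Normalized a v ∧ Normalized b g ∧
        Conds s c (Submodule.span R (Set.range v)) (Submodule.span R (Set.range g)) := by
  constructor
  · intro h
    have hv : Normalized a v := h.norm_v
    have hd := hv.isDualFrame h.iso
    refine ⟨hv, h.norm_g, ?_, ?_, ?_, ?_, ?_⟩
    · rw [Submodule.span_le]
      rintro _ ⟨i, rfl⟩
      rw [show g i = ∑ j, g i (a j) • v j from funext (h.mem i)]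
      exact sum_mem fun j _ => Submodule.smul_mem _ _ (Submodule.subset_span ⟨j, rfl⟩)
    · intro x hx y hy
      obtain ⟨p, rfl⟩ := (Submodule.mem_span_range_iff_exists_fun R).1 hx
      rw [map_sum, LinearMap.sum_apply]
      refine Finset.sum_eq_zero fun i _ => ?_
      rw [map_smul, LinearMap.smul_apply, hd.mem_span_iff.1 hy i, smul_zero]
    · intro x hx
      obtain ⟨p, rfl⟩ := (Submodule.mem_span_range_iff_exists_fun R).1 hx
      rw [map_sum]
      refine sum_mem fun i _ => ?_
      rw [map_smul, show coordPlus m c (v i) = _ from funext (h.plus i)]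
      exact Submodule.smul_mem _ _
        (sum_mem fun j _ => Submodule.smul_mem _ _ (Submodule.subset_span ⟨j, rfl⟩))
    · intro x hx
      obtain ⟨p, rfl⟩ := (Submodule.mem_span_range_iff_exists_fun R).1 hx
      rw [map_sum]
      refine Finset.sum_eq_zero fun i _ => ?_
      rw [map_smul, show coordMinus m c (g i) = 0 from funext (h.minus i), smul_zero]
    · exact (hd.spin_iff _).2 h.spin
  · rintro ⟨hv, hg, h⟩
    have hvi := fun i => (Submodule.subset_span ⟨i, rfl⟩ : v i ∈ Submodule.span R (Set.range v))
    have hgi := fun i => (Submodule.subset_span ⟨i, rfl⟩ : g i ∈ Submodule.span R (Set.range g))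
    have hd := hv.isDualFrame fun i j => h.iso _ (hvi i) _ (hvi j)
    exact
      { norm_v := hv
        norm_g := hg
        mem := fun i => congrFun (hv.eq_sum (h.le (hgi i)))
        iso := hd.iso
        plus := fun i => congrFun (hg.eq_sum (h.plus _ (hvi i)))
        minus := fun i => congrFun (h.minus _ (hgi i))
        spin := (hd.spin_iff _).1 h.spin }

theorem FrameEqs.map {c : R} {a : Fin (2 * m) → Idx m} {b : Fin s → Idx m}
    {v : Fin (2 * m) → Idx m → R} {g : Fin s → Idx m → R} (h : FrameEqs s c a b v g)
    (f : R →+* R') : FrameEqs s (f c) a b (fun i => f ∘ v i) fun i => f ∘ g i where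
  norm_v := Normalized.map h.norm_v f
  norm_g := Normalized.map h.norm_g f
  mem i k := by
    have h1 : g i = ∑ j, g i (a j) • v j := funext (h.mem i)
    have h2 : f ∘ g i = f ∘ ∑ j, g i (a j) • v j := congrArg (f ∘ ·) h1
    simp only [comp_sum, comp_smul] at h2
    exact congrFun h2 k
  iso i j := by rw [← map_hypForm, h.iso, map_zero]
  plus i k := by
    have h1 : coordPlus m c (v i) = ∑ j, coordPlus m c (v i) (b j) • g j := funext (h.plus i)
    have h2 : f ∘ coordPlus m c (v i) = f ∘ ∑ j, coordPlus m c (v i) (b j) • g j :=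
      congrArg (f ∘ ·) h1
    simp only [comp_sum, comp_smul] at h2
    rw [← map_coordPlus]
    exact congrFun h2 k
  minus i k := by rw [← map_coordMinus, Function.comp_apply, h.minus, map_zero]
  spin := by
    have := congrArg f h.spin
    rw [map_fullDet] at this
    simpa only [map_dualCoord, map_intCast] using this

/-- A pair of submodules spanned by frames satisfying the equations of the splitting model. -/
def HasFrames (s : ℕ) (c : R) (F G : Submodule R (Idx m → R)) : Prop :=
  ∃ (a : Fin (2 * m) → Idx m) (b : Fin s → Idx m) (v : Fin (2 * m) → Idx m → R)
    (g : Fin s → Idx m → R), FrameEqs s c a b v g ∧ F = Submodule.span R (Set.range v) ∧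
      G = Submodule.span R (Set.range g)

theorem HasFrames.push {c : R} {F G : Submodule R (Idx m → R)} (h : HasFrames s c F G)
    (f : R →+* R') : HasFrames s (f c) (push f F) (push f G) := by
  obtain ⟨a, b, v, g, h, rfl, rfl⟩ := h
  exact ⟨a, b, _, _, h.map f, push_span_range f v, push_span_range f g⟩

theorem HasFrames.conds {c : R} {F G : Submodule R (Idx m → R)} (h : HasFrames s c F G) :
    Conds s c F G := by
  obtain ⟨a, b, v, g, h, rfl, rfl⟩ := h
  exact (frameEqs_iff.1 h).2.2

theorem HasFrames.mem_of_forall {c : R} {F G : Submodule R (Idx m → R)} (h : HasFrames s c F G)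
    {x : Idx m → R} (hx : ∀ y ∈ F, hypForm m R y x = 0) : x ∈ F := by
  obtain ⟨a, b, v, g, h, rfl, rfl⟩ := h
  have hd := Normalized.isDualFrame h.norm_v h.iso
  exact hd.mem_span_iff.2 fun i => hx _ (Submodule.subset_span ⟨i, rfl⟩)

end Conds

section LocPoint

variable {O : Type u} [CommRing O] (c : O) (m s : ℕ)

/-- The points of the splitting model in coordinates. -/
structure LocPoint (R : Type u) [CommRing R] [Algebra O R] where
  /-- The larger submodule. -/
  fil : Submodule R (Idx m → R)
  /-- The smaller submodule. -/
  gil : Submodule R (Idx m → R)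
  frames : ∀ p : PrimeSpectrum R, ∃ r ∉ p.asIdeal,
    HasFrames s (algebraMap O (Localization.Away r) c)
      (push (algebraMap R (Localization.Away r)) fil)
      (push (algebraMap R (Localization.Away r)) gil)

variable {c m s}

theorem LocPoint.ext_iff' {R : Type u} [CommRing R] [Algebra O R] {x y : LocPoint c m s R} :
    x = y ↔ x.fil = y.fil ∧ x.gil = y.gil := by
  cases x; cases y; simp

variable {R : Type u} [CommRing R] [Algebra O R]

/-- A pair of submodules spanned by frames. -/
def LocPoint.ofFrames {F G : Submodule R (Idx m → R)} (h : HasFrames s (algebraMap O R c) F G) :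
    LocPoint c m s R where
  fil := F
  gil := G
  frames p := ⟨1, fun h => p.2.ne_top ((Ideal.eq_top_iff_one _).2 h), by
    have := h.push (algebraMap R (Localization.Away (1 : R)))
    rwa [← IsScalarTower.algebraMap_apply] at this⟩

/-- The base change of a point. -/
def LocPoint.map {R' : Type u} [CommRing R'] [Algebra O R'] (f : R →ₐ[O] R')
    (x : LocPoint c m s R) : LocPoint c m s R' where
  fil := push f.toRingHom x.fil
  gil := push f.toRingHom x.gil
  frames p := by
    obtain ⟨r, hr, h⟩ := x.frames (p.comap f.toRingHom)
    refine ⟨f r, hr, ?_⟩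
    have h1 := h.push (awayMap f r).toRingHom
    have h2 : (awayMap f r).toRingHom.comp (algebraMap R _) =
        (algebraMap R' (Localization.Away (f r))).comp f.toRingHom :=
      RingHom.ext fun z => congr($(awayMap_comp f r) z)
    rw [← push_comp, ← push_comp, h2, push_comp, push_comp] at h1
    rwa [show (awayMap f r).toRingHom (algebraMap O _ c) = algebraMap O _ c from
      (awayMap f r).commutes c] at h1

variable (c m s) in
/-- The functor of points of the splitting model in coordinates. -/
def locFunctor : PointFunctor O where
  obj R _ _ := LocPoint c m s R
  map f x := x.map f
  map_id _ _ _ _ := LocPoint.ext_iff'.2 ⟨push_id _, push_id _⟩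
  map_comp f g _ := LocPoint.ext_iff'.2 ⟨push_comp f.toRingHom g.toRingHom _,
    push_comp f.toRingHom g.toRingHom _⟩

/-- Localizing twice can be dominated by localizing once. -/
theorem exists_away_dominating (O : Type u) [CommRing O] [Algebra O R] (r : R)
    (p : PrimeSpectrum R) (q : PrimeSpectrum (Localization.Away r))
    (hq : q.comap (algebraMap R _) = p) (r' : Localization.Away r) (hr' : r' ∉ q.asIdeal) :
    ∃ t ∉ p.asIdeal, ∃ ψ : Localization.Away r' →ₐ[O] Localization.Away t,
      (ψ.comp (awayHom O r')).comp (awayHom O r) = awayHom O t := by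
  obtain ⟨⟨x, _, k, rfl⟩, hx⟩ := IsLocalization.surj (Submonoid.powers r) r'
  have hu : ∀ t : R, (IsUnit (algebraMap R (Localization.Away t) t)) := fun t =>
    IsLocalization.Away.algebraMap_isUnit t
  have hur := hu r
  have hrq : algebraMap R (Localization.Away r) r ∉ q.asIdeal := fun h =>
    q.2.ne_top (Ideal.eq_top_of_isUnit_mem _ h hur)
  have hxp : x ∉ p.asIdeal := by
    subst hq
    change algebraMap R _ x ∉ q.asIdeal
    rw [← hx, map_pow]
    exact fun h => (q.2.mem_or_mem h).elim hr' fun h => hrq (q.2.mem_of_pow_mem _ h)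
  have hrp : r ∉ p.asIdeal := by
    subst hq; exact hrq
  refine ⟨r * x, fun h => (p.2.mem_or_mem h).elim hrp hxp, ?_⟩
  have h1 := hu (r * x)
  rw [map_mul, IsUnit.mul_iff] at h1
  let φ : Localization.Away r →ₐ[O] Localization.Away (r * x) :=
    IsLocalization.liftAlgHom (M := Submonoid.powers r) (f := awayHom O (r * x)) (by
      rintro ⟨_, n, rfl⟩
      simpa using h1.1.pow n)
  have hφ : ∀ z, φ (algebraMap R _ z) = algebraMap R _ z := fun z => by simp [φ]
  have hφr : IsUnit (φ r') := by
    have := congrArg φ hx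
    rw [map_mul, hφ, hφ] at this
    exact isUnit_of_mul_isUnit_left (this ▸ h1.2)
  refine ⟨IsLocalization.liftAlgHom (M := Submonoid.powers r') (f := φ) (by
      rintro ⟨_, n, rfl⟩
      simpa using hφr.pow n), ?_⟩
  ext z
  simp [hφ]

theorem isZariskiSheaf_locFunctor : (locFunctor c m s).IsZariskiSheaf where
  sep r hr x y h := LocPoint.ext_iff'.2
    ⟨eq_of_push_eq r hr fun p => (LocPoint.ext_iff'.1 (h p)).1,
      eq_of_push_eq r hr fun p => (LocPoint.ext_iff'.1 (h p)).2⟩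
  glue {R} _ _ r hr x h := by
    obtain ⟨F, hF⟩ := exists_glue_submodule (O := O) r hr (fun p => (x p).fil)
      fun p q R' _ _ f g hfg => (LocPoint.ext_iff'.1 (h p q R' f g hfg)).1
    obtain ⟨G, hG⟩ := exists_glue_submodule (O := O) r hr (fun p => (x p).gil)
      fun p q R' _ _ f g hfg => (LocPoint.ext_iff'.1 (h p q R' f g hfg)).2
    refine ⟨⟨F, G, fun p => ?_⟩, fun p => LocPoint.ext_iff'.2 ⟨hF p, hG p⟩⟩
    -- The local point has frames only after a further localization at the prime over `p`; a single
    -- basic open neighbourhood of `p` dominates both localizations.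
    obtain ⟨q, hq⟩ : p ∈ Set.range (PrimeSpectrum.comap
        (algebraMap R (Localization.Away (r p)))) := by
      rw [PrimeSpectrum.localization_away_comap_range (Localization.Away (r p)) (r p)]
      exact hr p
    obtain ⟨r', hr', hfr⟩ := (x p).frames q
    obtain ⟨t, ht, ψ, hψ⟩ := exists_away_dominating O (r p) p q hq r' hr'
    refine ⟨t, ht, ?_⟩
    have h1 := hfr.push ψ.toRingHom
    have h2 : (ψ.toRingHom.comp (algebraMap _ (Localization.Away r'))).comp
        (algebraMap R (Localization.Away (r p))) = algebraMap R (Localization.Away t) :=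
      RingHom.ext fun z => congr($hψ z)
    rw [← hF, ← hG, ← push_comp, ← push_comp, ← push_comp, ← push_comp, h2] at h1
    rwa [show ψ.toRingHom (algebraMap O _ c) = algebraMap O _ c from ψ.commutes c] at h1

end LocPoint

section Charts

variable {m s : ℕ} {R R' : Type u} [CommRing R] [CommRing R']

/-- The indices of the equations of the splitting model. -/
abbrev EqIdx (m s : ℕ) : Type :=
  (Fin (2 * m) × Fin (2 * m)) ⊕ (Fin s × Fin s) ⊕ (Fin s × Idx m) ⊕ (Fin (2 * m) × Fin (2 * m)) ⊕
    (Fin (2 * m) × Idx m) ⊕ (Fin s × Idx m) ⊕ Unit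

/-- The equations of the splitting model. -/
def frameDefect (c : R) (a : Fin (2 * m) → Idx m) (b : Fin s → Idx m)
    (v : Fin (2 * m) → Idx m → R) (g : Fin s → Idx m → R) : EqIdx m s → R :=
  Sum.elim (fun p => v p.1 (a p.2) - if p.1 = p.2 then 1 else 0) <|
  Sum.elim (fun p => g p.1 (b p.2) - if p.1 = p.2 then 1 else 0) <|
  Sum.elim (fun p => (g p.1 - ∑ j, g p.1 (a j) • v j) p.2) <|
  Sum.elim (fun p => hypForm m R (v p.1) (v p.2)) <|
  Sum.elim (fun p => (coordPlus m c (v p.1) - ∑ j, coordPlus m c (v p.1) (b j) • g j) p.2) <|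
  Sum.elim (fun p => coordMinus m c (g p.1) p.2) <|
  fun _ => fullDet (dualCoord a) v - (((-1) ^ s : ℤˣ) : ℤ)

theorem frameEqs_iff_defect {c : R} {a : Fin (2 * m) → Idx m} {b : Fin s → Idx m}
    {v : Fin (2 * m) → Idx m → R} {g : Fin s → Idx m → R} :
    FrameEqs s c a b v g ↔ ∀ k, frameDefect c a b v g k = 0 := by
  constructor
  · rintro h (⟨i, j⟩ | ⟨i, j⟩ | ⟨i, k⟩ | ⟨i, j⟩ | ⟨i, k⟩ | ⟨i, k⟩ | _)
    · exact sub_eq_zero.2 (h.norm_v i j)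
    · exact sub_eq_zero.2 (h.norm_g i j)
    · exact sub_eq_zero.2 (h.mem i k)
    · exact h.iso i j
    · exact sub_eq_zero.2 (h.plus i k)
    · exact h.minus i k
    · exact sub_eq_zero.2 h.spin
  · intro h
    exact
      { norm_v := fun i j => sub_eq_zero.1 (h (.inl (i, j)))
        norm_g := fun i j => sub_eq_zero.1 (h (.inr (.inl (i, j))))
        mem := fun i k => sub_eq_zero.1 (h (.inr (.inr (.inl (i, k)))))
        iso := fun i j => h (.inr (.inr (.inr (.inl (i, j)))))
        plus := fun i k => sub_eq_zero.1 (h (.inr (.inr (.inr (.inr (.inl (i, k)))))))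
        minus := fun i k => h (.inr (.inr (.inr (.inr (.inr (.inl (i, k)))))))
        spin := sub_eq_zero.1 (h (.inr (.inr (.inr (.inr (.inr (.inr ()))))))) }

theorem map_frameDefect (f : R →+* R') (c : R) (a : Fin (2 * m) → Idx m) (b : Fin s → Idx m)
    (v : Fin (2 * m) → Idx m → R) (g : Fin s → Idx m → R) (k : EqIdx m s) :
    f (frameDefect c a b v g k) =
      frameDefect (f c) a b (fun i => f ∘ v i) (fun i => f ∘ g i) k := by
  rcases k with ⟨i, j⟩ | ⟨i, j⟩ | ⟨i, k⟩ | ⟨i, j⟩ | ⟨i, k⟩ | ⟨i, k⟩ | _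
  · simp only [frameDefect, Sum.elim_inl, map_sub, Function.comp_apply]
    split_ifs <;> simp
  · simp only [frameDefect, Sum.elim_inl, Sum.elim_inr, map_sub, Function.comp_apply]
    split_ifs <;> simp
  · simp only [frameDefect, Sum.elim_inl, Sum.elim_inr]
    change (f ∘ (g i - ∑ j, g i (a j) • v j)) k = _
    simp only [comp_sub, comp_sum, comp_smul]
    rfl
  · exact map_hypForm f _ _
  · simp only [frameDefect, Sum.elim_inl, Sum.elim_inr]
    change (f ∘ (coordPlus m c (v i) - ∑ j, coordPlus m c (v i) (b j) • g j)) k = _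
    simp only [comp_sub, comp_sum, comp_smul, ← map_coordPlus]
    rfl
  · simp only [frameDefect, Sum.elim_inl, Sum.elim_inr, ← map_coordMinus]
    rfl
  · simp only [frameDefect, Sum.elim_inr, map_sub, map_fullDet, map_intCast]
    simp only [map_dualCoord]

/-- The variables of a chart. -/
abbrev ChartVar (m s : ℕ) : Type := (Fin (2 * m) × Idx m) ⊕ (Fin s × Idx m)

variable {O : Type u} [CommRing O] (c : O) (a : Fin (2 * m) → Idx m) (b : Fin s → Idx m)

/-- The ideal of a chart. -/
def chartIdeal : Ideal (MvPolynomial (ChartVar m s) O) :=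
  Ideal.span (Set.range (frameDefect (MvPolynomial.C c) a b
    (fun i k => MvPolynomial.X (Sum.inl (i, k))) fun i k => MvPolynomial.X (Sum.inr (i, k))))

/-- The coordinate ring of a chart. -/
abbrev ChartRing : Type u := MvPolynomial (ChartVar m s) O ⧸ chartIdeal c a b

/-- The first universal frame of a chart. -/
def chartV (i : Fin (2 * m)) (k : Idx m) : ChartRing c a b :=
  Ideal.Quotient.mk _ (MvPolynomial.X (Sum.inl (i, k)))

/-- The second universal frame of a chart. -/
def chartG (i : Fin s) (k : Idx m) : ChartRing c a b :=
  Ideal.Quotient.mk _ (MvPolynomial.X (Sum.inr (i, k)))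

theorem frameEqs_chart :
    FrameEqs s (algebraMap O (ChartRing c a b) c) a b (chartV c a b) (chartG c a b) := by
  rw [frameEqs_iff_defect]
  intro k
  have h := map_frameDefect (Ideal.Quotient.mk (chartIdeal c a b)) (MvPolynomial.C c) a b
    (fun i k => MvPolynomial.X (Sum.inl (i, k))) (fun i k => MvPolynomial.X (Sum.inr (i, k))) k
  exact h.symm.trans (Ideal.Quotient.eq_zero_iff_mem.2 (Ideal.subset_span (Set.mem_range_self k)))

variable {c a b} [Algebra O R]

theorem exists_chart_hom {v : Fin (2 * m) → Idx m → R} {g : Fin s → Idx m → R}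
    (h : FrameEqs s (algebraMap O R c) a b v g) : ∃ φ : ChartRing c a b →ₐ[O] R,
      (∀ i, φ ∘ chartV c a b i = v i) ∧ ∀ i, φ ∘ chartG c a b i = g i := by
  let z : ChartVar m s → R := Sum.elim (fun p => v p.1 p.2) fun p => g p.1 p.2
  refine ⟨Ideal.Quotient.liftₐ _ (MvPolynomial.aeval z) fun x hx => ?_, ?_, ?_⟩
  · suffices h' : chartIdeal c a b ≤ RingHom.ker (MvPolynomial.aeval z : _ →ₐ[O] R) from h' hx
    rw [chartIdeal, Ideal.span_le]
    rintro _ ⟨k, rfl⟩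
    have h' := map_frameDefect (MvPolynomial.aeval z : _ →ₐ[O] R).toRingHom (MvPolynomial.C c) a b
      (fun i k => MvPolynomial.X (Sum.inl (i, k))) (fun i k => MvPolynomial.X (Sum.inr (i, k))) k
    refine (h'.trans ?_)
    rw [← frameEqs_iff_defect.1 h k]
    congr 1
    · simp
    · funext i k; simp [z]
    · funext i k; simp [z]
  · intro i
    funext k
    exact (Ideal.Quotient.lift_mk _ _ _).trans (MvPolynomial.aeval_X z _)
  · intro i
    funext k
    exact (Ideal.Quotient.lift_mk _ _ _).trans (MvPolynomial.aeval_X z _)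

theorem chart_hom_ext {φ ψ : ChartRing c a b →ₐ[O] R}
    (hv : ∀ i, φ ∘ chartV c a b i = ψ ∘ chartV c a b i)
    (hg : ∀ i, φ ∘ chartG c a b i = ψ ∘ chartG c a b i) : φ = ψ := by
  refine Ideal.Quotient.algHom_ext _ (MvPolynomial.algHom_ext fun k => ?_)
  rcases k with ⟨i, k⟩ | ⟨i, k⟩
  · exact congrFun (hv i) k
  · exact congrFun (hg i) k

variable (c a b) in
/-- The universal point of a chart. -/
def chartPoint : LocPoint c m s (ChartRing c a b) :=
  LocPoint.ofFrames ⟨a, b, _, _, frameEqs_chart c a b, rfl, rfl⟩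

theorem map_chartPoint_fil (φ : ChartRing c a b →ₐ[O] R) : ((chartPoint c a b).map φ).fil =
    Submodule.span R (Set.range fun i => φ ∘ chartV c a b i) :=
  push_span_range φ.toRingHom _

theorem map_chartPoint_gil (φ : ChartRing c a b →ₐ[O] R) : ((chartPoint c a b).map φ).gil =
    Submodule.span R (Set.range fun i => φ ∘ chartG c a b i) :=
  push_span_range φ.toRingHom _

theorem frameEqs_map_chart (φ : ChartRing c a b →ₐ[O] R) :
    FrameEqs s (algebraMap O R c) a b (fun i => φ ∘ chartV c a b i)
      fun i => φ ∘ chartG c a b i := by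
  have h := (frameEqs_chart c a b).map φ.toRingHom
  rwa [show φ.toRingHom (algebraMap O _ c) = algebraMap O R c from φ.commutes c] at h

theorem exists_chart_hom_iff (x : LocPoint c m s R) :
    (∃ φ : ChartRing c a b →ₐ[O] R, (chartPoint c a b).map φ = x) ↔
      ∃ (v : Fin (2 * m) → Idx m → R) (g : Fin s → Idx m → R),
        FrameEqs s (algebraMap O R c) a b v g ∧ x.fil = Submodule.span R (Set.range v) ∧
          x.gil = Submodule.span R (Set.range g) := by
  constructor
  · rintro ⟨φ, rfl⟩
    exact ⟨_, _, frameEqs_map_chart φ, map_chartPoint_fil φ, map_chartPoint_gil φ⟩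
  · rintro ⟨v, g, h, hv, hg⟩
    obtain ⟨φ, h1, h2⟩ := exists_chart_hom h
    refine ⟨φ, LocPoint.ext_iff'.2 ⟨?_, ?_⟩⟩
    · rw [map_chartPoint_fil, hv]; simp only [h1]
    · rw [map_chartPoint_gil, hg]; simp only [h2]

/-- If `p` expresses `v` through `w`, comparison of the coordinates at `a` exhibits `p` as a left
inverse of the minor of `w`. -/
theorem isUnit_det_of_span_eq {W : Type} [Finite W] {d : ℕ} {a : Fin d → W} {v w : Fin d → W → R}
    (hv : Normalized a v)
    (h : Submodule.span R (Set.range v) = Submodule.span R (Set.range w)) :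
    IsUnit (Matrix.of fun i j => w i (a j)).det := by
  have hm (i) : v i ∈ Submodule.span R (Set.range w) := h ▸ Submodule.subset_span ⟨i, rfl⟩
  choose p hp using fun i => (Submodule.mem_span_range_iff_exists_fun R).1 (hm i)
  have : Matrix.of p * (Matrix.of fun i j => w i (a j)) = 1 := by
    ext i j
    rw [Matrix.mul_apply, Matrix.one_apply, ← hv i j, ← hp i]
    simp [Finset.sum_apply]
  have h1 := congrArg Matrix.det this
  rw [Matrix.det_mul, Matrix.det_one] at h1
  exact IsUnit.of_mul_eq_one_right _ h1

variable (c m s) in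
/-- The cover of the splitting model by charts. -/
def chartAtlas : Atlas (locFunctor c m s) where
  C := ULift.{u} ((Fin (2 * m) → Idx m) × (Fin s → Idx m))
  A i := ChartRing c i.down.1 i.down.2
  univ i := chartPoint c i.down.1 i.down.2
  inj i R _ _ φ ψ h := by
    -- A submodule has at most one frame normalized at given positions, so equal points have equal
    -- coordinates.
    obtain ⟨h1, h2⟩ := LocPoint.ext_iff'.1 h
    have hφ := frameEqs_map_chart φ
    have hψ := frameEqs_map_chart ψ
    refine chart_hom_ext (fun j => ?_) fun j => ?_
    · exact congrFun (Normalized.ext hφ.norm_v hψ.norm_v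
        ((map_chartPoint_fil φ).symm.trans (h1.trans (map_chartPoint_fil ψ)))) j
    · exact congrFun (Normalized.ext hφ.norm_g hψ.norm_g
        ((map_chartPoint_gil φ).symm.trans (h2.trans (map_chartPoint_gil ψ)))) j
  -- A point of chart `i` lies in chart `j` when both of its frames can be renormalized at the
  -- positions of `j`, that is, when both minors are invertible; hence the product.
  δ i j := (Matrix.of fun k l => chartV c i.down.1 i.down.2 k (j.down.1 l)).det *
    (Matrix.of fun k l => chartG c i.down.1 i.down.2 k (j.down.2 l)).det
  isUnit_iff i j R _ _ φ := by
    change _ ↔ ∃ ψ : ChartRing c j.down.1 j.down.2 →ₐ[O] R, (chartPoint c j.down.1 j.down.2).map ψ =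
      (chartPoint c i.down.1 i.down.2).map φ
    rw [exists_chart_hom_iff, map_chartPoint_fil, map_chartPoint_gil, map_mul, AlgHom.map_det,
      AlgHom.map_det, IsUnit.mul_iff]
    change IsUnit (Matrix.of fun k l => (φ ∘ chartV c i.down.1 i.down.2 k) (j.down.1 l)).det ∧
      IsUnit (Matrix.of fun k l => (φ ∘ chartG c i.down.1 i.down.2 k) (j.down.2 l)).det ↔ _
    constructor
    · rintro ⟨h1, h2⟩
      obtain ⟨v, hv, hv'⟩ := exists_normalized h1
      obtain ⟨g, hg, hg'⟩ := exists_normalized h2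
      refine ⟨v, g, frameEqs_iff.2 ⟨hv, hg, ?_⟩, hv'.symm, hg'.symm⟩
      rw [hv', hg']
      exact (frameEqs_iff.1 (frameEqs_map_chart φ)).2.2
    · rintro ⟨v, g, h, hv, hg⟩
      exact ⟨isUnit_det_of_span_eq h.norm_v hv.symm, isUnit_det_of_span_eq h.norm_g hg.symm⟩

theorem isCovering_chartAtlas : (chartAtlas m s c).directed.IsCovering :=
  (chartAtlas m s c).isCovering_directed fun R _ _ x p => by
    obtain ⟨r, hr, a, b, v, g, h, h1, h2⟩ := LocPoint.frames x p
    exact ⟨r, hr, ⟨(a, b)⟩, (exists_chart_hom_iff _).2 ⟨v, g, h, h1, h2⟩⟩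

theorem finitePresentation_chartRing [IsNoetherianRing O] :
    Algebra.FinitePresentation O (ChartRing c a b) :=
  Algebra.FinitePresentation.of_finiteType.1 inferInstance

theorem finitePresentation_chartAtlas [IsNoetherianRing O] (j : (chartAtlas m s c).directed.J) :
    Algebra.FinitePresentation O ((chartAtlas m s c).directed.A j) :=
  (chartAtlas m s c).finitePresentation_directed (fun _ => finitePresentation_chartRing) j

end Charts

/-! ### Local frames versus the global moduli conditions. -/

section Equiv

variable {m s : ℕ} {R : Type u} [CommRing R]

theorem eq_of_locally_eq (r : PrimeSpectrum R → R) (hr : ∀ p, r p ∉ p.asIdeal) {x y : R}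
    (h : ∀ p, algebraMap R (Localization.Away (r p)) x = algebraMap R _ y) : x = y := by
  rw [← sub_eq_zero, ← Ideal.mem_bot]
  refine mem_of_locally_mem fun p => ?_
  obtain ⟨⟨_, n, rfl⟩, hn⟩ := (IsLocalization.eq_iff_exists (Submonoid.powers (r p)) _).1 (h p)
  exact ⟨r p ^ n, fun h => hr p (p.2.mem_of_pow_mem _ h), by
    simpa [mul_sub, sub_eq_zero] using hn⟩

theorem IsSummandOfRank.map {M N : Type u} [AddCommGroup M] [AddCommGroup N] [Module R M]
    [Module R N] {d : ℕ} {P : Submodule R M} (h : IsSummandOfRank d P) (e : M ≃ₗ[R] N) :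
    IsSummandOfRank d (P.map (e : M →ₗ[R] N)) := by
  obtain ⟨⟨Q, hQ⟩, hd⟩ := h
  refine ⟨⟨Q.map (e : M →ₗ[R] N), ?_⟩, fun p => ?_⟩
  · exact (Submodule.orderIsoMapComap e).isCompl hQ
  · rw [← hd p]
    exact congrFun (Module.rankAtStalk_eq_of_equiv (e.submoduleMap P).symm) p

theorem hypForm_push_eq_zero {R' : Type u} [CommRing R'] (f : R →+* R')
    {P Q : Submodule R (Idx m → R)} (h : ∀ x ∈ P, ∀ y ∈ Q, hypForm m R x y = 0)
    {x y : Idx m → R'} (hx : x ∈ push f P) (hy : y ∈ push f Q) : hypForm m R' x y = 0 := by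
  induction hx using Submodule.span_induction with
  | mem x hx =>
    obtain ⟨v, hv, rfl⟩ := hx
    induction hy using Submodule.span_induction with
    | mem y hy =>
      obtain ⟨w, hw, rfl⟩ := hy
      exact (map_hypForm f v w).symm.trans (by rw [h v hv w hw, map_zero])
    | zero => rw [map_zero]
    | add x y _ _ h h' => rw [map_add, h, h', add_zero]
    | smul a x _ h => rw [map_smul, h, smul_zero]
  | zero => rw [map_zero, LinearMap.zero_apply]
  | add x y _ _ h h' => rw [map_add, LinearMap.add_apply, h, h', add_zero]
  | smul a x _ h => rw [map_smul, LinearMap.smul_apply, h, smul_zero]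

/-- The conditions defining the points of the splitting model, in coordinates. -/
structure SplConds (s : ℕ) (c : R) (F G : Submodule R (Idx m → R)) : Prop where
  fil_summand : IsSummandOfRank (2 * m) F
  gil_summand : IsSummandOfRank s G
  conds : Conds s c F G
  dual : ∀ x, (∀ y ∈ F, hypForm m R y x = 0) → x ∈ F

theorem SplConds.hasFrames_of_frames {c : R} {F G : Submodule R (Idx m → R)}
    (h : SplConds s c F G) (r : R) {S : Type u} [CommRing S] [Algebra R S]
    [IsLocalization.Away r S]
    {a : Fin (2 * m) → Idx m} {b : Fin s → Idx m} {v : Fin (2 * m) → Idx m → S}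
    {g : Fin s → Idx m → S} (hv : Normalized a v) (hg : Normalized b g)
    (hF : push (algebraMap R S) F = Submodule.span S (Set.range v))
    (hG : push (algebraMap R S) G = Submodule.span S (Set.range g)) :
    HasFrames s (algebraMap R S c) (push (algebraMap R S) F) (push (algebraMap R S) G) := by
  refine ⟨a, b, v, g, frameEqs_iff.2 ⟨hv, hg, ?_⟩, hF, hG⟩
  have hiso : ∀ x ∈ push (algebraMap R S) F, ∀ y ∈ push (algebraMap R S) F,
      hypForm m S x y = 0 := fun x hx y hy => hypForm_push_eq_zero _ h.conds.iso hx hy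
  have hvi (i) : v i ∈ push (algebraMap R S) F := hF ▸ Submodule.subset_span ⟨i, rfl⟩
  have hd := hv.isDualFrame fun i j => hiso _ (hvi i) _ (hvi j)
  rw [← hF, ← hG]
  refine ⟨push_mono h.conds.le, hiso, ?_, ?_, ?_⟩
  · suffices h' : push (algebraMap R S) F ≤
        (push (algebraMap R S) G).comap (coordPlus m (algebraMap R S c)) from h'
    refine push_le.2 fun x hx => ?_
    rw [Submodule.mem_comap, ← map_coordPlus]
    exact mem_push (h.conds.plus x hx)
  · suffices h' : push (algebraMap R S) G ≤
        LinearMap.ker (coordMinus m (algebraMap R S c)) from h'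
    refine push_le.2 fun x hx => ?_
    rw [LinearMap.mem_ker, ← map_coordMinus, h.conds.minus x hx, comp_zero]
  · rw [hF, hd.spin_iff]
    -- The spin condition is known only for vectors of `F`. Clearing denominators of the frame
    -- multiplies both determinants by the same unit, since they are multilinear, and the unit is
    -- cancelled.
    choose n w hw hnw using fun i => exists_smul_eq_of_mem_push r (hvi i)
    have h1 := congrArg (algebraMap R S) (h.conds.spin w hw (dualCoord a))
    rw [map_mul, map_gramDet, map_fullDet, map_intCast] at h1
    simp only [map_dualCoord, hnw] at h1
    have hu : IsUnit (∏ i, algebraMap R S r ^ n i) :=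
      IsUnit.prod_iff.2 fun i _ => (IsLocalization.Away.algebraMap_isUnit r).pow _
    rw [AlternatingMap.map_smul_univ, AlternatingMap.map_smul_univ, hd.gramDet_eq_one,
      mul_smul_comm] at h1
    have h2 := (hu.smul_left_cancel).1 h1
    have h3 : ((((-1) ^ s : ℤˣ) : ℤ) : S) * (((-1) ^ s : ℤˣ) : ℤ) = 1 := by
      rw [← Int.cast_mul, ← Units.val_mul, Int.units_mul_self]; simp
    linear_combination (-(((((-1) ^ s : ℤˣ) : ℤ) : S))) * h2 - fullDet (dualCoord a) v * h3

theorem SplConds.exists_hasFrames {c : R} {F G : Submodule R (Idx m → R)}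
    (h : SplConds s c F G) (p : PrimeSpectrum R) : ∃ r ∉ p.asIdeal,
      HasFrames s (algebraMap R (Localization.Away r) c)
        (push (algebraMap R (Localization.Away r)) F)
        (push (algebraMap R (Localization.Away r)) G) := by
  obtain ⟨r₁, hr₁, a, v, hv, hF⟩ := exists_local_frame h.fil_summand p
  obtain ⟨r₂, hr₂, b, g, hg, hG⟩ := exists_local_frame h.gil_summand p
  let S := Localization.Away (r₁ * r₂)
  have hu := IsLocalization.Away.algebraMap_isUnit (S := S) (r₁ * r₂)
  rw [map_mul, IsUnit.mul_iff] at hu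
  let f₁ : Localization.Away r₁ →+* S := IsLocalization.Away.lift r₁ hu.1
  let f₂ : Localization.Away r₂ →+* S := IsLocalization.Away.lift r₂ hu.2
  have h₁ : f₁.comp (algebraMap R _) = algebraMap R S := IsLocalization.Away.lift_comp r₁ hu.1
  have h₂ : f₂.comp (algebraMap R _) = algebraMap R S := IsLocalization.Away.lift_comp r₂ hu.2
  refine ⟨r₁ * r₂, fun h => (p.2.mem_or_mem h).elim hr₁ hr₂,
    h.hasFrames_of_frames (r₁ * r₂) (hv.map f₁) (hg.map f₂) ?_ ?_⟩
  · rw [← push_span_range, ← hF, ← push_comp, h₁]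
  · rw [← push_span_range, ← hG, ← push_comp, h₂]

/-- Each condition can be checked on a cover by basic opens: equalities and memberships by clearing
denominators, the existence of a complement by `isSummandOfRank_of_frames`. -/
theorem splConds_of_hasFrames {c : R} {F G : Submodule R (Idx m → R)}
    (h : ∀ p : PrimeSpectrum R, ∃ r ∉ p.asIdeal,
      HasFrames s (algebraMap R (Localization.Away r) c)
        (push (algebraMap R (Localization.Away r)) F)
        (push (algebraMap R (Localization.Away r)) G)) : SplConds s c F G := by
  choose r hr hf using h
  have hpow (p : PrimeSpectrum R) (n : ℕ) : r p ^ n ∉ p.asIdeal :=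
    fun h => hr p (p.2.mem_of_pow_mem _ h)
  refine ⟨isSummandOfRank_of_frames fun p => ?_, isSummandOfRank_of_frames fun p => ?_,
    ⟨le_of_push_le r hr fun p => (hf p).conds.le, fun x hx y hy => ?_, fun x hx => ?_,
      fun x hx => ?_, fun w hw x => ?_⟩, fun x hx => ?_⟩
  · obtain ⟨a, b, v, g, h, h1, h2⟩ := hf p
    exact ⟨r p, hr p, a, v, h.norm_v, h1⟩
  · obtain ⟨a, b, v, g, h, h1, h2⟩ := hf p
    exact ⟨r p, hr p, b, g, h.norm_g, h2⟩
  · refine eq_of_locally_eq r hr fun p => ?_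
    rw [map_hypForm, map_zero]
    exact (hf p).conds.iso _ (mem_push hx) _ (mem_push hy)
  · refine mem_of_locally_mem fun p => ?_
    have := (hf p).conds.plus _ (mem_push hx)
    rw [← map_coordPlus, comp_mem_push_iff (r p)] at this
    obtain ⟨n, hn⟩ := this
    exact ⟨_, hpow p n, hn⟩
  · funext k
    refine eq_of_locally_eq r hr fun p => ?_
    have := (hf p).conds.minus _ (mem_push hx)
    rw [← map_coordMinus] at this
    exact (congrFun this k).trans (map_zero _).symm
  · refine eq_of_locally_eq r hr fun p => ?_
    rw [map_mul, map_gramDet, map_fullDet, map_intCast]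
    exact (hf p).conds.spin _ (fun i => mem_push (hw i)) _
  · refine mem_of_locally_mem fun p => ?_
    have hspan : ∀ y ∈ Submodule.span R {x}, ∀ z ∈ F, hypForm m R z y = 0 := by
      intro y hy z hz
      obtain ⟨a, rfl⟩ := Submodule.mem_span_singleton.1 hy
      rw [map_smul, hx z hz, smul_zero]
    have := (hf p).mem_of_forall (x := algebraMap R _ ∘ x) fun y hy =>
      hypForm_push_eq_zero (Q := Submodule.span R {x}) _ (fun z hz y hy => hspan y hy z hz) hy
        (mem_push (Submodule.mem_span_singleton_self x))
    obtain ⟨n, hn⟩ := (comp_mem_push_iff (r p)).1 this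
    exact ⟨_, hpow p n, hn⟩

theorem LocPoint.splConds {O : Type u} [CommRing O] [Algebra O R] {c : O}
    (x : LocPoint c m s R) : SplConds s (algebraMap O R c) x.fil x.gil :=
  splConds_of_hasFrames fun p => by
    obtain ⟨r, hr, h⟩ := x.frames p
    rw [IsScalarTower.algebraMap_apply O R] at h
    exact ⟨r, hr, h⟩

/-- A point of the splitting model in coordinates from the global conditions. -/
def LocPoint.ofSplConds {O : Type u} [CommRing O] [Algebra O R] {c : O}
    {F G : Submodule R (Idx m → R)} (h : SplConds s (algebraMap O R c) F G) :
    LocPoint c m s R where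
  fil := F
  gil := G
  frames p := by
    obtain ⟨r, hr, h⟩ := h.exists_hasFrames p
    rw [← IsScalarTower.algebraMap_apply O R] at h
    exact ⟨r, hr, h⟩

end Equiv

section SplPoint

variable {O₀ F₀ O F : Type u}
  [CommRing O₀] [IsDomain O₀] [IsDiscreteValuationRing O₀]
  [Field F₀] [Algebra O₀ F₀] [IsFractionRing O₀ F₀]
  [Field F] [Algebra F₀ F] [Algebra O₀ F] [IsScalarTower O₀ F₀ F]
  [CommRing O] [IsDomain O] [IsDiscreteValuationRing O]
  [Algebra O₀ O] [Algebra O F] [IsScalarTower O₀ O F] [IsIntegralClosure O O₀ F]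
  {D : RamifiedQuadratic O₀ F₀ O F} {m s : ℕ} {R : Type u} [CommRing R] [Algebra O R]

theorem SplPoint.ext_iff' {x y : SplPoint D m R s} : x = y ↔ x.Fil = y.Fil ∧ x.Gil = y.Gil := by
  cases x; cases y; simp

theorem coord_tPlus (v : LamR D m R) :
    coord D m R (tPlus D m R v) = coordPlus m (algebraMap O R D.unif) (coord D m R v) := by
  rw [tPlus, LinearMap.add_apply, map_add, coord_tR, LinearMap.smul_apply, map_smul]
  rfl

theorem coord_tMinus (v : LamR D m R) :
    coord D m R (tMinus D m R v) = coordMinus m (algebraMap O R D.unif) (coord D m R v) := by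
  rw [tMinus, LinearMap.sub_apply, map_sub, coord_tR, LinearMap.smul_apply, map_smul]
  rfl

theorem map_coord_splConds (x : SplPoint D m R s) :
    SplConds s (algebraMap O R D.unif) (x.Fil.map (coord D m R : LamR D m R →ₗ[R] Idx m → R))
      (x.Gil.map (coord D m R : LamR D m R →ₗ[R] Idx m → R)) where
  fil_summand := x.fil_summand.map _
  gil_summand := x.gil_summand.map _
  conds :=
    { le := Submodule.map_mono x.gil_le_fil
      iso := by
        rintro _ ⟨v, hv, rfl⟩ _ ⟨w, hw, rfl⟩
        have hw' := hw
        rw [SetLike.mem_coe, x.fil_eq_orthogonal] at hw'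
        exact (formR_eq_hypForm D m R v w).symm.trans (hw' v hv)
      plus := by
        rintro _ ⟨v, hv, rfl⟩
        exact ⟨_, x.map_tPlus_le ⟨v, hv, rfl⟩, coord_tPlus v⟩
      minus := by
        rintro _ ⟨v, hv, rfl⟩
        refine (coord_tMinus v).symm.trans ?_
        have : tMinus D m R v ∈ x.Gil.map (tMinus D m R) := ⟨v, hv, rfl⟩
        rw [x.map_tMinus_eq_bot, Submodule.mem_bot] at this
        rw [this, map_zero]
      spin := by
        intro w hw
        choose v hv hvw using hw
        obtain rfl : (fun i => coord D m R (v i)) = w := funext hvw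
        exact (ιMulti_mem_L_iff D m R _ v).1 (x.spin v hv) }
  dual := by
    intro y hy
    refine ⟨(coord D m R).symm y, ?_, by simp⟩
    rw [SetLike.mem_coe, x.fil_eq_orthogonal]
    intro v hv
    have := hy _ ⟨v, hv, rfl⟩
    refine (formR_eq_hypForm D m R v _).trans ?_
    rw [LinearEquiv.apply_symm_apply]
    exact this

/-- A point of the splitting model from a point in coordinates. -/
def SplPoint.ofLoc (x : LocPoint D.unif m s R) : SplPoint D m R s where
  Fil := x.fil.map ((coord D m R).symm : _ →ₗ[R] LamR D m R)
  Gil := x.gil.map ((coord D m R).symm : _ →ₗ[R] LamR D m R)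
  fil_summand := x.splConds.fil_summand.map _
  gil_summand := x.splConds.gil_summand.map _
  gil_le_fil := Submodule.map_mono x.splConds.conds.le
  fil_eq_orthogonal := by
    refine le_antisymm ?_ fun v hv => ?_
    · rintro _ ⟨v, hv, rfl⟩ _ ⟨w, hw, rfl⟩
      refine (formR_eq_hypForm D m R _ _).trans ?_
      simpa using x.splConds.conds.iso w hw v hv
    · refine ⟨coord D m R v, x.splConds.dual _ fun y hy => ?_, by simp⟩
      refine Eq.trans ?_ (hv _ ⟨y, hy, rfl⟩)
      refine Eq.trans ?_ (formR_eq_hypForm D m R _ _).symm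
      simp
  map_tPlus_le := by
    rintro _ ⟨_, ⟨v, hv, rfl⟩, rfl⟩
    refine ⟨_, x.splConds.conds.plus v hv, ?_⟩
    apply (coord D m R).injective
    rw [coord_tPlus]
    simp
  map_tMinus_eq_bot := by
    rw [eq_bot_iff]
    rintro _ ⟨_, ⟨v, hv, rfl⟩, rfl⟩
    rw [Submodule.mem_bot]
    apply (coord D m R).injective
    rw [coord_tMinus]
    simpa using x.splConds.conds.minus v hv
  spin v hv := by
    rw [ιMulti_mem_L_iff]
    refine x.splConds.conds.spin _ fun i => ?_
    obtain ⟨w, hw, e⟩ := hv i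
    rw [← e]
    simpa using hw

variable (D m s R) in
/-- The points of the splitting model are the points in coordinates. -/
def locEquiv : LocPoint D.unif m s R ≃ SplPoint D m R s where
  toFun := SplPoint.ofLoc
  invFun x := LocPoint.ofSplConds (map_coord_splConds x)
  left_inv x := LocPoint.ext_iff'.2 ⟨by
    simp [LocPoint.ofSplConds, SplPoint.ofLoc, ← Submodule.map_comp], by
    simp [LocPoint.ofSplConds, SplPoint.ofLoc, ← Submodule.map_comp]⟩
  right_inv x := SplPoint.ext_iff'.2 ⟨by
    simp [LocPoint.ofSplConds, SplPoint.ofLoc, ← Submodule.map_comp], by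
    simp [LocPoint.ofSplConds, SplPoint.ofLoc, ← Submodule.map_comp]⟩

theorem map_coord_symm_push {R' : Type u} [CommRing R'] [Algebra O R'] (g : R →ₐ[O] R')
    (P : Submodule R (Idx m → R)) :
    (push g.toRingHom P).map ((coord D m R').symm : _ →ₗ[R'] LamR D m R') =
      pushSubmodule g (P.map ((coord D m R).symm : _ →ₗ[R] LamR D m R)) := by
  rw [push, pushSubmodule, Submodule.map_span]
  congr 1
  ext v
  constructor
  · rintro ⟨_, ⟨w, hw, rfl⟩, rfl⟩
    refine ⟨_, ⟨w, hw, rfl⟩, (coord D m R').injective ?_⟩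
    rw [coord_rTensor]
    simp
  · rintro ⟨_, ⟨w, hw, rfl⟩, rfl⟩
    refine ⟨_, ⟨w, hw, rfl⟩, (coord D m R').injective ?_⟩
    rw [coord_rTensor]
    simp

variable (D m s) in
/-- The splitting model. -/
def splModel : SplModel D m s where
  scheme := (chartAtlas m s D.unif).directed.glued
  str := (chartAtlas m s D.unif).directed.str
  point R _ _ := ((chartAtlas m s D.unif).directed.pointEquiv isZariskiSheaf_locFunctor
    isCovering_chartAtlas R).trans (locEquiv D m s R)
  point_natural R R' _ _ _ _ g f f' h := by
    obtain ⟨h1, h2⟩ := LocPoint.ext_iff'.1 ((chartAtlas m s D.unif).directed.pointEquiv_natural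
      isZariskiSheaf_locFunctor isCovering_chartAtlas g f f' h)
    exact ⟨(congrArg _ h1).trans (map_coord_symm_push g _),
      (congrArg _ h2).trans (map_coord_symm_push g _)⟩

instance : LocallyOfFinitePresentation (splModel D m s).str :=
  (chartAtlas m s D.unif).directed.locallyOfFinitePresentation_str finitePresentation_chartAtlas

end SplPoint

/-! ### Uniqueness of the representing scheme, and points of its special fibre. -/

/-- A natural transformation between the functors of affine points comes from a morphism. -/
theorem exists_hom_of_affine_points {X Y : Scheme.{u}}
    (τ : ∀ R : CommRingCat.{u}, (Spec R ⟶ X) → (Spec R ⟶ Y))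
    (hτ : ∀ (R R' : CommRingCat.{u}) (g : R ⟶ R') (f : Spec R ⟶ X),
      τ R' (Spec.map g ≫ f) = Spec.map g ≫ τ R f) :
    ∃ φ : X ⟶ Y, ∀ (R : CommRingCat.{u}) (f : Spec R ⟶ X), f ≫ φ = τ R f := by
  have hτ' : ∀ (R R' : CommRingCat.{u}) (g : Spec R' ⟶ Spec R) (f : Spec R ⟶ X),
      g ≫ τ R f = τ R' (g ≫ f) := by
    intro R R' g f
    obtain ⟨g, rfl⟩ := Spec.map_surjective g
    exact (hτ R R' g f).symm
  let 𝒰 := X.affineCover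
  let φ : X ⟶ Y := 𝒰.glueMorphisms (fun i => τ _ (𝒰.f i)) fun i j => by
    refine (Limits.pullback (𝒰.f i) (𝒰.f j)).affineCover.hom_ext _ _ fun k => ?_
    have h1 := hτ' _ _ ((Limits.pullback (𝒰.f i) (𝒰.f j)).affineCover.f k ≫
      Limits.pullback.fst _ _) (𝒰.f i)
    have h2 := hτ' _ _ ((Limits.pullback (𝒰.f i) (𝒰.f j)).affineCover.f k ≫
      Limits.pullback.snd _ _) (𝒰.f j)
    refine (Category.assoc _ _ _).symm.trans (h1.trans (Eq.trans (congrArg _ ?_)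
      (h2.symm.trans (Category.assoc _ _ _))))
    exact (Category.assoc _ _ _).trans ((congrArg _ Limits.pullback.condition).trans
      (Category.assoc _ _ _).symm)
  have hφ (i) : 𝒰.f i ≫ φ = τ _ (𝒰.f i) := 𝒰.ι_glueMorphisms _ _ i
  refine ⟨φ, fun R f => ?_⟩
  refine Scheme.Cover.hom_ext (𝒰.pullback₁ f) _ _ fun i => ?_
  change Limits.pullback.fst f (𝒰.f i) ≫ f ≫ φ = Limits.pullback.fst f (𝒰.f i) ≫ τ R f
  refine (Limits.pullback f (𝒰.f i)).affineCover.hom_ext _ _ fun k => ?_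
  have h1 := hτ' _ _ ((Limits.pullback f (𝒰.f i)).affineCover.f k ≫
    Limits.pullback.fst _ _) f
  have h2 := hτ' _ _ ((Limits.pullback f (𝒰.f i)).affineCover.f k ≫
    Limits.pullback.snd _ _) (𝒰.f i)
  have h3 : Limits.pullback.fst f (𝒰.f i) ≫ f ≫ φ =
      Limits.pullback.snd f (𝒰.f i) ≫ τ _ (𝒰.f i) :=
    (Category.assoc _ _ _).symm.trans ((congrArg (· ≫ φ) Limits.pullback.condition).trans
      ((Category.assoc _ _ _).trans (congrArg _ (hφ i))))
  refine (congrArg _ h3).trans ((Category.assoc _ _ _).symm.trans (h2.trans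
    (Eq.trans (congrArg _ ?_) (h1.symm.trans (Category.assoc _ _ _)))))
  exact (Category.assoc _ _ _).trans ((congrArg _ Limits.pullback.condition.symm).trans
    (Category.assoc _ _ _).symm)

/-- The points of the special fiber of the splitting model, in coordinates. -/
structure RedPoint (m s : ℕ) (R : Type u) [CommRing R] where
  /-- The larger submodule. -/
  fil : Submodule R (Idx m → R)
  /-- The smaller submodule. -/
  gil : Submodule R (Idx m → R)
  splConds : SplConds s 0 fil gil

namespace RedPoint

variable {m s : ℕ} {R R' : Type u} [CommRing R] [CommRing R']

theorem ext_iff' {x y : RedPoint m s R} : x = y ↔ x.fil = y.fil ∧ x.gil = y.gil := by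
  cases x; cases y; simp

/-- The base change of a point. -/
def map (f : R →+* R') (x : RedPoint m s R) : RedPoint m s R' where
  fil := push f x.fil
  gil := push f x.gil
  splConds := by
    let _ : Algebra R R' := f.toAlgebra
    -- A point with `π = 0` is a point of the coordinate functor over the base ring `R` itself with
    -- parameter `0`, so base change is already available.
    let y : LocPoint (0 : R) m s R := LocPoint.ofSplConds (by simpa using x.splConds)
    have h := (y.map (Algebra.ofId R R')).splConds
    rw [map_zero] at h
    exact h

/-- The points of the splitting model with values in a ring in which `c` vanishes. -/
def ofLoc {O : Type u} [CommRing O] [Algebra O R] {c : O} (hc : algebraMap O R c = 0) :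
    LocPoint c m s R ≃ RedPoint m s R where
  toFun x := ⟨x.fil, x.gil, hc ▸ x.splConds⟩
  invFun x := LocPoint.ofSplConds (by rw [hc]; exact x.splConds)
  left_inv _ := rfl
  right_inv _ := rfl

end RedPoint

section Unique

variable {O₀ F₀ O F : Type u}
  [CommRing O₀] [IsDomain O₀] [IsDiscreteValuationRing O₀]
  [Field F₀] [Algebra O₀ F₀] [IsFractionRing O₀ F₀]
  [Field F] [Algebra F₀ F] [Algebra O₀ F] [IsScalarTower O₀ F₀ F]
  [CommRing O] [IsDomain O] [IsDiscreteValuationRing O]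
  [Algebra O₀ O] [Algebra O F] [IsScalarTower O₀ O F] [IsIntegralClosure O O₀ F]
  {D : RamifiedQuadratic O₀ F₀ O F} {m s : ℕ}

namespace SplModel

theorem point_ext (N : SplModel D m s) {R R' : Type u} [CommRing R] [CommRing R'] [Algebra O R]
    [Algebra O R'] (g : R →ₐ[O] R') (f : SchemePoint N.str R) (f' : SchemePoint N.str R')
    (h1 : (N.point R' f').Fil = pushSubmodule g (N.point R f).Fil)
    (h2 : (N.point R' f').Gil = pushSubmodule g (N.point R f).Gil) : f'.1 = specMap g ≫ f.1 := by
  let f'' : SchemePoint N.str R' := ⟨specMap g ≫ f.1, by rw [Category.assoc, f.2, specMap_over]⟩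
  have h := N.point_natural R R' g f f'' rfl
  have h3 : f' = f'' := (N.point R').injective
    (SplPoint.ext_iff'.2 ⟨h1.trans h.1.symm, h2.trans h.2.symm⟩)
  rw [h3]

/-- The comparison of the functors of points of two splitting models. -/
def compare (M N : SplModel D m s) (R : CommRingCat.{u}) (f : Spec R ⟶ M.scheme) :
    Spec R ⟶ N.scheme :=
  let _ : Algebra O R := (Spec.preimage (f ≫ M.str)).hom.toAlgebra
  ((N.point R).symm (M.point R ⟨f, (Spec.map_preimage _).symm⟩)).1

/-- `compare` extracts the `O`-algebra structure from the morphism; it is the given structure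
because `f` lies over `Spec O`. -/
theorem compare_eq (M N : SplModel D m s) (R : Type u) [CommRing R] [Algebra O R]
    (f : SchemePoint M.str R) :
    compare M N (.of R) f.1 = ((N.point R).symm (M.point R f)).1 := by
  obtain ⟨f, hf⟩ := f
  have : (Spec.preimage (f ≫ M.str)).hom.toAlgebra = ‹Algebra O R› := by
    refine Algebra.algebra_ext _ _ fun r => ?_
    have h : Spec.preimage (f ≫ M.str) = CommRingCat.ofHom (algebraMap O R) := by
      rw [hf, Spec.preimage_map]
    exact congr($(h).hom r)
  subst this
  rfl

theorem compare_str (M N : SplModel D m s) (R : CommRingCat.{u}) (f : Spec R ⟶ M.scheme) :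
    compare M N R f ≫ N.str = f ≫ M.str := by
  let _ : Algebra O R := (Spec.preimage (f ≫ M.str)).hom.toAlgebra
  exact ((N.point R).symm (M.point R ⟨f, (Spec.map_preimage _).symm⟩)).2.trans
    (Spec.map_preimage _)

theorem compare_compare (M N : SplModel D m s) (R : CommRingCat.{u}) (f : Spec R ⟶ M.scheme) :
    compare N M R (compare M N R f) = f := by
  let _ : Algebra O R := (Spec.preimage (f ≫ M.str)).hom.toAlgebra
  have h := compare_eq N M R ((N.point R).symm (M.point R ⟨f, (Spec.map_preimage _).symm⟩))
  rw [Equiv.apply_symm_apply, Equiv.symm_apply_apply] at h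
  exact h

theorem compare_natural (M N : SplModel D m s) (R R' : CommRingCat.{u}) (g : R ⟶ R')
    (f : Spec R ⟶ M.scheme) :
    compare M N R' (Spec.map g ≫ f) = Spec.map g ≫ compare M N R f := by
  let _ : Algebra O R := (Spec.preimage (f ≫ M.str)).hom.toAlgebra
  let _ : Algebra O R' := (g.hom.comp (algebraMap O R)).toAlgebra
  let g' : R →ₐ[O] R' := ⟨g.hom, fun _ => rfl⟩
  let f₁ : SchemePoint M.str R := ⟨f, (Spec.map_preimage _).symm⟩
  let f₂ : SchemePoint M.str R' := ⟨specMap g' ≫ f, by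
    rw [Category.assoc, f₁.2, specMap_over]⟩
  have h1 := compare_eq M N R f₁
  have h2 := compare_eq M N R' f₂
  have h := M.point_natural R R' g' f₁ f₂ rfl
  refine h2.trans (Eq.trans ?_ (congrArg (specMap g' ≫ ·) h1.symm))
  refine N.point_ext g' ((N.point R).symm (M.point R f₁)) _ ?_ ?_
  · rw [Equiv.apply_symm_apply, Equiv.apply_symm_apply, h.1]
  · rw [Equiv.apply_symm_apply, Equiv.apply_symm_apply, h.2]

/-- Yoneda, tested on affine covers. It serves to transfer local finite presentation, which is not
part of the data of `SplModel`, from the glued scheme to any representing scheme. -/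
theorem exists_iso (M N : SplModel D m s) : ∃ e : M.scheme ≅ N.scheme, e.hom ≫ N.str = M.str := by
  obtain ⟨φ, hφ⟩ := exists_hom_of_affine_points (compare M N) (compare_natural M N)
  obtain ⟨ψ, hψ⟩ := exists_hom_of_affine_points (compare N M) (compare_natural N M)
  refine ⟨⟨φ, ψ, ?_, ?_⟩, ?_⟩
  · refine M.scheme.affineCover.hom_ext _ _ fun i => ?_
    rw [← Category.assoc, Category.comp_id]
    refine ((congrArg (· ≫ ψ) (hφ _ _)).trans (hψ _ _)).trans (compare_compare M N _ _)
  · refine N.scheme.affineCover.hom_ext _ _ fun i => ?_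
    rw [← Category.assoc, Category.comp_id]
    refine ((congrArg (· ≫ φ) (hψ _ _)).trans (hφ _ _)).trans (compare_compare N M _ _)
  · refine M.scheme.affineCover.hom_ext _ _ fun i => ?_
    rw [← Category.assoc]
    exact (congrArg (· ≫ N.str) (hφ _ _)).trans (compare_str M N _ _)

instance locallyOfFinitePresentation_str (M : SplModel D m s) :
    LocallyOfFinitePresentation M.str := by
  obtain ⟨e, he⟩ := M.exists_iso (splModel D m s)
  rw [← he]
  infer_instance

instance (M : SplModel D m s) : LocallyOfFinitePresentation M.specialFiberStr := by
  unfold specialFiberStr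
  exact locallyOfFinitePresentation_isStableUnderBaseChange.{u}.of_isPullback
    (IsPullback.of_hasPullback M.str _) inferInstance

/-- The points of a splitting model in coordinates. -/
def locPoint (M : SplModel D m s) (R : Type u) [CommRing R] [Algebra O R] :
    SchemePoint M.str R ≃ LocPoint D.unif m s R :=
  (M.point R).trans (locEquiv D m s R).symm

theorem locPoint_natural (M : SplModel D m s) {R R' : Type u} [CommRing R] [CommRing R']
    [Algebra O R] [Algebra O R'] (g : R →ₐ[O] R') (f : SchemePoint M.str R)
    (f' : SchemePoint M.str R') (h : f'.1 = specMap g ≫ f.1) :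
    M.locPoint R' f' = (M.locPoint R f).map g := by
  rw [locPoint, Equiv.trans_apply, Equiv.symm_apply_eq]
  have hx : locEquiv D m s R (M.locPoint R f) = M.point R f := by simp [locPoint]
  obtain ⟨h1, h2⟩ := M.point_natural R R' g f f' h
  rw [← hx] at h1 h2
  exact SplPoint.ext_iff'.2 ⟨h1.trans (map_coord_symm_push g _).symm,
    h2.trans (map_coord_symm_push g _).symm⟩

/-- If `π` were a unit, so would be `π² = π₀` in `O`, and then also in `O₀`, because `O` is integral
over `O₀`. -/
theorem residue_unif (D : RamifiedQuadratic O₀ F₀ O F) : IsLocalRing.residue O D.unif = 0 := by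
  rw [IsLocalRing.residue_eq_zero_iff, IsLocalRing.mem_maximalIdeal, mem_nonunits_iff]
  intro h
  have h1 := h.pow 2
  rw [D.unif_sq] at h1
  have hinj : Function.Injective (algebraMap O₀ F) := by
    rw [IsScalarTower.algebraMap_eq O₀ F₀ F]
    exact (algebraMap F₀ F).injective.comp (IsFractionRing.injective O₀ F₀)
  rw [IsScalarTower.algebraMap_eq O₀ O F] at hinj
  have : FaithfulSMul O₀ O := (faithfulSMul_iff_algebraMap_injective O₀ O).2
    (Function.Injective.of_comp (f := algebraMap O F) hinj)
  have : Algebra.IsIntegral O₀ O := IsIntegralClosure.isIntegral_algebra O₀ F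
  exact D.irreducible_unif₀.not_isUnit (isUnit_of_map_unit _ _ h1)

variable (M : SplModel D m s) {R : Type u} [CommRing R]
  [Algebra (IsLocalRing.ResidueField O) R]

theorem specialFiber_condition : M.specialFiberι ≫ M.str =
    M.specialFiberStr ≫ Spec.map (CommRingCat.ofHom (IsLocalRing.residue O)) :=
  Limits.pullback.condition

/-- The points of the special fiber are points of the splitting model. -/
def fiberPoint [Algebra O R] [IsScalarTower O (IsLocalRing.ResidueField O) R] :
    SchemePoint M.specialFiberStr R ≃ SchemePoint M.str R where
  toFun z := ⟨z.1 ≫ M.specialFiberι, by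
    rw [Category.assoc, specialFiber_condition, ← Category.assoc, z.2, ← Spec.map_comp,
      IsScalarTower.algebraMap_eq O (IsLocalRing.ResidueField O) R]
    rfl⟩
  invFun z := ⟨Limits.pullback.lift z.1 (Spec.map (CommRingCat.ofHom (algebraMap _ R))) (by
    rw [z.2, ← Spec.map_comp, IsScalarTower.algebraMap_eq O (IsLocalRing.ResidueField O) R]
    rfl), Limits.pullback.lift_snd _ _ _⟩
  left_inv z := Subtype.ext <| Limits.pullback.hom_ext (Limits.pullback.lift_fst _ _ _)
    ((Limits.pullback.lift_snd _ _ _).trans z.2.symm)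
  right_inv z := Subtype.ext (Limits.pullback.lift_fst _ _ _)

theorem algebraMap_unif_eq_zero [Algebra O R] [IsScalarTower O (IsLocalRing.ResidueField O) R] :
    algebraMap O R D.unif = 0 := by
  rw [IsScalarTower.algebraMap_apply O (IsLocalRing.ResidueField O) R]
  exact (congrArg _ (residue_unif D)).trans (map_zero _)

variable (R) in
/-- The points of the special fiber in coordinates. -/
def redPoint : SchemePoint M.specialFiberStr R ≃ RedPoint m s R :=
  let _ : Algebra O R := Algebra.compHom R (algebraMap O (IsLocalRing.ResidueField O))
  have : IsScalarTower O (IsLocalRing.ResidueField O) R := .of_algebraMap_eq fun _ => rfl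
  M.fiberPoint.trans ((M.locPoint R).trans (RedPoint.ofLoc algebraMap_unif_eq_zero))

theorem redPoint_natural {R' : Type u} [CommRing R'] [Algebra (IsLocalRing.ResidueField O) R']
    (g : R →ₐ[IsLocalRing.ResidueField O] R') (f : SchemePoint M.specialFiberStr R)
    (f' : SchemePoint M.specialFiberStr R') (h : f'.1 = specMap g ≫ f.1) :
    M.redPoint R' f' = (M.redPoint R f).map g := by
  let _ : Algebra O R := Algebra.compHom R (algebraMap O (IsLocalRing.ResidueField O))
  have : IsScalarTower O (IsLocalRing.ResidueField O) R := .of_algebraMap_eq fun _ => rfl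
  let _ : Algebra O R' := Algebra.compHom R' (algebraMap O (IsLocalRing.ResidueField O))
  have : IsScalarTower O (IsLocalRing.ResidueField O) R' := .of_algebraMap_eq fun _ => rfl
  obtain ⟨h1, h2⟩ := LocPoint.ext_iff'.1 (M.locPoint_natural (g.restrictScalars O)
    (M.fiberPoint f) (M.fiberPoint f') ((congrArg (· ≫ M.specialFiberι) h).trans
      (Category.assoc _ _ _)))
  exact RedPoint.ext_iff'.2 ⟨h1, h2⟩

end SplModel
end Unique

/-! ### Smoothness at a point in terms of infinitesimal lifting for local rings. -/

section Smooth

/-- A localization at a prime is formally smooth as soon as its points lift along square zero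
thickenings by local rings. -/
theorem formallySmooth_localization {k B : Type u} [CommRing k] [CommRing B] [Algebra k B]
    [Algebra.FiniteType k B] (q : Ideal B) [q.IsPrime]
    (h : ∀ (C : Type u) [CommRing C] [Algebra k C] [IsLocalRing C]
      (ρ : C →ₐ[k] Localization.AtPrime q), Function.Surjective ρ → RingHom.ker ρ ^ 2 = ⊥ →
      ∃ g : B →ₐ[k] C, ρ.comp g = IsScalarTower.toAlgHom k B (Localization.AtPrime q)) :
    Algebra.FormallySmooth k (Localization.AtPrime q) := by
  obtain ⟨n, π, hπ⟩ := Algebra.FiniteType.iff_quotient_mvPolynomial''.1 ‹Algebra.FiniteType k B›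
  let q' := q.comap π.toRingHom
  let P := Localization.AtPrime q'
  have : Algebra.FormallySmooth (MvPolynomial (Fin n) k) P :=
    Algebra.FormallySmooth.of_isLocalization q'.primeCompl
  have : Algebra.FormallySmooth k P := Algebra.FormallySmooth.comp k (MvPolynomial (Fin n) k) P
  let φ₀ : P →+* Localization.AtPrime q := Localization.localRingHom q' q π.toRingHom rfl
  let φ : P →ₐ[k] Localization.AtPrime q := { φ₀ with
    commutes' := fun r => by
      change φ₀ (algebraMap k P r) = _
      rw [IsScalarTower.algebraMap_apply k (MvPolynomial (Fin n) k) P,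
        Localization.localRingHom_to_map, IsScalarTower.algebraMap_apply k B (Localization.AtPrime q)]
      congr 1
      exact π.commutes r }
  have hφ : Function.Surjective φ :=
    RingHom.surjective_localRingHom_of_surjective π.toRingHom hπ q
  -- `P` is a localized polynomial ring, hence formally smooth, so it suffices to split `P / (ker
  -- φ)² → P / ker φ`. The source is local, so the hypothesis applies to it.
  rw [Algebra.FormallySmooth.iff_split_surjection φ hφ]
  have hne : RingHom.ker φ.toRingHom ^ 2 ≠ ⊤ := fun h => by
    have h1 : RingHom.ker φ.toRingHom = ⊤ := by
      rw [eq_top_iff, ← h]; exact Ideal.pow_le_self two_ne_zero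
    exact one_ne_zero ((map_one φ).symm.trans
      (show φ 1 = 0 from h1.ge (Submodule.mem_top (x := (1 : P)))))
  have : Nontrivial (P ⧸ RingHom.ker φ.toRingHom ^ 2) := Ideal.Quotient.nontrivial_iff.2 hne
  have : IsLocalRing (P ⧸ RingHom.ker φ.toRingHom ^ 2) :=
    IsLocalRing.of_surjective' (Ideal.Quotient.mk _) Ideal.Quotient.mk_surjective
  have hker : RingHom.ker φ.kerSquareLift ^ 2 = ⊥ := by
    refine (pow_two _).trans (eq_bot_iff.2 (Ideal.mul_le.2 fun a ha b hb => ?_))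
    obtain ⟨a, rfl⟩ := Ideal.Quotient.mk_surjective a
    obtain ⟨b, rfl⟩ := Ideal.Quotient.mk_surjective b
    rw [Ideal.mem_bot, ← map_mul, Ideal.Quotient.eq_zero_iff_mem, pow_two]
    exact Ideal.mul_mem_mul ha hb
  have hsurj : Function.Surjective φ.kerSquareLift := fun z => by
    obtain ⟨w, rfl⟩ := hφ z
    exact ⟨Ideal.Quotient.mk _ w, rfl⟩
  obtain ⟨g, hg⟩ := h _ φ.kerSquareLift hsurj hker
  -- Units lift along a nilpotent ideal, so `g` extends to the localization.
  have hu : ∀ y : q.primeCompl, IsUnit (g y) := fun y => by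
    have h1 : IsUnit (φ.kerSquareLift (g y)) := by
      rw [show φ.kerSquareLift (g y) = algebraMap B _ (y : B) from congr($hg (y : B))]
      exact IsLocalization.map_units _ y
    have h2 : IsNilpotent (RingHom.ker φ.kerSquareLift) := ⟨2, hker⟩
    obtain ⟨b, hb⟩ := h1.exists_right_inv
    obtain ⟨b, rfl⟩ := hsurj b
    have h3 : g y * b - 1 ∈ RingHom.ker φ.kerSquareLift := by
      rw [RingHom.mem_ker, map_sub, map_mul, hb, map_one, sub_self]
    have h4 : IsNilpotent (g y * b - 1) := ⟨2, by
      have := Ideal.pow_mem_pow h3 2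
      rwa [hker] at this⟩
    have h5 := h4.isUnit_add_one
    rw [sub_add_cancel] at h5
    exact isUnit_of_mul_isUnit_left h5
  refine ⟨IsLocalization.liftAlgHom (M := q.primeCompl) (f := g) hu, ?_⟩
  refine IsLocalization.algHom_ext q.primeCompl ?_
  ext b
  have h1 : φ.kerSquareLift (g b) = algebraMap B _ b := congr($hg b)
  change φ.kerSquareLift (IsLocalization.liftAlgHom (M := q.primeCompl) (f := g) hu
    (algebraMap B _ b)) = algebraMap B _ b
  exact (congrArg φ.kerSquareLift (IsLocalization.lift_eq hu b)).trans h1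

variable {k : Type u} [Field k] {X : Scheme.{u}} (f : X ⟶ Spec (.of k))

/-- The points of the spectrum of a local ring map to generizations of the image of the closed
point. -/
theorem range_subset_of_closedPoint {A : Type u} [CommRing A] [IsLocalRing A]
    (y : Spec (.of A) ⟶ X) (U : X.Opens) (h : y (IsLocalRing.closedPoint A) ∈ U) :
    Set.range y ⊆ U := by
  rintro _ ⟨p, rfl⟩
  have h1 : (show PrimeSpectrum A from p) ⤳ IsLocalRing.closedPoint A :=
    IsLocalRing.specializes_closedPoint _
  have h2 : y p ⤳ y (IsLocalRing.closedPoint A) := h1.map y.continuous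
  exact h2.mem_open U.2 h

/-- The whole spectrum of the local ring `A` maps into any neighbourhood of the image of its closed
point, in particular into a smooth affine one; there the lift comes from formal smoothness of its
coordinate ring. -/
theorem exists_lift_of_mem_smoothPoints {x : X} (hx : x ∈ smoothPoints f)
    {C A : Type u} [CommRing C] [CommRing A] [IsLocalRing A] [Algebra k C] [Algebra k A]
    (ρ : C →ₐ[k] A) (hρ : Function.Surjective ρ) (hker : RingHom.ker ρ ^ 2 = ⊥)
    (y : SchemePoint f A) (hy : y.1 (IsLocalRing.closedPoint A) = x) :
    ∃ z : SchemePoint f C, y.1 = specMap ρ ≫ z.1 := by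
  obtain ⟨U, hxU, hU⟩ := hx
  obtain ⟨_, ⟨V, hV, rfl⟩, hxV, hVU⟩ :=
    X.isBasis_affineOpens.exists_subset_of_mem_open hxU U.2
  replace hV : IsAffineOpen V := hV
  have hr : Set.range y.1 ⊆ Set.range hV.fromSpec := by
    rw [hV.range_fromSpec]
    exact range_subset_of_closedPoint y.1 V (by rw [hy]; exact hxV)
  have hjU : Set.range hV.fromSpec ⊆ Set.range U.ι := by
    rw [hV.range_fromSpec, Scheme.Opens.range_ι]; exact hVU
  have hsm : Smooth (hV.fromSpec ≫ f) := by
    rw [← IsOpenImmersion.lift_fac U.ι hV.fromSpec hjU, Category.assoc]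
    infer_instance
  let φ := Spec.preimage (hV.fromSpec ≫ f)
  let _ : Algebra k Γ(X, V) := φ.hom.toAlgebra
  have hφ : Spec.map (CommRingCat.ofHom (algebraMap k Γ(X, V))) = hV.fromSpec ≫ f :=
    Spec.map_preimage _
  rw [← hφ, HasRingHomProperty.Spec_iff (P := @Smooth)] at hsm
  have hsm' : Algebra.Smooth k Γ(X, V) := hsm
  obtain ⟨ψ, hψ⟩ := exists_specMap_eq (O := k) (A := Γ(X, V)) (IsOpenImmersion.lift hV.fromSpec y.1 hr) (by
    rw [hφ, ← Category.assoc, IsOpenImmersion.lift_fac, y.2])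
  let χ : Γ(X, V) →ₐ[k] C := Algebra.FormallySmooth.liftOfSurjective ψ ρ hρ ⟨2, hker⟩
  refine ⟨⟨specMap χ ≫ hV.fromSpec, ?_⟩, ?_⟩
  · rw [Category.assoc, ← hφ, specMap_over]
  · rw [← Category.assoc, ← specMap_comp,
      show ρ.comp χ = ψ from Algebra.FormallySmooth.comp_liftOfSurjective _ _ _ _, hψ,
      IsOpenImmersion.lift_fac]

/-- Applied to thickenings of the local ring at `x`, the hypothesis makes that local ring formally
smooth. -/
theorem mem_smoothPoints_of_forall_lift [LocallyOfFinitePresentation f] (x : X)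
    (h : ∀ (C A : Type u) [CommRing C] [CommRing A] [IsLocalRing C] [IsLocalRing A] [Algebra k C]
      [Algebra k A] (ρ : C →ₐ[k] A), Function.Surjective ρ → RingHom.ker ρ ^ 2 = ⊥ →
      ∀ y : SchemePoint f A, y.1 (IsLocalRing.closedPoint A) = x →
        ∃ z : SchemePoint f C, y.1 = specMap ρ ≫ z.1) : x ∈ smoothPoints f := by
  obtain ⟨_, ⟨V, hV, rfl⟩, hxV, -⟩ :=
    X.isBasis_affineOpens.exists_subset_of_mem_open (Set.mem_univ x) isOpen_univ
  replace hV : IsAffineOpen V := hV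
  let φ := Spec.preimage (hV.fromSpec ≫ f)
  let _ : Algebra k Γ(X, V) := φ.hom.toAlgebra
  have hφ : Spec.map (CommRingCat.ofHom (algebraMap k Γ(X, V))) = hV.fromSpec ≫ f :=
    Spec.map_preimage _
  have hfp : LocallyOfFinitePresentation (hV.fromSpec ≫ f) := inferInstance
  rw [← hφ, LocallyOfFinitePresentation.SpecMap_iff] at hfp
  have hfp' : Algebra.FinitePresentation k Γ(X, V) := hfp
  obtain ⟨q, hq⟩ : x ∈ Set.range hV.fromSpec := by rw [hV.range_fromSpec]; exact hxV
  let q' : PrimeSpectrum Γ(X, V) := q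
  have hsm : Algebra.FormallySmooth k (Localization.AtPrime q'.asIdeal) := by
    refine formallySmooth_localization q'.asIdeal fun C _ _ _ ρ hρ hker => ?_
    let y : SchemePoint f (Localization.AtPrime q'.asIdeal) :=
      ⟨specMap (IsScalarTower.toAlgHom k Γ(X, V) _) ≫ hV.fromSpec, by
        rw [Category.assoc, ← hφ, specMap_over]⟩
    have hy : y.1 (IsLocalRing.closedPoint _) = x := by
      rw [← hq]
      refine (Scheme.Hom.comp_apply _ _ _).trans (congrArg _ ?_)
      exact PrimeSpectrum.ext (IsLocalization.AtPrime.under_maximalIdeal _ q'.asIdeal)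
    obtain ⟨z, hz⟩ := h C _ ρ hρ hker y hy
    have hr : Set.range z.1 ⊆ Set.range hV.fromSpec := by
      rw [hV.range_fromSpec]
      refine range_subset_of_closedPoint z.1 V ?_
      have h1 : y.1 (IsLocalRing.closedPoint _) = z.1 (IsLocalRing.closedPoint C) := by
        rw [hz]
        refine (Scheme.Hom.comp_apply _ _ _).trans (congrArg _ ?_)
        have : IsLocalHom ρ.toRingHom := IsLocalHom.of_surjective _ hρ
        exact IsLocalRing.comap_closedPoint ρ.toRingHom
      rw [← h1, hy]
      exact hxV
    obtain ⟨g, hg⟩ := exists_specMap_eq (O := k) (A := Γ(X, V)) (IsOpenImmersion.lift hV.fromSpec z.1 hr) (by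
      rw [hφ, ← Category.assoc, IsOpenImmersion.lift_fac, z.2])
    refine ⟨g, specMap_injective ?_⟩
    rw [← cancel_mono hV.fromSpec, specMap_comp, Category.assoc, hg, IsOpenImmersion.lift_fac]
    exact hz.symm
  -- By finite presentation, smoothness of the local ring spreads out to a basic open.
  obtain ⟨r, hr, hrs⟩ := Algebra.IsSmoothAt.exists_notMem_smooth k q'.asIdeal
  let j : Spec (.of (Localization.Away r)) ⟶ X := specMap (awayHom k r) ≫ hV.fromSpec
  have hj : IsOpenImmersion (specMap (awayHom k r)) :=
    inferInstanceAs (IsOpenImmersion (Spec.map (CommRingCat.ofHom (algebraMap _ (Localization.Away r)))))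
  have hxj : x ∈ j.opensRange := by
    obtain ⟨p, hp⟩ : q' ∈ Set.range (PrimeSpectrum.comap (algebraMap _ (Localization.Away r))) := by
      rw [PrimeSpectrum.localization_away_comap_range (Localization.Away r) r]
      exact hr
    rw [← hq]
    exact ⟨p, (Scheme.Hom.comp_apply _ _ _).trans (congrArg _ hp)⟩
  refine ⟨j.opensRange, hxj, ?_⟩
  have h1 : Smooth (j ≫ f) := by
    rw [Category.assoc, ← hφ, specMap_over, HasRingHomProperty.Spec_iff (P := @Smooth)]
    exact RingHom.smooth_algebraMap.2 hrs
  have h2 : j.opensRange.ι ≫ f = j.isoOpensRange.inv ≫ j ≫ f := by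
    rw [← Category.assoc, Scheme.Hom.isoOpensRange_inv_comp]
  rw [h2]
  infer_instance

end Smooth

/-! ### The special fibre as two copies of a symplectic space. -/

section Omega

variable (m : ℕ) (R : Type u) [CommRing R]

/-- The standard symplectic form. -/
def omega : LinearMap.BilinForm R (Fin (2 * m) → R) :=
  LinearMap.mk₂ R (fun x y => ∑ i, (hsgn i : R) * (x i * y i.rev))
    (by intro v v' w; rw [← Finset.sum_add_distrib]; congr 1; ext i; simp only [Pi.add_apply]; ring)
    (by intro c v w; rw [smul_eq_mul, Finset.mul_sum]; congr 1; ext i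
        simp only [Pi.smul_apply, smul_eq_mul]; ring)
    (by intro v v' w; rw [← Finset.sum_add_distrib]; congr 1; ext i; simp only [Pi.add_apply]; ring)
    (by intro c v w; rw [smul_eq_mul, Finset.mul_sum]; congr 1; ext i
        simp only [Pi.smul_apply, smul_eq_mul]; ring)

/-- The first component of a vector. -/
def ypart : (Idx m → R) →ₗ[R] (Fin (2 * m) → R) := LinearMap.funLeft R R Sum.inl

/-- The second component of a vector, twisted so that `t` maps `(y, u)` to `(u, 0)`. -/
def upart : (Idx m → R) →ₗ[R] (Fin (2 * m) → R) := srev m R ∘ₗ LinearMap.funLeft R R Sum.inr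

/-- The vector with given components. -/
def pairVec : (Fin (2 * m) → R) × (Fin (2 * m) → R) →ₗ[R] (Idx m → R) where
  toFun p := Sum.elim p.1 (-srev m R p.2)
  map_add' p q := by ext (i | i) <;> simp; ring
  map_smul' c p := by ext (i | i) <;> simp

variable {m R}

theorem omega_apply (x y : Fin (2 * m) → R) :
    omega m R x y = ∑ i, (hsgn i : R) * (x i * y i.rev) := rfl

theorem omega_neg_swap (x y : Fin (2 * m) → R) : omega m R x y = -omega m R y x := by
  rw [omega_apply, omega_apply, ← Equiv.sum_comp Fin.revPerm, ← Finset.sum_neg_distrib]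
  refine Finset.sum_congr rfl fun i _ => ?_
  rw [Fin.revPerm_apply, hsgn_rev, Fin.rev_rev]
  push_cast
  ring

@[simp] theorem ypart_pairVec (y u : Fin (2 * m) → R) : ypart m R (pairVec m R (y, u)) = y := rfl

@[simp] theorem upart_pairVec (y u : Fin (2 * m) → R) : upart m R (pairVec m R (y, u)) = u := by
  change srev m R (-srev m R u) = u
  rw [map_neg, srev_srev, neg_neg]

theorem pairVec_parts (v : Idx m → R) : pairVec m R (ypart m R v, upart m R v) = v := by
  ext (i | i)
  · rfl
  · change -srev m R (srev m R (v ∘ Sum.inr)) i = _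
    rw [srev_srev, Pi.neg_apply, neg_neg]
    rfl

theorem vec_ext {v w : Idx m → R} (h1 : ypart m R v = ypart m R w)
    (h2 : upart m R v = upart m R w) : v = w := by
  rw [← pairVec_parts v, h1, h2, pairVec_parts]

theorem sum_mul_srev (x u : Fin (2 * m) → R) : ∑ i, x i * srev m R u i = -omega m R x u := by
  rw [omega_apply, ← Finset.sum_neg_distrib]
  refine Finset.sum_congr rfl fun i _ => ?_
  rw [srev_apply]; ring

/-- If `g` has zero `u`-part, its pairing with `v` is `ω(y_g, u_v)`, and `t v = (u_v, 0)`. Thus `ω`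
on `{u = 0}` is the modified pairing, and orthogonality of `G` to `F` is orthogonality of `G` to `t
F` for `ω`. -/
theorem hypForm_eq_omega (v w : Idx m → R) : hypForm m R v w =
    omega m R (ypart m R v) (upart m R w) + omega m R (ypart m R w) (upart m R v) := by
  have h (x : Idx m → R) : (fun i => x (.inr i)) = -srev m R (upart m R x) := by
    change _ = -srev m R (srev m R (x ∘ Sum.inr))
    rw [srev_srev, neg_neg]
    rfl
  have h1 (x y : Idx m → R) : ∑ i, x (.inl i) * y (.inr i) =
      omega m R (ypart m R x) (upart m R y) := by
    rw [← neg_inj, ← sum_mul_srev, ← Finset.sum_neg_distrib]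
    refine Finset.sum_congr rfl fun i _ => ?_
    rw [congrFun (h y) i, Pi.neg_apply]
    change -(x (.inl i) * -_) = x (.inl i) * _
    ring
  rw [hypForm_apply, Finset.sum_add_distrib, h1, ← h1 w v]
  congr 1
  exact Finset.sum_congr rfl fun i _ => mul_comm _ _

theorem coordT_zero (v : Idx m → R) : coordT m R 0 v = pairVec m R (upart m R v, 0) := by
  ext (i | i)
  · change srev m R (v ∘ Sum.inr) i - (0 : R) * _ = _
    rw [zero_mul, sub_zero]
    rfl
  · change (0 : R) * _ = -srev m R 0 i
    rw [map_zero, zero_mul, Pi.zero_apply, neg_zero]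

theorem coordPlus_zero (v : Idx m → R) : coordPlus m (0 : R) v = pairVec m R (upart m R v, 0) := by
  rw [coordPlus, zero_smul, add_zero, coordT_zero]

theorem coordMinus_zero (v : Idx m → R) :
    coordMinus m (0 : R) v = pairVec m R (upart m R v, 0) := by
  rw [coordMinus, zero_smul, sub_zero, coordT_zero]

theorem coordMinus_eq_zero_iff (v : Idx m → R) : coordMinus m (0 : R) v = 0 ↔ upart m R v = 0 := by
  rw [coordMinus_zero]
  constructor
  · intro h
    have := congrArg (ypart m R) h
    rwa [ypart_pairVec, map_zero] at this
  · intro h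
    rw [h, show ((0 : Fin (2 * m) → R), (0 : Fin (2 * m) → R)) = 0 from rfl, map_zero]

section Map

variable {R' : Type u} [CommRing R'] (f : R →+* R')

theorem map_omega (x y : Fin (2 * m) → R) :
    f (omega m R x y) = omega m R' (f ∘ x) (f ∘ y) := by
  simp [omega_apply]

theorem map_ypart (v : Idx m → R) : f ∘ ypart m R v = ypart m R' (f ∘ v) := rfl

theorem map_upart (v : Idx m → R) : f ∘ upart m R v = upart m R' (f ∘ v) :=
  map_srev f _

theorem map_pairVec (y u : Fin (2 * m) → R) :
    f ∘ pairVec m R (y, u) = pairVec m R' (f ∘ y, f ∘ u) :=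
  vec_ext (by rw [← map_ypart, ypart_pairVec, ypart_pairVec])
    (by rw [← map_upart, upart_pairVec, upart_pairVec])

end Map

/-- The vector representing a coordinate with respect to the symplectic form. -/
def coordVec (k : Idx m) : Fin (2 * m) → R :=
  Sum.elim (fun i => (hsgn i.rev : R) • Pi.single i.rev 1) (fun _ => 0) k

theorem omega_coordVec {g : Idx m → R} (hg : upart m R g = 0) (k : Idx m) :
    omega m R (coordVec k) (ypart m R g) = g k := by
  rcases k with i | i
  · rw [coordVec, Sum.elim_inl, map_smul, LinearMap.smul_apply, omega_apply,
      Finset.sum_eq_single i.rev]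
    · rw [Pi.single_eq_same, Fin.rev_rev, one_mul, smul_eq_mul, ← mul_assoc, ← Int.cast_mul,
        hsgn_mul_self, Int.cast_one, one_mul]
      rfl
    · intro j _ hj
      simp [hj]
    · simp
  · have h : srev m R (srev m R (g ∘ Sum.inr)) = 0 := by
      rw [show srev m R (g ∘ Sum.inr) = 0 from hg, map_zero]
    rw [srev_srev, neg_eq_zero] at h
    rw [coordVec, Sum.elim_inr, map_zero, LinearMap.zero_apply]
    exact (congrFun h i).symm

/-- Families of vectors of `{u = 0}` with an invertible maximal minor have dual families. -/
theorem exists_omega_dual {s : ℕ} {b : Fin s → Idx m} {g : Fin s → Idx m → R}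
    (hg : IsUnit (Matrix.of fun i j => g i (b j)).det) (hu : ∀ i, upart m R (g i) = 0) :
    ∃ d : Fin s → Fin (2 * m) → R, ∀ k j,
      omega m R (d k) (ypart m R (g j)) = if k = j then 1 else 0 := by
  let N : Matrix (Fin s) (Fin s) R := Matrix.of fun i j => g i (b j)
  refine ⟨fun k => ∑ i, N⁻¹ i k • coordVec (b i), fun k j => ?_⟩
  have h := congrFun (congrFun (N.mul_nonsing_inv hg) j) k
  rw [Matrix.mul_apply, Matrix.one_apply] at h
  rw [map_sum, LinearMap.sum_apply]
  refine Eq.trans (Finset.sum_congr rfl fun i _ => ?_) (h.trans ?_)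
  · rw [map_smul, LinearMap.smul_apply, omega_coordVec (hu j), smul_eq_mul, mul_comm]
    rfl
  · simp only [eq_comm]

end Omega

section Frames

variable {m s : ℕ} {R R' : Type u} [CommRing R] [CommRing R']

theorem exists_of_mem_push {W : Type} {f : R →+* R'} (hf : Function.Surjective f)
    {P : Submodule R (W → R)} {x : W → R'} (hx : x ∈ push f P) : ∃ v ∈ P, f ∘ v = x := by
  induction hx using Submodule.span_induction with
  | mem x hx => exact hx
  | zero => exact ⟨0, zero_mem _, comp_zero f⟩
  | add x y _ _ h h' =>
    obtain ⟨v, hv, rfl⟩ := h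
    obtain ⟨w, hw, rfl⟩ := h'
    exact ⟨_, add_mem hv hw, comp_add f v w⟩
  | smul c x _ h =>
    obtain ⟨v, hv, rfl⟩ := h
    obtain ⟨c, rfl⟩ := hf c
    exact ⟨_, P.smul_mem c hv, comp_smul f c v⟩

/-- The minor of `w` is the transition matrix `P` times a minor of `v`, so `P` is invertible as soon
as the minor of `w` is. -/
theorem span_eq_of_isUnit_det {W : Type} [Finite W] {d : ℕ} {a a' : Fin d → W}
    {v w : Fin d → W → R} (hv : Normalized a' v) (hw : ∀ i, w i ∈ Submodule.span R (Set.range v))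
    (h : IsUnit (Matrix.of fun i j => w i (a j)).det) :
    Submodule.span R (Set.range w) = Submodule.span R (Set.range v) := by
  refine le_antisymm (Submodule.span_le.2 (by rintro _ ⟨i, rfl⟩; exact hw i)) ?_
  let P : Matrix (Fin d) (Fin d) R := Matrix.of fun i j => w i (a' j)
  have h1 (i) : w i = ∑ j, P i j • v j := hv.eq_sum (hw i)
  have h2 : (Matrix.of fun i j => w i (a j)) = P * Matrix.of fun i j => v i (a j) := by
    ext i j
    rw [Matrix.mul_apply]
    exact (congrFun (h1 i) (a j)).trans (by simp [Finset.sum_apply])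
  have hP : IsUnit P.det := by
    rw [h2, Matrix.det_mul] at h
    exact isUnit_of_mul_isUnit_left h
  rw [Submodule.span_le]
  rintro _ ⟨i, rfl⟩
  have h3 : v i = ∑ k, P⁻¹ i k • w k := by
    simp only [h1, Finset.smul_sum, smul_smul]
    rw [Finset.sum_comm]
    simp only [← Finset.sum_smul, ← Matrix.mul_apply, P.nonsing_inv_mul hP, Matrix.one_apply,
      ite_smul, one_smul, zero_smul, Finset.sum_ite_eq, Finset.mem_univ, if_true]
  rw [h3]
  exact sum_mem fun k _ => Submodule.smul_mem _ _ (Submodule.subset_span ⟨k, rfl⟩)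

namespace RedPoint

variable (x : RedPoint m s R)

theorem upart_of_mem_gil {g : Idx m → R} (hg : g ∈ x.gil) : upart m R g = 0 :=
  (coordMinus_eq_zero_iff g).1 (x.splConds.conds.minus g hg)

theorem upart_mem_gil {v : Idx m → R} (hv : v ∈ x.fil) :
    pairVec m R (upart m R v, 0) ∈ x.gil := by
  rw [← coordPlus_zero]
  exact x.splConds.conds.plus v hv

theorem gil_le_fil : x.gil ≤ x.fil := x.splConds.conds.le

/-- Only one term of `hypForm_eq_omega` survives, because `g` has zero `u`-part. This is the
inclusion `t F ⊆ G^⊥'`, hence the source of `h ≤ l`. -/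
theorem omega_of_mem {g v : Idx m → R} (hg : g ∈ x.gil) (hv : v ∈ x.fil) :
    omega m R (ypart m R g) (upart m R v) = 0 := by
  have h := x.splConds.conds.iso g (x.gil_le_fil hg) v hv
  rwa [hypForm_eq_omega, x.upart_of_mem_gil hg, map_zero, add_zero] at h

/-- By maximality `F` contains the whole orthogonal complement of `t F` in `{u = 0}`. The
obstruction argument uses this for a vector outside `G^⊥'`. -/
theorem pairVec_mem_fil {y : Fin (2 * m) → R}
    (h : ∀ v ∈ x.fil, omega m R y (upart m R v) = 0) : pairVec m R (y, 0) ∈ x.fil := by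
  refine x.splConds.dual _ fun v hv => ?_
  rw [hypForm_eq_omega, upart_pairVec, map_zero, zero_add, ypart_pairVec, h v hv]

theorem pairVec_ypart_of_mem_gil {g : Idx m → R} (hg : g ∈ x.gil) :
    pairVec m R (ypart m R g, 0) = g := by
  conv_rhs => rw [← pairVec_parts g, x.upart_of_mem_gil hg]

theorem exists_frames [IsLocalRing R] : ∃ (a : Fin (2 * m) → Idx m) (b : Fin s → Idx m)
    (v : Fin (2 * m) → Idx m → R) (g : Fin s → Idx m → R), FrameEqs s 0 a b v g ∧
      x.fil = Submodule.span R (Set.range v) ∧ x.gil = Submodule.span R (Set.range g) := by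
  obtain ⟨r, hr, h⟩ := x.splConds.exists_hasFrames (IsLocalRing.closedPoint R)
  have hu : IsUnit r := by
    by_contra hu
    exact hr ((IsLocalRing.mem_maximalIdeal r).2 hu)
  let f : Localization.Away r →+* R := IsLocalization.Away.lift (g := RingHom.id R) r hu
  have hf : f.comp (algebraMap R _) = RingHom.id R := IsLocalization.Away.lift_comp r hu
  have h1 := h.push f
  rw [← push_comp, ← push_comp, hf, push_id, push_id, map_zero, map_zero] at h1
  exact h1

theorem exists_of_frames {a : Fin (2 * m) → Idx m} {b : Fin s → Idx m}
    {v : Fin (2 * m) → Idx m → R} {g : Fin s → Idx m → R} (h : FrameEqs s 0 a b v g) :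
    ∃ z : RedPoint m s R, z.fil = Submodule.span R (Set.range v) ∧
      z.gil = Submodule.span R (Set.range g) := by
  have h' : HasFrames s (algebraMap R R 0) (Submodule.span R (Set.range v))
      (Submodule.span R (Set.range g)) := ⟨a, b, v, g, by rwa [map_zero], rfl, rfl⟩
  have h'' := (LocPoint.ofFrames (O := R) h').splConds
  rw [map_zero] at h''
  exact ⟨⟨_, _, h''⟩, rfl, rfl⟩

/-- Lifts of frames satisfying all equations except for the spin condition define lifts of points. -/
theorem exists_lift_of_frames [IsLocalRing R] (h2 : IsUnit (2 : R)) (f : R →+* R') [IsLocalHom f]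
    (x : RedPoint m s R') {a : Fin (2 * m) → Idx m} {b : Fin s → Idx m}
    {v : Fin (2 * m) → Idx m → R} {g : Fin s → Idx m → R}
    (hv : IsUnit (Matrix.of fun i j => v i (a j)).det)
    (hg : IsUnit (Matrix.of fun i j => g i (b j)).det)
    (hiso : ∀ i j, hypForm m R (v i) (v j) = 0) (hgu : ∀ i, upart m R (g i) = 0)
    (hgv : ∀ i j, hypForm m R (g i) (v j) = 0)
    (hmem : ∀ i, pairVec m R (upart m R (v i), 0) ∈ Submodule.span R (Set.range g))
    (hF : Submodule.span R' (Set.range fun i => f ∘ v i) = x.fil)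
    (hG : Submodule.span R' (Set.range fun i => f ∘ g i) = x.gil) :
    ∃ z : RedPoint m s R, z.map f = x ∧ z.fil = Submodule.span R (Set.range v) ∧
      z.gil = Submodule.span R (Set.range g) := by
  obtain ⟨v', hv', hvv⟩ := exists_normalized hv
  obtain ⟨g', hg', hgg⟩ := exists_normalized hg
  have hiso' : ∀ p ∈ Submodule.span R (Set.range v), ∀ q ∈ Submodule.span R (Set.range v),
      hypForm m R p q = 0 := by
    intro p hp q hq
    obtain ⟨c, rfl⟩ := (Submodule.mem_span_range_iff_exists_fun R).1 hp
    obtain ⟨c', rfl⟩ := (Submodule.mem_span_range_iff_exists_fun R).1 hq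
    simp [LinearMap.sum_apply, hiso]
  have hvi (i) : v' i ∈ Submodule.span R (Set.range v) := hvv ▸ Submodule.subset_span ⟨i, rfl⟩
  have hd := hv'.isDualFrame fun i j => hiso' _ (hvi i) _ (hvi j)
  -- A vector orthogonal to an isotropic frame that has a dual frame lies in its span, so `hgv`
  -- gives the inclusion.
  have hle : Submodule.span R (Set.range g) ≤ Submodule.span R (Set.range v) := by
    rw [Submodule.span_le]
    rintro _ ⟨i, rfl⟩
    rw [← hvv, SetLike.mem_coe, hd.mem_span_iff]
    intro j
    obtain ⟨c, hc⟩ := (Submodule.mem_span_range_iff_exists_fun R).1 (hvi j)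
    rw [← hc, map_sum, LinearMap.sum_apply]
    refine Finset.sum_eq_zero fun k _ => ?_
    rw [map_smul, LinearMap.smul_apply, hypForm_comm, hgv, smul_zero]
  have hspin : fullDet (dualCoord a) v' = (((-1) ^ s : ℤˣ) : ℤ) := by
    have e1 := hd.fullDet_mul_self
    have hε : ((((-1) ^ s : ℤˣ) : ℤ) : R) * (((-1) ^ s : ℤˣ) : ℤ) = 1 := by
      rw [← Int.cast_mul, ← Units.val_mul, Int.units_mul_self]; simp
    have e2 : f (fullDet (dualCoord a) v') = (((-1) ^ s : ℤˣ) : ℤ) := by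
      rw [map_fullDet]
      simp only [map_dualCoord]
      have hn := hv'.map f
      have hsp : Submodule.span R' (Set.range fun i => f ∘ v' i) = x.fil := by
        rw [← push_span_range, hvv, push_span_range, hF]
      have hd' := hn.isDualFrame fun i j => by rw [← map_hypForm, hd.iso, map_zero]
      refine (hd'.spin_iff _).1 ?_
      rw [hsp]
      exact x.splConds.conds.spin
    -- The determinant and the sign both have square 1, so the product of their difference and their
    -- sum vanishes. Along `f` the sum becomes twice a sign, a unit, hence it is a unit and the
    -- difference is zero.
    have hu : IsUnit (fullDet (dualCoord a) v' + (((-1) ^ s : ℤˣ) : ℤ)) := by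
      refine isUnit_of_map_unit f _ ?_
      rw [map_add, e2, map_intCast, ← two_mul]
      have h2' := h2.map f
      rw [map_ofNat] at h2'
      refine h2'.mul (IsUnit.of_mul_eq_one ((((-1) ^ s : ℤˣ) : ℤ) : R') ?_)
      rw [← Int.cast_mul, ← Units.val_mul, Int.units_mul_self]; simp
    rw [← sub_eq_zero, ← hu.mul_right_eq_zero]
    linear_combination e1 - hε
  have hfr : FrameEqs s (0 : R) a b v' g' := by
    rw [frameEqs_iff, hvv, hgg]
    refine ⟨hv', hg', hle, hiso', fun p hp => ?_, fun p hp => ?_, ?_⟩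
    · rw [coordPlus_zero]
      obtain ⟨c, rfl⟩ := (Submodule.mem_span_range_iff_exists_fun R).1 hp
      suffices h : Submodule.span R (Set.range v) ≤ (Submodule.span R (Set.range g)).comap
          (pairVec m R ∘ₗ LinearMap.inl R _ _ ∘ₗ upart m R) from h hp
      rw [Submodule.span_le]
      rintro _ ⟨i, rfl⟩
      exact hmem i
    · rw [coordMinus_eq_zero_iff]
      obtain ⟨c, rfl⟩ := (Submodule.mem_span_range_iff_exists_fun R).1 hp
      simp [hgu]
    · rw [← hvv]
      exact (hd.spin_iff _).2 hspin
  obtain ⟨z, hz1, hz2⟩ := exists_of_frames hfr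
  rw [hvv] at hz1
  rw [hgg] at hz2
  refine ⟨z, ext_iff'.2 ⟨?_, ?_⟩, hz1, hz2⟩
  · change push f z.fil = _
    rw [hz1, push_span_range, hF]
  · change push f z.gil = _
    rw [hz2, push_span_range, hG]

end RedPoint
end Frames

/-! ### Adapted bases and the parity of the two invariants. -/

section Parity

variable {m s h k : ℕ} {R : Type u} [CommRing R]

/-- The determinant of the permutation swapping two copies of a part of a finite set. -/
theorem det_swap_part {n : ℕ} (e : Fin h ⊕ Fin k ≃ Fin n) :
    (Matrix.fromBlocks
      (Matrix.diagonal fun i => if (e.symm i).isLeft then (0 : R) else 1)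
      (Matrix.diagonal fun i => if (e.symm i).isLeft then (1 : R) else 0)
      (Matrix.diagonal fun i => if (e.symm i).isLeft then (1 : R) else 0)
      (Matrix.diagonal fun i => if (e.symm i).isLeft then (0 : R) else 1)).det = (-1) ^ h := by
  set p : Matrix (Fin n) (Fin n) R := Matrix.diagonal fun i => if (e.symm i).isLeft then 0 else 1
    with hp
  set q : Matrix (Fin n) (Fin n) R := Matrix.diagonal fun i => if (e.symm i).isLeft then 1 else 0
    with hq
  have hpq : p + q = 1 := by
    rw [hp, hq, Matrix.diagonal_add, ← Matrix.diagonal_one]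
    congr 1
    funext i
    split_ifs <;> simp
  -- Adding the second block row to the first yields the block row `(1 1)`. The Schur complement is
  -- then `p - q`, a diagonal matrix with `h` entries `-1` and all others `1`.
  have h1 : Matrix.fromBlocks 1 1 0 1 * Matrix.fromBlocks p q q p = Matrix.fromBlocks 1 1 q p := by
    rw [Matrix.fromBlocks_multiply]
    simp only [one_mul, zero_mul, zero_add, hpq, add_comm q p]
  have h2 := congrArg Matrix.det h1
  rw [Matrix.det_mul, Matrix.det_fromBlocks_zero₂₁, Matrix.det_one, one_mul, one_mul,
    Matrix.det_fromBlocks_one₁₁, mul_one] at h2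
  rw [h2, hp, hq, Matrix.diagonal_sub, Matrix.det_diagonal, ← Equiv.prod_comp e,
    Fintype.prod_sum_type]
  simp

/-- The sign of an adapted Lagrangian frame. -/
theorem exists_sign_of_adapted (e : Fin h ⊕ Fin k ≃ Fin (2 * m)) {v : Fin (2 * m) → Idx m → R}
    (hv : ∀ i j, hypForm m R (v i) (v j) = 0) (h0 : ∀ j, upart m R (v (e (.inr j))) = 0)
    {p : Fin h → Fin (2 * m) → R} {q : Fin k → Fin (2 * m) → R}
    (hp : ∀ i j, omega m R (p i) (upart m R (v (e (.inl j)))) = if i = j then 1 else 0)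
    (hq : ∀ i j, omega m R (ypart m R (v (e (.inr i)))) (q j) = if i = j then 1 else 0) :
    ∃ x, gramDet x v = 1 ∧ fullDet x v = (-1) ^ h := by
  let x' : Fin h ⊕ Fin k → Idx m → R :=
    Sum.elim (fun i => pairVec m R (p i, 0)) fun j => pairVec m R (0, q j)
  let x : Fin (2 * m) → Idx m → R := fun i => x' (e.symm i)
  refine ⟨x, ?_, ?_⟩
  · rw [gramDet_apply, ← Matrix.det_submatrix_equiv_self e]
    have : (Matrix.of fun i j => hypForm m R (v i) (x j)).submatrix e e = Matrix.fromBlocks 1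
        (Matrix.of fun i j => omega m R (ypart m R (v (e (.inl i)))) (q j)) 0 1 := by
      ext (i | i) (j | j)
      · simp [x, x', hypForm_eq_omega, hp, Matrix.one_apply, eq_comm]
      · simp [x, x', hypForm_eq_omega]
      · simp [x, x', hypForm_eq_omega, h0]
      · simp [x, x', hypForm_eq_omega, hq, Matrix.one_apply]
    rw [this, Matrix.det_fromBlocks_zero₂₁, Matrix.det_one, Matrix.det_one, one_mul]
  · let A : Fin h ⊕ Fin k → Fin (2 * m) → R := Sum.elim p fun j => ypart m R (v (e (.inr j)))
    let U : Fin h ⊕ Fin k → Fin (2 * m) → R := Sum.elim (fun i => upart m R (v (e (.inl i)))) q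
    let A' : Matrix (Fin (2 * m)) (Fin (2 * m)) R := Matrix.of fun i => A (e.symm i)
    let C : Matrix (Fin (2 * m)) (Fin (2 * m)) R := Matrix.of fun i => -srev m R (U (e.symm i))
    let B : Matrix (Fin (2 * m)) (Fin (2 * m)) R := Matrix.of fun i =>
      Sum.elim (fun i => ypart m R (v (e (.inl i)))) (fun _ => 0) (e.symm i)
    have hAC : A'.det * C.det = 1 := by
      rw [← Matrix.det_transpose C, ← Matrix.det_mul, ← Matrix.det_submatrix_equiv_self e]
      have hω (i j) : (A' * C.transpose) (e i) (e j) = omega m R (A i) (U j) := by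
        rw [Matrix.mul_apply]
        simp only [A', C, Matrix.transpose_apply, Matrix.of_apply, Equiv.symm_apply_apply,
          Pi.neg_apply, mul_neg]
        rw [Finset.sum_neg_distrib, sum_mul_srev, neg_neg]
      have : (A' * C.transpose).submatrix e e = Matrix.fromBlocks 1
          (Matrix.of fun i j => omega m R (p i) (q j)) 0 1 := by
        ext (i | i) (j | j)
        · rw [Matrix.submatrix_apply, hω]
          simp [A, U, hp, Matrix.one_apply]
        · rw [Matrix.submatrix_apply, hω]
          simp [A, U]
        · rw [Matrix.submatrix_apply, hω]
          have := hv (e (.inr i)) (e (.inl j))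
          rw [hypForm_eq_omega, h0, map_zero, add_zero] at this
          simp [A, U, this]
        · rw [Matrix.submatrix_apply, hω]
          simp [A, U, hq, Matrix.one_apply]
      rw [this, Matrix.det_fromBlocks_zero₂₁, Matrix.det_one, Matrix.det_one, one_mul]
    -- Exchanging each of the first `h` frame vectors with its dual vector, at the cost of a sign
    -- each, leaves only vectors with `u = 0` in the upper half. The result is block triangular, and
    -- its diagonal blocks have inverse determinants by `hAC`.
    have hM : (Matrix.fromBlocks
        (Matrix.diagonal fun i => if (e.symm i).isLeft then (0 : R) else 1)
        (Matrix.diagonal fun i => if (e.symm i).isLeft then (1 : R) else 0)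
        (Matrix.diagonal fun i => if (e.symm i).isLeft then (1 : R) else 0)
        (Matrix.diagonal fun i => if (e.symm i).isLeft then (0 : R) else 1)) *
        (Matrix.of (Sum.elim v x) : Matrix (Idx m) (Idx m) R) = Matrix.fromBlocks A' 0 B C := by
      have hrow (i) (l : Idx m) : (Matrix.of (Sum.elim v x) : Matrix (Idx m) (Idx m) R) i l =
          Sum.elim v x i l := rfl
      have hparts (w : Idx m → R) (l : Idx m) :
          w l = Sum.elim (ypart m R w) (-srev m R (upart m R w)) l :=
        (congrFun (pairVec_parts w) l).symm
      ext i l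
      rw [Matrix.mul_apply, Fintype.sum_sum_type]
      simp only [hrow, Sum.elim_inl, Sum.elim_inr]
      rcases i with i | i
      all_goals
        obtain ⟨i, rfl⟩ := e.surjective i
        simp only [Matrix.fromBlocks_apply₁₁, Matrix.fromBlocks_apply₁₂, Matrix.fromBlocks_apply₂₁,
          Matrix.fromBlocks_apply₂₂, Matrix.diagonal_apply, ite_mul, zero_mul, Finset.sum_ite_eq,
          Finset.mem_univ, if_true, Equiv.symm_apply_apply, hparts (v _) l, hparts (x _) l]
        rcases i with i | i <;> rcases l with l | l <;>
          simp [A', B, C, A, U, x, x', h0]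
    have h1 := congrArg Matrix.det hM
    rw [Matrix.det_mul, det_swap_part, Matrix.det_fromBlocks_zero₁₂, hAC] at h1
    change (Matrix.of (Sum.elim v x)).det = _
    have h2 : ((-1 : R) ^ h) * (-1) ^ h = 1 := by rw [← mul_pow]; simp
    linear_combination (-1) ^ h * h1 - (Matrix.of (Sum.elim v x) : Matrix (Idx m) (Idx m) R).det * h2

end Parity

section Linear

variable {K V W : Type u} [Field K] [AddCommGroup V] [Module K V] [AddCommGroup W] [Module K W]

theorem span_coe_basis {P : Submodule K V} {ι : Type*} (b : Module.Basis ι K P) :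
    Submodule.span K (Set.range fun i => (b i : V)) = P := by
  have := congrArg (Submodule.map P.subtype) b.span_eq
  rw [Submodule.map_span, ← Set.range_comp, Submodule.map_top, Submodule.range_subtype] at this
  exact this

theorem linearIndependent_coe_basis {P : Submodule K V} {ι : Type*} (b : Module.Basis ι K P) :
    LinearIndependent K fun i => (b i : V) :=
  b.linearIndependent.map' P.subtype (Submodule.ker_subtype _)

/-- Bases adapted to a linear map. -/
theorem exists_adapted_basis [FiniteDimensional K V] (φ : V →ₗ[K] W) :
    ∃ (k : ℕ) (_ : Module.finrank K (LinearMap.range φ) + k = Module.finrank K V)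
      (v₁ : Fin (Module.finrank K (LinearMap.range φ)) → V) (v₂ : Fin k → V),
      LinearIndependent K (Sum.elim v₁ v₂) ∧ LinearIndependent K (fun i => φ (v₁ i)) ∧
        Submodule.span K (Set.range fun i => φ (v₁ i)) = LinearMap.range φ ∧
          ∀ i, φ (v₂ i) = 0 := by
  let b₁ := Module.finBasis K (LinearMap.range φ)
  let b₂ := Module.finBasis K (LinearMap.ker φ)
  have hlift (i) : ∃ v, φ v = b₁ i := (b₁ i).2
  choose v₁ hv₁ using hlift
  have hU : ∀ i, φ (b₂ i) = 0 := fun i => (b₂ i).2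
  have hli₁ := linearIndependent_coe_basis b₁
  have hli₂ := linearIndependent_coe_basis b₂
  refine ⟨_, LinearMap.finrank_range_add_finrank_ker φ, v₁, fun i => b₂ i, ?_, ?_, ?_, hU⟩
  · rw [Fintype.linearIndependent_iff] at hli₁ hli₂ ⊢
    intro c hc
    rw [Fintype.sum_sum_type] at hc
    simp only [Sum.elim_inl, Sum.elim_inr] at hc
    have h1 : ∀ i, c (.inl i) = 0 := by
      refine hli₁ _ ?_
      have := congrArg φ hc
      simpa [map_sum, hv₁, hU] using this
    simp only [h1, zero_smul, Finset.sum_const_zero, zero_add] at hc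
    rintro (i | i)
    · exact h1 i
    · exact hli₂ _ hc i
  · simpa only [hv₁] using hli₁
  · simp only [hv₁]
    exact span_coe_basis b₁

/-- Completion of a basis of a subspace. -/
theorem exists_compl_basis [FiniteDimensional K V] (P : Submodule K V) : ∃ (j : ℕ)
    (_ : Module.finrank K P + j = Module.finrank K V) (g : Fin j → V), LinearIndependent K g ∧
      IsCompl P (Submodule.span K (Set.range g)) := by
  obtain ⟨Q, hQ⟩ := Submodule.exists_isCompl P
  let b := Module.finBasis K Q
  refine ⟨_, Submodule.finrank_add_eq_of_isCompl hQ, fun i => b i, linearIndependent_coe_basis b, ?_⟩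
  rwa [span_coe_basis b]

end Linear

namespace RedPoint

variable {m s : ℕ}

section Sub

variable {R : Type u} [CommRing R] (x : RedPoint m s R)

/-- The submodule `t F`. -/
def tfil : Submodule R (Idx m → R) := x.fil.map (coordT m R 0)

/-- The orthogonal complement of `G` under the modified pairing. -/
def gilPerp : Submodule R (Idx m → R) where
  carrier := {w | upart m R w = 0 ∧ ∀ g ∈ x.gil, omega m R (ypart m R g) (ypart m R w) = 0}
  add_mem' {v w} hv hw := ⟨by rw [map_add, hv.1, hw.1, add_zero], fun g hg => by
    rw [map_add, map_add, hv.2 g hg, hw.2 g hg, add_zero]⟩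
  zero_mem' := ⟨map_zero _, fun _ _ => by rw [map_zero, map_zero]⟩
  smul_mem' c w hw := ⟨by rw [map_smul, hw.1, smul_zero], fun g hg => by
    rw [map_smul, map_smul, hw.2 g hg, smul_zero]⟩

/-- The radical of the modified pairing on `G`. -/
def rad : Submodule R (Idx m → R) := x.gil ⊓ x.gilPerp

theorem tfil_le_rad : x.tfil ≤ x.rad := by
  rintro _ ⟨v, hv, rfl⟩
  rw [coordT_zero]
  exact ⟨x.upart_mem_gil hv, upart_pairVec _ _, fun g hg => x.omega_of_mem hg hv⟩

end Sub

variable {K : Type u} [Field K] (x : RedPoint m s K)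

theorem finrank_fil : Module.finrank K x.fil = 2 * m := by
  obtain ⟨a, b, v, g, h, h1, h2⟩ := x.exists_frames
  rw [h1, finrank_span_eq_card (Normalized.linearIndependent h.norm_v), Fintype.card_fin]

theorem finrank_gil : Module.finrank K x.gil = s := by
  obtain ⟨a, b, v, g, h, h1, h2⟩ := x.exists_frames
  rw [h2, finrank_span_eq_card (Normalized.linearIndependent h.norm_g), Fintype.card_fin]

theorem finrank_rad_le : Module.finrank K x.rad ≤ s :=
  (Submodule.finrank_mono inf_le_left).trans x.finrank_gil.le

/-- Adapted bases of `F` over a field. -/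
theorem exists_adapted_fil {h : ℕ} (hh : Module.finrank K x.tfil = h) :
    ∃ (k : ℕ) (_ : h + k = 2 * m) (v₁ : Fin h → Idx m → K) (v₂ : Fin k → Idx m → K),
      (∀ i, v₁ i ∈ x.fil) ∧ (∀ i, v₂ i ∈ x.fil) ∧ LinearIndependent K (Sum.elim v₁ v₂) ∧
        LinearIndependent K (fun i => coordT m K 0 (v₁ i)) ∧
          (Submodule.span K (Set.range fun i => coordT m K 0 (v₁ i)) = x.tfil) ∧
          ∀ i, upart m K (v₂ i) = 0 := by
  subst hh
  let φ : x.fil →ₗ[K] (Idx m → K) := (coordT m K 0).domRestrict x.fil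
  have hrange : LinearMap.range φ = x.tfil := by
    rw [LinearMap.range_domRestrict]; rfl
  obtain ⟨k, hk, v₁, v₂, h1, h2, h3, h4⟩ := exists_adapted_basis φ
  rw [x.finrank_fil] at hk
  rw [← hrange]
  refine ⟨k, hk, fun i => v₁ i, fun i => v₂ i, fun i => (v₁ i).2, fun i => (v₂ i).2, ?_, h2,
    h3, ?_⟩
  · have := h1.map' x.fil.subtype (Submodule.ker_subtype _)
    rwa [show (x.fil.subtype ∘ Sum.elim v₁ v₂) = Sum.elim (fun i => (v₁ i : Idx m → K))
      (fun i => (v₂ i : Idx m → K)) from Sum.comp_elim _ _ _] at this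
  · intro i
    have := congrArg (ypart m K) (h4 i)
    rwa [show φ (v₂ i) = coordT m K 0 (v₂ i) from rfl, coordT_zero, ypart_pairVec, map_zero] at this

/-- The equivalence splitting an initial segment. -/
def splitEquiv {h k n : ℕ} (e : h + k = n) : Fin h ⊕ Fin k ≃ Fin n :=
  finSumFinEquiv.trans (finCongr e)

theorem exists_dual_of_linearIndependent {d : ℕ} {g : Fin d → Idx m → K}
    (hg : LinearIndependent K g) (hu : ∀ i, upart m K (g i) = 0) :
    ∃ y : Fin d → Fin (2 * m) → K, ∀ k j,
      omega m K (y k) (ypart m K (g j)) = if k = j then 1 else 0 := by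
  obtain ⟨b, hb⟩ := exists_det_ne_zero hg
  exact exists_omega_dual (isUnit_iff_ne_zero.2 hb) hu

/-- A frame of `F` adapted to `t` has sign `(-1)^h` by `exists_sign_of_adapted`, whereas the spin
condition prescribes `(-1)^s`; the two signs differ unless the exponents are congruent, as `2 ≠ 0`.
-/
theorem finrank_tfil_modEq (h2 : (2 : K) ≠ 0) : Module.finrank K x.tfil ≡ s [MOD 2] := by
  obtain ⟨k, hk, v₁, v₂, hv₁, hv₂, hli, hli', -, h0⟩ := x.exists_adapted_fil rfl
  let e := splitEquiv hk
  have hv : ∀ i, Sum.elim v₁ v₂ i ∈ x.fil := by rintro (i | i) <;> simp [hv₁, hv₂]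
  obtain ⟨p, hp⟩ := exists_dual_of_linearIndependent hli' fun i => by
    rw [coordT_zero, upart_pairVec]
  obtain ⟨q, hq⟩ := exists_dual_of_linearIndependent (hli.comp _ Sum.inr_injective) h0
  simp only [coordT_zero, ypart_pairVec] at hp
  obtain ⟨z, hz1, hz2⟩ := exists_sign_of_adapted e (v := fun i => Sum.elim v₁ v₂ (e.symm i))
    (fun i j => x.splConds.conds.iso _ (hv _) _ (hv _)) (by simpa using h0) (by simpa using hp)
    (q := fun j => -q j) (fun i j => by
      rw [Equiv.symm_apply_apply, Sum.elim_inr, map_neg, omega_neg_swap, neg_neg]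
      exact (hq j i).trans (by simp only [eq_comm]))
  have h3 := x.splConds.conds.spin _ (fun i => hv (e.symm i)) z
  rw [hz1, hz2] at h3
  have h4 : ((-1 : K)) ^ (s + Module.finrank K x.tfil) = 1 := by
    rw [pow_add]
    refine Eq.trans ?_ h3.symm
    push_cast
    rfl
  rcases Nat.even_or_odd (s + Module.finrank K x.tfil) with h5 | h5
  · obtain ⟨c, hc⟩ := h5
    unfold Nat.ModEq
    omega
  · rw [h5.neg_one_pow] at h4
    exact absurd (by linear_combination -h4) h2

/-- Complements of the radical. -/
theorem exists_compl_rad {l : ℕ} {g₁ : Fin l → Idx m → K} (hg₁ : LinearIndependent K g₁)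
    (hspan : Submodule.span K (Set.range g₁) = x.rad) :
    ∃ (j : ℕ) (_ : l + j = s) (g₂ : Fin j → Idx m → K), (∀ i, g₂ i ∈ x.gil) ∧
      LinearIndependent K (Sum.elim g₁ g₂) ∧
        (Matrix.of fun i i' => omega m K (ypart m K (g₂ i)) (ypart m K (g₂ i'))).det ≠ 0 := by
  obtain ⟨j, hj, g₂', hli₂', hQ⟩ := exists_compl_basis (x.rad.comap x.gil.subtype)
  have hle : x.rad ≤ x.gil := inf_le_left
  let g₂ := fun i => (g₂' i : Idx m → K)
  have hli₂ : LinearIndependent K g₂ := hli₂'.map' x.gil.subtype (Submodule.ker_subtype _)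
  set Q := Submodule.span K (Set.range g₂') with hQdef
  have hspan₂ : Submodule.span K (Set.range g₂) = Q.map x.gil.subtype := by
    rw [hQdef, Submodule.map_span, ← Set.range_comp]
    rfl
  have hdisj : Disjoint x.rad (Q.map x.gil.subtype) := by
    rw [Submodule.disjoint_def]
    rintro _ hw ⟨w, hw', rfl⟩
    rw [(Submodule.disjoint_def.1 hQ.disjoint) w hw hw', map_zero]
  have hli : LinearIndependent K (Sum.elim g₁ g₂) :=
    hg₁.sum_type hli₂ (by rw [hspan, hspan₂]; exact hdisj)
  have hdim : l + j = s := by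
    have h2 : Module.finrank K (x.rad.comap x.gil.subtype) = l := by
      rw [(Submodule.comapSubtypeEquivOfLe hle).finrank_eq, ← hspan, finrank_span_eq_card hg₁,
        Fintype.card_fin]
    rw [h2, x.finrank_gil] at hj
    exact hj
  refine ⟨j, hdim, g₂, fun i => (g₂' i).2, hli, fun hdet => ?_⟩
  -- A kernel vector of the Gram matrix would give a vector of the complement orthogonal to the
  -- complement and to the radical, hence to all of `G`; it would lie in the radical and so vanish.
  obtain ⟨c, hc, hc0⟩ := Matrix.exists_mulVec_eq_zero_iff.2 hdet
  have hw : ∑ j, c j • g₂ j ∈ Q.map x.gil.subtype := by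
    rw [← hspan₂]
    exact sum_mem fun j _ => Submodule.smul_mem _ _ (Submodule.subset_span ⟨j, rfl⟩)
  have hwG : ∑ j, c j • g₂ j ∈ x.gil := Submodule.map_subtype_le _ _ hw
  have hG : ∀ g ∈ x.gil, omega m K (ypart m K g) (ypart m K (∑ j, c j • g₂ j)) = 0 := by
    intro g hg
    obtain ⟨r, hr, z, hz, e⟩ := Submodule.mem_sup.1
      (hQ.sup_eq_top.ge (Submodule.mem_top (x := (⟨g, hg⟩ : x.gil))))
    obtain rfl : (r : Idx m → K) + z = g := congrArg Subtype.val e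
    have hr' : (r : Idx m → K) ∈ x.rad := hr
    have hz' : (z : Idx m → K) ∈ Submodule.span K (Set.range g₂) := by
      rw [hspan₂]; exact ⟨z, hz, rfl⟩
    rw [map_add, map_add, LinearMap.add_apply, omega_neg_swap, hr'.2.2 _ hwG, neg_zero, zero_add]
    clear e hz hr hr'
    generalize (z : Idx m → K) = z at hz' ⊢
    induction hz' using Submodule.span_induction with
    | mem z h =>
      obtain ⟨i, rfl⟩ := h
      have := congrFun hc0 i
      simp only [Matrix.mulVec, dotProduct, Matrix.of_apply, Pi.zero_apply] at this
      rw [map_sum, map_sum, ← this]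
      refine Finset.sum_congr rfl fun j _ => ?_
      rw [map_smul, map_smul, smul_eq_mul, mul_comm]
    | zero => rw [map_zero, map_zero, LinearMap.zero_apply]
    | add y z _ _ h h' => rw [map_add, map_add, LinearMap.add_apply, h, h', add_zero]
    | smul a z _ h => rw [map_smul, map_smul, LinearMap.smul_apply, h, smul_zero]
  have hrad : ∑ j, c j • g₂ j ∈ x.rad := ⟨hwG, x.upart_of_mem_gil hwG, hG⟩
  have h0 := Submodule.disjoint_def.1 hdisj _ hrad hw
  exact hc (funext (Fintype.linearIndependent_iff.1 hli₂ c h0))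

/-- On a complement of the radical in `G` the Gram matrix of `ω` is invertible and skew-symmetric,
which forces even size when `2 ≠ 0`. -/
theorem finrank_rad_modEq (h2 : (2 : K) ≠ 0) : Module.finrank K x.rad ≡ s [MOD 2] := by
  let b := Module.finBasis K x.rad
  obtain ⟨j, hj, g₂, -, -, hdet⟩ := x.exists_compl_rad
    (linearIndependent_coe_basis b) (span_coe_basis b)
  have h3 : (Matrix.of fun i i' => omega m K (ypart m K (g₂ i)) (ypart m K (g₂ i'))).transpose =
      -(Matrix.of fun i i' => omega m K (ypart m K (g₂ i)) (ypart m K (g₂ i'))) := by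
    ext i i'
    exact omega_neg_swap _ _
  have h4 := congrArg Matrix.det h3
  rw [Matrix.det_transpose, Matrix.det_neg, Fintype.card_fin] at h4
  rcases Nat.even_or_odd j with h5 | h5
  · obtain ⟨c, hc⟩ := h5
    unfold Nat.ModEq
    omega
  · rw [h5.neg_one_pow] at h4
    have : (2 : K) * (Matrix.of fun i i' => omega m K (ypart m K (g₂ i)) (ypart m K (g₂ i'))).det = 0 := by
      linear_combination h4
    exact absurd this (mul_ne_zero h2 hdet)

end RedPoint

/-! ### Lifting points with `t F = G ∩ G^⊥'` along square zero extensions. -/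

section Deform

variable {m : ℕ} {R : Type u} [CommRing R] {σ τ : Type} [Fintype σ] [Fintype τ]
  [DecidableEq σ] [DecidableEq τ]

theorem omega_sum_dual {d g : σ → Fin (2 * m) → R}
    (hd : ∀ k j, omega m R (d k) (g j) = if k = j then 1 else 0) (c : σ → R) (j : σ) :
    omega m R (∑ k, c k • d k) (g j) = c j := by
  simp [LinearMap.sum_apply, hd]

/-- Deformation of a partially isotropic family to an isotropic one, modulo a square zero ideal. -/
theorem exists_isotropic_deformation (h2 : IsUnit (2 : R)) {I : Ideal R}
    (hI : ∀ a ∈ I, ∀ b ∈ I, a * b = 0) {g d : σ ⊕ τ → Fin (2 * m) → R}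
    (hd : ∀ k j, omega m R (d k) (g j) = if k = j then 1 else 0)
    (hA : ∀ i k, omega m R (g (.inl i)) (g k) ∈ I) :
    ∃ c : σ → σ ⊕ τ → R, (∀ i k, c i k ∈ I) ∧
      (∀ i j, omega m R (g (.inl i) + ∑ k, c i k • d k) (g (.inl j) + ∑ k, c j k • d k) = 0) ∧
        ∀ i j, omega m R (g (.inl i) + ∑ k, c i k • d k) (g (.inr j)) = 0 := by
  obtain ⟨w, hw⟩ := h2.exists_right_inv
  -- A pairing between two `σ`-vectors is corrected from both sides, so each takes half of it. A
  -- pairing with a `τ`-vector, which stays fixed, is corrected by the `σ`-vector alone.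
  let c : σ → σ ⊕ τ → R := fun i => Sum.elim
    (fun k => -(w * omega m R (g (.inl i)) (g (.inl k))))
    (fun k => -omega m R (g (.inl i)) (g (.inr k)))
  have hc : ∀ i k, c i k ∈ I := by
    rintro i (k | k)
    · exact neg_mem (I.mul_mem_left _ (hA _ _))
    · exact neg_mem (hA _ _)
  refine ⟨c, hc, fun i j => ?_, fun i j => ?_⟩
  · have h1 : omega m R (∑ k, c i k • d k) (∑ k, c j k • d k) = 0 := by
      simp only [map_sum, LinearMap.sum_apply, map_smul, LinearMap.smul_apply, smul_eq_mul]
      refine Finset.sum_eq_zero fun k _ => ?_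
      rw [Finset.mul_sum]
      refine Finset.sum_eq_zero fun l _ => ?_
      rw [← mul_assoc, hI _ (hc _ _) _ (hc _ _), zero_mul]
    simp only [map_add (omega m R), map_add (omega m R _), LinearMap.add_apply]
    rw [h1,
      omega_sum_dual hd, omega_neg_swap (g (.inl i)) (∑ k, _), omega_sum_dual hd]
    simp only [c, Sum.elim_inl]
    rw [omega_neg_swap (g (.inl j)) (g (.inl i))]
    linear_combination (-omega m R (g (.inl i)) (g (.inl j))) * hw
  · rw [map_add, LinearMap.add_apply, omega_sum_dual hd]
    simp only [c, Sum.elim_inr]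
    ring

/-- Deformation of a family of vectors to one spanning an isotropic subspace. -/
theorem exists_lagrangian_deformation (h2 : IsUnit (2 : R)) {I : Ideal R}
    {g d : σ → Fin (2 * m) → R} (hd : ∀ k j, omega m R (d k) (g j) = if k = j then 1 else 0)
    {y : σ ⊕ τ → Fin (2 * m) → R}
    (h₁ : ∀ i j, omega m R (y (.inl i)) (g j) + omega m R (y (.inl j)) (g i) ∈ I)
    (h₂ : ∀ i j, omega m R (y (.inr i)) (g j) ∈ I) :
    ∃ c : σ ⊕ τ → σ → R, (∀ i k, c i k ∈ I) ∧
      (∀ i j, omega m R (y (.inl i) + ∑ k, c (.inl i) k • d k) (g j) +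
        omega m R (y (.inl j) + ∑ k, c (.inl j) k • d k) (g i) = 0) ∧
      ∀ i j, omega m R (y (.inr i) + ∑ k, c (.inr i) k • d k) (g j) = 0 := by
  obtain ⟨w, hw⟩ := h2.exists_right_inv
  refine ⟨Sum.elim
    (fun i j => -(w * (omega m R (y (.inl i)) (g j) + omega m R (y (.inl j)) (g i))))
    (fun i j => -omega m R (y (.inr i)) (g j)), ?_, fun i j => ?_, fun i j => ?_⟩
  · rintro (i | i) k
    · exact neg_mem (I.mul_mem_left _ (h₁ _ _))
    · exact neg_mem (h₂ _ _)
  · rw [map_add, LinearMap.add_apply, map_add, LinearMap.add_apply, omega_sum_dual hd,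
      omega_sum_dual hd]
    simp only [Sum.elim_inl]
    linear_combination -(omega m R (y (.inl i)) (g j) + omega m R (y (.inl j)) (g i)) * hw
  · rw [map_add, LinearMap.add_apply, omega_sum_dual hd]
    simp only [Sum.elim_inr]
    ring

end Deform

namespace RedPoint

variable {m s : ℕ} {A C : Type u} [CommRing A] [IsLocalRing A]

theorem isUnit_det_of_residue {ι : Type} [Fintype ι] [DecidableEq ι] {M : Matrix ι ι A}
    (h : (M.map (IsLocalRing.residue A)).det ≠ 0) : IsUnit M.det := by
  rw [← IsLocalRing.residue_ne_zero_iff_isUnit, RingHom.map_det]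
  exact h

/-- Adapted frames over a local ring. -/
theorem exists_adapted_frames (x : RedPoint m s A)
    (hx : Module.finrank (IsLocalRing.ResidueField A) (x.map (IsLocalRing.residue A)).tfil =
      Module.finrank (IsLocalRing.ResidueField A) (x.map (IsLocalRing.residue A)).rad) :
    ∃ (h k j : ℕ) (_ : h + k = 2 * m) (_ : h + j = s) (V₁ : Fin h → Idx m → A)
      (V₂ : Fin k → Idx m → A) (G₂ : Fin j → Idx m → A), (∀ i, upart m A (V₂ i) = 0) ∧
        Submodule.span A (Set.range (Sum.elim V₁ V₂)) = x.fil ∧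
        Submodule.span A (Set.range (Sum.elim (fun i => coordT m A 0 (V₁ i)) G₂)) = x.gil := by
  set κ := IsLocalRing.ResidueField A
  set ρ : A →+* κ := IsLocalRing.residue A
  have hρ : Function.Surjective ρ := IsLocalRing.residue_surjective
  set x' := x.map ρ
  obtain ⟨k, hk, v₁, v₂, hv₁, hv₂, hli, hli', hspan, h0⟩ := x'.exists_adapted_fil rfl
  -- This is where `h = l` enters: the images of `v₁` under `t` are a basis of the whole radical, so
  -- the rest of a basis of `G` can be chosen with nondegenerate Gram matrix.
  have hrad : x'.tfil = x'.rad := Submodule.eq_of_le_of_finrank_eq x'.tfil_le_rad hx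
  obtain ⟨j, hj, g₂, hg₂, hlig, hdet⟩ := x'.exists_compl_rad hli' (hspan.trans hrad)
  choose V₁ hV₁ hV₁' using fun i => exists_of_mem_push hρ (hv₁ i)
  choose V₂ hV₂ hV₂' using fun i => exists_of_mem_push hρ (hv₂ i)
  choose G₂ hG₂ hG₂' using fun i => exists_of_mem_push hρ (hg₂ i)
  obtain ⟨a, b, v, g, hfr, hF, hG⟩ := x.exists_frames
  let G₁ := fun i => coordT m A 0 (V₁ i)
  have hG₁ (i) : G₁ i ∈ x.gil := by
    simp only [G₁, coordT_zero]
    exact x.upart_mem_gil (hV₁ i)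
  have hG₁' (i) : ρ ∘ G₁ i = coordT m κ 0 (v₁ i) := by
    simp only [G₁, coordT_zero, map_pairVec, map_upart, hV₁', comp_zero]
  have hspan' {d p q : ℕ} (e : p + q = d) {P : Submodule A (Idx m → A)}
      {w : Fin p → Idx m → A} {w' : Fin q → Idx m → A} {a : Fin d → Idx m} {v : Fin d → Idx m → A}
      (hv : Normalized a v) (hP : P = Submodule.span A (Set.range v)) (hw : ∀ i, w i ∈ P)
      (hw' : ∀ i, w' i ∈ P)
      (hl : LinearIndependent κ (Sum.elim (fun i => ρ ∘ w i) (fun i => ρ ∘ w' i))) :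
      Submodule.span A (Set.range (Sum.elim w w')) = P := by
    have hl' := hl.comp _ (splitEquiv e).symm.injective
    obtain ⟨a', ha'⟩ := exists_det_ne_zero hl'
    have h1 : IsUnit (Matrix.of fun i j => (Sum.elim w w' ((splitEquiv e).symm i)) (a' j)).det := by
      refine isUnit_det_of_residue ?_
      refine ne_of_eq_of_ne (congrArg Matrix.det (Matrix.ext fun i j => ?_)) ha'
      rw [Matrix.map_apply, Matrix.of_apply, Matrix.of_apply, Function.comp_apply]
      rcases (splitEquiv e).symm i with i | i <;> rfl
    have h2 := span_eq_of_isUnit_det hv (fun i => ?_) h1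
    · rw [← hP] at h2
      rw [← h2]
      congr 1
      exact ((splitEquiv e).symm.surjective.range_comp (Sum.elim w w')).symm
    · rw [← hP]
      rcases (splitEquiv e).symm i with i | i
      · exact hw i
      · exact hw' i
  have hfil : Submodule.span A (Set.range (Sum.elim V₁ V₂)) = x.fil :=
    hspan' hk hfr.norm_v hF hV₁ hV₂ (by simpa only [hV₁', hV₂'] using hli)
  have hgil : Submodule.span A (Set.range (Sum.elim G₁ G₂)) = x.gil :=
    hspan' hj hfr.norm_g hG hG₁ hG₂ (by simpa only [hG₁', hG₂'] using hlig)
  have hgram : IsUnit (Matrix.of fun i i' =>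
      omega m A (ypart m A (G₂ i)) (ypart m A (G₂ i'))).det := by
    refine isUnit_det_of_residue ?_
    refine ne_of_eq_of_ne (congrArg Matrix.det (Matrix.ext fun i i' => ?_)) hdet
    rw [Matrix.map_apply, Matrix.of_apply, Matrix.of_apply, ← hG₂', ← hG₂']
    exact map_omega ρ _ _
  -- Over the residue field `V₂` has zero `u`-part, over `A` perhaps not. But `t V₂` lies in `G` and
  -- is orthogonal to `G₂`, whose Gram matrix is invertible, so it has no `G₂`-component;
  -- subtracting combinations of `V₁` from `V₂` then kills the `u`-part.
  have hred (i : Fin k) : ∃ c : Fin _ → A, upart m A (V₂ i) = ∑ l, c l • upart m A (V₁ l) := by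
    have h1 := x.upart_mem_gil (hV₂ i)
    rw [← hgil] at h1
    obtain ⟨c, hc⟩ := (Submodule.mem_span_range_iff_exists_fun A).1 h1
    rw [Fintype.sum_sum_type] at hc
    simp only [Sum.elim_inl, Sum.elim_inr] at hc
    have h2 : upart m A (V₂ i) = ∑ l, c (.inl l) • upart m A (V₁ l) +
        ∑ l, c (.inr l) • ypart m A (G₂ l) := by
      have := congrArg (ypart m A) hc
      rw [ypart_pairVec] at this
      rw [← this]
      simp only [map_add, map_sum, map_smul, G₁, coordT_zero, ypart_pairVec]
    have h3 : (Matrix.of fun i i' => omega m A (ypart m A (G₂ i)) (ypart m A (G₂ i'))).mulVec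
        (fun l => c (.inr l)) = 0 := by
      ext i'
      have h4 := x.omega_of_mem (hG₂ i') (hV₂ i)
      rw [h2] at h4
      simp only [map_add, map_sum, map_smul, x.omega_of_mem (hG₂ i') (hV₁ _), smul_zero,
        Finset.sum_const_zero, zero_add] at h4
      rw [Pi.zero_apply, ← h4]
      simp only [Matrix.mulVec, dotProduct, Matrix.of_apply, smul_eq_mul]
      exact Finset.sum_congr rfl fun l _ => mul_comm _ _
    have h5 := congrArg (Matrix.mulVec
      (Matrix.of fun i i' => omega m A (ypart m A (G₂ i)) (ypart m A (G₂ i')))⁻¹) h3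
    rw [Matrix.mulVec_mulVec, Matrix.nonsing_inv_mul _ hgram, Matrix.one_mulVec,
      Matrix.mulVec_zero] at h5
    refine ⟨fun l => c (.inl l), h2.trans ?_⟩
    rw [Finset.sum_eq_zero (s := Finset.univ) (f := fun l => c (.inr l) • ypart m A (G₂ l)) fun l _ =>
      by rw [show c (.inr l) = 0 from congrFun h5 l, zero_smul], add_zero]
  choose c hc using hred
  refine ⟨_, k, j, hk, hj, V₁, fun i => V₂ i - ∑ l, c i l • V₁ l, G₂, fun i => ?_, ?_, hgil⟩
  · rw [map_sub, hc, map_sum]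
    simp only [map_smul, sub_self]
  · rw [← hfil]
    refine le_antisymm (Submodule.span_le.2 ?_) (Submodule.span_le.2 ?_)
    · rintro _ ⟨i | i, rfl⟩
      · exact Submodule.subset_span ⟨.inl i, rfl⟩
      · exact sub_mem (Submodule.subset_span ⟨.inr i, rfl⟩) (sum_mem fun l _ =>
          Submodule.smul_mem _ _ (Submodule.subset_span ⟨.inl l, rfl⟩))
    · rintro _ ⟨i | i, rfl⟩
      · exact Submodule.subset_span ⟨.inl i, rfl⟩
      · have h1 : V₂ i = (V₂ i - ∑ l, c i l • V₁ l) + ∑ l, c i l • V₁ l := (sub_add_cancel _ _).symm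
        rw [SetLike.mem_coe, Sum.elim_inr, h1]
        exact add_mem (Submodule.subset_span ⟨.inr i, rfl⟩) (sum_mem fun l _ =>
          Submodule.smul_mem _ _ (Submodule.subset_span ⟨.inl l, rfl⟩))

end RedPoint

namespace RedPoint

variable {m s : ℕ} {A C : Type u} [CommRing A] [IsLocalRing A] [CommRing C] [IsLocalRing C]

theorem isUnit_det_of_comp (ρ : C →+* A) [IsLocalHom ρ] {W : Type} {d : ℕ} {a : Fin d → W}
    {w : Fin d → W → C} {w' : Fin d → W → A} (h : ∀ i, ρ ∘ w i = w' i)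
    (hw : IsUnit (Matrix.of fun i j => w' i (a j)).det) :
    IsUnit (Matrix.of fun i j => w i (a j)).det := by
  refine isUnit_of_map_unit ρ _ ?_
  rw [RingHom.map_det]
  convert hw using 2
  refine Matrix.ext fun i j => ?_
  exact congrFun (h i) (a j)

theorem comp_add_sum (ρ : C →+* A) {W ι : Type} [Fintype ι] {w : W → C} {c : ι → C}
    (hc : ∀ k, c k ∈ RingHom.ker ρ) (d : ι → W → C) : ρ ∘ (w + ∑ k, c k • d k) = ρ ∘ w := by
  have hc' (k) : ρ (c k) = 0 := hc k
  ext l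
  simp [Finset.sum_apply, hc']

/-- Points with `t F = G ∩ G^⊥` at the closed point lift along square zero extensions. -/
theorem exists_lift (h2 : IsUnit (2 : C)) (ρ : C →+* A) (hρ : Function.Surjective ρ)
    [IsLocalHom ρ] (hker : ∀ a ∈ RingHom.ker ρ, ∀ b ∈ RingHom.ker ρ, a * b = 0)
    (x : RedPoint m s A)
    (hx : Module.finrank (IsLocalRing.ResidueField A) (x.map (IsLocalRing.residue A)).tfil =
      Module.finrank (IsLocalRing.ResidueField A) (x.map (IsLocalRing.residue A)).rad) :
    ∃ z : RedPoint m s C, z.map ρ = x := by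
  obtain ⟨h, k, j, ef, eg, V₁, V₂, G₂, hV₂, hF, hG⟩ := x.exists_adapted_frames hx
  obtain ⟨a, b, v, g, hfr, hF', hG'⟩ := x.exists_frames
  have hV₁ (i) : V₁ i ∈ x.fil := hF ▸ Submodule.subset_span ⟨.inl i, rfl⟩
  have hV₂F (i) : V₂ i ∈ x.fil := hF ▸ Submodule.subset_span ⟨.inr i, rfl⟩
  have hG₂ (i) : G₂ i ∈ x.gil := hG ▸ Submodule.subset_span ⟨.inr i, rfl⟩
  let G : Fin h ⊕ Fin j → Idx m → A := Sum.elim (fun i => coordT m A 0 (V₁ i)) G₂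
  have hGG (p) : G p ∈ x.gil := hG ▸ Submodule.subset_span ⟨p, rfl⟩
  have hFs : Submodule.span A (Set.range fun i => Sum.elim V₁ V₂ ((splitEquiv ef).symm i)) =
      x.fil := by
    rw [← hF]
    congr 1
    exact (splitEquiv ef).symm.surjective.range_comp (Sum.elim V₁ V₂)
  have hGs : Submodule.span A (Set.range fun i => G ((splitEquiv eg).symm i)) = x.gil := by
    rw [← hG]
    congr 1
    exact (splitEquiv eg).symm.surjective.range_comp G
  have hFdet := isUnit_det_of_span_eq hfr.norm_v (hF'.symm.trans hFs.symm)
  have hGdet := isUnit_det_of_span_eq hfr.norm_g (hG'.symm.trans hGs.symm)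
  choose g₀ hg₀ using fun p => hρ.comp_left (ypart m A (G p))
  replace hg₀ (p) : ρ ∘ g₀ p = ypart m A (G p) := hg₀ p
  have hdual {g : Fin h ⊕ Fin j → Fin (2 * m) → C} (hg : ∀ p, ρ ∘ g p = ypart m A (G p)) :
      IsUnit (Matrix.of fun i j => pairVec m C (g ((splitEquiv eg).symm i), 0) (b j)).det ∧
      ∃ d : Fin h ⊕ Fin j → Fin (2 * m) → C,
        ∀ p q, omega m C (d p) (g q) = if p = q then 1 else 0 := by
    have h1 : IsUnit (Matrix.of fun i j =>
        pairVec m C (g ((splitEquiv eg).symm i), 0) (b j)).det := by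
      refine isUnit_det_of_comp ρ (fun i => ?_) hGdet
      rw [map_pairVec, hg, comp_zero]
      exact x.pairVec_ypart_of_mem_gil (hGG _)
    obtain ⟨d, hd⟩ := exists_omega_dual h1 fun i => upart_pairVec _ _
    refine ⟨h1, fun p => d (splitEquiv eg p), fun p q => ?_⟩
    have := hd (splitEquiv eg p) (splitEquiv eg q)
    simpa only [ypart_pairVec, Equiv.symm_apply_apply, (splitEquiv eg).injective.eq_iff] using this
  have hker' {w w' : Fin (2 * m) → C} : omega m C w w' ∈ RingHom.ker ρ ↔
      omega m A (ρ ∘ w) (ρ ∘ w') = 0 := by rw [RingHom.mem_ker, map_omega]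
  have hG₁ (i) : ypart m A (G (.inl i)) = upart m A (V₁ i) := by
    simp only [G, Sum.elim_inl, coordT_zero, ypart_pairVec]
  obtain ⟨d, hd⟩ := (hdual hg₀).2
  -- The part of `G` coming from `t V₁` is orthogonal to all of `G` over `A`. Its lift is corrected
  -- by elements of the kernel to have this property over `C`; the remaining vectors keep their
  -- arbitrary lifts.
  obtain ⟨c, hc, hc₁, hc₂⟩ := exists_isotropic_deformation h2 hker hd fun i p => by
    rw [hker', hg₀, hg₀, hG₁, omega_neg_swap, x.omega_of_mem (hGG p) (hV₁ i), neg_zero]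
  let g₁ : Fin h ⊕ Fin j → Fin (2 * m) → C :=
    Sum.elim (fun i => g₀ (.inl i) + ∑ p, c i p • d p) fun i => g₀ (.inr i)
  have hg₁ (p) : ρ ∘ g₁ p = ypart m A (G p) := by
    rcases p with i | i
    · exact (comp_add_sum ρ (hc i) d).trans (hg₀ _)
    · exact hg₀ _
  have hg₁o (i p) : omega m C (g₁ (.inl i)) (g₁ p) = 0 := by
    rcases p with p | p
    · exact hc₁ i p
    · exact hc₂ i p
  obtain ⟨hdet, d', hd'⟩ := hdual hg₁
  choose y₀ hy₀ using fun p => hρ.comp_left (ypart m A (Sum.elim V₁ V₂ p))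
  replace hy₀ (p) : ρ ∘ y₀ p = ypart m A (Sum.elim V₁ V₂ p) := hy₀ p
  -- With the `u`-parts now prescribed by the lift of `t V₁`, the `y`-parts are corrected so that
  -- the frame of `F` becomes isotropic.
  obtain ⟨c', hc', hc₁', hc₂'⟩ := exists_lagrangian_deformation h2 (I := RingHom.ker ρ)
    (g := fun i => g₁ (.inl i)) (d := fun i => d' (.inl i))
    (fun p q => by simpa only [Sum.inl.injEq] using hd' (.inl p) (.inl q)) (y := y₀)
    (fun p q => by
      rw [RingHom.mem_ker, map_add, map_omega, map_omega, hy₀, hy₀, hg₁, hg₁, hG₁, hG₁]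
      have := x.splConds.conds.iso _ (hV₁ p) _ (hV₁ q)
      rwa [hypForm_eq_omega] at this)
    (fun p q => by
      rw [hker', hy₀, hg₁, hG₁]
      have := x.splConds.conds.iso _ (hV₂F p) _ (hV₁ q)
      rwa [hypForm_eq_omega, hV₂, map_zero, add_zero] at this)
  let y₁ : Fin h ⊕ Fin k → Fin (2 * m) → C := fun p => y₀ p + ∑ q, c' p q • d' (.inl q)
  have hy₁ (p) : ρ ∘ y₁ p = ypart m A (Sum.elim V₁ V₂ p) :=
    (comp_add_sum ρ (hc' p) _).trans (hy₀ p)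
  -- Taking the first vectors of the lifted basis of `G` as `u`-parts makes the inclusion `t F ⊆ G`
  -- automatic.
  let v₁ : Fin h ⊕ Fin k → Idx m → C := Sum.elim (fun i => pairVec m C (y₁ (.inl i), g₁ (.inl i)))
    fun i => pairVec m C (y₁ (.inr i), 0)
  have hv₁ (p) : ρ ∘ v₁ p = Sum.elim V₁ V₂ p := by
    rcases p with i | i
    · simp only [v₁, Sum.elim_inl]
      rw [map_pairVec, hy₁, hg₁, hG₁]
      exact pairVec_parts _
    · simp only [v₁, Sum.elim_inr]
      rw [map_pairVec, hy₁, comp_zero, Sum.elim_inr]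
      conv_rhs => rw [← pairVec_parts (V₂ i), hV₂]
  have hu₁ (i) : upart m C (v₁ (.inl i)) = g₁ (.inl i) := upart_pairVec _ _
  have hu₂ (i) : upart m C (v₁ (.inr i)) = 0 := upart_pairVec _ _
  have hyp (p) : ypart m C (v₁ p) = y₁ p := by rcases p with i | i <;> rfl
  refine Exists.imp (fun z hz => hz.1) (exists_lift_of_frames h2 ρ x
    (v := fun i => v₁ ((splitEquiv ef).symm i))
    (g := fun i => pairVec m C (g₁ ((splitEquiv eg).symm i), 0)) (a := a) (b := b)
    (isUnit_det_of_comp ρ (fun i => hv₁ _) hFdet) hdet ?_ (fun i => upart_pairVec _ _) ?_ ?_ ?_ ?_)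
  · intro i i'
    rw [hypForm_eq_omega, hyp, hyp]
    generalize (splitEquiv ef).symm i = p
    generalize (splitEquiv ef).symm i' = q
    rcases p with p | p <;> rcases q with q | q
    · rw [hu₁, hu₁]; exact hc₁' p q
    · rw [hu₁, hu₂, map_zero, zero_add]; exact hc₂' q p
    · rw [hu₁, hu₂, map_zero, add_zero]; exact hc₂' p q
    · rw [hu₂, hu₂, map_zero, map_zero, add_zero]
  · intro i i'
    rw [hypForm_eq_omega, upart_pairVec, map_zero, add_zero, ypart_pairVec]
    generalize (splitEquiv ef).symm i' = q
    rcases q with q | q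
    · rw [hu₁, omega_neg_swap, hg₁o, neg_zero]
    · rw [hu₂, map_zero]
  · intro i
    generalize (splitEquiv ef).symm i = p
    rcases p with p | p
    · rw [hu₁]
      refine Submodule.subset_span ⟨splitEquiv eg (.inl p), ?_⟩
      simp only [Equiv.symm_apply_apply]
    · rw [hu₂, show ((0 : Fin (2 * m) → C), (0 : Fin (2 * m) → C)) = 0 from rfl, map_zero]
      exact zero_mem _
  · simp only [hv₁]
    exact hFs
  · simp only [map_pairVec, hg₁, comp_zero, x.pairVec_ypart_of_mem_gil (hGG _)]
    exact hGs

end RedPoint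

/-! ### Truncated polynomials and the obstructed deformation for `h < l`. -/

section Trunc

variable (K : Type u) [Field K]

/-- The class of the variable in `K[ε]/ε^j`. -/
def truncEps (j : ℕ) : TruncPoly K j := Ideal.Quotient.mk _ X

variable {K}

@[simp] theorem truncPolyEval_eps (j : ℕ) : truncPolyEval K j (truncEps K (j + 1)) = 0 := by
  rw [truncEps, truncPolyEval, Ideal.Quotient.lift_mk, coe_evalRingHom, eval_X]

@[simp] theorem truncPolyEval_algebraMap (j : ℕ) (a : K) :
    truncPolyEval K j (algebraMap K _ a) = a :=
  (Ideal.Quotient.lift_mk _ _ _).trans eval_C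

@[simp] theorem truncPolyReduce_algebraMap {i j : ℕ} (h : j ≤ i) (a : K) :
    truncPolyReduce K h (algebraMap K _ a) = algebraMap K _ a := rfl

theorem truncEps_pow (j : ℕ) : truncEps K j ^ j = 0 := by
  rw [truncEps, ← map_pow, Ideal.Quotient.eq_zero_iff_mem]
  exact Ideal.mem_span_singleton_self _

theorem exists_eq_eps_mul {j : ℕ} {c : TruncPoly K (j + 1)} (h : truncPolyEval K j c = 0) :
    ∃ d, c = truncEps K (j + 1) * d := by
  obtain ⟨p, rfl⟩ := Ideal.Quotient.mk_surjective c
  rw [truncPolyEval, Ideal.Quotient.lift_mk, coe_evalRingHom, ← coeff_zero_eq_eval_zero,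
    ← X_dvd_iff] at h
  obtain ⟨q, rfl⟩ := h
  exact ⟨Ideal.Quotient.mk _ q, map_mul _ _ _⟩

theorem exists_eq_add_eps_mul {j : ℕ} (c : TruncPoly K (j + 1)) :
    ∃ d, c = algebraMap K _ (truncPolyEval K j c) + truncEps K (j + 1) * d := by
  obtain ⟨d, hd⟩ := exists_eq_eps_mul (c := c - algebraMap K _ (truncPolyEval K j c)) (by
    rw [map_sub, truncPolyEval_algebraMap, sub_self])
  exact ⟨d, by rw [← hd, add_sub_cancel]⟩

theorem eps_mul_algebraMap_eq_zero {a : K} (h : truncEps K 2 * algebraMap K _ a = 0) : a = 0 := by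
  have h1 : Ideal.Quotient.mk (Ideal.span {(X : K[X]) ^ 2}) (X * C a) = 0 := h
  rw [Ideal.Quotient.eq_zero_iff_mem, Ideal.mem_span_singleton, X_pow_dvd_iff] at h1
  simpa using h1 1 one_lt_two

/-- Dividing a relation by `ε` costs one order of precision: a relation modulo `ε³` leaves one
modulo `ε²`. -/
theorem truncPolyReduce_eq_zero {j : ℕ} {c : TruncPoly K (j + 1)}
    (h : truncEps K (j + 1) * c = 0) : truncPolyReduce K j.le_succ c = 0 := by
  obtain ⟨p, rfl⟩ := Ideal.Quotient.mk_surjective c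
  have h1 : Ideal.Quotient.mk (Ideal.span {(X : K[X]) ^ (j + 1)}) (X * p) = 0 := h
  rw [Ideal.Quotient.eq_zero_iff_mem, Ideal.mem_span_singleton, pow_succ',
    mul_dvd_mul_iff_left X_ne_zero] at h1
  exact Ideal.Quotient.eq_zero_iff_mem.2 (Ideal.mem_span_singleton.2 h1)

theorem isLocalHom_truncPolyEval (j : ℕ) : IsLocalHom (truncPolyEval K j) where
  map_nonunit c hc := by
    obtain ⟨d, hd⟩ := exists_eq_add_eps_mul c
    have h1 : IsNilpotent (truncEps K (j + 1) * d) :=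
      Commute.isNilpotent_mul_right (Commute.all _ _) ⟨_, truncEps_pow _⟩
    rw [hd]
    exact h1.isUnit_add_left_of_commute (hc.map (algebraMap K _)) (Commute.all _ _)

instance (j : ℕ) : IsLocalRing (TruncPoly K (j + 1)) :=
  have := isLocalHom_truncPolyEval (K := K) j
  RingHom.domain_isLocalRing (truncPolyEval K j)

theorem truncPolyReduce_surjective {i j : ℕ} (h : j ≤ i) :
    Function.Surjective (truncPolyReduce K h) := Ideal.Quotient.factor_surjective _

theorem exists_eq_eps_mul_of_reduce {c : TruncPoly K 3} {d : TruncPoly K 2}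
    (h : truncPolyReduce K (by norm_num : 2 ≤ 3) c = truncEps K 2 * d) :
    ∃ e, c = truncEps K 3 * e := by
  obtain ⟨p, rfl⟩ := Ideal.Quotient.mk_surjective c
  obtain ⟨q, rfl⟩ := Ideal.Quotient.mk_surjective d
  rw [truncPolyReduce, Ideal.Quotient.factor_mk, truncEps, ← map_mul, ← sub_eq_zero, ← map_sub,
    Ideal.Quotient.eq_zero_iff_mem, Ideal.mem_span_singleton] at h
  obtain ⟨r, hr⟩ := h
  refine ⟨Ideal.Quotient.mk _ (X * r + q), ?_⟩
  rw [truncEps, ← map_mul]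
  congr 1
  linear_combination hr

theorem ker_truncPolyReduce_sq (a b : TruncPoly K 3)
    (ha : truncPolyReduce K (by norm_num : 2 ≤ 3) a = 0)
    (hb : truncPolyReduce K (by norm_num : 2 ≤ 3) b = 0) : a * b = 0 := by
  obtain ⟨p, rfl⟩ := Ideal.Quotient.mk_surjective a
  obtain ⟨q, rfl⟩ := Ideal.Quotient.mk_surjective b
  obtain ⟨p, rfl⟩ := Ideal.mem_span_singleton.1 (Ideal.Quotient.eq_zero_iff_mem.1 ha)
  obtain ⟨q, rfl⟩ := Ideal.mem_span_singleton.1 (Ideal.Quotient.eq_zero_iff_mem.1 hb)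
  rw [← map_mul, Ideal.Quotient.eq_zero_iff_mem, Ideal.mem_span_singleton]
  exact ⟨X * p * q, by ring⟩

end Trunc

namespace RedPoint

variable {m s : ℕ} {K : Type u} [Field K] (x : RedPoint m s K)

/-- Both dimensions are congruent to `s` modulo 2, so their difference is at least two and two
vectors of the radical are independent modulo `t F`. The `y i` are members of a family dual to a
basis of the radical that extends one of `t F`, so they annihilate `t F`. -/
theorem exists_transversal (h2 : (2 : K) ≠ 0)
    (hx : Module.finrank K x.tfil < Module.finrank K x.rad) :
    ∃ p y : Fin 2 → Fin (2 * m) → K, (∀ i, pairVec m K (p i, 0) ∈ x.rad) ∧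
      (∀ i, ∀ v ∈ x.fil, omega m K (y i) (upart m K v) = 0) ∧
        ∀ i j, omega m K (y i) (p j) = if i = j then 1 else 0 := by
  have hle := x.tfil_le_rad
  let b := Module.finBasis K x.tfil
  obtain ⟨j, hj, g', hli', hQ⟩ := exists_compl_basis (x.tfil.comap x.rad.subtype)
  rw [(Submodule.comapSubtypeEquivOfLe hle).finrank_eq] at hj
  have hj2 : 2 ≤ j := by
    have h3 := x.finrank_tfil_modEq h2
    have h4 := x.finrank_rad_modEq h2
    unfold Nat.ModEq at h3 h4
    omega
  let g := fun i => (g' i : Idx m → K)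
  have hli : LinearIndependent K g := hli'.map' x.rad.subtype (Submodule.ker_subtype _)
  have hspan : Submodule.span K (Set.range g) =
      (Submodule.span K (Set.range g')).map x.rad.subtype := by
    rw [Submodule.map_span, ← Set.range_comp]
    rfl
  have hdisj : Disjoint x.tfil ((Submodule.span K (Set.range g')).map x.rad.subtype) := by
    rw [Submodule.disjoint_def]
    rintro _ hw ⟨w, hw', rfl⟩
    rw [(Submodule.disjoint_def.1 hQ.disjoint) w hw hw', map_zero]
  have hlis : LinearIndependent K (Sum.elim (fun i => (b i : Idx m → K)) g) :=
    (linearIndependent_coe_basis b).sum_type hli (by rw [span_coe_basis, hspan]; exact hdisj)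
  let e := splitEquiv (rfl : Module.finrank K x.tfil + j = _)
  have hrad (i) : Sum.elim (fun i => (b i : Idx m → K)) g i ∈ x.rad := by
    rcases i with i | i
    · exact hle (b i).2
    · exact (g' i).2
  obtain ⟨d, hd⟩ := exists_dual_of_linearIndependent (hlis.comp _ e.symm.injective)
    fun i => (hrad _).2.1
  have hd' (k l) : omega m K (d (e k)) (ypart m K (Sum.elim (fun i => (b i : Idx m → K)) g l)) =
      if k = l then 1 else 0 := by
    have := hd (e k) (e l)
    simpa only [Function.comp_apply, Equiv.symm_apply_apply, e.injective.eq_iff] using this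
  let c : Fin 2 → Fin j := Fin.castLE hj2
  refine ⟨fun i => ypart m K (g (c i)), fun i => d (e (.inr (c i))), fun i => ?_, fun i v hv => ?_,
    fun i l => ?_⟩
  · have h1 := hrad (.inr (c i))
    rw [← x.pairVec_ypart_of_mem_gil h1.1] at h1
    exact h1
  · have h1 : coordT m K 0 v ∈ x.tfil := ⟨v, hv, rfl⟩
    rw [← span_coe_basis b] at h1
    obtain ⟨r, hr⟩ := (Submodule.mem_span_range_iff_exists_fun K).1 h1
    have h3 := congrArg (ypart m K) hr
    rw [coordT_zero, ypart_pairVec] at h3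
    rw [← h3, map_sum, map_sum]
    refine Finset.sum_eq_zero fun l _ => ?_
    have := hd' (.inr (c i)) (.inl l)
    rw [Sum.elim_inl, if_neg Sum.inr_ne_inl] at this
    rw [map_smul, map_smul, this, smul_zero]
  · have := hd' (.inr (c i)) (.inr (c l))
    rw [Sum.elim_inr] at this
    refine this.trans ?_
    simp only [Sum.inr.injEq, c, Fin.castLE_inj]

end RedPoint

namespace RedPoint

variable {m s : ℕ} {K : Type u} [Field K]

theorem eps_mul_eps : truncEps K 2 * truncEps K 2 = 0 := by
  rw [← sq, truncEps_pow]

theorem eps_smul_eps_smul {W : Type} (w : W → TruncPoly K 2) :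
    truncEps K 2 • truncEps K 2 • w = 0 := by
  ext l
  change truncEps K 2 * (truncEps K 2 * w l) = 0
  rw [← mul_assoc, eps_mul_eps, zero_mul]

/-- First order elements in the image of a deformed submodule. -/
theorem mem_span_deform {W ι : Type} [Fintype ι] {g : ι → W → K} (γ : (W → K) →ₗ[K] (W → K))
    {z : W → K} (hz : z ∈ Submodule.span K (Set.range g)) :
    algebraMap K (TruncPoly K 2) ∘ z + truncEps K 2 • (algebraMap K (TruncPoly K 2) ∘ γ z) ∈
      Submodule.span (TruncPoly K 2) (Set.range fun i => algebraMap K (TruncPoly K 2) ∘ g i +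
        truncEps K 2 • (algebraMap K (TruncPoly K 2) ∘ γ (g i))) := by
  induction hz using Submodule.span_induction with
  | mem z hz =>
    obtain ⟨i, rfl⟩ := hz
    exact Submodule.subset_span ⟨i, rfl⟩
  | zero => rw [map_zero, comp_zero, smul_zero, add_zero]; exact zero_mem _
  | add y z _ _ h h' =>
    rw [map_add, comp_add, comp_add, smul_add, add_add_add_comm]
    exact add_mem h h'
  | smul a z _ h =>
    rw [map_smul, comp_smul, comp_smul, smul_comm, ← smul_add]
    exact Submodule.smul_mem _ _ h

/-- Elements of a deformed submodule. -/
theorem exists_of_mem_span_deform {W ι : Type} [Fintype ι] {g : ι → W → K}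
    (γ : (W → K) →ₗ[K] (W → K)) {w : W → TruncPoly K 2}
    (hw : w ∈ Submodule.span (TruncPoly K 2) (Set.range fun i =>
      algebraMap K (TruncPoly K 2) ∘ g i +
        truncEps K 2 • (algebraMap K (TruncPoly K 2) ∘ γ (g i)))) :
    ∃ a ∈ Submodule.span K (Set.range g), ∃ b ∈ Submodule.span K (Set.range g),
      w = algebraMap K (TruncPoly K 2) ∘ a +
        truncEps K 2 • (algebraMap K (TruncPoly K 2) ∘ (γ a + b)) := by
  induction hw using Submodule.span_induction with
  | mem z hz =>
    obtain ⟨i, rfl⟩ := hz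
    exact ⟨g i, Submodule.subset_span ⟨i, rfl⟩, 0, zero_mem _, by rw [add_zero]⟩
  | zero => exact ⟨0, zero_mem _, 0, zero_mem _, by
      rw [map_zero, add_zero, comp_zero, smul_zero, add_zero]⟩
  | add y z _ _ h h' =>
    obtain ⟨a, ha, b, hb, rfl⟩ := h
    obtain ⟨a', ha', b', hb', rfl⟩ := h'
    refine ⟨_, add_mem ha ha', _, add_mem hb hb', ?_⟩
    simp only [map_add, comp_add, smul_add]
    abel
  | smul c z _ h =>
    obtain ⟨a, ha, b, hb, rfl⟩ := h
    obtain ⟨d, hd⟩ := exists_eq_add_eps_mul c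
    obtain ⟨d', hd'⟩ := exists_eq_add_eps_mul d
    set c₀ := truncPolyEval K 1 c
    set d₀ := truncPolyEval K 1 d
    have hc : c = algebraMap K _ c₀ + truncEps K 2 * algebraMap K _ d₀ := by
      rw [hd, hd']
      linear_combination d' * eps_mul_eps (K := K)
    refine ⟨c₀ • a, Submodule.smul_mem _ _ ha, c₀ • b + d₀ • a,
      add_mem (Submodule.smul_mem _ _ hb) (Submodule.smul_mem _ _ ha), ?_⟩
    rw [hc]
    ext l
    simp only [Pi.smul_apply, Pi.add_apply, Function.comp_apply, smul_eq_mul, map_smul, map_add,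
      map_mul]
    linear_combination (algebraMap K (TruncPoly K 2) (γ a l) + algebraMap K (TruncPoly K 2) (b l)) *
      algebraMap K _ d₀ * eps_mul_eps (K := K)

variable (x : RedPoint m s K) {p y : Fin 2 → Fin (2 * m) → K}

/-- The first order deformation of `F`. -/
def filVar (p : Fin 2 → Fin (2 * m) → K) : (Idx m → K) →ₗ[K] (Idx m → K) :=
  pairVec m K ∘ₗ LinearMap.inr K _ _ ∘ₗ
    ((((omega m K).flip (p 1)).smulRight (p 0) - ((omega m K).flip (p 0)).smulRight (p 1)) ∘ₗ
      ypart m K)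

/-- The first order deformation of `G`. -/
def gilVar (y : Fin 2 → Fin (2 * m) → K) : (Idx m → K) →ₗ[K] (Idx m → K) :=
  pairVec m K ∘ₗ LinearMap.inl K _ _ ∘ₗ (((omega m K) (y 0)).smulRight (y 1)) ∘ₗ ypart m K

theorem filVar_apply (v : Idx m → K) : filVar p v = pairVec m K
    (0, omega m K (ypart m K v) (p 1) • p 0 - omega m K (ypart m K v) (p 0) • p 1) := rfl

theorem gilVar_apply (v : Idx m → K) : gilVar y v = pairVec m K
    (omega m K (y 0) (ypart m K v) • y 1, 0) := rfl

theorem eval_comp_deform {W : Type} (v w : W → K) : truncPolyEval K 1 ∘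
    (algebraMap K (TruncPoly K 2) ∘ v + truncEps K 2 • (algebraMap K (TruncPoly K 2) ∘ w)) = v := by
  ext l
  simp

/-- The variation of `F` is antisymmetric in `p 0` and `p 1`, so `F` stays isotropic to first order,
and it moves `t F` only by multiples of `ε` times radical vectors, which lie in the deformed `G`.
The variation of `G` adds multiples of `y 1`, orthogonal to `t F`. The conditions do not interact
further: `p i` is orthogonal to `G`, and `y 0` annihilates `t F`. -/
theorem exists_deformation (h2 : (2 : K) ≠ 0) (hp : ∀ i, pairVec m K (p i, 0) ∈ x.rad)
    (hy : ∀ i, ∀ v ∈ x.fil, omega m K (y i) (upart m K v) = 0) :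
    ∃ z : RedPoint m s (TruncPoly K 2), z.map (truncPolyEval K 1) = x ∧
      (∀ v ∈ x.fil, algebraMap K (TruncPoly K 2) ∘ v + truncEps K 2 •
        (algebraMap K (TruncPoly K 2) ∘ filVar p v) ∈ z.fil) ∧
      (∀ v ∈ x.gil, algebraMap K (TruncPoly K 2) ∘ v + truncEps K 2 •
        (algebraMap K (TruncPoly K 2) ∘ gilVar y v) ∈ z.gil) ∧
      ∀ w ∈ z.gil, ∃ a ∈ x.gil, ∃ b ∈ x.gil, w = algebraMap K (TruncPoly K 2) ∘ a +
        truncEps K 2 • (algebraMap K (TruncPoly K 2) ∘ (gilVar y a + b)) := by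
  obtain ⟨a, b, v, g, hfr, hF, hG⟩ := x.exists_frames
  have := isLocalHom_truncPolyEval (K := K) 1
  set ι := algebraMap K (TruncPoly K 2)
  have hv (i) : v i ∈ x.fil := hF ▸ Submodule.subset_span ⟨i, rfl⟩
  have hg (i) : g i ∈ x.gil := hG ▸ Submodule.subset_span ⟨i, rfl⟩
  have hpg (i) {z} (hz : z ∈ x.gil) : omega m K (ypart m K z) (p i) = 0 := by
    have := (hp i).2.2 z hz
    rwa [ypart_pairVec] at this
  have hdet {d : ℕ} {W : Type} {a : Fin d → W} {v : Fin d → W → K} (hv : Normalized a v)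
      (w : Fin d → W → K) :
      IsUnit (Matrix.of fun i j => (ι ∘ v i + truncEps K 2 • (ι ∘ w i)) (a j)).det := by
    refine isUnit_det_of_comp (truncPolyEval K 1) (fun i => eval_comp_deform _ _) ?_
    rw [show (Matrix.of fun i j => v i (a j)) = 1 from Matrix.ext fun i j => by
      rw [Matrix.of_apply, hv, Matrix.one_apply], Matrix.det_one]
    exact isUnit_one
  have hyp (v w : Idx m → K) : ypart m _ (ι ∘ v + truncEps K 2 • (ι ∘ w)) =
      ι ∘ ypart m K v + truncEps K 2 • (ι ∘ ypart m K w) := rfl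
  have hup (v w : Idx m → K) : upart m _ (ι ∘ v + truncEps K 2 • (ι ∘ w)) =
      ι ∘ upart m K v + truncEps K 2 • (ι ∘ upart m K w) := by
    rw [map_add, map_smul, map_upart, map_upart]
  have hom (v w v' w' : Fin (2 * m) → K) : omega m _ (ι ∘ v + truncEps K 2 • (ι ∘ w))
      (ι ∘ v' + truncEps K 2 • (ι ∘ w')) = ι (omega m K v v') +
        truncEps K 2 * ι (omega m K v w' + omega m K w v') := by
    simp only [map_add, LinearMap.add_apply, map_smul, LinearMap.smul_apply, smul_eq_mul, map_omega]
    linear_combination omega m _ (ι ∘ w) (ι ∘ w') * eps_mul_eps (K := K)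
  obtain ⟨z, hz1, hz2, hz3⟩ := exists_lift_of_frames (R := TruncPoly K 2)
    (v := fun i => ι ∘ v i + truncEps K 2 • (ι ∘ filVar p (v i)))
    (g := fun i => ι ∘ g i + truncEps K 2 • (ι ∘ gilVar y (g i))) (a := a) (b := b)
    (by
      have := (isUnit_iff_ne_zero.2 h2).map ι
      rwa [map_ofNat] at this) (truncPolyEval K 1 : TruncPoly K 2 →+* K) x
    (hdet hfr.norm_v _) (hdet hfr.norm_g _)
    (fun i j => by
      rw [hypForm_eq_omega, hyp, hyp, hup, hup, hom, hom]
      have h1 := x.splConds.conds.iso _ (hv i) _ (hv j)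
      rw [hypForm_eq_omega] at h1
      simp only [filVar_apply, ypart_pairVec, upart_pairVec, map_zero, LinearMap.zero_apply,
        add_zero, map_sub, map_smul, smul_eq_mul]
      rw [add_add_add_comm, ← map_add, h1, map_zero, zero_add, ← mul_add]
      simp only [map_mul]
      ring)
    (fun i => by
      rw [hup, x.upart_of_mem_gil (hg i), gilVar_apply, upart_pairVec, comp_zero, smul_zero,
        add_zero])
    (fun i j => by
      rw [hypForm_eq_omega, hyp, hyp, hup, hup, hom, hom, x.upart_of_mem_gil (hg i), gilVar_apply,
        upart_pairVec, ypart_pairVec, filVar_apply, upart_pairVec, ypart_pairVec,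
        x.omega_of_mem (hg i) (hv j), map_sub, map_smul, map_smul, hpg _ (hg i), hpg _ (hg i),
        map_smul, LinearMap.smul_apply, hy _ _ (hv j)]
      simp)
    (fun i => by
      rw [hup, filVar_apply, upart_pairVec]
      have h1 := mem_span_deform (gilVar y) (hG ▸ x.upart_mem_gil (hv i))
      have h3 (i) : truncEps K 2 • (ι ∘ pairVec m K (p i, 0)) ∈ Submodule.span (TruncPoly K 2)
          (Set.range fun i => ι ∘ g i + truncEps K 2 • (ι ∘ gilVar y (g i))) := by
        have h4 := Submodule.smul_mem _ (truncEps K 2)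
          (mem_span_deform (gilVar y) (hG ▸ (hp i).1))
        rwa [smul_add, eps_smul_eps_smul, add_zero] at h4
      rw [gilVar_apply, ypart_pairVec, hy _ _ (hv i), zero_smul, Prod.mk_zero_zero, map_zero,
        comp_zero, smul_zero, add_zero] at h1
      have h5 := add_mem h1 (sub_mem
        (Submodule.smul_mem _ (ι (omega m K (ypart m K (v i)) (p 1))) (h3 0))
        (Submodule.smul_mem _ (ι (omega m K (ypart m K (v i)) (p 0))) (h3 1)))
      have e (w : Fin (2 * m) → K) : ι ∘ pairVec m K (w, 0) = pairVec m _ (ι ∘ w, 0) := by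
        rw [map_pairVec, comp_zero]
      rw [e, e, e, ← map_smul, ← map_smul, ← map_smul, ← map_smul, ← map_sub, ← map_add] at h5
      convert h5 using 2
      refine Prod.ext ?_ ?_
      · ext l
        change ι _ + truncEps K 2 * ι (_ * _ - _ * _) = ι _ + (ι _ * (truncEps K 2 * ι _) -
          ι _ * (truncEps K 2 * ι _))
        rw [map_sub, map_mul, map_mul]
        ring
      · simp only [Prod.snd_add, Prod.snd_sub, Prod.smul_snd, smul_zero, sub_zero, add_zero])
    ((congrArg (fun w => Submodule.span K (Set.range w))
      (funext fun i => eval_comp_deform _ _)).trans hF.symm)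
    ((congrArg (fun w => Submodule.span K (Set.range w))
      (funext fun i => eval_comp_deform _ _)).trans hG.symm)
  refine ⟨z, hz1, fun w hw => ?_, fun w hw => ?_, fun w hw => ?_⟩
  · rw [hz2]
    exact mem_span_deform _ (hF ▸ hw)
  · rw [hz3]
    exact mem_span_deform _ (hG ▸ hw)
  · rw [hz3] at hw
    rw [hG]
    exact exists_of_mem_span_deform _ hw

/-- Points with `t F ≠ G ∩ G^⊥` have obstructed first order deformations. -/
theorem exists_obstructed (h2 : (2 : K) ≠ 0)
    (hx : Module.finrank K x.tfil < Module.finrank K x.rad) :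
    ∃ x₁ : RedPoint m s (TruncPoly K 2), x₁.map (truncPolyEval K 1) = x ∧
      ∀ x₂ : RedPoint m s (TruncPoly K 3),
        x₂.map (truncPolyReduce K (by norm_num : 2 ≤ 3)) ≠ x₁ := by
  obtain ⟨p, y, hp, hy, hyp⟩ := x.exists_transversal h2 hx
  obtain ⟨x₁, h₁, hfil, hgil, hgil'⟩ := x.exists_deformation h2 hp hy
  refine ⟨x₁, h₁, ?_⟩
  rintro x₂ rfl
  set ρ := truncPolyReduce K (by norm_num : 2 ≤ 3)
  set ι := algebraMap K (TruncPoly K 2)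
  have hρ : Function.Surjective ρ := truncPolyReduce_surjective _
  -- By duality of `p` and `y`, the variations send `(p 0, 0)` to `(y 1, 0)` and `(y 0, 0)` to `(0,
  -- -p 1)`. So `g` lifts `p 0 + ε y 1` and `v` lifts `(y 0, -ε p 1)`.
  obtain ⟨g, hg, hg'⟩ := exists_of_mem_push hρ (hgil _ (hp 0).1)
  obtain ⟨v, hv, hv'⟩ := exists_of_mem_push hρ (hfil _ (x.pairVec_mem_fil (hy 0)))
  rw [gilVar_apply, ypart_pairVec, hyp, if_pos rfl, one_smul] at hg'
  rw [filVar_apply, ypart_pairVec, hyp, hyp, if_pos rfl, if_neg (by decide), zero_smul, zero_sub,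
    one_smul] at hv'
  have hu : ρ ∘ upart m _ v = -(truncEps K 2 • (ι ∘ p 1)) := by
    rw [map_upart, hv', map_add, map_smul, ← map_upart, ← map_upart, upart_pairVec, upart_pairVec,
      comp_zero, zero_add, ← smul_neg]
    congr 1
    ext l
    simp
  obtain ⟨a, b, _, w, hfr, _, hG⟩ := x₂.exists_frames
  have hw (i) : w i ∈ x₂.gil := hG ▸ Submodule.subset_span ⟨i, rfl⟩
  have h3 := x₂.upart_mem_gil hv
  have h4 := Normalized.eq_sum hfr.norm_g (hG ▸ h3)
  set c : Fin s → TruncPoly K 3 := fun i => pairVec m _ (upart m _ v, 0) (b i)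
  -- The coefficients of `t v` in a normalized frame of `G` are coordinates of `t v`, which is
  -- divisible by `ε` modulo `ε²` and hence modulo `ε³`. Dividing them gives `z` in `G` with `ε z =
  -- t v`.
  have hc (i) : ∃ d, c i = truncEps K 3 * d := by
    refine exists_eq_eps_mul_of_reduce (d := pairVec m _ (-(ι ∘ p 1), 0) (b i)) ?_
    have h5 : ρ ∘ pairVec m _ (upart m _ v, 0) = truncEps K 2 • pairVec m _ (-(ι ∘ p 1), 0) := by
      rw [map_pairVec, comp_zero, hu, ← smul_neg, ← map_smul, Prod.smul_mk, smul_zero]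
    exact congrFun h5 (b i)
  choose d hd using hc
  let z := ∑ i, d i • w i
  have hz : z ∈ x₂.gil := sum_mem fun i _ => Submodule.smul_mem _ _ (hw i)
  have hεz : truncEps K 3 • ypart m _ z = upart m _ v := by
    rw [← map_smul, Finset.smul_sum]
    simp only [smul_smul, ← hd]
    rw [← h4, ypart_pairVec]
  -- Orthogonality of `g` and `v` reads `ε ω(g, z) = 0`, so `ω(g, z)` vanishes modulo `ε²`.
  have h5 := x₂.omega_of_mem hg hv
  rw [← hεz, map_smul, smul_eq_mul] at h5
  have h6 := truncPolyReduce_eq_zero h5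
  change ρ _ = 0 at h6
  rw [map_omega, map_ypart, hg', map_ypart] at h6
  -- The constant term of `z` is `-p 1`. It is orthogonal to `y 0`, so the variation of `G`
  -- contributes nothing, and `z` is `-p 1` plus `ε` times an element `a₁` of the original `G`.
  obtain ⟨a₀, ha₀, a₁, ha₁, hz'⟩ := hgil' _ (mem_push hz : ρ ∘ z ∈ push ρ x₂.gil)
  have h7 : truncEps K 2 • (ι ∘ ypart m K a₀) = -(truncEps K 2 • (ι ∘ p 1)) := by
    rw [← hu, ← hεz, comp_smul, map_ypart ρ, hz', map_add, map_smul, smul_add,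
      show ρ (truncEps K 3) = truncEps K 2 from rfl, eps_smul_eps_smul, add_zero, ← map_ypart ι]
  have h8 : ypart m K a₀ = -p 1 := by
    ext l
    rw [← sub_eq_zero]
    refine eps_mul_algebraMap_eq_zero ?_
    have := congrFun h7 l
    simp only [Pi.smul_apply, Pi.neg_apply, Function.comp_apply, smul_eq_mul] at this
    rw [Pi.neg_apply, sub_neg_eq_add, map_add, mul_add, this, neg_add_cancel]
  have h9 : omega m K (y 0) (ypart m K a₀) = 0 := by
    rw [h8, map_neg, hyp, if_neg (by decide), neg_zero]
  rw [hz', gilVar_apply, h9, zero_smul, Prod.mk_zero_zero, map_zero, zero_add] at h6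
  have h10 : ypart m (TruncPoly K 2) (ι ∘ pairVec m K (p 0, 0) + truncEps K 2 •
      (ι ∘ pairVec m K (y 1, 0))) = ι ∘ p 0 + truncEps K 2 • (ι ∘ y 1) := rfl
  have h11 : ypart m (TruncPoly K 2) (ι ∘ a₀ + truncEps K 2 • (ι ∘ a₁)) =
      ι ∘ (-p 1) + truncEps K 2 • (ι ∘ ypart m K a₁) := by rw [← h8]; rfl
  have hp' {w} (hw : w ∈ x.gil) : omega m K (p 0) (ypart m K w) = 0 := by
    rw [omega_neg_swap]
    have := (hp 0).2.2 w hw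
    rw [ypart_pairVec] at this
    rw [this, neg_zero]
  have hpp : omega m K (p 0) (p 1) = 0 := hp' (hp 1).1
  rw [h10, h11] at h6
  simp only [map_add, LinearMap.add_apply, map_smul, LinearMap.smul_apply, ← map_omega, map_neg,
    hpp, hp' ha₁, hyp, smul_eq_mul, neg_zero, map_zero, if_true] at h6
  rw [map_one] at h6
  -- In `ω(p 0 + ε y 1, -p 1 + ε a₁)` the terms with `p 0` vanish because `p 0` is in the radical;
  -- there remains `-ε ω(y 1, p 1) = -ε`, which is not zero modulo `ε²`.
  have h12 : truncEps K 2 * ι (-1) = 0 := by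
    rw [map_neg, map_one]
    linear_combination h6 - ι (omega m K (y 1) (ypart m K a₁)) * eps_mul_eps (K := K)
  have := eps_mul_algebraMap_eq_zero h12
  exact one_ne_zero (neg_eq_zero.1 this)

end RedPoint

/-! ### Points with prescribed invariants, spanned by coordinate vectors. -/

section Coord

variable {m s : ℕ} {K : Type u} [Field K]

theorem pairVec_zero : pairVec m K (0, 0) = 0 := map_zero _

theorem omega_coordVec_inl (i : Fin (2 * m)) (w : Fin (2 * m) → K) :
    omega m K (coordVec (.inl i)) w = w i := by
  have := omega_coordVec (upart_pairVec w (0 : Fin (2 * m) → K)) (.inl i)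
  exact this

theorem omega_single (i : Fin (2 * m)) (w : Fin (2 * m) → K) :
    omega m K (Pi.single i 1) w = (hsgn i : K) * w i.rev := by
  rw [omega_apply, Finset.sum_eq_single i]
  · rw [Pi.single_eq_same, one_mul]
  · intro j _ hj
    rw [Pi.single_eq_of_ne hj, zero_mul, mul_zero]
  · simp

variable (m K) in
/-- The coordinate vectors of `{u = 0}`. -/
def coordFam {d : ℕ} (β : Fin d → Fin (2 * m)) : Fin d → Idx m → K :=
  fun i => pairVec m K (Pi.single (β i) 1, 0)

theorem mem_span_coordFam_iff {d : ℕ} {β : Fin d → Fin (2 * m)} (hβ : Function.Injective β)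
    {w : Idx m → K} : w ∈ Submodule.span K (Set.range (coordFam m K β)) ↔
      upart m K w = 0 ∧ ∀ j, j ∉ Set.range β → ypart m K w j = 0 := by
  constructor
  · intro hw
    obtain ⟨c, rfl⟩ := (Submodule.mem_span_range_iff_exists_fun K).1 hw
    refine ⟨?_, fun j hj => ?_⟩
    · simp only [map_sum, map_smul, coordFam, upart_pairVec, smul_zero, Finset.sum_const_zero]
    · simp only [map_sum, map_smul, coordFam, ypart_pairVec, Finset.sum_apply, Pi.smul_apply]
      refine Finset.sum_eq_zero fun i _ => ?_
      rw [Pi.single_eq_of_ne (fun h => hj ⟨i, h.symm⟩), smul_zero]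
  · rintro ⟨h1, h2⟩
    have : w = ∑ i, ypart m K w (β i) • coordFam m K β i := by
      refine vec_ext ?_ ?_
      · ext j
        simp only [map_sum, map_smul, coordFam, ypart_pairVec, Finset.sum_apply, Pi.smul_apply]
        by_cases hj : j ∈ Set.range β
        · obtain ⟨i, rfl⟩ := hj
          rw [Finset.sum_eq_single i]
          · rw [Pi.single_eq_same, smul_eq_mul, mul_one]
          · intro i' _ hi'
            rw [Pi.single_eq_of_ne (hβ.ne hi'.symm), smul_zero]
          · simp
        · rw [h2 j hj, Finset.sum_eq_zero]
          intro i _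
          rw [Pi.single_eq_of_ne (fun h => hj ⟨i, h.symm⟩), smul_zero]
      · simp only [h1, map_sum, map_smul, coordFam, upart_pairVec, smul_zero, Finset.sum_const_zero]
    rw [this]
    exact sum_mem fun i _ => Submodule.smul_mem _ _ (Submodule.subset_span ⟨i, rfl⟩)

theorem linearIndependent_coordFam {d : ℕ} {β : Fin d → Fin (2 * m)}
    (hβ : Function.Injective β) : LinearIndependent K (coordFam m K β) := by
  rw [Fintype.linearIndependent_iff]
  intro c hc i
  have h1 := congrFun (congrArg (ypart m K) hc) (β i)
  simp only [map_sum, map_smul, coordFam, ypart_pairVec, Finset.sum_apply, Pi.smul_apply, map_zero,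
    Pi.zero_apply] at h1
  rwa [Finset.sum_eq_single i, Pi.single_eq_same, smul_eq_mul, mul_one] at h1
  · intro i' _ hi'
    rw [Pi.single_eq_of_ne (hβ.ne hi'.symm), smul_zero]
  · simp

theorem IsDualFrame.linearIndependent {v x : Fin (2 * m) → Idx m → K} (h : IsDualFrame v x) :
    LinearIndependent K v := by
  rw [Fintype.linearIndependent_iff]
  intro c hc i
  have h1 := congrArg (fun w => hypForm m K w (x i)) hc
  simpa [h.dual] using h1

theorem RedPoint.exists_of_conds {v : Fin (2 * m) → Idx m → K} {g : Fin s → Idx m → K}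
    (hv : LinearIndependent K v) (hg : LinearIndependent K g)
    (h : Conds s 0 (Submodule.span K (Set.range v)) (Submodule.span K (Set.range g))) :
    ∃ z : RedPoint m s K, z.fil = Submodule.span K (Set.range v) ∧
      z.gil = Submodule.span K (Set.range g) := by
  obtain ⟨a, ha⟩ := exists_det_ne_zero hv
  obtain ⟨b, hb⟩ := exists_det_ne_zero hg
  obtain ⟨v', hv', hvv⟩ := exists_normalized (isUnit_iff_ne_zero.2 ha)
  obtain ⟨g', hg', hgg⟩ := exists_normalized (isUnit_iff_ne_zero.2 hb)
  rw [← hvv, ← hgg] at h ⊢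
  exact exists_of_frames (frameEqs_iff.2 ⟨hv', hg', h⟩)

theorem negOne_pow_eq_of_modEq {R : Type*} [Ring R] {a b : ℕ} (h : a ≡ b [MOD 2]) :
    (-1 : R) ^ a = (-1) ^ b := by
  rw [neg_one_pow_eq_pow_mod_two, neg_one_pow_eq_pow_mod_two (n := b), h]

/-- Existence of points with given invariants. -/
theorem RedPoint.exists_of_invariants {h l : ℕ} (hhl : h ≤ l) (hls : l ≤ s) (hsm : s ≤ m)
    (hh : h ≡ s [MOD 2]) (hl : l ≡ s [MOD 2]) : ∃ z : RedPoint m s K,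
      Module.finrank K z.tfil = h ∧ Module.finrank K z.rad = l := by
  -- Here `p` is the number of hyperbolic planes in `G` modulo its radical. The subspace `t F` is
  -- spanned by the first `h` coordinate vectors, and `F ∩ {u = 0}` by the first `2m - h`, which is
  -- the orthogonal complement of `t F`.
  obtain ⟨p, rfl⟩ : ∃ p, s = l + p + p := ⟨(s - l) / 2, by unfold Nat.ModEq at hl; omega⟩
  obtain ⟨k, ef⟩ : ∃ k, h + k = 2 * m := ⟨2 * m - h, by omega⟩
  let α : Fin h → Fin (2 * m) := Fin.castLE (by omega)
  let β : Fin k → Fin (2 * m) := Fin.castLE (by omega)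
  -- `G` is spanned by the first `l + p` coordinate vectors and the `p` vectors paired by `ω` with
  -- those of index `l` to `l + p - 1`. Only the first `l` have no partner, and they span the
  -- radical. The bound `s ≤ m` keeps the two ranges disjoint.
  let b : Fin (l + p + p) → Fin (2 * m) := fun i =>
    if (i : ℕ) < l + p then ⟨i, by omega⟩ else Fin.rev ⟨i - p, by omega⟩
  have hα : Function.Injective α := Fin.castLE_injective _
  have hβ : Function.Injective β := Fin.castLE_injective _
  have hb : Function.Injective b := by
    intro i j hij
    have := congrArg Fin.val hij
    simp only [b] at this
    ext
    have hi := i.2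
    have hj := j.2
    split_ifs at this <;> simp only [Fin.val_rev] at this <;> omega
  have hbr (j : Fin (2 * m)) : j ∈ Set.range b ↔
      (j : ℕ) < l + p ∨ (2 * m ≤ j + l + p ∧ (j : ℕ) + l < 2 * m) := by
    constructor
    · rintro ⟨i, rfl⟩
      have hi := i.2
      simp only [b]
      split_ifs <;> simp only [Fin.val_rev] <;> omega
    · have hj := j.2
      rintro (h1 | h1)
      · exact ⟨⟨j, by omega⟩, by simp only [b, h1, if_true]⟩
      · refine ⟨⟨2 * m - 1 - j + p, by omega⟩, ?_⟩
        ext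
        simp only [b]
        rw [if_neg (by omega), Fin.val_rev]
        simp only
        omega
  have hαr (i) : α i ∈ Set.range b := (hbr _).2 (Or.inl (by
    have := i.2
    simp only [α, Fin.val_castLE]
    omega))
  have hbβ (i) : b i ∈ Set.range β := by
    have h1 : ((b i : Fin (2 * m)) : ℕ) < k := by
      have := (hbr (b i)).1 ⟨i, rfl⟩
      omega
    exact ⟨⟨b i, h1⟩, rfl⟩
  let e := splitEquiv ef
  let v' : Fin h ⊕ Fin k → Idx m → K :=
    Sum.elim (fun i => pairVec m K (0, Pi.single (α i) 1)) (coordFam m K β)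
  let v : Fin (2 * m) → Idx m → K := fun i => v' (e.symm i)
  let x' : Fin h ⊕ Fin k → Idx m → K :=
    Sum.elim (fun i => pairVec m K (coordVec (.inl (α i)), 0))
      (fun i => pairVec m K (0, -coordVec (.inl (β i))))
  let x : Fin (2 * m) → Idx m → K := fun i => x' (e.symm i)
  have hαβ (i j) : omega m K (Pi.single (β j) 1) (Pi.single (α i) 1) = 0 := by
    rw [omega_single, Pi.single_eq_of_ne, mul_zero]
    intro h1
    have h2 := congrArg Fin.val h1
    have hi := i.2
    have hj := j.2
    simp only [α, β, Fin.val_rev, Fin.val_castLE] at h2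
    omega
  have hiso (i j) : hypForm m K (v' i) (v' j) = 0 := by
    rw [hypForm_eq_omega]
    rcases i with i | i <;> rcases j with j | j <;> simp [v', coordFam, hαβ]
  have hdual (i j) : hypForm m K (v' i) (x' j) = if i = j then 1 else 0 := by
    rw [hypForm_eq_omega]
    rcases i with i | i <;> rcases j with j | j
    · simp only [v', x', Sum.elim_inl, ypart_pairVec, upart_pairVec, map_zero, zero_add,
        omega_coordVec_inl, Sum.inl.injEq, Pi.single_apply, hα.eq_iff, eq_comm]
    · simp [v', x']
    · simp [v', x', coordFam]
    · simp only [v', x', Sum.elim_inr, coordFam, ypart_pairVec, upart_pairVec, map_zero, add_zero,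
        map_neg, Sum.inr.injEq]
      rw [omega_neg_swap, neg_neg, omega_coordVec_inl]
      simp only [Pi.single_apply, hβ.eq_iff, eq_comm]
  have hd : IsDualFrame v x :=
    ⟨fun i j => hiso _ _, fun i j => (hdual _ _).trans (by simp only [e.symm.injective.eq_iff])⟩
  have hspan : Submodule.span K (Set.range v) = Submodule.span K (Set.range v') :=
    congrArg _ (e.symm.surjective.range_comp v')
  -- The frame is adapted to `t`, so its sign is `(-1)^h`; the parity of `h` makes it the required
  -- one.
  have hspin : fullDet x v = (((-1) ^ (l + p + p) : ℤˣ) : ℤ) := by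
    obtain ⟨y, hy1, hy2⟩ := exists_sign_of_adapted e (v := v) hd.iso
      (fun j => by
        change upart m K (v' (e.symm (e (.inr j)))) = 0
        rw [Equiv.symm_apply_apply]
        exact upart_pairVec _ _)
      (p := fun i => coordVec (.inl (α i))) (q := fun i => -coordVec (.inl (β i)))
      (fun i j => by
        change omega m K _ (upart m K (v' (e.symm (e (.inl j))))) = _
        rw [Equiv.symm_apply_apply]
        simp only [v', Sum.elim_inl, upart_pairVec, omega_coordVec_inl, Pi.single_apply,
          hα.eq_iff])
      (fun i j => by
        change omega m K (ypart m K (v' (e.symm (e (.inr i))))) _ = _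
        rw [Equiv.symm_apply_apply, omega_neg_swap]
        simp only [v', Sum.elim_inr, coordFam, ypart_pairVec, map_neg, LinearMap.neg_apply, neg_neg,
          omega_coordVec_inl, Pi.single_apply, hβ.eq_iff, eq_comm])
    rw [hd.fullDet_eq y, hy1, one_mul] at hy2
    rw [hy2]
    push_cast
    exact negOne_pow_eq_of_modEq hh
  have hgm (w) := mem_span_coordFam_iff (K := K) (w := w) hb
  have hconds : Conds (l + p + p) (0 : K) (Submodule.span K (Set.range v))
      (Submodule.span K (Set.range (coordFam m K b))) := by
    refine ⟨?_, fun y hy z hz => ?_, fun y hy => ?_, fun y hy => ?_, (hd.spin_iff _).2 hspin⟩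
    · rw [hspan, Submodule.span_le]
      rintro _ ⟨i, rfl⟩
      obtain ⟨j, hj⟩ := hbβ i
      exact Submodule.subset_span ⟨.inr j, by simp only [v', Sum.elim_inr, coordFam, hj]⟩
    · obtain ⟨c, rfl⟩ := (Submodule.mem_span_range_iff_exists_fun K).1 hy
      obtain ⟨c', rfl⟩ := (Submodule.mem_span_range_iff_exists_fun K).1 hz
      simp [LinearMap.sum_apply, hd.iso]
    · rw [hspan] at hy
      rw [coordPlus_zero]
      suffices h1 : Submodule.span K (Set.range v') ≤
          (Submodule.span K (Set.range (coordFam m K b))).comap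
            (pairVec m K ∘ₗ LinearMap.inl K _ _ ∘ₗ upart m K) from h1 hy
      rw [Submodule.span_le]
      rintro _ ⟨i | i, rfl⟩
      · obtain ⟨j, hj⟩ := hαr i
        refine Submodule.subset_span ⟨j, ?_⟩
        simp [v', coordFam, hj]
      · simp [v', coordFam, pairVec_zero]
    · rw [coordMinus_eq_zero_iff]
      exact ((hgm y).1 hy).1
  obtain ⟨z, hz1, hz2⟩ := exists_of_conds hd.linearIndependent (linearIndependent_coordFam hb) hconds
  refine ⟨z, ?_, ?_⟩
  · have h1 : z.tfil = Submodule.span K (Set.range (coordFam m K α)) := by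
      rw [tfil, hz1, hspan, Submodule.map_span, ← Set.range_comp]
      refine le_antisymm (Submodule.span_le.2 ?_) (Submodule.span_le.2 ?_)
      · rintro _ ⟨i | i, rfl⟩
        · refine Submodule.subset_span ⟨i, ?_⟩
          simp [v', coordFam, coordT_zero]
        · simp [v', coordFam, coordT_zero, pairVec_zero]
      · rintro _ ⟨i, rfl⟩
        refine Submodule.subset_span ⟨.inl i, ?_⟩
        simp [v', coordFam, coordT_zero]
    rw [h1, finrank_span_eq_card (linearIndependent_coordFam hα), Fintype.card_fin]
  · let γ : Fin l → Fin (2 * m) := Fin.castLE (by omega)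
    have hγ : Function.Injective γ := Fin.castLE_injective _
    have hγr (j : Fin (2 * m)) : j ∈ Set.range γ ↔ (j : ℕ) < l := by
      constructor
      · rintro ⟨i, rfl⟩
        exact i.2
      · exact fun h1 => ⟨⟨j, h1⟩, rfl⟩
    have h1 : z.rad = Submodule.span K (Set.range (coordFam m K γ)) := by
      ext w
      rw [mem_span_coordFam_iff hγ]
      have h2 : w ∈ z.rad ↔ w ∈ z.gil ∧ upart m K w = 0 ∧
        ∀ g ∈ z.gil, omega m K (ypart m K g) (ypart m K w) = 0 := Iff.rfl
      rw [h2, hz2, hgm]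
      constructor
      · rintro ⟨⟨h3, h4⟩, -, h5⟩
        refine ⟨h3, fun j hj => ?_⟩
        rw [hγr] at hj
        by_cases hjb : j ∈ Set.range b
        · have h6 : j.rev ∈ Set.range b := by
            rw [hbr] at hjb ⊢
            have := j.2
            rw [Fin.val_rev]
            omega
          obtain ⟨i, hi⟩ := h6
          have h7 := h5 _ (Submodule.subset_span ⟨i, rfl⟩)
          rw [coordFam, ypart_pairVec, omega_single, hi, Fin.rev_rev] at h7
          refine (mul_eq_zero.1 h7).resolve_left fun h8 => ?_
          have h9 := congrArg (Int.cast : ℤ → K) (hsgn_mul_self j.rev)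
          rw [Int.cast_mul, h8, zero_mul, Int.cast_one] at h9
          exact zero_ne_one h9
        · exact h4 j hjb
      · rintro ⟨h3, h4⟩
        refine ⟨⟨h3, fun j hj => h4 j fun h5 => hj ?_⟩, h3, fun g hg => ?_⟩
        · rw [hγr] at h5
          exact (hbr j).2 (Or.inl (by omega))
        · rw [hgm] at hg
          rw [omega_apply]
          refine Finset.sum_eq_zero fun j _ => ?_
          by_cases hj : j ∈ Set.range b
          · rw [h4 j.rev, mul_zero, mul_zero]
            rw [hγr, Fin.val_rev]
            rw [hbr] at hj
            have := j.2
            omega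
          · rw [hg.2 j hj, zero_mul, mul_zero]
    rw [h1, finrank_span_eq_card (linearIndependent_coordFam hγ), Fintype.card_fin]

end Coord

/-! ### Invariance under field extension, and the strata in coordinates. -/

section FieldExtension

variable {m s : ℕ} {K L : Type u} [Field K] [Field L]

theorem finrank_push_field {W : Type} [Fintype W] (φ : K →+* L) (P : Submodule K (W → K)) :
    Module.finrank L (push φ P) = Module.finrank K P := by
  let _ : Algebra K L := φ.toAlgebra
  obtain ⟨Q, hQ⟩ := P.exists_isCompl
  exact (finrank_push (S := L) hQ).trans Module.finrank_baseChange

namespace RedPoint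

variable (x : RedPoint m s K) (φ : K →+* L)

theorem tfil_map : (x.map φ).tfil = push φ x.tfil := by
  refine le_antisymm ?_ (push_le.2 ?_)
  · rw [tfil, Submodule.map_le_iff_le_comap]
    refine push_le.2 fun v hv => ?_
    have h1 : coordT m L 0 (φ ∘ v) = φ ∘ coordT m K 0 v := by
      rw [coordT_zero, coordT_zero, map_pairVec, map_upart, comp_zero]
    rw [Submodule.mem_comap, h1]
    exact mem_push ⟨v, hv, rfl⟩
  · rintro _ ⟨v, hv, rfl⟩
    refine ⟨φ ∘ v, mem_push hv, ?_⟩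
    rw [coordT_zero, coordT_zero, map_pairVec, map_upart, comp_zero]

/-- The radical could only grow. A complement of it in `G` has an invertible Gram matrix, and this
persists over the larger field, so an element of the new radical has no component along the
complement. -/
theorem rad_map : (x.map φ).rad = push φ x.rad := by
  refine le_antisymm ?_ (push_le.2 ?_)
  · let b := Module.finBasis K x.rad
    obtain ⟨j, hj, g₂, hg₂, hli, hdet⟩ := x.exists_compl_rad
      (linearIndependent_coe_basis b) (span_coe_basis b)
    let g := Sum.elim (fun i => (b i : Idx m → K)) g₂
    have hspan : Submodule.span K (Set.range g) = x.gil := by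
      refine Submodule.eq_of_le_of_finrank_eq (Submodule.span_le.2 ?_) ?_
      · rintro _ ⟨i | i, rfl⟩
        · exact (b i).2.1
        · exact hg₂ i
      · rw [finrank_span_eq_card hli, x.finrank_gil, Fintype.card_sum, Fintype.card_fin,
          Fintype.card_fin, hj]
    rintro w ⟨hw, -, hw'⟩
    have hw1 : w ∈ push φ x.gil := hw
    rw [← hspan, push_span_range] at hw1
    obtain ⟨c, rfl⟩ := (Submodule.mem_span_range_iff_exists_fun L).1 hw1
    have h1 : (Matrix.of fun i i' => omega m L (ypart m L (φ ∘ g₂ i))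
        (ypart m L (φ ∘ g₂ i'))).det ≠ 0 := by
      have h2 := (map_ne_zero φ).2 hdet
      rw [RingHom.map_det] at h2
      refine ne_of_eq_of_ne (congrArg Matrix.det (Matrix.ext fun i i' => ?_)) h2
      rw [RingHom.mapMatrix_apply, Matrix.map_apply, Matrix.of_apply, Matrix.of_apply]
      exact (map_omega φ _ _).symm
    have h3 : (fun i => c (.inr i)) = 0 := by
      refine Matrix.eq_zero_of_mulVec_eq_zero h1 (funext fun i => ?_)
      have h4 := hw' _ (mem_push (hg₂ i))
      rw [Fintype.sum_sum_type] at h4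
      have h5 (l) : omega m L (ypart m L (φ ∘ g₂ i)) (ypart m L (φ ∘ g (.inl l))) = 0 := by
        rw [← map_ypart, ← map_ypart, ← map_omega]
        exact (congrArg φ ((b l).2.2.2 _ (hg₂ i))).trans (map_zero φ)
      simp only [map_add, map_sum, map_smul, h5, smul_zero, Finset.sum_const_zero, zero_add] at h4
      rw [Pi.zero_apply, ← h4]
      simp only [Matrix.mulVec, dotProduct, Matrix.of_apply, smul_eq_mul]
      exact Finset.sum_congr rfl fun l _ => mul_comm _ _
    refine sum_mem fun i _ => ?_
    rcases i with i | i
    · exact Submodule.smul_mem _ _ (mem_push (b i).2)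
    · rw [show c (.inr i) = 0 from congrFun h3 i, zero_smul]
      exact zero_mem _
  · rintro v ⟨hv, hu, hω⟩
    refine ⟨mem_push hv, ?_, ?_⟩
    · rw [← map_upart, hu, comp_zero]
    · intro g hg
      have hle : push φ x.gil ≤ LinearMap.ker
          ((omega m L).flip (ypart m L (φ ∘ v)) ∘ₗ ypart m L) := by
        refine push_le.2 fun g hg => ?_
        change omega m L (ypart m L (φ ∘ g)) (ypart m L (φ ∘ v)) = 0
        rw [← map_ypart, ← map_ypart, ← map_omega, hω g hg, map_zero]
      exact hle hg

theorem finrank_tfil_map : Module.finrank L (x.map φ).tfil = Module.finrank K x.tfil := by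
  rw [tfil_map, finrank_push_field]

theorem finrank_rad_map : Module.finrank L (x.map φ).rad = Module.finrank K x.rad := by
  rw [rad_map, finrank_push_field]

end RedPoint

end FieldExtension

section Strata

variable {O₀ F₀ O F : Type u}
  [CommRing O₀] [IsDomain O₀] [IsDiscreteValuationRing O₀]
  [Field F₀] [Algebra O₀ F₀] [IsFractionRing O₀ F₀]
  [Field F] [Algebra F₀ F] [Algebra O₀ F] [IsScalarTower O₀ F₀ F]
  [CommRing O] [IsDomain O] [IsDiscreteValuationRing O]
  [Algebra O₀ O] [Algebra O F] [IsScalarTower O₀ O F] [IsIntegralClosure O O₀ F]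
  {D : RamifiedQuadratic O₀ F₀ O F} {m s : ℕ} {K : Type u} [Field K]

theorem SplPoint.dimTFil_eq [Algebra O K] (h0 : algebraMap O K D.unif = 0)
    (y : SplPoint D m K s) (z : RedPoint m s K)
    (hF : y.Fil.map (coord D m K : LamR D m K →ₗ[K] Idx m → K) = z.fil) :
    y.dimTFil = Module.finrank K z.tfil := by
  have e : (coord D m K : LamR D m K →ₗ[K] Idx m → K) ∘ₗ tR D m K =
      coordT m K 0 ∘ₗ (coord D m K : LamR D m K →ₗ[K] Idx m → K) :=
    LinearMap.ext fun v => (coord_tR D m K v).trans (by rw [h0]; rfl)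
  rw [SplPoint.dimTFil, ← LinearEquiv.finrank_map_eq (coord D m K), RedPoint.tfil, ← hF,
    ← Submodule.map_comp, ← Submodule.map_comp, e]

theorem SplPoint.dimGilInf_eq [Algebra O K] (h0 : algebraMap O K D.unif = 0)
    (y : SplPoint D m K s) (z : RedPoint m s K)
    (hG : y.Gil.map (coord D m K : LamR D m K →ₗ[K] Idx m → K) = z.gil) :
    y.dimGilInf = Module.finrank K z.rad := by
  have hmem {g} (hg : g ∈ y.Gil) : coord D m K g ∈ z.gil := hG ▸ ⟨g, hg, rfl⟩
  have hω {g} (hg : g ∈ y.Gil) (w : LamR D m K) : formR D m K g w =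
      omega m K (ypart m K (coord D m K g)) (upart m K (coord D m K w)) := by
    rw [formR_eq_hypForm, hypForm_eq_omega, z.upart_of_mem_gil (hmem hg), map_zero, add_zero]
  have h1 : y.gilDual.map (coord D m K : LamR D m K →ₗ[K] Idx m → K) = z.gilPerp := by
    refine le_antisymm ?_ fun w hw => ?_
    · rintro _ ⟨_, ⟨v, hv, rfl⟩, rfl⟩
      have h2 : (coord D m K : LamR D m K →ₗ[K] Idx m → K) (tMinus D m K v) =
          pairVec m K (upart m K (coord D m K v), 0) := by
        rw [← coordMinus_zero, ← h0]
        exact coord_tMinus v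
      rw [h2]
      refine ⟨upart_pairVec _ _, fun g hg => ?_⟩
      rw [← hG] at hg
      obtain ⟨g, hg, rfl⟩ := hg
      rw [ypart_pairVec]
      exact (hω hg v).symm.trans (LinearMap.BilinForm.mem_orthogonal_iff.1 hv g hg)
    -- As `π = 0`, a vector `(w, 0)` is the image under `t` of `(0, w)`, and pairing `(0, w)` with
    -- elements of `G` is the modified pairing with `(w, 0)`.
    · refine ⟨tMinus D m K ((coord D m K).symm (pairVec m K (0, ypart m K w))), ⟨_, ?_, rfl⟩, ?_⟩
      · refine LinearMap.BilinForm.mem_orthogonal_iff.2 fun g hg => ?_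
        rw [hω hg, LinearEquiv.apply_symm_apply, upart_pairVec]
        exact hw.2 _ (hmem hg)
      · refine (coord_tMinus _).trans ?_
        rw [h0, LinearEquiv.apply_symm_apply, coordMinus_zero, upart_pairVec]
        conv_rhs => rw [← pairVec_parts w, hw.1]
  rw [SplPoint.dimGilInf, ← LinearEquiv.finrank_map_eq (coord D m K), RedPoint.rad, ← h1, ← hG]
  rw [Submodule.map_inf _ (coord D m K).injective]

namespace SplModel

variable (M : SplModel D m s)

theorem dim_point [Algebra (IsLocalRing.ResidueField O) K] (f : SchemePoint M.specialFiberStr K)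
    (i : Algebra O K) (hf : (f.1 ≫ M.specialFiberι) ≫ M.str =
      Spec.map (CommRingCat.ofHom (algebraMap O K))) :
    (M.point K ⟨f.1 ≫ M.specialFiberι, hf⟩).dimTFil = Module.finrank K (M.redPoint K f).tfil ∧
      (M.point K ⟨f.1 ≫ M.specialFiberι, hf⟩).dimGilInf =
        Module.finrank K (M.redPoint K f).rad := by
  -- The `O`-algebra structure on the field is determined by the morphism to `Spec O`, and this
  -- factors through the residue field of `O`.
  obtain rfl : i = Algebra.compHom K (algebraMap O (IsLocalRing.ResidueField O)) := by
    refine Algebra.algebra_ext _ _ fun r => ?_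
    rw [Category.assoc, specialFiber_condition, ← Category.assoc, f.2, ← Spec.map_comp] at hf
    exact congr($(Spec.map_injective hf.symm).hom r)
  let _ : Algebra O K := Algebra.compHom K (algebraMap O (IsLocalRing.ResidueField O))
  have : IsScalarTower O (IsLocalRing.ResidueField O) K := .of_algebraMap_eq fun _ => rfl
  let y := M.point K ⟨f.1 ≫ M.specialFiberι, hf⟩
  have h1 : y.Fil.map (coord D m K : LamR D m K →ₗ[K] Idx m → K) = (M.redPoint K f).fil := rfl
  have h2 : y.Gil.map (coord D m K : LamR D m K →ₗ[K] Idx m → K) = (M.redPoint K f).gil := rfl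
  exact ⟨y.dimTFil_eq algebraMap_unif_eq_zero _ h1, y.dimGilInf_eq algebraMap_unif_eq_zero _ h2⟩

theorem finrank_redPoint_eq {κ : Type u} [Field κ] [Algebra (IsLocalRing.ResidueField O) κ]
    [Algebra (IsLocalRing.ResidueField O) K] (q : SchemePoint M.specialFiberStr κ)
    (f : SchemePoint M.specialFiberStr K) (φ : Spec (.of K) ⟶ Spec (.of κ)) (h : φ ≫ q.1 = f.1) :
    Module.finrank K (M.redPoint K f).tfil = Module.finrank κ (M.redPoint κ q).tfil ∧
      Module.finrank K (M.redPoint K f).rad = Module.finrank κ (M.redPoint κ q).rad := by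
  obtain ⟨ψ, rfl⟩ := exists_specMap_eq (O := IsLocalRing.ResidueField O) φ (by
    rw [← q.2, ← Category.assoc, h, f.2])
  rw [M.redPoint_natural ψ q f h.symm, RedPoint.finrank_tfil_map, RedPoint.finrank_rad_map]
  exact ⟨rfl, rfl⟩

/-- The residue field is hidden behind an abstract field `κ` with its point and factorization
property, so that further arguments need only field-valued points. -/
theorem exists_residuePoint (x : M.specialFiber) :
    ∃ (κ : Type u) (_ : Field κ) (_ : Algebra (IsLocalRing.ResidueField O) κ)
      (q : SchemePoint M.specialFiberStr κ), q.1 (IsLocalRing.closedPoint κ) = x ∧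
        (∀ h l, x ∈ M.stratum h l ↔
          Module.finrank κ (M.redPoint κ q).tfil = h ∧ Module.finrank κ (M.redPoint κ q).rad = l) ∧
        ∀ (K : Type u) [Field K] (f : Spec (.of K) ⟶ M.specialFiber),
          f (IsLocalRing.closedPoint K) = x → ∃ φ : Spec (.of K) ⟶ Spec (.of κ), φ ≫ q.1 = f := by
  let κ : Type u := M.specialFiber.residueField x
  let _ : Field κ := inferInstanceAs (Field (M.specialFiber.residueField x))
  let i : Algebra (IsLocalRing.ResidueField O) κ :=
    (Spec.preimage (M.specialFiber.fromSpecResidueField x ≫ M.specialFiberStr)).hom.toAlgebra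
  let q : SchemePoint M.specialFiberStr κ :=
    ⟨M.specialFiber.fromSpecResidueField x, (Spec.map_preimage _).symm⟩
  refine ⟨κ, inferInstance, i, q, M.specialFiber.fromSpecResidueField_apply x _, fun h l => ?_, ?_⟩
  · obtain ⟨h1, h2⟩ := M.dim_point q (M.residueAlgebra x) (by
      rw [Category.assoc]
      exact (Spec.map_preimage _).symm)
    rw [← h1, ← h2]
    rfl
  · rintro K _ f rfl
    exact ⟨_, Scheme.descResidueField_stalkClosedPointTo_fromSpecResidueField K _ f⟩

/-- Any field-valued point at `x` factors through the residue field, and the two dimensions are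
unchanged by field extension. -/
theorem mem_stratum_iff [Algebra (IsLocalRing.ResidueField O) K]
    (f : SchemePoint M.specialFiberStr K) {x : M.specialFiber}
    (hx : f.1 (IsLocalRing.closedPoint K) = x) (h l : ℕ) : x ∈ M.stratum h l ↔
      Module.finrank K (M.redPoint K f).tfil = h ∧ Module.finrank K (M.redPoint K f).rad = l := by
  obtain ⟨κ, _, _, q, -, h1, h2⟩ := M.exists_residuePoint x
  obtain ⟨φ, hφ⟩ := h2 K f.1 hx
  obtain ⟨h3, h4⟩ := M.finrank_redPoint_eq q f φ hφ
  rw [h3, h4, h1]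

theorem eq_comp_of_redPoint_eq {R R' : Type u} [CommRing R] [CommRing R']
    [Algebra (IsLocalRing.ResidueField O) R] [Algebra (IsLocalRing.ResidueField O) R']
    (g : R →ₐ[IsLocalRing.ResidueField O] R') (f : SchemePoint M.specialFiberStr R)
    (f' : SchemePoint M.specialFiberStr R') (h : M.redPoint R' f' = (M.redPoint R f).map g) :
    f'.1 = specMap g ≫ f.1 := by
  let f'' : SchemePoint M.specialFiberStr R' := ⟨specMap g ≫ f.1, by
    rw [Category.assoc, f.2, specMap_over]⟩
  have h1 := (M.redPoint R').injective (h.trans (M.redPoint_natural g f f'' rfl).symm)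
  rw [h1]

end SplModel
end Strata

/-! ### The smooth locus of the special fibre. -/

variable {O₀ F₀ O F : Type u}
  [CommRing O₀] [IsDomain O₀] [IsDiscreteValuationRing O₀]
  [Field F₀] [Algebra O₀ F₀] [IsFractionRing O₀ F₀]
  [Field F] [Algebra F₀ F] [Algebra O₀ F] [IsScalarTower O₀ F₀ F]
  [CommRing O] [IsDomain O] [IsDiscreteValuationRing O]
  [Algebra O₀ O] [Algebra O F] [IsScalarTower O₀ O F] [IsIntegralClosure O O₀ F]
  {D : RamifiedQuadratic O₀ F₀ O F} {m s : ℕ}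

theorem isUnit_two_of_residue (D : RamifiedQuadratic O₀ F₀ O F) (R : Type u) [CommRing R]
    [Algebra (IsLocalRing.ResidueField O) R] : IsUnit (2 : R) := by
  have h := ((isUnit_two₀ D).map (algebraMap O₀ O)).map
    ((algebraMap (IsLocalRing.ResidueField O) R).comp (IsLocalRing.residue O))
  rwa [map_ofNat, map_ofNat] at h

/-- The reduction of truncated polynomials as a map of algebras. -/
def truncPolyEvalₐ (k K : Type u) [Field k] [Field K] [Algebra k K] (j : ℕ) :
    TruncPoly K (j + 1) →ₐ[k] K :=
  ⟨truncPolyEval K j, fun a => by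
    rw [IsScalarTower.algebraMap_apply k K (TruncPoly K (j + 1))]
    exact truncPolyEval_algebraMap j _⟩

/-- The reduction of truncated polynomials as a map of algebras. -/
def truncPolyReduceₐ (k K : Type u) [Field k] [Field K] [Algebra k K] {i j : ℕ} (h : j ≤ i) :
    TruncPoly K i →ₐ[k] TruncPoly K j :=
  ⟨truncPolyReduce K h, fun a => by
    rw [IsScalarTower.algebraMap_apply k K (TruncPoly K i),
      IsScalarTower.algebraMap_apply k K (TruncPoly K j)]
    exact truncPolyReduce_algebraMap h _⟩

namespace SplModel

variable (M : SplModel D m s)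

/-- Obstructed first order deformations of points of the special fiber. -/
theorem exists_obstructed {K : Type u} [Field K] [Algebra (IsLocalRing.ResidueField O) K]
    (f : SchemePoint M.specialFiberStr K) (hf : Module.finrank K (M.redPoint K f).tfil <
      Module.finrank K (M.redPoint K f).rad) :
    ∃ f₁ : SchemePoint M.specialFiberStr (TruncPoly K 2),
      f.1 = specMap (truncPolyEvalₐ (IsLocalRing.ResidueField O) K 1) ≫ f₁.1 ∧
      ∀ f₂ : SchemePoint M.specialFiberStr (TruncPoly K 3),
        f₁.1 ≠ specMap (truncPolyReduceₐ (IsLocalRing.ResidueField O) K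
          (by norm_num : 2 ≤ 3)) ≫ f₂.1 := by
  obtain ⟨x₁, h1, h2⟩ := (M.redPoint K f).exists_obstructed
    (isUnit_two_of_residue D K).ne_zero hf
  refine ⟨(M.redPoint _).symm x₁, M.eq_comp_of_redPoint_eq _ _ _ ?_, fun f₂ h3 => ?_⟩
  · rw [Equiv.apply_symm_apply]
    exact h1.symm
  · have h4 := M.redPoint_natural _ f₂ _ h3
    rw [Equiv.apply_symm_apply] at h4
    exact h2 _ h4.symm

/-- Were the dimensions different, the obstructed deformation would contradict infinitesimal lifting
along `K[ε]/ε³ → K[ε]/ε²`, whose kernel has square zero. -/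
theorem finrank_tfil_eq_of_mem_smoothPoints {K : Type u} [Field K]
    [Algebra (IsLocalRing.ResidueField O) K] (f : SchemePoint M.specialFiberStr K)
    (hx : f.1 (IsLocalRing.closedPoint K) ∈ smoothPoints M.specialFiberStr) :
    Module.finrank K (M.redPoint K f).tfil = Module.finrank K (M.redPoint K f).rad := by
  by_contra hne
  obtain ⟨f₁, h1, h2⟩ := M.exists_obstructed f
    (lt_of_le_of_ne (Submodule.finrank_mono (RedPoint.tfil_le_rad _)) hne)
  have hy : f₁.1 (IsLocalRing.closedPoint (TruncPoly K 2)) = f.1 (IsLocalRing.closedPoint K) := by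
    rw [h1]
    refine Eq.symm ((Scheme.Hom.comp_apply _ _ _).trans (congrArg f₁.1 ?_))
    have := isLocalHom_truncPolyEval (K := K) 1
    exact IsLocalRing.comap_closedPoint (truncPolyEval K 1)
  obtain ⟨f₂, h3⟩ := exists_lift_of_mem_smoothPoints M.specialFiberStr hx
    (truncPolyReduceₐ (IsLocalRing.ResidueField O) K (by norm_num : 2 ≤ 3))
    (truncPolyReduce_surjective (by norm_num : 2 ≤ 3)) (by
      rw [sq, eq_bot_iff, Ideal.mul_le]
      intro a ha b hb
      exact ker_truncPolyReduce_sq a b ha hb) f₁ hy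
  exact h2 f₂ h3

/-- The equality of the two dimensions depends only on the image point, so it holds at the closed
point of every local ring mapping there; `RedPoint.exists_lift` then supplies all the lifts demanded
by `mem_smoothPoints_of_forall_lift`. -/
theorem mem_smoothPoints {K : Type u} [Field K] [Algebra (IsLocalRing.ResidueField O) K]
    (f : SchemePoint M.specialFiberStr K) (hf : Module.finrank K (M.redPoint K f).tfil =
      Module.finrank K (M.redPoint K f).rad) :
    f.1 (IsLocalRing.closedPoint K) ∈ smoothPoints M.specialFiberStr := by
  have hst := (M.mem_stratum_iff f rfl _ _).2 ⟨rfl, rfl⟩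
  refine mem_smoothPoints_of_forall_lift M.specialFiberStr _ ?_
  intro C A _ _ _ _ _ _ ρ hρ hker y hy
  have : IsLocalHom ρ.toRingHom := Function.Surjective.isLocalHom _ hρ
  let g : A →ₐ[IsLocalRing.ResidueField O] IsLocalRing.ResidueField A :=
    IsScalarTower.toAlgHom _ A _
  let y' : SchemePoint M.specialFiberStr (IsLocalRing.ResidueField A) :=
    ⟨specMap g ≫ y.1, by rw [Category.assoc, y.2, specMap_over]⟩
  have hy' : y'.1 (IsLocalRing.closedPoint (IsLocalRing.ResidueField A)) =
      f.1 (IsLocalRing.closedPoint K) := by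
    rw [← hy]
    exact (Scheme.Hom.comp_apply _ _ _).trans (congrArg y.1
      (IsLocalRing.comap_closedPoint (IsLocalRing.residue A)))
  obtain ⟨h1, h2⟩ := (M.mem_stratum_iff y' hy' _ _).1 hst
  rw [M.redPoint_natural g y y' rfl] at h1 h2
  obtain ⟨z, hz⟩ := RedPoint.exists_lift (isUnit_two_of_residue D C) ρ.toRingHom hρ
    (fun a ha b hb => by
      have h3 : a * b ∈ RingHom.ker ρ ^ 2 := by
        rw [sq]
        exact Ideal.mul_mem_mul ha hb
      rwa [hker] at h3) (M.redPoint A y) (h1.trans (hf.trans h2.symm))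
  refine ⟨(M.redPoint C).symm z, M.eq_comp_of_redPoint_eq ρ _ _ ?_⟩
  rw [Equiv.apply_symm_apply]
  exact hz.symm

theorem smoothPoints_eq : smoothPoints M.specialFiberStr =
    ⋃ h ∈ {h : ℕ | h ≤ s ∧ h ≡ s [MOD 2]}, M.stratum h h := by
  ext x
  obtain ⟨κ, _, _, q, rfl, h1, -⟩ := M.exists_residuePoint x
  simp only [Set.mem_iUnion, Set.mem_ofPred_eq, exists_prop, h1]
  constructor
  · intro hx
    have h2 := M.finrank_tfil_eq_of_mem_smoothPoints q hx
    refine ⟨_, ⟨?_, RedPoint.finrank_tfil_modEq _ (isUnit_two_of_residue D κ).ne_zero⟩, rfl, h2.symm⟩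
    rw [h2]
    exact RedPoint.finrank_rad_le _
  · rintro ⟨h, -, h2, h3⟩
    exact M.mem_smoothPoints q (h2.trans h3.symm)

end SplModel

end SplittingModel

end

theorem mainTheorem6 {O₀ F₀ O F : Type u}
    [CommRing O₀] [IsDomain O₀] [IsDiscreteValuationRing O₀]
    [IsAdicComplete (IsLocalRing.maximalIdeal O₀) O₀] [PerfectField (IsLocalRing.ResidueField O₀)]
    [Field F₀] [Algebra O₀ F₀] [IsFractionRing O₀ F₀]
    [Field F] [Algebra F₀ F] [Algebra O₀ F] [IsScalarTower O₀ F₀ F]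
    [CommRing O] [IsDomain O] [IsDiscreteValuationRing O]
    [Algebra O₀ O] [Algebra O F] [IsScalarTower O₀ O F] [IsIntegralClosure O O₀ F]
    (D : SplittingModel.RamifiedQuadratic O₀ F₀ O F)
    (m r s : ℕ) (hm : 2 ≤ m) (hrs : r + s = 2 * m) (hsr : s ≤ r) :
    -- the splitting model exists as a scheme over `O`
    Nonempty (SplittingModel.SplModel D m s) ∧
    ∀ M : SplittingModel.SplModel D m s,
      -- the smooth locus of the special fiber is the union of the strata `X_{h,h}`
      SplittingModel.smoothPoints M.specialFiberStr =
        (⋃ h ∈ {h : ℕ | h ≤ s ∧ h ≡ s [MOD 2]}, M.stratum h h) ∧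
      -- each stratum `X_{h,l}` with `h < l` has a point `x₀` with a lift `x₁` over `k[ε]/ε²`
      -- that does not extend to `k[ε]/ε³`, and the special fiber is not smooth there
      ∀ h l : ℕ, h < l → l ≤ s → h ≡ s [MOD 2] → l ≡ s [MOD 2] →
        ∃ (x₀ : Spec (.of (IsLocalRing.ResidueField O)) ⟶ M.specialFiber)
          (x₁ : Spec (.of (SplittingModel.TruncPoly (IsLocalRing.ResidueField O) 2)) ⟶
            M.specialFiber),
          x₀ ≫ M.specialFiberStr = 𝟙 _ ∧
          x₁ ≫ M.specialFiberStr = Spec.map (CommRingCat.ofHom (algebraMap _ _)) ∧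
          Spec.map (CommRingCat.ofHom (SplittingModel.truncPolyEval _ 1)) ≫ x₁ = x₀ ∧
          (∀ p, x₀ p ∈ M.stratum h l ∧ x₀ p ∉ SplittingModel.smoothPoints M.specialFiberStr) ∧
          ¬ ∃ x₂ : Spec (.of (SplittingModel.TruncPoly (IsLocalRing.ResidueField O) 3)) ⟶
              M.specialFiber,
            x₂ ≫ M.specialFiberStr = Spec.map (CommRingCat.ofHom (algebraMap _ _)) ∧
            Spec.map (CommRingCat.ofHom
              (SplittingModel.truncPolyReduce _ (by norm_num : 2 ≤ 3))) ≫ x₂ = x₁ := by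
  refine ⟨⟨SplittingModel.splModel D m s⟩, fun M => ⟨M.smoothPoints_eq, ?_⟩⟩
  intro h l hhl hls hh hl
  -- The bound `s ≤ m` follows from `r + s = 2m` and `s ≤ r`.
  obtain ⟨z, hz1, hz2⟩ := SplittingModel.RedPoint.exists_of_invariants
    (K := IsLocalRing.ResidueField O) (m := m) hhl.le hls (by omega) hh hl
  let x₀ := (M.redPoint (IsLocalRing.ResidueField O)).symm z
  have hx₀ : M.redPoint _ x₀ = z := Equiv.apply_symm_apply _ _
  obtain ⟨x₁, h1, h2⟩ := M.exists_obstructed x₀ (by rw [hx₀, hz1, hz2]; exact hhl)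
  refine ⟨x₀.1, x₁.1, x₀.2.trans (Spec.map_id _), x₁.2, h1.symm, fun p => ?_, ?_⟩
  · obtain rfl : p = IsLocalRing.closedPoint (IsLocalRing.ResidueField O) :=
      Subsingleton.elim (α := PrimeSpectrum (IsLocalRing.ResidueField O)) _ _
    refine ⟨(M.mem_stratum_iff x₀ rfl h l).2 ⟨by rw [hx₀, hz1], by rw [hx₀, hz2]⟩, fun hx => ?_⟩
    have := M.finrank_tfil_eq_of_mem_smoothPoints x₀ hx
    rw [hx₀, hz1, hz2] at this
    exact hhl.ne this
  · rintro ⟨x₂, h3, h4⟩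
    exact h2 ⟨x₂, h3⟩ h4.symm
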